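/- Let $N=N(d)$, $n=n(d)$ with $N/d\to\psi_1\in(0,\infty)$ and $n/d\to\psi_2\in(0,\infty)$ as $d\to\infty$, let $\boldsymbol\beta\in\mathbb R^d$ be deterministic with $\|\boldsymbol\beta\|_2\to1$, and fix $\varepsilon>0$, $\zeta>0$, $\tau\ge0$. Let $\boldsymbol w_1,\dots,\boldsymbol w_N\sim\mathrm{Unif}(\mathbb S^{d-1})$, $\boldsymbol x_1,\dots,\boldsymbol x_n\sim\mathcal N(0,I_d)$ and $\xi_1,\dots,\xi_n\sim\mathcal N(0,\tau^2)$ be mutually independent, let $\boldsymbol W\in\mathbb R^{N\times d}$ have rows $\boldsymbol w_\ell$, and put $y_i=\langle \boldsymbol x_i,\boldsymbol\beta\rangle+\xi_i$. Let $\sigma(t)=\max(t,0)-1/\sqrt{2\pi}$ (applied entrywise), $\boldsymbol\Omega=I+\frac{\sqrt{\log d}}{d}\mathbf 1\mathbf 1^{\mathsf T}\in\mathbb R^{N\times N}$, and $$\boldsymbol J=\Big((\boldsymbol W\boldsymbol W^{\mathsf T})\odot\frac{\pi-\cos^{-1}(\boldsymbol W\boldsymbol W^{\mathsf T})}{2\pi}\Big)^{1/2},$$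 where $\odot$ is the entrywise product, $\cos^{-1}$ acts entrywise, and the square root is the positive semidefinite one. For $\boldsymbol\theta\in\mathbb R^N$ define the robust loss and the simplified loss $$L(\boldsymbol\theta)=\max_{\|\boldsymbol\delta_1\|_2,\dots,\|\boldsymbol\delta_n\|_2\le\varepsilon}\frac1{2n}\sum_{i=1}^n\big(y_i-\boldsymbol\theta^{\mathsf T}\sigma(\boldsymbol W(\boldsymbol x_i+\boldsymbol\delta_i))\big)^2+\frac\zeta2\boldsymbol\theta^{\mathsf T}\boldsymbol\Omega\boldsymbol\theta,$$ $$L^{\circ\circ}(\boldsymbol\theta)=\frac1{2n}\sum_{i=1}^n\big(|y_i-\boldsymbol\theta^{\mathsf T}\sigma(\boldsymbol W\boldsymbol x_i)|+\varepsilon\|\boldsymbol J\boldsymbol\theta\|_2\big)^2+\frac\zeta2\boldsymbol\theta^{\mathsf T}\boldsymbol\Omega\boldsymbol\theta .$$ For a constant $C_0>0$ let $\mathcal C_{\boldsymbol\theta}=\{\boldsymbol\theta\in\mathbb R^N:\|\boldsymbol\theta\|_\infty\le C_0\sqrt{\log(d)/d},\ \|\boldsymbol\theta\|_2\le C_0\}$.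 Then, with respect to the joint randomness of the $\boldsymbol w_\ell$, $\boldsymbol x_i$ and $\xi_i$: (a) for every fixed $C_0>0$, $$\sup_{\boldsymbol\theta\in\mathcal C_{\boldsymbol\theta}}\frac{|L^{\circ\circ}(\boldsymbol\theta)-L(\boldsymbol\theta)|}{1+\min(L(\boldsymbol\theta),L^{\circ\circ}(\boldsymbol\theta))}\to0\quad\text{in probability as }d\to\infty;$$ (b) $L$ and $L^{\circ\circ}$ each have exactly one minimizer over $\mathbb R^N$, and these minimizers, $\widehat{\boldsymbol\theta}$ of $L$ and $\boldsymbol\theta^{\circ\circ}$ of $L^{\circ\circ}$, satisfy $\|\boldsymbol\theta^{\circ\circ}-\widehat{\boldsymbol\theta}\|_2\to0$ in probability as $d\to\infty$. -/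

import Mathlib

open MeasureTheory ProbabilityTheory Filter Topology
open scoped Matrix NNReal ENNReal

noncomputable section

namespace RobustRF

/-- The shifted ReLU activation `σ(t) = max(t, 0) - 1 / √(2π)`. -/
def shiftedReLU (t : ℝ) : ℝ := max t 0 - 1 / √(2 * Real.pi)

/-- One realization of all the randomness in dimension `d`, with `N` features and `n` samples: the
first-layer weights `w_1, …, w_N` (the rows of the matrix `W`), the covariates `x_1, …, x_n`, and
the label noise `ξ_1, …, ξ_n`. -/
structure Sample (d N n : ℕ) where
  w : Fin N → EuclideanSpace ℝ (Fin d)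
  x : Fin n → EuclideanSpace ℝ (Fin d)
  noise : Fin n → ℝ

/-- A triple of arrays (weights, covariates, noise), seen as a sample. -/
def Sample.ofTriple {d N n : ℕ}
    (p : (Fin N → EuclideanSpace ℝ (Fin d)) × (Fin n → EuclideanSpace ℝ (Fin d)) × (Fin n → ℝ)) :
    Sample d N n := ⟨p.1, p.2.1, p.2.2⟩

/-- The uniform probability measure on the unit sphere of `ℝ^d` (for `d ≥ 1`): the normalized
surface measure, seen as a measure on `ℝ^d`. -/
def unifSphere (d : ℕ) : Measure (EuclideanSpace ℝ (Fin d)) :=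
  let μ : Measure (Metric.sphere (0 : EuclideanSpace ℝ (Fin d)) 1) :=
    (volume : Measure (EuclideanSpace ℝ (Fin d))).toSphere
  ((μ Set.univ)⁻¹ • μ).map Subtype.val

/-- The joint law of weights, covariates and noise: `w_ℓ ~ Unif(S^{d-1})`, `x_i ~ N(0, I_d)`,
`ξ_i ~ N(0, τ²)`, all of them mutually independent. -/
def jointLaw (d N n : ℕ) (τ : ℝ≥0) :
    Measure ((Fin N → EuclideanSpace ℝ (Fin d)) ×
      (Fin n → EuclideanSpace ℝ (Fin d)) × (Fin n → ℝ)) :=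
  (Measure.pi fun _ : Fin N => unifSphere d).prod
    ((Measure.pi fun _ : Fin n => stdGaussian (EuclideanSpace ℝ (Fin d))).prod
      (Measure.pi fun _ : Fin n => gaussianReal 0 (τ ^ 2)))

/-- The probability that a property of the sample holds under the joint law. -/
def prob {d N n : ℕ} (τ : ℝ≥0) (A : Sample d N n → Prop) : ℝ≥0∞ :=
  jointLaw d N n τ {p | A (Sample.ofTriple p)}

variable {d N n : ℕ}

/-- The label `y_i = ⟨x_i, β⟩ + ξ_i`. -/
def label (β : EuclideanSpace ℝ (Fin d)) (s : Sample d N n) (i : Fin n) : ℝ :=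
  inner ℝ (s.x i) β + s.noise i

/-- The random features predictor `θᵀ σ(W x) = ∑ₗ θₗ σ(⟨wₗ, x⟩)`. -/
def predictor (w : Fin N → EuclideanSpace ℝ (Fin d)) (θ : EuclideanSpace ℝ (Fin N))
    (x : EuclideanSpace ℝ (Fin d)) : ℝ :=
  ∑ l, θ l * shiftedReLU (inner ℝ (w l) x)

/-- The matrix `Ω = I + (√(log d) / d) 1 1ᵀ`. -/
def omegaMatrix (d N : ℕ) : Matrix (Fin N) (Fin N) ℝ :=
  1 + (√(Real.log d) / d) • Matrix.vecMulVec (1 : Fin N → ℝ) (1 : Fin N → ℝ)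

/-- The regularizer `(ζ / 2) θᵀ Ω θ`. -/
def regularizer (d : ℕ) (ζ : ℝ) (θ : EuclideanSpace ℝ (Fin N)) : ℝ :=
  ζ / 2 * (θ.ofLp ⬝ᵥ (omegaMatrix d N *ᵥ θ.ofLp))

/-- The robust (adversarial) loss
`max_{‖δ_i‖ ≤ ε} (1 / 2n) ∑ᵢ (y_i - θᵀ σ(W (x_i + δ_i)))² + (ζ / 2) θᵀ Ω θ`.
For `ε ≥ 0` the supremum is that of a continuous function over a nonempty compact set. -/
def robustLoss (ε ζ : ℝ) (β : EuclideanSpace ℝ (Fin d)) (s : Sample d N n)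
    (θ : EuclideanSpace ℝ (Fin N)) : ℝ :=
  (⨆ δ : {δ : Fin n → EuclideanSpace ℝ (Fin d) // ∀ i, ‖δ i‖ ≤ ε},
      1 / (2 * (n : ℝ)) * ∑ i, (label β s i - predictor s.w θ (s.x i + δ.1 i)) ^ 2)
    + regularizer d ζ θ

/-- The matrix `(W Wᵀ) ⊙ ((π - arccos(W Wᵀ)) / (2π))`, with `arccos` applied entrywise. -/
def arccosKernel (w : Fin N → EuclideanSpace ℝ (Fin d)) : Matrix (Fin N) (Fin N) ℝ :=
  Matrix.gram ℝ w ⊙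
    (Matrix.gram ℝ w).map fun ρ => (Real.pi - Real.arccos ρ) / (2 * Real.pi)

/-- The matrix `J`: the positive semidefinite square root of the arccos kernel matrix, through the
continuous functional calculus of real symmetric matrices. -/
def J (w : Fin N → EuclideanSpace ℝ (Fin d)) : Matrix (Fin N) (Fin N) ℝ :=
  cfc Real.sqrt (arccosKernel w)

/-- The simplified loss
`(1 / 2n) ∑ᵢ (|y_i - θᵀ σ(W x_i)| + ε ‖J θ‖₂)² + (ζ / 2) θᵀ Ω θ`. -/
def simplifiedLoss (ε ζ : ℝ) (β : EuclideanSpace ℝ (Fin d)) (s : Sample d N n)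
    (θ : EuclideanSpace ℝ (Fin N)) : ℝ :=
  1 / (2 * (n : ℝ)) *
      ∑ i, (|label β s i - predictor s.w θ (s.x i)| + ε * ‖Matrix.toEuclideanLin (J s.w) θ‖) ^ 2
    + regularizer d ζ θ

/-- The set `C_θ = {θ ∈ ℝ^N : ‖θ‖_∞ ≤ C₀ √(log d / d), ‖θ‖₂ ≤ C₀}`. -/
def paramSet (d N : ℕ) (C₀ : ℝ) : Set (EuclideanSpace ℝ (Fin N)) :=
  {θ | (∀ l, |θ l| ≤ C₀ * √(Real.log d / d)) ∧ ‖θ‖ ≤ C₀}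

/-- `sup_{θ ∈ C_θ} |L°°(θ) - L(θ)| / (1 + min(L(θ), L°°(θ)))`, as a supremum in `[0, ∞]`. -/
def supRelGap (C₀ ε ζ : ℝ) (β : EuclideanSpace ℝ (Fin d)) (s : Sample d N n) : ℝ≥0∞ :=
  ⨆ θ ∈ paramSet d N C₀,
    ENNReal.ofReal (|simplifiedLoss ε ζ β s θ - robustLoss ε ζ β s θ| /
      (1 + min (robustLoss ε ζ β s θ) (simplifiedLoss ε ζ β s θ)))

end RobustRF

end

/-! Let `f_θ` be the predictor. On unit weights with `∑ ⟪w l, u⟫² ≤ C ‖u‖²`, which hold with high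
probability, a perturbation `δ` of length at most `ε` changes `f_θ(x)` by `⟪∇f_θ(x), δ⟫` up to an
error coming only from neurons whose preactivation is so small that `δ` can change its sign
(`predictor_linearization`). The worst perturbation therefore gives a residual close to `|y -
f_θ(x)| + ε ‖∇f_θ(x)‖`. By Sheppard's orthant formula the Gaussian mean of `‖∇f_θ(x)‖²` is exactly
the quadratic form of the arccos kernel, that is `‖J θ‖²` (`integral_norm_gradAt_sq`, `norm_J_sq`).
What remains is to see that `‖∇f_θ(x)‖` concentrates around its root mean square.

The gradient is discontinuous in `x`, so the step function is smoothed at scale `η`. The derivative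
of the smoothed squared norm is then at most of order `κ / η`, where `κ` bounds the coordinates of
`θ`, and the Maurey–Pisier inequality gives a small fourth moment once `κ` is small
(`lintegral_norm_gradAt_sub_sq_le`). The squared deviation is bounded and has small mean, so a
Chernoff bound over the `n` samples has an exponential rate as large as desired. This rate beats a
net of parameters, whose cardinality is exponential in `N`, and a fixed small `κ` suffices. The
result is uniform relative closeness of the losses on `‖θ‖ ≤ C₀`, `‖θ‖_∞ ≤ κ`
(`exists_tendsto_prob_gap`). Part (a) follows because `C₀ √(log d / d)` tends to zero.

For part (b) both losses are `ζ`-strongly convex, hence have unique minimizers. The gap estimate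
applies only at parameters with small coordinates, and the losses are not differentiable. So `L` is
replaced by a log-sum-exp over a finite net of perturbations (`softLoss`) and `L°°` by a version
with smoothed absolute value and norm (`smoothLoss`). The coordinates of the surrogate minimizers
are controlled by a leave-one-out argument (`prob_exists_coord_le`). The minimizer over the
hyperplane `θ l = 0` does not depend on `w l`; by strong convexity the `l`-th coordinate of the
global minimizer is at most `2 / ζ` times the `l`-th partial derivative there; and this derivative
is a function of a fresh uniform vector `w l`. Its fourth moment is of order `d⁻²`, which survives
the union bound over the `N` neurons. The smallness rests on the shift `1 / √(2π)` of the
activation, which cancels the Gaussian mean of the ReLU up to the fluctuation of `‖x‖`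
(`lintegral_reluSum_pow_four_le`). Spherical moments are bounded by Gaussian ones through Jensen's
inequality in the radius (`lintegral_unifSphere_le_stdGaussian`).

Finally `norm_sub_sq_le_of_surrogates` compares values at the two surrogate minimizers. The
minimizer of the smooth loss turns out to be a near-minimizer of both `L` and `L°°`, and strong
convexity places it close to both true minimizers. -/

noncomputable section

namespace RobustRF

/-! ### Density of the standard Gaussian measure and polar coordinates. -/

section GaussianMeasure

variable {E : Type*} [NormedAddCommGroup E] [InnerProductSpace ℝ E] [FiniteDimensional ℝ E]
  [MeasurableSpace E] [BorelSpace E]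

/-- The density of the standard Gaussian measure, as a function of the norm. -/
def gaussianDensity (m : ℕ) (r : ℝ) : ℝ :=
  (2 * Real.pi) ^ (-(m : ℝ) / 2) * Real.exp (-(1 / 2) * r ^ 2)

lemma gaussianDensity_nonneg (m : ℕ) (r : ℝ) : 0 ≤ gaussianDensity m r := by
  unfold gaussianDensity; positivity

lemma measurable_gaussianDensity (m : ℕ) : Measurable (gaussianDensity m) := by
  unfold gaussianDensity; fun_prop

/-- A non-integrable function has Bochner integral zero, whereas the Gaussian integral formula gives
a positive value. -/
lemma integrable_exp_neg_half_norm_sq :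
    Integrable (fun x : E => Real.exp (-(1 / 2) * ‖x‖ ^ 2)) := by
  by_contra h
  have h1 := GaussianFourier.integral_rexp_neg_mul_sq_norm (V := E) (b := 1 / 2) (by norm_num)
  rw [integral_undef h] at h1
  have : (0 : ℝ) < (Real.pi / (1 / 2)) ^ ((Module.finrank ℝ E : ℝ) / 2) := by positivity
  linarith

/-- Both finite measures have characteristic function `exp (-‖t‖² / 2)`; for the density this is the
complex Gaussian integral with linear coefficient `I`. The density gives access to polar coordinates
of the volume. -/
lemma stdGaussian_eq_withDensity :
    stdGaussian E = (volume : Measure E).withDensity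
      (fun x => ENNReal.ofReal (gaussianDensity (Module.finrank ℝ E) ‖x‖)) := by
  have hint : Integrable (fun x : E => gaussianDensity (Module.finrank ℝ E) ‖x‖) :=
    integrable_exp_neg_half_norm_sq.const_mul _
  have : IsFiniteMeasure ((volume : Measure E).withDensity
      (fun x => ENNReal.ofReal (gaussianDensity (Module.finrank ℝ E) ‖x‖))) :=
    isFiniteMeasure_withDensity_ofReal hint.2
  apply Measure.ext_of_charFun
  ext t
  rw [charFun_stdGaussian, charFun_apply, integral_withDensity_eq_integral_toReal_smul]
  · have key := GaussianFourier.integral_cexp_neg_mul_sq_norm_add (V := E) (b := 1 / 2)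
      (by norm_num) Complex.I t
    have e1 : ∀ x : E, (ENNReal.ofReal (gaussianDensity (Module.finrank ℝ E) ‖x‖)).toReal •
        Complex.exp ((inner ℝ x t : ℝ) * Complex.I) =
        ((2 * Real.pi) ^ (-(Module.finrank ℝ E : ℝ) / 2) : ℝ) *
          Complex.exp (-(1 / 2) * (‖x‖ : ℂ) ^ 2 + Complex.I * (inner ℝ t x : ℝ)) := by
      intro x
      rw [ENNReal.toReal_ofReal (gaussianDensity_nonneg _ _), gaussianDensity, Complex.exp_add,
        Complex.real_smul, real_inner_comm]
      push_cast
      rw [mul_comm Complex.I]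
      ring
    simp_rw [e1]
    rw [integral_const_mul, key, Complex.I_sq]
    have e2 : ((Real.pi : ℂ) / (1 / 2)) ^ ((Module.finrank ℝ E : ℂ) / 2) =
        ((2 * Real.pi) ^ ((Module.finrank ℝ E : ℝ) / 2) : ℝ) := by
      rw [Complex.ofReal_cpow (by positivity)]
      push_cast
      congr 1
      ring
    rw [e2, ← mul_assoc, ← Complex.ofReal_mul, ← Real.rpow_add (by positivity)]
    rw [show -(Module.finrank ℝ E : ℝ) / 2 + (Module.finrank ℝ E : ℝ) / 2 = 0 by ring]
    simp only [Real.rpow_zero, Complex.ofReal_one, one_mul]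
    congr 1
    ring
  · exact ((measurable_gaussianDensity _).comp measurable_norm).ennreal_ofReal
  · filter_upwards with x using ENNReal.ofReal_lt_top

/-- The origin is a null set, and away from it the volume is the product of the surface measure and
`r ^ (dim - 1) dr`. -/
lemma lintegral_polar [Nontrivial E] {g : E → ℝ≥0∞} (hg : Measurable g) :
    ∫⁻ x, g x = ∫⁻ r, ∫⁻ u, g (r.1 • u.1) ∂(volume : Measure E).toSphere
      ∂(Measure.volumeIoiPow (Module.finrank ℝ E - 1)) := by
  have h := (volume : Measure E).measurePreserving_homeomorphUnitSphereProd
  have hm : Measurable fun p : Metric.sphere (0 : E) 1 × Set.Ioi (0 : ℝ) => g (p.2.1 • p.1.1) := by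
    fun_prop
  calc ∫⁻ x, g x = ∫⁻ x : (({0} : Set E)ᶜ : Set E), g x.1 ∂((volume : Measure E).comap Subtype.val) := by
        rw [lintegral_subtype_comap (measurableSet_singleton _).compl,
          restrict_compl_singleton]
    _ = ∫⁻ p, g (p.2.1 • p.1.1) ∂((volume : Measure E).toSphere.prod
          (Measure.volumeIoiPow (Module.finrank ℝ E - 1))) := by
        rw [← h.lintegral_comp hm]
        refine lintegral_congr fun x => ?_
        rw [homeomorphUnitSphereProd_apply_snd_coe, homeomorphUnitSphereProd_apply_fst_coe,
          smul_smul, mul_inv_cancel₀ (norm_ne_zero_iff.2 x.2), one_smul]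
    _ = _ := by
        rw [lintegral_prod_symm _ hm.aemeasurable]

end GaussianMeasure

/-! ### The uniform law on the sphere as the direction of a Gaussian vector. -/

section Sphere

variable {d : ℕ}

lemma lintegral_unifSphere (f : EuclideanSpace ℝ (Fin d) → ℝ≥0∞) (hf : Measurable f) :
    ∫⁻ w, f w ∂unifSphere d =
      ((volume : Measure (EuclideanSpace ℝ (Fin d))).toSphere Set.univ)⁻¹ *
        ∫⁻ u, f u.1 ∂(volume : Measure (EuclideanSpace ℝ (Fin d))).toSphere := by
  rw [unifSphere, lintegral_map hf measurable_subtype_coe, lintegral_smul_measure, smul_eq_mul]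

lemma ae_norm_eq_one_unifSphere : ∀ᵐ w ∂unifSphere d, ‖w‖ = 1 := by
  rw [unifSphere, ae_map_iff measurable_subtype_coe.aemeasurable
    (measurableSet_eq_fun measurable_norm measurable_const)]
  filter_upwards with w
  simp

variable [NeZero d]

lemma toSphere_univ_ne_zero :
    (volume : Measure (EuclideanSpace ℝ (Fin d))).toSphere Set.univ ≠ 0 := by
  rw [Measure.measure_univ_ne_zero]
  exact Measure.toSphere_ne_zero _

instance isProbabilityMeasure_unifSphere : IsProbabilityMeasure (unifSphere d) := by
  constructor
  rw [← lintegral_one, lintegral_unifSphere _ measurable_const, lintegral_one]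
  exact ENNReal.inv_mul_cancel toSphere_univ_ne_zero (measure_ne_top _ _)

/-- Polar decomposition of the standard Gaussian measure: the radius is independent of the
direction, and the direction is uniform on the sphere. -/
lemma lintegral_stdGaussian_polar {F : EuclideanSpace ℝ (Fin d) → ℝ≥0∞} (hF : Measurable F) :
    ∫⁻ x, F x ∂stdGaussian (EuclideanSpace ℝ (Fin d)) =
      ∫⁻ x, ∫⁻ w, F (‖x‖ • w) ∂unifSphere d ∂stdGaussian (EuclideanSpace ℝ (Fin d)) := by
  have hρ : Measurable fun x : EuclideanSpace ℝ (Fin d) =>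
      ENNReal.ofReal (gaussianDensity (Module.finrank ℝ (EuclideanSpace ℝ (Fin d))) ‖x‖) :=
    ((measurable_gaussianDensity _).comp measurable_norm).ennreal_ofReal
  -- The density is a function of the radius alone, so it comes out of the spherical integral.
  have key : ∀ G : EuclideanSpace ℝ (Fin d) → ℝ≥0∞, Measurable G →
      ∫⁻ x, G x ∂stdGaussian (EuclideanSpace ℝ (Fin d)) =
        ∫⁻ r, ENNReal.ofReal (gaussianDensity (Module.finrank ℝ (EuclideanSpace ℝ (Fin d))) r.1) *
          ∫⁻ u, G (r.1 • u.1) ∂(volume : Measure (EuclideanSpace ℝ (Fin d))).toSphere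
          ∂(Measure.volumeIoiPow (Module.finrank ℝ (EuclideanSpace ℝ (Fin d)) - 1)) := by
    intro G hG
    rw [stdGaussian_eq_withDensity, lintegral_withDensity_eq_lintegral_mul _ hρ hG,
      lintegral_polar (hρ.mul hG)]
    refine lintegral_congr fun r => ?_
    rw [← lintegral_const_mul _ (by fun_prop)]
    refine lintegral_congr fun u => ?_
    have hu : ‖r.1 • u.1‖ = r.1 := by
      have := u.2
      have h2 := r.2
      rw [norm_smul, mem_sphere_zero_iff_norm.1 this, mul_one, Real.norm_of_nonneg (le_of_lt h2)]
    rw [Pi.mul_apply, hu]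
  have hG : Measurable fun x : EuclideanSpace ℝ (Fin d) => ∫⁻ w, F (‖x‖ • w) ∂unifSphere d := by
    apply Measurable.lintegral_prod_right'
      (f := fun p : EuclideanSpace ℝ (Fin d) × EuclideanSpace ℝ (Fin d) => F (‖p.1‖ • p.2))
    fun_prop
  -- On the right the integrand is already radial, so its surface integral multiplies it by the
  -- total surface mass, which cancels the normalization of `unifSphere`.
  rw [key F hF, key _ hG]
  refine lintegral_congr fun r => ?_
  congr 1
  have hu : ∀ u : Metric.sphere (0 : EuclideanSpace ℝ (Fin d)) 1, ‖r.1 • u.1‖ = r.1 := by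
    intro u
    have h2 := r.2
    rw [norm_smul, mem_sphere_zero_iff_norm.1 u.2, mul_one, Real.norm_of_nonneg (le_of_lt h2)]
  simp_rw [hu]
  rw [lintegral_const, lintegral_unifSphere _ (by fun_prop), mul_comm, ← mul_assoc,
    ENNReal.mul_inv_cancel toSphere_univ_ne_zero (measure_ne_top _ _), one_mul]

end Sphere

/-! ### Jensen's inequality for nonnegative convex functions. -/

section Jensen

variable {α : Type*} [MeasurableSpace α]

/-- If the right side is infinite there is nothing to prove; otherwise `Φ ∘ u` is integrable and the
usual inequality applies. In this form no later use has to check integrability of `Φ ∘ u`. -/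
lemma ofReal_convex_integral_le {μ : Measure α} [IsProbabilityMeasure μ] {Φ : ℝ → ℝ}
    (hΦ : ConvexOn ℝ Set.univ Φ) (h0 : ∀ t, 0 ≤ Φ t) {u : α → ℝ} (hu : Integrable u μ) :
    ENNReal.ofReal (Φ (∫ x, u x ∂μ)) ≤ ∫⁻ x, ENNReal.ofReal (Φ (u x)) ∂μ := by
  have hc : Continuous Φ := by
    rw [← continuousOn_univ]; exact hΦ.continuousOn isOpen_univ
  by_cases htop : ∫⁻ x, ENNReal.ofReal (Φ (u x)) ∂μ = ⊤
  · rw [htop]; exact le_top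
  have hm : AEStronglyMeasurable (fun x => Φ (u x)) μ :=
    hc.comp_aestronglyMeasurable hu.aestronglyMeasurable
  have hi : Integrable (fun x => Φ (u x)) μ :=
    (lintegral_ofReal_ne_top_iff_integrable hm (ae_of_all _ fun x => h0 _)).1 htop
  rw [← ofReal_integral_eq_lintegral_ofReal hi (ae_of_all _ fun x => h0 _)]
  exact ENNReal.ofReal_le_ofReal (hΦ.map_integral_le hc.continuousOn isClosed_univ
    (ae_of_all _ fun _ => Set.mem_univ _) hu hi)

end Jensen

/-! ### Gaussian moments and the Maurey–Pisier inequality. -/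

section GaussianMoments

variable {E : Type*} [NormedAddCommGroup E] [InnerProductSpace ℝ E] [FiniteDimensional ℝ E]
  [MeasurableSpace E] [BorelSpace E]

lemma integrable_norm_pow_stdGaussian (k : ℕ) : Integrable (fun x : E => ‖x‖ ^ k) (stdGaussian E) := by
  have := (IsGaussian.memLp_id (stdGaussian E) k (by simp)).integrable_norm_pow'
  simpa using this

lemma integrable_norm_stdGaussian : Integrable (fun x : E => ‖x‖) (stdGaussian E) := by
  simpa using integrable_norm_pow_stdGaussian (E := E) 1

lemma map_inner_stdGaussian (w : E) :
    (stdGaussian E).map (fun x => inner ℝ w x) = (gaussianReal 0 1).map (fun t => ‖w‖ * t) := by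
  have h := IsGaussian.map_eq_gaussianReal (μ := stdGaussian E) (innerSL ℝ w)
  rw [integral_strongDual_stdGaussian, variance_dual_stdGaussian] at h
  rw [gaussianReal_map_const_mul]
  simp only [innerSL_apply_norm, mul_zero, mul_one] at h ⊢
  have e : (⇑(innerSL ℝ w) : E → ℝ) = fun x => inner ℝ w x := by
    ext x; rfl
  rw [e] at h
  rw [h]
  congr 1
  ext
  simp

lemma lintegral_inner_stdGaussian (w : E) {F : ℝ → ℝ≥0∞} (hF : Measurable F) :
    ∫⁻ x, F (inner ℝ w x) ∂stdGaussian E = ∫⁻ t, F (‖w‖ * t) ∂gaussianReal 0 1 := by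
  rw [← lintegral_map (f := F) hF (by fun_prop : Measurable fun x : E => inner ℝ w x),
    map_inner_stdGaussian, lintegral_map hF (by fun_prop)]

/-- The `k`-th absolute moment of a standard Gaussian variable. -/
def gaussMoment (k : ℕ) : ℝ := ∫ t, |t| ^ k ∂gaussianReal 0 1

lemma gaussMoment_nonneg (k : ℕ) : 0 ≤ gaussMoment k :=
  integral_nonneg fun _ => by positivity

lemma lintegral_abs_pow_gaussianReal (k : ℕ) :
    ∫⁻ t, ENNReal.ofReal (|t| ^ k) ∂gaussianReal 0 1 = ENNReal.ofReal (gaussMoment k) := by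
  rw [gaussMoment, ofReal_integral_eq_lintegral_ofReal]
  · have := (IsGaussian.memLp_id (gaussianReal 0 1) k (by simp)).integrable_norm_pow'
    simpa using this
  · exact ae_of_all _ fun _ => by positivity

lemma lintegral_inner_pow_stdGaussian (w : E) (k : ℕ) :
    ∫⁻ x, ENNReal.ofReal (|inner ℝ w x| ^ k) ∂stdGaussian E =
      ENNReal.ofReal (‖w‖ ^ k * gaussMoment k) := by
  rw [lintegral_inner_stdGaussian w (F := fun t => ENNReal.ofReal (|t| ^ k)) (by fun_prop)]
  simp_rw [abs_mul, mul_pow, abs_norm]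
  simp_rw [ENNReal.ofReal_mul (pow_nonneg (norm_nonneg w) k)]
  rw [lintegral_const_mul _ (by fun_prop), lintegral_abs_pow_gaussianReal]

/-- The constant of the fourth moment Maurey–Pisier inequality. -/
def pisierConst : ℝ := (Real.pi / 2) ^ 4 * gaussMoment 4

lemma pisierConst_nonneg : 0 ≤ pisierConst := by
  have := gaussMoment_nonneg 4
  unfold pisierConst; positivity

-- The curve `cos t • p.1 + sin t • p.2` joins `p.1` to `p.2` for `t` in `[0, π / 2]`, and its
-- velocity is the second component of the rotated pair. The increment of `f` is the integral of its
-- derivative along the curve; Jensen for the fourth power on the normalized interval gives the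
-- constant.
omit [FiniteDimensional ℝ E] [MeasurableSpace E] [BorelSpace E] in
lemma pow_four_sub_le_lintegral_rotation {f : E → ℝ} {f' : E → E →L[ℝ] ℝ}
    (hf : ∀ x, HasFDerivAt f (f' x) x) (hc : Continuous f') (p : E × E) :
    ENNReal.ofReal ((f p.1 - f p.2) ^ 4) ≤ ENNReal.ofReal ((Real.pi / 2) ^ 3) *
      ∫⁻ t in Set.Ioc 0 (Real.pi / 2), ENNReal.ofReal
        (|f' (ContinuousLinearMap.rotation t p).1 (ContinuousLinearMap.rotation t p).2| ^ 4) := by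
  have hpi : 0 < Real.pi / 2 := by positivity
  set u : ℝ → ℝ := fun t => f' (ContinuousLinearMap.rotation t p).1
    (ContinuousLinearMap.rotation t p).2 with hu
  have hφ : ∀ t, HasDerivAt (fun t => Real.cos t • p.1 + Real.sin t • p.2)
      (-Real.sin t • p.1 + Real.cos t • p.2) t := fun t =>
    ((Real.hasDerivAt_cos t).smul_const p.1).add ((Real.hasDerivAt_sin t).smul_const p.2)
  have hder : ∀ t, HasDerivAt (fun t => f (Real.cos t • p.1 + Real.sin t • p.2)) (u t) t :=
    fun t => (hf _).comp_hasDerivAt t (hφ t)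
  have hucont : Continuous u := by
    simp only [hu, ContinuousLinearMap.rotation_apply]
    have h1 : Continuous fun t => f' (Real.cos t • p.1 + Real.sin t • p.2) :=
      hc.comp (by fun_prop)
    exact h1.clm_apply (by fun_prop)
  have hint : ∫ t in (0)..(Real.pi / 2), u t = f p.2 - f p.1 := by
    rw [intervalIntegral.integral_eq_sub_of_hasDerivAt (fun t _ => hder t)
      (hucont.intervalIntegrable _ _)]
    simp
  set μ : Measure ℝ := (ENNReal.ofReal (Real.pi / 2))⁻¹ • volume.restrict (Set.Ioc 0 (Real.pi / 2))
    with hμ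
  have hμp : IsProbabilityMeasure μ := by
    constructor
    rw [hμ, Measure.smul_apply, Measure.restrict_apply_univ, Real.volume_Ioc, sub_zero, smul_eq_mul]
    exact ENNReal.inv_mul_cancel (by simpa using hpi) ENNReal.ofReal_ne_top
  have hui : Integrable u μ := by
    have : IntegrableOn u (Set.Ioc 0 (Real.pi / 2)) :=
      (hucont.integrableOn_Icc).mono_set Set.Ioc_subset_Icc_self
    exact Integrable.smul_measure this (by simp [hpi])
  have hJ := ofReal_convex_integral_le (μ := μ) (Φ := fun t => t ^ 4)
    (Even.convexOn_pow (by decide)) (fun t => by positivity) hui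
  have h1 : ∫ t, u t ∂μ = (Real.pi / 2)⁻¹ * (f p.2 - f p.1) := by
    rw [hμ, integral_smul_measure, ← hint, intervalIntegral.integral_of_le hpi.le,
      ENNReal.toReal_inv, ENNReal.toReal_ofReal hpi.le, smul_eq_mul]
  rw [h1] at hJ
  have h2 : (f p.1 - f p.2) ^ 4 =
      (Real.pi / 2) ^ 4 * ((Real.pi / 2)⁻¹ * (f p.2 - f p.1)) ^ 4 := by
    field_simp
    ring
  rw [h2, ENNReal.ofReal_mul (by positivity)]
  refine (mul_le_mul_right hJ _).trans (le_of_eq ?_)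
  rw [hμ, lintegral_smul_measure, smul_eq_mul, ← mul_assoc]
  have h3 : ENNReal.ofReal ((Real.pi / 2) ^ 4) * (ENNReal.ofReal (Real.pi / 2))⁻¹ =
      ENNReal.ofReal ((Real.pi / 2) ^ 3) := by
    rw [pow_succ, ENNReal.ofReal_mul (by positivity), mul_assoc,
      ENNReal.mul_inv_cancel (by simpa using hpi) ENNReal.ofReal_ne_top, mul_one]
  rw [h3]
  congr 2
  ext t
  rw [Even.pow_abs (by decide)]

/-- The Maurey–Pisier inequality for fourth moments. -/
lemma lintegral_pow_four_sub_le {f : E → ℝ} {f' : E → E →L[ℝ] ℝ}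
    (hf : ∀ x, HasFDerivAt f (f' x) x) (hc : Continuous f') {M : ℝ} (hM : ∀ x, ‖f' x‖ ≤ M) :
    ∫⁻ p, ENNReal.ofReal ((f p.1 - f p.2) ^ 4) ∂(stdGaussian E).prod (stdGaussian E) ≤
      ENNReal.ofReal (pisierConst * M ^ 4) := by
  have hM0 : 0 ≤ M := (norm_nonneg _).trans (hM 0)
  have hcont : Continuous fun q : E × E => |f' q.1 q.2| ^ 4 :=
    (((hc.comp continuous_fst).clm_apply continuous_snd).abs).pow 4
  have hrot : ∀ t : ℝ, ∫⁻ p, ENNReal.ofReal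
      (|f' (ContinuousLinearMap.rotation t p).1 (ContinuousLinearMap.rotation t p).2| ^ 4)
        ∂(stdGaussian E).prod (stdGaussian E) ≤ ENNReal.ofReal (M ^ 4 * gaussMoment 4) := by
    intro t
    -- The rotated pair has the law of the original pair, so its components are again independent
    -- and, given `x`, the variable `f' x y` is centered Gaussian with standard deviation `‖f' x‖`.
    have h1 := IsGaussian.map_rotation_eq_self (μ := stdGaussian E)
      (by simp) t
    have h2 := lintegral_map (μ := (stdGaussian E).prod (stdGaussian E))
      (f := fun q : E × E => ENNReal.ofReal (|f' q.1 q.2| ^ 4))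
      (g := ContinuousLinearMap.rotation t) hcont.measurable.ennreal_ofReal
      (ContinuousLinearMap.continuous _).measurable
    rw [h1] at h2
    rw [← h2, lintegral_prod _ hcont.measurable.ennreal_ofReal.aemeasurable]
    have h3 : ∀ x : E, ∫⁻ y, ENNReal.ofReal (|f' x y| ^ 4) ∂stdGaussian E ≤
        ENNReal.ofReal (M ^ 4 * gaussMoment 4) := by
      intro x
      have h4 := lintegral_inner_pow_stdGaussian ((InnerProductSpace.toDual ℝ E).symm (f' x)) 4
      simp only [InnerProductSpace.toDual_symm_apply, LinearIsometryEquiv.norm_map] at h4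
      rw [h4]
      gcongr
      · exact gaussMoment_nonneg 4
      · exact hM x
    calc _ ≤ ∫⁻ x : E, ENNReal.ofReal (M ^ 4 * gaussMoment 4) ∂stdGaussian E :=
          lintegral_mono h3
      _ = _ := by simp
  have hjoint : Continuous fun q : (E × E) × ℝ =>
      |f' (ContinuousLinearMap.rotation q.2 q.1).1 (ContinuousLinearMap.rotation q.2 q.1).2| ^ 4 := by
    simp only [ContinuousLinearMap.rotation_apply]
    exact (((hc.comp (by fun_prop)).clm_apply (by fun_prop)).abs).pow 4
  calc _ ≤ ∫⁻ p, ENNReal.ofReal ((Real.pi / 2) ^ 3) *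
      (∫⁻ t in Set.Ioc 0 (Real.pi / 2), ENNReal.ofReal
        (|f' (ContinuousLinearMap.rotation t p).1 (ContinuousLinearMap.rotation t p).2| ^ 4))
          ∂(stdGaussian E).prod (stdGaussian E) :=
        lintegral_mono fun p => pow_four_sub_le_lintegral_rotation hf hc p
    _ = ENNReal.ofReal ((Real.pi / 2) ^ 3) *
      ∫⁻ t in Set.Ioc 0 (Real.pi / 2), ∫⁻ p, ENNReal.ofReal
        (|f' (ContinuousLinearMap.rotation t p).1 (ContinuousLinearMap.rotation t p).2| ^ 4)
          ∂(stdGaussian E).prod (stdGaussian E) := by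
        rw [lintegral_const_mul', lintegral_lintegral_swap]
        · exact hjoint.measurable.ennreal_ofReal.aemeasurable
        · exact ENNReal.ofReal_ne_top
    _ ≤ ENNReal.ofReal ((Real.pi / 2) ^ 3) *
      ∫⁻ t in Set.Ioc 0 (Real.pi / 2), ENNReal.ofReal (M ^ 4 * gaussMoment 4) := by
        gcongr with t
        exact hrot t
    _ = ENNReal.ofReal (pisierConst * M ^ 4) := by
        have hm := gaussMoment_nonneg 4
        rw [setLIntegral_const, Real.volume_Ioc, sub_zero, ← ENNReal.ofReal_mul (by positivity),
          ← ENNReal.ofReal_mul (by positivity), pisierConst]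
        congr 1
        ring

lemma integrable_of_hasFDerivAt_bounded {f : E → ℝ} {f' : E → E →L[ℝ] ℝ}
    (hf : ∀ x, HasFDerivAt f (f' x) x) {M : ℝ} (hM : ∀ x, ‖f' x‖ ≤ M) :
    Integrable f (stdGaussian E) := by
  have hcf : Continuous f := continuous_iff_continuousAt.2 fun x => (hf x).continuousAt
  have hb : Integrable (fun x : E => ‖f 0‖ + M * ‖x‖) (stdGaussian E) :=
    (integrable_const _).add (integrable_norm_stdGaussian.const_mul _)
  refine hb.mono' hcf.aestronglyMeasurable (ae_of_all _ fun x => ?_)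
  have := Convex.norm_image_sub_le_of_norm_hasFDerivWithin_le (s := Set.univ) (f := f) (f' := f')
    (fun y _ => (hf y).hasFDerivWithinAt) (fun y _ => hM y) convex_univ (Set.mem_univ 0)
    (Set.mem_univ x)
  rw [sub_zero] at this
  calc ‖f x‖ = ‖f 0 + (f x - f 0)‖ := by congr 1; ring
    _ ≤ _ := (norm_add_le _ _).trans (by gcongr)

/-- Jensen in the independent copy: `f x` minus its mean is the average of `f x - f y` over `y`. -/
lemma lintegral_pow_four_sub_mean_le {f : E → ℝ} {f' : E → E →L[ℝ] ℝ}
    (hf : ∀ x, HasFDerivAt f (f' x) x) (hc : Continuous f') {M : ℝ} (hM : ∀ x, ‖f' x‖ ≤ M) :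
    ∫⁻ x, ENNReal.ofReal ((f x - ∫ y, f y ∂stdGaussian E) ^ 4) ∂stdGaussian E ≤
      ENNReal.ofReal (pisierConst * M ^ 4) := by
  have hcf : Continuous f := continuous_iff_continuousAt.2 fun x => (hf x).continuousAt
  have hi := integrable_of_hasFDerivAt_bounded hf hM
  refine le_trans ?_ (lintegral_pow_four_sub_le hf hc hM)
  rw [lintegral_prod]
  · refine lintegral_mono fun x => ?_
    have h1 : f x - ∫ y, f y ∂stdGaussian E = ∫ y, (f x - f y) ∂stdGaussian E := by
      rw [integral_sub (integrable_const _) hi]; simp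
    rw [h1]
    exact ofReal_convex_integral_le (Φ := fun t => t ^ 4) (Even.convexOn_pow (by decide))
      (fun t => by positivity) ((integrable_const _).sub hi)
  · exact (((hcf.comp continuous_fst).sub (hcf.comp continuous_snd)).pow 4).measurable.ennreal_ofReal.aemeasurable

end GaussianMoments

/-! ### Finite nets by volume comparison. -/

section Nets

variable {E : Type*} [NormedAddCommGroup E] [InnerProductSpace ℝ E] [FiniteDimensional ℝ E]

/-- The balls of radius `ρ / 2` around the points are disjoint and contained in the ball of radius
`R + ρ / 2`. -/
lemma card_le_of_pairwise_separated {R ρ : ℝ} (hR : 0 ≤ R) (hρ : 0 < ρ) (s : Finset E)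
    (hs : ∀ c ∈ s, ‖c‖ ≤ R) (h : ∀ c ∈ s, ∀ c' ∈ s, c ≠ c' → ρ ≤ ‖c - c'‖) :
    (s.card : ℝ) ≤ (1 + 2 * R / ρ) ^ Module.finrank ℝ E := by
  borelize E
  let μ : Measure E := Measure.addHaar
  have hδ : 0 < ρ / 2 := by positivity
  have hρ' : 0 < R + ρ / 2 := by positivity
  set A := ⋃ c ∈ s, Metric.ball (c : E) (ρ / 2) with hA
  have D : Set.Pairwise (s : Set E) (Function.onFun Disjoint fun c => Metric.ball (c : E) (ρ / 2)) := by
    rintro c hc c' hc' hcc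
    apply Metric.ball_disjoint_ball
    rw [dist_eq_norm]
    have := h c hc c' hc' hcc
    linarith
  have A_subset : A ⊆ Metric.ball (0 : E) (R + ρ / 2) := by
    refine Set.iUnion₂_subset fun x hx => ?_
    apply Metric.ball_subset_ball'
    rw [dist_zero_right]
    linarith [hs x hx]
  have I : (s.card : ℝ≥0∞) * ENNReal.ofReal ((ρ / 2) ^ Module.finrank ℝ E) * μ (Metric.ball 0 1) ≤
      ENNReal.ofReal ((R + ρ / 2) ^ Module.finrank ℝ E) * μ (Metric.ball 0 1) :=
    calc
      _ = μ A := by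
        rw [hA, measure_biUnion_finset D fun c _ => measurableSet_ball]
        simp only [μ.addHaar_ball_of_pos _ hδ]
        simp only [Finset.sum_const, nsmul_eq_mul, mul_assoc]
      _ ≤ μ (Metric.ball (0 : E) (R + ρ / 2)) := measure_mono A_subset
      _ = _ := by simp only [μ.addHaar_ball_of_pos _ hρ']
  have J := (ENNReal.mul_le_mul_iff_left (Metric.measure_ball_pos _ _ zero_lt_one).ne'
    measure_ball_lt_top.ne).1 I
  have K := ENNReal.toReal_le_of_le_ofReal (pow_nonneg hρ'.le _) J
  rw [ENNReal.toReal_mul, ENNReal.toReal_natCast, ENNReal.toReal_ofReal (by positivity)] at K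
  have e : (1 + 2 * R / ρ) = (R + ρ / 2) / (ρ / 2) := by field_simp; ring
  rw [e, div_pow, le_div_iff₀ (by positivity)]
  exact K

/-- A separated subset of `S` of maximal cardinality is a net. Its points lie in `S` itself, so they
inherit the coordinate bound when `S` carries one. -/
lemma exists_net {R ρ : ℝ} (hR : 0 ≤ R) (hρ : 0 < ρ) (S : Set E) (hS : ∀ x ∈ S, ‖x‖ ≤ R) :
    ∃ t : Finset E, (∀ y ∈ t, y ∈ S) ∧ (t.card : ℝ) ≤ (1 + 2 * R / ρ) ^ Module.finrank ℝ E ∧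
      ∀ x ∈ S, ∃ y ∈ t, ‖x - y‖ ≤ ρ := by
  classical
  set P : Finset E → Prop := fun t => (∀ y ∈ t, y ∈ S) ∧
    ∀ c ∈ t, ∀ c' ∈ t, c ≠ c' → ρ ≤ ‖c - c'‖ with hP
  have hcard : ∀ t, P t → (t.card : ℝ) ≤ (1 + 2 * R / ρ) ^ Module.finrank ℝ E := fun t ht =>
    card_le_of_pairwise_separated hR hρ t (fun c hc => hS c (ht.1 c hc)) ht.2
  obtain ⟨n, hn⟩ := exists_nat_ge ((1 + 2 * R / ρ) ^ Module.finrank ℝ E)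
  set cards : Set ℕ := {k | ∃ t, P t ∧ t.card = k} with hcards
  have hbdd : BddAbove cards := by
    refine ⟨n, ?_⟩
    rintro k ⟨t, ht, rfl⟩
    exact_mod_cast (hcard t ht).trans hn
  have hne : cards.Nonempty := ⟨0, ∅, by simp [hP], rfl⟩
  obtain ⟨t, ht, htc⟩ := Nat.sSup_mem hne hbdd
  refine ⟨t, ht.1, hcard t ht, fun x hx => ?_⟩
  by_contra! hcon
  have hxt : x ∉ t := fun hxt => by
    have := hcon x hxt
    simp at this
    linarith
  have hP' : P (insert x t) := by
    refine ⟨?_, ?_⟩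
    · intro y hy
      rcases Finset.mem_insert.1 hy with rfl | hy
      · exact hx
      · exact ht.1 y hy
    · intro c hc c' hc' hcc
      rcases Finset.mem_insert.1 hc with rfl | h1 <;> rcases Finset.mem_insert.1 hc' with rfl | h2
      · exact absurd rfl hcc
      · exact (hcon c' h2).le
      · rw [norm_sub_rev]; exact (hcon c h1).le
      · exact ht.2 c h1 c' h2 hcc
  have := le_csSup hbdd ⟨insert x t, hP', rfl⟩
  rw [Finset.card_insert_of_notMem hxt, ← htc] at this
  omega

end Nets

/-! ### Exponential moment bounds for sums of independent copies. -/

section ExponentialMarkov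

variable {α : Type*} [MeasurableSpace α]

lemma lintegral_exp_sum_pi {μ : Measure α} [IsProbabilityMeasure μ] {m : ℕ} {F : α → ℝ}
    (hF : Measurable F) :
    ∫⁻ x, ENNReal.ofReal (Real.exp (∑ i, F (x i))) ∂Measure.pi (fun _ : Fin m => μ) =
      (∫⁻ a, ENNReal.ofReal (Real.exp (F a)) ∂μ) ^ m := by
  have hind : iIndepFun (fun (i : Fin m) (x : Fin m → α) => ENNReal.ofReal (Real.exp (F (x i))))
      (Measure.pi (fun _ : Fin m => μ)) :=
    iIndepFun_pi (X := fun _ a => ENNReal.ofReal (Real.exp (F a)))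
      (fun i => hF.exp.ennreal_ofReal.aemeasurable)
  have h := lintegral_prod_eq_prod_lintegral_of_indepFun Finset.univ _ hind
    (fun i => (hF.comp (measurable_pi_apply i)).exp.ennreal_ofReal)
  have e : ∀ x : Fin m → α, ENNReal.ofReal (Real.exp (∑ i, F (x i))) =
      ∏ i, ENNReal.ofReal (Real.exp (F (x i))) := by
    intro x
    rw [Real.exp_sum, ENNReal.ofReal_prod_of_nonneg fun i _ => (Real.exp_pos _).le]
  simp_rw [e]
  rw [h]
  have h2 : ∀ i : Fin m, ∫⁻ x, ENNReal.ofReal (Real.exp (F (x i)))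
      ∂Measure.pi (fun _ : Fin m => μ) = ∫⁻ a, ENNReal.ofReal (Real.exp (F a)) ∂μ := fun i =>
    (measurePreserving_eval (fun _ : Fin m => μ) i).lintegral_comp
      (f := fun a => ENNReal.ofReal (Real.exp (F a))) hF.exp.ennreal_ofReal
  simp_rw [h2]
  simp

/-- The exponential Markov inequality for sums of independent copies. -/
lemma measure_pi_sum_ge_le {μ : Measure α} [IsProbabilityMeasure μ] {m : ℕ} {F : α → ℝ}
    (hF : Measurable F) {B : ℝ} (hB0 : 0 ≤ B)
    (hB : ∫⁻ a, ENNReal.ofReal (Real.exp (F a)) ∂μ ≤ ENNReal.ofReal B) (T : ℝ) :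
    Measure.pi (fun _ : Fin m => μ) {x | T ≤ ∑ i, F (x i)} ≤
      ENNReal.ofReal (B ^ m * Real.exp (-T)) := by
  have hm : Measurable fun x : Fin m → α => ENNReal.ofReal (Real.exp (∑ i, F (x i))) :=
    (Finset.measurable_sum _ fun i _ => hF.comp (measurable_pi_apply i)).exp.ennreal_ofReal
  have h := meas_ge_le_lintegral_div (μ := Measure.pi (fun _ : Fin m => μ)) hm.aemeasurable
    (ε := ENNReal.ofReal (Real.exp T)) (by simp [Real.exp_pos]) ENNReal.ofReal_ne_top
  rw [lintegral_exp_sum_pi hF] at h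
  refine (measure_mono ?_).trans (h.trans ?_)
  · intro x hx
    exact ENNReal.ofReal_le_ofReal (Real.exp_le_exp.2 hx)
  · rw [ENNReal.div_eq_inv_mul, ← ENNReal.ofReal_inv_of_pos (Real.exp_pos _), ← Real.exp_neg,
      mul_comm, ENNReal.ofReal_mul (by positivity), ENNReal.ofReal_pow hB0]
    gcongr

/-- A Chernoff bound for averages of bounded nonnegative variables of small mean. -/
lemma measure_pi_avg_ge_le {μ : Measure α} [IsProbabilityMeasure μ] {m : ℕ} {Z : α → ℝ}
    (hZ : Measurable Z) {B q lam : ℝ} (hlam : 0 ≤ lam) (hq : 0 ≤ q) (hZ0 : ∀ a, 0 ≤ Z a)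
    (hZB : ∀ a, Z a ≤ B)
    (hZq : ∫⁻ a, ENNReal.ofReal (Z a) ∂μ ≤ ENNReal.ofReal q) (t : ℝ) :
    Measure.pi (fun _ : Fin m => μ) {x | t * m ≤ ∑ i, Z (x i)} ≤
      ENNReal.ofReal (Real.exp (m * (q * (lam * Real.exp (lam * B)) - lam * t))) := by
  have hF : Measurable fun a => lam * Z a := hZ.const_mul _
  set c := lam * Real.exp (lam * B) with hc
  have hc0 : 0 ≤ c := by positivity
  -- From `e^z - 1 ≤ z e^z` with `z ≤ lam * B` in the last exponent: a bound linear in `Z`, so that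
  -- only the mean of `Z` matters.
  have h1 : ∀ a, Real.exp (lam * Z a) ≤ 1 + c * Z a := by
    intro a
    have hz : 0 ≤ lam * Z a := mul_nonneg hlam (hZ0 a)
    have h2 : Real.exp (lam * Z a) - 1 ≤ (lam * Z a) * Real.exp (lam * Z a) := by
      have := Real.add_one_le_exp (-(lam * Z a))
      have h3 : Real.exp (-(lam * Z a)) * Real.exp (lam * Z a) = 1 := by
        rw [← Real.exp_add]; simp
      nlinarith [Real.exp_pos (lam * Z a)]
    have h4 : Real.exp (lam * Z a) ≤ Real.exp (lam * B) :=
      Real.exp_le_exp.2 (mul_le_mul_of_nonneg_left (hZB a) hlam)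
    nlinarith [mul_le_mul_of_nonneg_left h4 hz]
  have hB : ∫⁻ a, ENNReal.ofReal (Real.exp (lam * Z a)) ∂μ ≤ ENNReal.ofReal (Real.exp (q * c)) := by
    calc _ ≤ ∫⁻ a, (1 + ENNReal.ofReal c * ENNReal.ofReal (Z a)) ∂μ := by
          refine lintegral_mono fun a => ?_
          rw [← ENNReal.ofReal_mul hc0, ← ENNReal.ofReal_one,
            ← ENNReal.ofReal_add zero_le_one (mul_nonneg hc0 (hZ0 a))]
          exact ENNReal.ofReal_le_ofReal (h1 a)
      _ = 1 + ENNReal.ofReal c * ∫⁻ a, ENNReal.ofReal (Z a) ∂μ := by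
          rw [lintegral_add_left measurable_const, lintegral_const_mul _ hZ.ennreal_ofReal]
          simp
      _ ≤ 1 + ENNReal.ofReal c * ENNReal.ofReal q := by gcongr
      _ = ENNReal.ofReal (1 + c * q) := by
          rw [← ENNReal.ofReal_mul hc0, ENNReal.ofReal_add zero_le_one (by positivity),
            ENNReal.ofReal_one]
      _ ≤ _ := by
          apply ENNReal.ofReal_le_ofReal
          have := Real.add_one_le_exp (q * c)
          linarith
  have h := measure_pi_sum_ge_le (m := m) hF (Real.exp_pos _).le hB (lam * (t * m))
  refine (measure_mono ?_).trans (h.trans (le_of_eq ?_))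
  · intro x (hx : t * m ≤ _)
    simp only [Set.mem_ofPred_eq]
    rw [← Finset.mul_sum]
    exact mul_le_mul_of_nonneg_left hx hlam
  · rw [← Real.exp_nat_mul, ← Real.exp_add]
    congr 2
    ring

end ExponentialMarkov

/-! ### Operator norms of random families of vectors. -/

section OperatorNorm

variable {E : Type*} [NormedAddCommGroup E] [InnerProductSpace ℝ E]

/-- The family `v` satisfies `∑ ⟪v i, u⟫² ≤ C ‖u‖²` for all `u`. -/
def OpBound {m : ℕ} (v : Fin m → E) (C : ℝ) : Prop :=
  ∀ u, ∑ i, inner ℝ (v i) u ^ 2 ≤ C * ‖u‖ ^ 2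

/-- The linear map with rows `v i`. -/
def rowsCLM {m : ℕ} (v : Fin m → E) : E →L[ℝ] EuclideanSpace ℝ (Fin m) :=
  (EuclideanSpace.equiv (Fin m) ℝ).symm.toContinuousLinearMap ∘L
    ContinuousLinearMap.pi fun i => innerSL ℝ (v i)

lemma norm_rowsCLM_sq {m : ℕ} (v : Fin m → E) (u : E) :
    ‖rowsCLM v u‖ ^ 2 = ∑ i, inner ℝ (v i) u ^ 2 := by
  rw [EuclideanSpace.real_norm_sq_eq]; rfl

/-- Every unit vector is within `1 / 2` of the net, so `‖A‖ ≤ √s + ‖A‖ / 2` for the row map `A`,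
that is `‖A‖ ≤ 2 √s`. -/
lemma opBound_of_net {m : ℕ} (v : Fin m → E) (t : Finset E) {s : ℝ} (hs : 0 ≤ s)
    (ht : ∀ x : E, ‖x‖ ≤ 1 → ∃ y ∈ t, ‖x - y‖ ≤ 1 / 2)
    (h : ∀ y ∈ t, ∑ i, inner ℝ (v i) y ^ 2 ≤ s) : OpBound v (4 * s) := by
  set A := rowsCLM v
  have h1 : ∀ y ∈ t, ‖A y‖ ≤ √s := fun y hy => by
    apply Real.le_sqrt_of_sq_le
    rw [norm_rowsCLM_sq]
    exact h y hy
  have h2 : ‖A‖ ≤ √s + ‖A‖ / 2 := by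
    refine A.opNorm_le_of_unit_norm (by positivity) fun x hx => ?_
    obtain ⟨y, hy, hxy⟩ := ht x hx.le
    calc ‖A x‖ = ‖A y + A (x - y)‖ := by rw [← map_add]; simp
      _ ≤ ‖A y‖ + ‖A (x - y)‖ := norm_add_le _ _
      _ ≤ √s + ‖A‖ * (1 / 2) := by
        gcongr
        · exact h1 y hy
        · exact (A.le_opNorm _).trans (by gcongr)
      _ = _ := by ring
  have h3 : ‖A‖ ≤ 2 * √s := by linarith
  intro u
  rw [← norm_rowsCLM_sq]
  calc ‖A u‖ ^ 2 ≤ (2 * √s * ‖u‖) ^ 2 := by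
        gcongr
        exact (A.le_opNorm u).trans (by gcongr)
    _ = 4 * s * ‖u‖ ^ 2 := by rw [mul_pow, mul_pow, Real.sq_sqrt hs]; ring

/-- The adjoint of the row map has the same norm: pair the sum with itself and apply Cauchy–Schwarz.
-/
lemma norm_sum_smul_sq_le {m : ℕ} {v : Fin m → E} {C : ℝ} (hC : 0 ≤ C) (h : OpBound v C)
    (a : Fin m → ℝ) : ‖∑ i, a i • v i‖ ^ 2 ≤ C * ∑ i, a i ^ 2 := by
  set z := ∑ i, a i • v i with hz
  have h1 : ‖z‖ ^ 2 = ∑ i, a i * inner ℝ (v i) z := by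
    rw [← real_inner_self_eq_norm_sq]
    conv_lhs => rw [hz, sum_inner]
    exact Finset.sum_congr rfl fun i _ => by rw [real_inner_smul_left]
  have h2 : (‖z‖ ^ 2) ^ 2 ≤ (∑ i, a i ^ 2) * (C * ‖z‖ ^ 2) := by
    rw [h1]
    exact (Finset.sum_mul_sq_le_sq_mul_sq _ _ _).trans
      (by rw [← h1]; exact mul_le_mul_of_nonneg_left (h z) (Finset.sum_nonneg fun i _ => sq_nonneg _))
  rcases eq_or_lt_of_le (sq_nonneg ‖z‖) with h0 | h0
  · rw [← h0]
    exact mul_nonneg hC (Finset.sum_nonneg fun i _ => sq_nonneg _)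
  · have h3 : (‖z‖ ^ 2) * ‖z‖ ^ 2 ≤ (C * ∑ i, a i ^ 2) * ‖z‖ ^ 2 := by nlinarith
    exact le_of_mul_le_mul_right h3 h0

variable [FiniteDimensional ℝ E] [MeasurableSpace E] [BorelSpace E]

/-- Union bound over a `1 / 2`-net of the unit ball, of cardinality at most `5 ^ dim`, with the
exponential Markov inequality at each point of the net. -/
lemma measure_not_opBound_le {μ : Measure E} [IsProbabilityMeasure μ] {a B : ℝ} (ha : 0 ≤ a)
    (hB0 : 0 ≤ B)
    (hB : ∀ u : E, ‖u‖ ≤ 1 →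
      ∫⁻ v, ENNReal.ofReal (Real.exp (a * inner ℝ v u ^ 2)) ∂μ ≤ ENNReal.ofReal B)
    (m : ℕ) {s : ℝ} (hs : 0 ≤ s) :
    Measure.pi (fun _ : Fin m => μ) {v | ¬ OpBound v (4 * s)} ≤
      ENNReal.ofReal (5 ^ Module.finrank ℝ E * (B ^ m * Real.exp (-(a * s)))) := by
  obtain ⟨t, htS, htc, htn⟩ := exists_net (E := E) (R := 1) (ρ := 1 / 2) zero_le_one (by norm_num)
    (Metric.closedBall 0 1) (fun x hx => by simpa using hx)
  have hsub : {v : Fin m → E | ¬ OpBound v (4 * s)} ⊆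
      ⋃ y ∈ t, {v | a * s ≤ ∑ i, a * inner ℝ (v i) y ^ 2} := by
    intro v hv
    by_contra hcon
    simp only [Set.mem_iUnion, not_exists, Set.mem_ofPred_eq, not_le] at hcon
    apply hv
    refine opBound_of_net v t hs (fun x hx => htn x (by simpa using hx)) fun y hy => ?_
    have := hcon y hy
    rw [← Finset.mul_sum] at this
    by_contra! hlt
    exact absurd (mul_le_mul_of_nonneg_left hlt.le ha) (not_le.2 this)
  have hb : ∀ y ∈ t, Measure.pi (fun _ : Fin m => μ)
      {v | a * s ≤ ∑ i, a * inner ℝ (v i) y ^ 2} ≤ ENNReal.ofReal (B ^ m * Real.exp (-(a * s))) := by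
    intro y hy
    exact measure_pi_sum_ge_le (F := fun v => a * inner ℝ v y ^ 2) (by fun_prop) hB0
      (hB y (by simpa using htS y hy)) _
  calc _ ≤ Measure.pi (fun _ : Fin m => μ) (⋃ y ∈ t, {v | a * s ≤ ∑ i, a * inner ℝ (v i) y ^ 2}) :=
        measure_mono hsub
    _ ≤ ∑ y ∈ t, Measure.pi (fun _ : Fin m => μ) {v | a * s ≤ ∑ i, a * inner ℝ (v i) y ^ 2} :=
        measure_biUnion_finset_le _ _
    _ ≤ ∑ y ∈ t, ENNReal.ofReal (B ^ m * Real.exp (-(a * s))) := Finset.sum_le_sum hb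
    _ = ENNReal.ofReal (t.card * (B ^ m * Real.exp (-(a * s)))) := by
        rw [Finset.sum_const, nsmul_eq_mul, ENNReal.ofReal_mul (Nat.cast_nonneg t.card),
          ENNReal.ofReal_natCast]
    _ ≤ _ := by
        apply ENNReal.ofReal_le_ofReal
        gcongr
        calc (t.card : ℝ) ≤ _ := htc
          _ = _ := by norm_num

end OperatorNorm

/-! ### The Gaussian radius, and comparison of spherical with Gaussian integrals. -/

section Radius

/-- The mean norm of a standard Gaussian vector in dimension `d`. -/
def meanRadius (d : ℕ) : ℝ := ∫ x, ‖x‖ ∂stdGaussian (EuclideanSpace ℝ (Fin d))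

variable {d : ℕ}

lemma meanRadius_nonneg : 0 ≤ meanRadius d := integral_nonneg fun _ => norm_nonneg _

lemma lintegral_stdGaussian_eq_pi {F : EuclideanSpace ℝ (Fin d) → ℝ≥0∞} (hF : Measurable F) :
    ∫⁻ x, F x ∂stdGaussian (EuclideanSpace ℝ (Fin d)) =
      ∫⁻ x, F (WithLp.toLp 2 x) ∂Measure.pi (fun _ : Fin d => gaussianReal 0 1) := by
  rw [← map_pi_eq_stdGaussian, lintegral_map hF (by fun_prop)]

/-- `‖x‖²` is a sum of `d` independent squares of mean one, so the left side is its variance, and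
the variance of one square is at most its second moment. -/
lemma lintegral_norm_sq_sub_sq_le :
    ∫⁻ x, ENNReal.ofReal ((‖x‖ ^ 2 - d) ^ 2) ∂stdGaussian (EuclideanSpace ℝ (Fin d)) ≤
      ENNReal.ofReal (d * gaussMoment 4) := by
  have hL : MemLp (fun t : ℝ => t ^ 2) 2 (gaussianReal 0 1) := by
    have h4 : Integrable (fun t : ℝ => ‖t‖ ^ 4) (gaussianReal 0 1) := by
      simpa using (IsGaussian.memLp_id (gaussianReal 0 1) 4 (by simp)).integrable_norm_pow'
    rw [memLp_two_iff_integrable_sq (by fun_prop)]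
    refine h4.congr (ae_of_all _ fun t => ?_)
    simp only [Real.norm_eq_abs]
    rw [Even.pow_abs (by decide)]
    ring
  have hmean1 : ∫ t : ℝ, t ^ 2 ∂gaussianReal 0 1 = 1 := by
    have h := variance_fun_id_gaussianReal (μ := 0) (v := 1)
    rw [variance_eq_integral (by fun_prop)] at h
    simpa using h
  have hpi : ∀ i : Fin d, MemLp (fun x : Fin d → ℝ => x i ^ 2) 2
      (Measure.pi (fun _ : Fin d => gaussianReal 0 1)) := fun i =>
    hL.comp_measurePreserving (measurePreserving_eval (fun _ : Fin d => gaussianReal 0 1) i)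
  have hvar := variance_sum_pi (ι := Fin d) (μ := fun _ => gaussianReal 0 1)
    (X := fun _ t => t ^ 2) (fun _ => hL)
  have hmem : MemLp (∑ i : Fin d, fun ω : Fin d → ℝ => ω i ^ 2) 2
      (Measure.pi (fun _ : Fin d => gaussianReal 0 1)) := memLp_finsetSum' _ fun i _ => hpi i
  have hmean : ∫ x, (∑ i : Fin d, fun ω : Fin d → ℝ => ω i ^ 2) x
      ∂Measure.pi (fun _ : Fin d => gaussianReal 0 1) = d := by
    simp only [Finset.sum_apply]
    rw [integral_finsetSum _ fun i _ => (hpi i).integrable (by norm_num)]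
    have : ∀ i : Fin d, ∫ x : Fin d → ℝ, x i ^ 2 ∂Measure.pi (fun _ : Fin d => gaussianReal 0 1)
        = 1 := fun i => by
      rw [integral_comp_eval (μ := fun _ : Fin d => gaussianReal 0 1) (f := fun t : ℝ => t ^ 2)
        (by fun_prop), hmean1]
    simp [this]
  have hev := evariance_eq_lintegral_ofReal (∑ i : Fin d, fun ω : Fin d → ℝ => ω i ^ 2)
    (Measure.pi (fun _ : Fin d => gaussianReal 0 1))
  rw [hmean, ← ofReal_variance hmem, hvar] at hev
  rw [lintegral_stdGaussian_eq_pi (by fun_prop)]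
  have e : ∀ x : Fin d → ℝ, ‖WithLp.toLp 2 x‖ ^ 2 =
      (∑ i : Fin d, fun ω : Fin d → ℝ => ω i ^ 2) x := by
    intro x
    rw [EuclideanSpace.real_norm_sq_eq]; simp
  simp_rw [e]
  rw [← hev, Finset.sum_const, Finset.card_univ, Fintype.card_fin, nsmul_eq_mul]
  apply ENNReal.ofReal_le_ofReal
  gcongr
  refine (variance_le_expectation_sq (by fun_prop)).trans (le_of_eq ?_)
  refine integral_congr_ae (ae_of_all _ fun t => ?_)
  simp only [Pi.pow_apply]
  rw [Even.pow_abs (by decide)]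
  ring

variable [NeZero d]

/-- Factor `‖x‖² - d` and use `‖x‖ + √d ≥ √d`: the norm fluctuates by order one, independently of
`d`. -/
lemma lintegral_norm_sub_sqrt_sq_le :
    ∫⁻ x, ENNReal.ofReal ((‖x‖ - √d) ^ 2) ∂stdGaussian (EuclideanSpace ℝ (Fin d)) ≤
      ENNReal.ofReal (gaussMoment 4) := by
  have hd : (0 : ℝ) < d := by exact_mod_cast Nat.pos_of_ne_zero (NeZero.ne d)
  calc _ ≤ ∫⁻ x, ENNReal.ofReal (d : ℝ)⁻¹ * ENNReal.ofReal ((‖x‖ ^ 2 - d) ^ 2)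
        ∂stdGaussian (EuclideanSpace ℝ (Fin d)) := by
        refine lintegral_mono fun x => ?_
        rw [← ENNReal.ofReal_mul (by positivity)]
        apply ENNReal.ofReal_le_ofReal
        rw [inv_mul_eq_div, le_div_iff₀ hd]
        have h1 : (‖x‖ ^ 2 - (d : ℝ)) = (‖x‖ - √d) * (‖x‖ + √d) := by
          have := Real.sq_sqrt hd.le
          ring_nf
          rw [this]
        rw [h1, mul_pow]
        gcongr
        nlinarith [Real.sq_sqrt hd.le, norm_nonneg x, Real.sqrt_nonneg (d : ℝ)]
    _ = ENNReal.ofReal (d : ℝ)⁻¹ * ∫⁻ x, ENNReal.ofReal ((‖x‖ ^ 2 - d) ^ 2)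
        ∂stdGaussian (EuclideanSpace ℝ (Fin d)) := by
        rw [lintegral_const_mul _ (by fun_prop)]
    _ ≤ ENNReal.ofReal (d : ℝ)⁻¹ * ENNReal.ofReal (d * gaussMoment 4) := by
        gcongr
        exact lintegral_norm_sq_sub_sq_le
    _ = _ := by
        rw [← ENNReal.ofReal_mul (by positivity), ← mul_assoc, inv_mul_cancel₀ hd.ne', one_mul]

lemma meanRadius_sub_sqrt_sq_le : (meanRadius d - √d) ^ 2 ≤ gaussMoment 4 := by
  have hconv : ConvexOn ℝ Set.univ (fun t : ℝ => (t - √d) ^ 2) := by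
    have := (Even.convexOn_pow (𝕜 := ℝ) (n := 2) (by decide)).translate_left (-√d)
    simpa [Function.comp_def, sub_eq_add_neg] using this
  have h := ofReal_convex_integral_le hconv (fun t => sq_nonneg _)
    (integrable_norm_stdGaussian (E := EuclideanSpace ℝ (Fin d)))
  exact (ENNReal.ofReal_le_ofReal_iff (gaussMoment_nonneg 4)).1
    (h.trans lintegral_norm_sub_sqrt_sq_le)

lemma abs_meanRadius_sub_sqrt_le : |meanRadius d - √d| ≤ √(gaussMoment 4) :=
  Real.abs_le_sqrt meanRadius_sub_sqrt_sq_le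

/-- Convex functionals of a homogeneous function are smaller on the sphere of radius `meanRadius d`
than under the standard Gaussian measure. -/
lemma lintegral_unifSphere_le_stdGaussian {Φ : ℝ → ℝ} (hΦ : ConvexOn ℝ Set.univ Φ)
    (h0 : ∀ t, 0 ≤ Φ t) {f : EuclideanSpace ℝ (Fin d) → ℝ} (hf : Measurable f)
    (hhom : ∀ r : ℝ, 0 ≤ r → ∀ w, f (r • w) = r * f w) :
    ∫⁻ w, ENNReal.ofReal (Φ (meanRadius d * f w)) ∂unifSphere d ≤
      ∫⁻ x, ENNReal.ofReal (Φ (f x)) ∂stdGaussian (EuclideanSpace ℝ (Fin d)) := by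
  have hc : Continuous Φ := by
    rw [← continuousOn_univ]; exact hΦ.continuousOn isOpen_univ
  have hm : Measurable fun x => ENNReal.ofReal (Φ (f x)) := (hc.measurable.comp hf).ennreal_ofReal
  -- In polar form, for each fixed direction `w` the Gaussian side averages `Φ (‖x‖ * f w)` over the
  -- radius; Jensen replaces the radius by its mean.
  rw [lintegral_stdGaussian_polar hm, lintegral_lintegral_swap]
  · refine lintegral_mono fun w => ?_
    have h := ofReal_convex_integral_le hΦ h0
      ((integrable_norm_stdGaussian (E := EuclideanSpace ℝ (Fin d))).mul_const (f w))
    rw [integral_mul_const] at h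
    refine h.trans (le_of_eq (lintegral_congr fun x => ?_))
    rw [hhom _ (norm_nonneg x)]
  · refine Measurable.aemeasurable ?_
    exact (hc.measurable.comp (hf.comp (by fun_prop))).ennreal_ofReal

lemma lintegral_inner_pow_unifSphere_le (k : ℕ) (u : EuclideanSpace ℝ (Fin d)) :
    ∫⁻ w, ENNReal.ofReal (|meanRadius d * inner ℝ w u| ^ k) ∂unifSphere d ≤
      ENNReal.ofReal (‖u‖ ^ k * gaussMoment k) := by
  have hconv : ConvexOn ℝ Set.univ fun t : ℝ => |t| ^ k := by
    have h1 : ConvexOn ℝ Set.univ fun t : ℝ => |t| :=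
      convexOn_norm (E := ℝ) convex_univ
    exact h1.pow (fun _ _ => abs_nonneg _) k
  refine (lintegral_unifSphere_le_stdGaussian hconv (fun t => by positivity)
    (f := fun w => inner ℝ w u) (by fun_prop) (fun r _ w => by rw [real_inner_smul_left])).trans ?_
  simp_rw [real_inner_comm u]
  exact (lintegral_inner_pow_stdGaussian u k).le

end Radius

/-! ### Square-exponential moments of one-dimensional projections. -/

section SquareExponential

/-- A number `a > 0` for which `exp (a t²)` is integrable under the standard Gaussian law. -/
def fernConst : ℝ := (IsGaussian.exists_integrable_exp_sq (gaussianReal 0 1)).choose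

lemma fernConst_pos : 0 < fernConst :=
  (IsGaussian.exists_integrable_exp_sq (gaussianReal 0 1)).choose_spec.1

/-- The integral of `exp (a t²)` under the standard Gaussian law, for `a = fernConst`. -/
def fernBound : ℝ := ∫ t, Real.exp (fernConst * t ^ 2) ∂gaussianReal 0 1

lemma integrable_exp_fernConst :
    Integrable (fun t : ℝ => Real.exp (fernConst * t ^ 2)) (gaussianReal 0 1) := by
  simpa [fernConst] using (IsGaussian.exists_integrable_exp_sq (gaussianReal 0 1)).choose_spec.2

lemma one_le_fernBound : 1 ≤ fernBound := by
  have h : ∫ _t : ℝ, (1 : ℝ) ∂gaussianReal 0 1 ≤ fernBound :=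
    integral_mono (integrable_const _) integrable_exp_fernConst fun t =>
      Real.one_le_exp (mul_nonneg fernConst_pos.le (sq_nonneg t))
  simpa using h

variable {E : Type*} [NormedAddCommGroup E] [InnerProductSpace ℝ E] [FiniteDimensional ℝ E]
  [MeasurableSpace E] [BorelSpace E]

lemma lintegral_exp_inner_sq_stdGaussian (u : E) (hu : ‖u‖ ≤ 1) :
    ∫⁻ v, ENNReal.ofReal (Real.exp (fernConst * inner ℝ v u ^ 2)) ∂stdGaussian E ≤
      ENNReal.ofReal fernBound := by
  simp_rw [real_inner_comm u]
  rw [lintegral_inner_stdGaussian u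
    (F := fun t => ENNReal.ofReal (Real.exp (fernConst * t ^ 2))) (by fun_prop),
    fernBound, ofReal_integral_eq_lintegral_ofReal integrable_exp_fernConst
      (ae_of_all _ fun t => (Real.exp_pos _).le)]
  refine lintegral_mono fun t => ENNReal.ofReal_le_ofReal (Real.exp_le_exp.2 ?_)
  have := fernConst_pos
  gcongr fernConst * ?_
  rw [mul_pow]
  have : ‖u‖ ^ 2 ≤ 1 := pow_le_one₀ (norm_nonneg _) hu
  nlinarith [sq_nonneg t]

/-- `t ↦ exp (a t²)` is convex, so the Gaussian bound passes to the sphere, with the exponent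
improved by the factor `meanRadius d ^ 2`. -/
lemma lintegral_exp_inner_sq_unifSphere {d : ℕ} [NeZero d] (u : EuclideanSpace ℝ (Fin d))
    (hu : ‖u‖ ≤ 1) :
    ∫⁻ v, ENNReal.ofReal (Real.exp (fernConst * meanRadius d ^ 2 * inner ℝ v u ^ 2))
      ∂unifSphere d ≤ ENNReal.ofReal fernBound := by
  have hconv : ConvexOn ℝ Set.univ fun t : ℝ => Real.exp (fernConst * t ^ 2) := by
    have h1 : ConvexOn ℝ Set.univ fun t : ℝ => fernConst * t ^ 2 :=
      (Even.convexOn_pow (𝕜 := ℝ) (n := 2) (by decide)).smul fernConst_pos.le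
    refine ⟨convex_univ, fun x _ y _ a b ha hb hab => ?_⟩
    exact (Real.exp_le_exp.2 (h1.2 (Set.mem_univ x) (Set.mem_univ y) ha hb hab)).trans
      (convexOn_exp.2 (Set.mem_univ _) (Set.mem_univ _) ha hb hab)
  have h := lintegral_unifSphere_le_stdGaussian hconv (fun t => (Real.exp_pos _).le)
    (f := fun w : EuclideanSpace ℝ (Fin d) => inner ℝ w u) (by fun_prop)
    (fun r _ w => by rw [real_inner_smul_left])
  refine le_trans (le_of_eq (lintegral_congr fun v => ?_))
    (h.trans (lintegral_exp_inner_sq_stdGaussian u hu))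
  rw [mul_pow, mul_assoc]

end SquareExponential

/-! ### Gaussian measure of planar sectors and Sheppard's formula. -/

section Orthant

lemma stdGaussian_real : stdGaussian ℝ = gaussianReal 0 1 := by
  have h := map_inner_stdGaussian (E := ℝ) 1
  simpa using h

/-- The angular sector `{0 < a, 0 < cos α · a + sin α · b}` of the plane. -/
def sector (α : ℝ) : Set (ℝ × ℝ) := {p | 0 < p.1 ∧ 0 < Real.cos α * p.1 + Real.sin α * p.2}

lemma measurableSet_sector (α : ℝ) : MeasurableSet (sector α) := by
  change MeasurableSet ({p : ℝ × ℝ | 0 < p.1} ∩ {p | 0 < Real.cos α * p.1 + Real.sin α * p.2})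
  exact (measurableSet_lt (by fun_prop) (by fun_prop)).inter
    (measurableSet_lt (by fun_prop) (by fun_prop))

/-- The planar Gaussian density depends on the radius only, so a cone has measure a radial constant
times its angular width. The constant is left as an integral; the full plane determines it later. -/
lemma gaussian_prod_apply {A : Set (ℝ × ℝ)} (hA : MeasurableSet A) (S : Set ℝ)
    (hS : MeasurableSet S)
    (hAS : ∀ r : ℝ, 0 < r → ∀ θ ∈ Set.Ioo (-Real.pi) Real.pi,
      ((r * Real.cos θ, r * Real.sin θ) ∈ A ↔ θ ∈ S)) :
    ((gaussianReal 0 1).prod (gaussianReal 0 1)) A =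
      (∫⁻ r in Set.Ioi (0 : ℝ), ENNReal.ofReal (r * ((2 * Real.pi)⁻¹ * Real.exp (-r ^ 2 / 2)))) *
        volume (Set.Ioo (-Real.pi) Real.pi ∩ S) := by
  rw [gaussianReal_of_var_ne_zero 0 one_ne_zero, prod_withDensity (by fun_prop) (by fun_prop),
    withDensity_apply _ hA, ← lintegral_indicator hA, ← Measure.volume_eq_prod,
    ← lintegral_comp_polarCoord_symm, polarCoord_target, Measure.volume_eq_prod,
    ← Measure.prod_restrict]
  have hmeas : Measurable fun r : ℝ =>
      ENNReal.ofReal (r * ((2 * Real.pi)⁻¹ * Real.exp (-r ^ 2 / 2))) := by fun_prop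
  have hres : volume (Set.Ioo (-Real.pi) Real.pi ∩ S) =
      ∫⁻ θ in Set.Ioo (-Real.pi) Real.pi, S.indicator (fun _ => (1 : ℝ≥0∞)) θ := by
    rw [lintegral_indicator hS, setLIntegral_const, one_mul, Measure.restrict_apply hS,
      Set.inter_comm]
  rw [hres, ← lintegral_prod_mul hmeas.aemeasurable
    ((measurable_const.indicator hS).aemeasurable), Measure.prod_restrict]
  refine setLIntegral_congr_fun (measurableSet_Ioi.prod measurableSet_Ioo) fun p hp => ?_
  have hr : 0 < p.1 := hp.1
  have hiff := hAS p.1 hr p.2 hp.2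
  simp only [polarCoord_symm_apply, smul_eq_mul]
  by_cases h : p.2 ∈ S
  · rw [Set.indicator_of_mem (hiff.2 h), Set.indicator_of_mem h, mul_one]
    simp only [gaussianPDF]
    rw [← ENNReal.ofReal_mul (gaussianPDFReal_nonneg _ _ _), ← ENNReal.ofReal_mul hr.le]
    congr 2
    simp only [gaussianPDFReal, NNReal.coe_one, mul_one, sub_zero]
    rw [mul_mul_mul_comm, ← Real.exp_add, ← mul_inv, Real.mul_self_sqrt (by positivity)]
    congr 2
    have := Real.sin_sq_add_cos_sq p.2
    linear_combination (-(p.1 ^ 2) / 2) * this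
  · rw [Set.indicator_of_notMem (fun h' => h (hiff.1 h')), Set.indicator_of_notMem h, mul_zero,
      mul_zero]

lemma cos_pos_iff_of_mem {θ : ℝ} (h1 : -(3 * Real.pi / 2) ≤ θ) (h2 : θ < 3 * Real.pi / 2) :
    0 < Real.cos θ ↔ θ ∈ Set.Ioo (-(Real.pi / 2)) (Real.pi / 2) := by
  refine ⟨fun h => ?_, fun h => Real.cos_pos_of_mem_Ioo h⟩
  by_contra hc
  rw [Set.mem_Ioo, not_and_or, not_lt, not_lt] at hc
  rcases hc with hc | hc
  · have := Real.cos_nonpos_of_pi_div_two_le_of_le (x := -θ) (by linarith) (by linarith)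
    rw [Real.cos_neg] at this
    linarith
  · have := Real.cos_nonpos_of_pi_div_two_le_of_le (x := θ) hc (by linarith)
    linarith

/-- At angle `θ` the second condition reads `0 < cos (θ - α)`, so the sector is the angular interval
`(α - π / 2, π / 2)` of length `π - α`. -/
lemma gaussian_sector {α : ℝ} (h0 : 0 ≤ α) (hπ : α ≤ Real.pi) :
    ((gaussianReal 0 1).prod (gaussianReal 0 1)) (sector α) =
      ENNReal.ofReal ((Real.pi - α) / (2 * Real.pi)) := by
  have hpi := Real.pi_pos
  set c := ∫⁻ r in Set.Ioi (0 : ℝ), ENNReal.ofReal (r * ((2 * Real.pi)⁻¹ * Real.exp (-r ^ 2 / 2)))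
    with hc
  -- The full plane, of mass one and angular width `2π`, fixes the radial constant.
  have huniv := gaussian_prod_apply (A := Set.univ) MeasurableSet.univ Set.univ MeasurableSet.univ
    (fun r _ θ _ => by simp)
  rw [measure_univ, Set.inter_univ, Real.volume_Ioo, ← hc] at huniv
  have hcv : c = ENNReal.ofReal (2 * Real.pi)⁻¹ := by
    rw [ENNReal.ofReal_inv_of_pos (by positivity)]
    apply ENNReal.eq_inv_of_mul_eq_one_left
    rw [huniv]
    congr 2
    ring
  have hsec := gaussian_prod_apply (measurableSet_sector α)
    (Set.Ioo (α - Real.pi / 2) (Real.pi / 2)) measurableSet_Ioo (by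
      intro r hr θ hθ
      have e1 : Real.cos α * (r * Real.cos θ) + Real.sin α * (r * Real.sin θ) =
          r * Real.cos (θ - α) := by rw [Real.cos_sub]; ring
      simp only [sector, Set.mem_ofPred_eq, e1]
      rw [mul_pos_iff_of_pos_left hr, mul_pos_iff_of_pos_left hr,
        cos_pos_iff_of_mem (by linarith [hθ.1]) (by linarith [hθ.2])]
      constructor
      · rintro ⟨ha, hb⟩
        rw [cos_pos_iff_of_mem (by linarith [ha.1]) (by linarith [ha.2])] at hb
        exact ⟨by linarith [hb.1], ha.2⟩
      · rintro ⟨ha, hb⟩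
        refine ⟨⟨by linarith, hb⟩, ?_⟩
        rw [cos_pos_iff_of_mem (by linarith) (by linarith)]
        exact ⟨by linarith, by linarith⟩)
  rw [hsec, ← hc, hcv, Set.inter_eq_self_of_subset_right
    (Set.Ioo_subset_Ioo (by linarith) (by linarith)), Real.volume_Ioo,
    ← ENNReal.ofReal_mul (by positivity)]
  congr 1
  rw [inv_mul_eq_div]
  congr 1
  ring

variable {E : Type*} [NormedAddCommGroup E] [InnerProductSpace ℝ E] [FiniteDimensional ℝ E]
  [MeasurableSpace E] [BorelSpace E]

/-- Both sides are centered Gaussian laws on the plane with unit variances and covariance `cos α`;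
their characteristic functionals agree. -/
lemma map_pair_stdGaussian {w w' : E} (hw : ‖w‖ = 1) (hw' : ‖w'‖ = 1) {α : ℝ}
    (hα : Real.cos α = inner ℝ w w') :
    (stdGaussian E).map (fun x => (inner ℝ w x, inner ℝ w' x)) =
      ((gaussianReal 0 1).prod (gaussianReal 0 1)).map
        (fun p => (p.1, Real.cos α * p.1 + Real.sin α * p.2)) := by
  set T : E →L[ℝ] ℝ × ℝ := (innerSL ℝ w).prod (innerSL ℝ w') with hT
  set S : ℝ × ℝ →L[ℝ] ℝ × ℝ := (ContinuousLinearMap.fst ℝ ℝ ℝ).prod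
    (Real.cos α • ContinuousLinearMap.fst ℝ ℝ ℝ + Real.sin α • ContinuousLinearMap.snd ℝ ℝ ℝ) with hS
  have eT : (fun x => (inner ℝ w x, inner ℝ w' x)) = ⇑T := by ext x <;> rfl
  have eS : (fun p : ℝ × ℝ => (p.1, Real.cos α * p.1 + Real.sin α * p.2)) = ⇑S := by
    ext p <;> simp [hS]
  rw [eT, eS]
  have : IsProbabilityMeasure ((stdGaussian E).map T) :=
    Measure.isProbabilityMeasure_map T.continuous.aemeasurable
  have : IsProbabilityMeasure (((gaussianReal 0 1).prod (gaussianReal 0 1)).map S) :=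
    Measure.isProbabilityMeasure_map S.continuous.aemeasurable
  apply Measure.ext_of_charFunDual
  ext L
  rw [charFunDual_map, charFunDual_map, charFunDual_prod, ← stdGaussian_real,
    charFunDual_stdGaussian, charFunDual_stdGaussian, charFunDual_stdGaussian, ← Complex.exp_add]
  set s := L (1, 0)
  set t := L (0, 1)
  have hL : ∀ a b : ℝ, L (a, b) = s * a + t * b := by
    intro a b
    have : ((a, b) : ℝ × ℝ) = a • ((1, 0) : ℝ × ℝ) + b • ((0, 1) : ℝ × ℝ) := by simp
    rw [this, map_add, map_smul, map_smul, smul_eq_mul, smul_eq_mul]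
    ring
  have hn : ∀ (c : ℝ) (M : ℝ →L[ℝ] ℝ), (∀ a, M a = c * a) → ‖M‖ ^ 2 = c ^ 2 := by
    intro c M hM
    have : M = c • ContinuousLinearMap.id ℝ ℝ := by ext; simp [hM]
    rw [this, norm_smul, ContinuousLinearMap.norm_id, mul_one, Real.norm_eq_abs, sq_abs]
  have h1 : ‖L ∘SL T‖ ^ 2 = s ^ 2 + t ^ 2 + 2 * s * t * Real.cos α := by
    have : L ∘SL T = innerSL ℝ (s • w + t • w') := by
      ext x
      rw [ContinuousLinearMap.comp_apply, hT, ContinuousLinearMap.prod_apply, hL]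
      simp
    rw [this, innerSL_apply_norm, norm_add_sq_real, norm_smul, norm_smul, hw, hw',
      real_inner_smul_left, real_inner_smul_right, ← hα]
    simp only [Real.norm_eq_abs, mul_one, sq_abs]
    ring
  have h2 := hn (s + t * Real.cos α) ((L ∘SL S) ∘SL ContinuousLinearMap.inl ℝ ℝ ℝ) (fun a => by
    simp [hS, hL]; ring)
  have h3 := hn (t * Real.sin α) ((L ∘SL S) ∘SL ContinuousLinearMap.inr ℝ ℝ ℝ) (fun a => by
    simp [hS, hL]; ring)
  congr 1
  rw [← Complex.ofReal_pow, ← Complex.ofReal_pow, ← Complex.ofReal_pow, h1, h2, h3,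
    ← Complex.ofReal_neg, ← Complex.ofReal_neg, ← Complex.ofReal_neg]
  rw [← add_div, ← Complex.ofReal_add]
  congr 2
  linear_combination t ^ 2 * Real.sin_sq_add_cos_sq α

/-- Sheppard's formula for the Gaussian measure of the intersection of two half-spaces. -/
lemma stdGaussian_orthant {w w' : E} (hw : ‖w‖ = 1) (hw' : ‖w'‖ = 1) :
    stdGaussian E {x | 0 < inner ℝ w x ∧ 0 < inner ℝ w' x} =
      ENNReal.ofReal ((Real.pi - Real.arccos (inner ℝ w w')) / (2 * Real.pi)) := by
  have hb := abs_le.1 (abs_real_inner_le_norm w w')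
  rw [hw, hw', one_mul] at hb
  have hcos : Real.cos (Real.arccos (inner ℝ w w')) = inner ℝ w w' := Real.cos_arccos hb.1 hb.2
  have h := map_pair_stdGaussian hw hw' hcos
  have hQ : MeasurableSet {p : ℝ × ℝ | 0 < p.1 ∧ 0 < p.2} :=
    ((isOpen_lt continuous_const continuous_fst).inter
      (isOpen_lt continuous_const continuous_snd)).measurableSet
  have h2 := congrArg (fun μ => μ {p : ℝ × ℝ | 0 < p.1 ∧ 0 < p.2}) h
  rw [Measure.map_apply (by fun_prop) hQ, Measure.map_apply (by fun_prop) hQ] at h2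
  exact h2.trans (gaussian_sector (Real.arccos_nonneg _) (Real.arccos_le_pi _))

end Orthant

/-! ### The arccos kernel as the mean square of the gradient. -/

section Kernel

variable {d N : ℕ}

/-- The indicator of the positive half-line. -/
def step (t : ℝ) : ℝ := if 0 < t then 1 else 0

lemma measurable_step : Measurable step :=
  Measurable.ite measurableSet_Ioi measurable_const measurable_const

lemma step_nonneg (t : ℝ) : 0 ≤ step t := by unfold step; split_ifs <;> norm_num

lemma step_le_one (t : ℝ) : step t ≤ 1 := by unfold step; split_ifs <;> norm_num

/-- The gradient `∑ θₗ 1(⟨wₗ, x⟩ > 0) wₗ` of the predictor. -/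
def gradAt (w : Fin N → EuclideanSpace ℝ (Fin d)) (θ : EuclideanSpace ℝ (Fin N))
    (x : EuclideanSpace ℝ (Fin d)) : EuclideanSpace ℝ (Fin d) :=
  ∑ l, (θ l * step (inner ℝ (w l) x)) • w l

lemma measurable_gradAt (w : Fin N → EuclideanSpace ℝ (Fin d)) (θ : EuclideanSpace ℝ (Fin N)) :
    Measurable (gradAt w θ) := by
  unfold gradAt
  refine Finset.measurable_sum _ fun l _ => ?_
  exact ((measurable_step.comp (by fun_prop)).const_mul _).smul_const _

/-- The quadratic form of the arccos kernel matrix. -/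
def kForm (w : Fin N → EuclideanSpace ℝ (Fin d)) (θ : EuclideanSpace ℝ (Fin N)) : ℝ :=
  ∑ l, ∑ k, θ l * θ k * arccosKernel w l k

lemma arccosKernel_apply (w : Fin N → EuclideanSpace ℝ (Fin d)) (l k : Fin N) :
    arccosKernel w l k = inner ℝ (w l) (w k) *
      ((Real.pi - Real.arccos (inner ℝ (w l) (w k))) / (2 * Real.pi)) := rfl

lemma arccosKernel_symm (w : Fin N → EuclideanSpace ℝ (Fin d)) (l k : Fin N) :
    arccosKernel w l k = arccosKernel w k l := by
  rw [arccosKernel_apply, arccosKernel_apply, real_inner_comm]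

lemma isHermitian_arccosKernel (w : Fin N → EuclideanSpace ℝ (Fin d)) :
    (arccosKernel w).IsHermitian := by
  ext l k
  simp [arccosKernel_symm w l k]

lemma norm_gradAt_sq (w : Fin N → EuclideanSpace ℝ (Fin d)) (θ : EuclideanSpace ℝ (Fin N))
    (x : EuclideanSpace ℝ (Fin d)) :
    ‖gradAt w θ x‖ ^ 2 = ∑ l, ∑ k, θ l * θ k * inner ℝ (w l) (w k) *
      (step (inner ℝ (w l) x) * step (inner ℝ (w k) x)) := by
  rw [← real_inner_self_eq_norm_sq, gradAt, sum_inner]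
  refine Finset.sum_congr rfl fun l _ => ?_
  rw [inner_sum]
  refine Finset.sum_congr rfl fun k _ => ?_
  rw [real_inner_smul_left, real_inner_smul_right]
  ring

lemma integral_step_mul_step {u v : EuclideanSpace ℝ (Fin d)} (hu : ‖u‖ = 1) (hv : ‖v‖ = 1) :
    ∫ x, step (inner ℝ u x) * step (inner ℝ v x) ∂stdGaussian (EuclideanSpace ℝ (Fin d)) =
      (Real.pi - Real.arccos (inner ℝ u v)) / (2 * Real.pi) := by
  have hA : MeasurableSet {x : EuclideanSpace ℝ (Fin d) | 0 < inner ℝ u x ∧ 0 < inner ℝ v x} := by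
    change MeasurableSet ({x : EuclideanSpace ℝ (Fin d) | 0 < inner ℝ u x} ∩ {x | 0 < inner ℝ v x})
    exact (measurableSet_lt (by fun_prop) (by fun_prop)).inter
      (measurableSet_lt (by fun_prop) (by fun_prop))
  have e : (fun x : EuclideanSpace ℝ (Fin d) => step (inner ℝ u x) * step (inner ℝ v x)) =
      {x | 0 < inner ℝ u x ∧ 0 < inner ℝ v x}.indicator (fun _ => (1 : ℝ)) := by
    ext x
    by_cases h1 : 0 < inner ℝ u x <;> by_cases h2 : 0 < inner ℝ v x <;>
      simp [step, Set.indicator, h1, h2]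
  rw [e, integral_indicator hA, setIntegral_const, smul_eq_mul, mul_one, measureReal_def,
    stdGaussian_orthant hu hv, ENNReal.toReal_ofReal]
  have := Real.arccos_le_pi (inner ℝ u v)
  have := Real.pi_pos
  exact div_nonneg (by linarith) (by linarith)

lemma integrable_step_mul_step (u v : EuclideanSpace ℝ (Fin d)) :
    Integrable (fun x => step (inner ℝ u x) * step (inner ℝ v x))
      (stdGaussian (EuclideanSpace ℝ (Fin d))) := by
  refine (integrable_const (1 : ℝ)).mono' ?_ (ae_of_all _ fun x => ?_)
  · exact ((measurable_step.comp (by fun_prop)).mul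
      (measurable_step.comp (by fun_prop))).aestronglyMeasurable
  · rw [Real.norm_of_nonneg (mul_nonneg (step_nonneg _) (step_nonneg _))]
    exact mul_le_one₀ (step_le_one _) (step_nonneg _) (step_le_one _)

lemma integrable_norm_gradAt_sq (w : Fin N → EuclideanSpace ℝ (Fin d))
    (θ : EuclideanSpace ℝ (Fin N)) :
    Integrable (fun x => ‖gradAt w θ x‖ ^ 2) (stdGaussian (EuclideanSpace ℝ (Fin d))) := by
  simp_rw [norm_gradAt_sq]
  exact integrable_finsetSum _ fun l _ => integrable_finsetSum _ fun k _ =>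
    (integrable_step_mul_step _ _).const_mul _

/-- Expanding the square leaves the probabilities that two neurons are active together, which
Sheppard's formula evaluates. This identity also shows that the kernel is positive semidefinite. -/
lemma integral_norm_gradAt_sq {w : Fin N → EuclideanSpace ℝ (Fin d)} (hw : ∀ l, ‖w l‖ = 1)
    (θ : EuclideanSpace ℝ (Fin N)) :
    ∫ x, ‖gradAt w θ x‖ ^ 2 ∂stdGaussian (EuclideanSpace ℝ (Fin d)) = kForm w θ := by
  simp_rw [norm_gradAt_sq]
  rw [integral_finsetSum _ fun l _ => integrable_finsetSum _ fun k _ =>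
    (integrable_step_mul_step _ _).const_mul _, kForm]
  refine Finset.sum_congr rfl fun l _ => ?_
  rw [integral_finsetSum _ fun k _ => (integrable_step_mul_step _ _).const_mul _]
  refine Finset.sum_congr rfl fun k _ => ?_
  rw [integral_const_mul, integral_step_mul_step (hw l) (hw k), arccosKernel_apply]
  ring

lemma kForm_nonneg {w : Fin N → EuclideanSpace ℝ (Fin d)} (hw : ∀ l, ‖w l‖ = 1)
    (θ : EuclideanSpace ℝ (Fin N)) : 0 ≤ kForm w θ := by
  rw [← integral_norm_gradAt_sq hw]
  exact integral_nonneg fun _ => by positivity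

lemma kForm_eq_dotProduct (w : Fin N → EuclideanSpace ℝ (Fin d)) (θ : EuclideanSpace ℝ (Fin N)) :
    kForm w θ = θ.ofLp ⬝ᵥ (arccosKernel w *ᵥ θ.ofLp) := by
  simp only [kForm, dotProduct, Matrix.mulVec, Finset.mul_sum]
  refine Finset.sum_congr rfl fun l _ => Finset.sum_congr rfl fun k _ => by ring

lemma posSemidef_arccosKernel {w : Fin N → EuclideanSpace ℝ (Fin d)} (hw : ∀ l, ‖w l‖ = 1) :
    (arccosKernel w).PosSemidef := by
  refine Matrix.PosSemidef.of_dotProduct_mulVec_nonneg (isHermitian_arccosKernel w) fun x => ?_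
  have := kForm_nonneg hw (WithLp.toLp 2 x)
  rw [kForm_eq_dotProduct] at this
  simpa using this

/-- `Real.sqrt` is a square root only on nonnegative reals; positive semidefiniteness, available for
unit weights, keeps the spectrum there. -/
lemma J_mul_self {w : Fin N → EuclideanSpace ℝ (Fin d)} (hw : ∀ l, ‖w l‖ = 1) :
    J w * J w = arccosKernel w := by
  have hP := posSemidef_arccosKernel hw
  have hsa : IsSelfAdjoint (arccosKernel w) := isHermitian_arccosKernel w
  rw [J, ← cfc_mul Real.sqrt Real.sqrt (arccosKernel w)]
  conv_rhs => rw [← cfc_id ℝ (arccosKernel w)]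
  refine cfc_congr fun x hx => ?_
  have hx0 : 0 ≤ x := by
    rw [(isHermitian_arccosKernel w).spectrum_real_eq_range_eigenvalues] at hx
    obtain ⟨i, rfl⟩ := hx
    exact hP.eigenvalues_nonneg i
  simp [Real.mul_self_sqrt hx0]

lemma norm_J_sq {w : Fin N → EuclideanSpace ℝ (Fin d)} (hw : ∀ l, ‖w l‖ = 1)
    (θ : EuclideanSpace ℝ (Fin N)) :
    ‖Matrix.toEuclideanLin (J w) θ‖ ^ 2 = kForm w θ := by
  have hJ : (J w).IsHermitian := cfc_predicate (p := IsSelfAdjoint) Real.sqrt (arccosKernel w)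
  rw [kForm_eq_dotProduct, ← J_mul_self hw, ← Matrix.mulVec_mulVec, Matrix.dotProduct_mulVec,
    EuclideanSpace.real_norm_sq_eq]
  have hT : θ.ofLp ᵥ* J w = J w *ᵥ θ.ofLp := by
    rw [← Matrix.mulVec_transpose]
    congr 1
  rw [hT, dotProduct]
  refine Finset.sum_congr rfl fun i _ => ?_
  rw [sq]
  rfl

lemma norm_J_eq_sqrt {w : Fin N → EuclideanSpace ℝ (Fin d)} (hw : ∀ l, ‖w l‖ = 1)
    (θ : EuclideanSpace ℝ (Fin N)) :
    ‖Matrix.toEuclideanLin (J w) θ‖ = √(kForm w θ) := by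
  rw [← norm_J_sq hw, Real.sqrt_sq (norm_nonneg _)]

end Kernel

/-! ### A smooth approximation of the step function. -/

section SmoothStep

/-- A smooth approximation of the indicator of the positive half-line. -/
def smoothStep (η t : ℝ) : ℝ := 1 / 2 * (1 + t / √(t ^ 2 + η ^ 2))

/-- The derivative of `smoothStep`. -/
def smoothStepDeriv (η t : ℝ) : ℝ := 1 / 2 * (η ^ 2 / ((t ^ 2 + η ^ 2) * √(t ^ 2 + η ^ 2)))

variable {η : ℝ}

lemma sqrt_add_sq_pos (hη : 0 < η) (t : ℝ) : 0 < √(t ^ 2 + η ^ 2) :=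
  Real.sqrt_pos.2 (by positivity)

lemma hasDerivAt_sqrt_add_sq (hη : 0 < η) (t : ℝ) :
    HasDerivAt (fun t => √(t ^ 2 + η ^ 2)) (t / √(t ^ 2 + η ^ 2)) t := by
  have h1 : HasDerivAt (fun t : ℝ => t ^ 2 + η ^ 2) (2 * t) t := by
    simpa using (hasDerivAt_pow 2 t).add_const (η ^ 2)
  have h2 := h1.sqrt (by positivity)
  convert h2 using 1
  field_simp

lemma hasDerivAt_smoothStep (hη : 0 < η) (t : ℝ) :
    HasDerivAt (smoothStep η) (smoothStepDeriv η t) t := by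
  have hr := sqrt_add_sq_pos hη t
  have h := (((hasDerivAt_id t).div (hasDerivAt_sqrt_add_sq hη t) hr.ne').const_add 1).const_mul
    (1 / 2 : ℝ)
  refine h.congr_deriv ?_
  have hs : √(t ^ 2 + η ^ 2) ^ 2 = t ^ 2 + η ^ 2 := Real.sq_sqrt (by positivity)
  have hp : 0 < t ^ 2 + η ^ 2 := by positivity
  rw [smoothStepDeriv, hs]
  simp only [id]
  congr 1
  rw [div_eq_div_iff hp.ne' (by positivity)]
  set r := √(t ^ 2 + η ^ 2)
  have : (1 * r - t * (t / r)) * r = η ^ 2 := by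
    field_simp
    linarith
  linear_combination (t ^ 2 + η ^ 2) * this

lemma continuous_smoothStepDeriv (hη : 0 < η) : Continuous (smoothStepDeriv η) := by
  unfold smoothStepDeriv
  refine continuous_const.mul (continuous_const.div (by fun_prop) fun t => ?_)
  have := sqrt_add_sq_pos hη t
  positivity

lemma continuous_smoothStep (hη : 0 < η) : Continuous (smoothStep η) :=
  continuous_iff_continuousAt.2 fun t => (hasDerivAt_smoothStep hη t).continuousAt

lemma smoothStepDeriv_nonneg (t : ℝ) : 0 ≤ smoothStepDeriv η t := by
  unfold smoothStepDeriv; positivity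

lemma smoothStepDeriv_le (hη : 0 < η) (t : ℝ) : smoothStepDeriv η t ≤ 1 / η := by
  have h1 : η ≤ √(t ^ 2 + η ^ 2) := Real.le_sqrt_of_sq_le (by nlinarith [sq_nonneg t])
  have h2 : η ^ 2 ≤ t ^ 2 + η ^ 2 := by nlinarith [sq_nonneg t]
  unfold smoothStepDeriv
  have h3 : η ^ 2 / ((t ^ 2 + η ^ 2) * √(t ^ 2 + η ^ 2)) ≤ η ^ 2 / (η ^ 2 * η) := by gcongr
  have h4 : η ^ 2 / (η ^ 2 * η) = 1 / η := by field_simp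
  have h5 : 0 < 1 / η := by positivity
  linarith

lemma abs_div_sqrt_le_one (hη : 0 < η) (t : ℝ) : |t / √(t ^ 2 + η ^ 2)| ≤ 1 := by
  have hr := sqrt_add_sq_pos hη t
  rw [abs_div, abs_of_pos hr, div_le_one hr]
  exact Real.abs_le_sqrt (by nlinarith [sq_nonneg η])

lemma smoothStep_nonneg (hη : 0 < η) (t : ℝ) : 0 ≤ smoothStep η t := by
  have := abs_le.1 (abs_div_sqrt_le_one hη t)
  unfold smoothStep; linarith

lemma smoothStep_le_one (hη : 0 < η) (t : ℝ) : smoothStep η t ≤ 1 := by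
  have := abs_le.1 (abs_div_sqrt_le_one hη t)
  unfold smoothStep; linarith

/-- The indicator of the interval `[-a, a]`. -/
def nearZero (a t : ℝ) : ℝ := if |t| ≤ a then 1 else 0

lemma measurable_nearZero (a : ℝ) : Measurable (nearZero a) :=
  Measurable.ite (measurableSet_le measurable_norm measurable_const) measurable_const
    measurable_const

lemma nearZero_nonneg (a t : ℝ) : 0 ≤ nearZero a t := by unfold nearZero; split_ifs <;> norm_num

lemma nearZero_le_one (a t : ℝ) : nearZero a t ≤ 1 := by unfold nearZero; split_ifs <;> norm_num

/-- The standard Gaussian density is at most `1 / √(2π) ≤ 1 / 2`. -/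
lemma lintegral_nearZero_le (a : ℝ) :
    ∫⁻ t, ENNReal.ofReal (nearZero a t) ∂gaussianReal 0 1 ≤ ENNReal.ofReal a := by
  have e : (fun t => ENNReal.ofReal (nearZero a t)) = (Set.Icc (-a) a).indicator fun _ => 1 := by
    ext t
    by_cases h : |t| ≤ a
    · have h' : t ∈ Set.Icc (-a) a := abs_le.1 h
      rw [Set.indicator_of_mem h']; simp [nearZero, h]
    · have h' : t ∉ Set.Icc (-a) a := fun h' => h (abs_le.2 h')
      rw [Set.indicator_of_notMem h']; simp [nearZero, h]
  rw [e, lintegral_indicator measurableSet_Icc, setLIntegral_const, one_mul,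
    gaussianReal_apply 0 one_ne_zero]
  have hb : ∀ t, gaussianPDF 0 1 t ≤ ENNReal.ofReal (1 / 2) := by
    intro t
    apply ENNReal.ofReal_le_ofReal
    simp only [gaussianPDFReal, NNReal.coe_one, mul_one, sub_zero]
    have h1 : Real.exp (-t ^ 2 / 2) ≤ 1 := Real.exp_le_one_iff.2 (by nlinarith [sq_nonneg t])
    have h2 : (2 : ℝ) ≤ √(2 * Real.pi) := Real.le_sqrt_of_sq_le (by linarith [Real.pi_gt_three])
    calc (√(2 * Real.pi))⁻¹ * Real.exp (-t ^ 2 / 2) ≤ (√(2 * Real.pi))⁻¹ * 1 := by gcongr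
      _ ≤ 1 / 2 := by rw [mul_one, one_div]; gcongr
  calc _ ≤ ∫⁻ t in Set.Icc (-a) a, ENNReal.ofReal (1 / 2) := lintegral_mono fun t => hb t
    _ = ENNReal.ofReal a := by
      rw [setLIntegral_const, Real.volume_Icc, ← ENNReal.ofReal_mul (by norm_num)]
      congr 1; ring

/-- For `|t| ≤ √η` the difference is at most one. For larger `|t|`, with `r = √(t² + η²)`, it is
half of `1 - |t| / r = η² / (r (r + |t|))`, which is at most `η` because `r² ≥ t² > η`. -/
lemma abs_step_sub_smoothStep_le (hη : 0 < η) (t : ℝ) :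
    (step t - smoothStep η t) ^ 2 ≤ nearZero (√η) t + η ^ 2 := by
  have h0 := smoothStep_nonneg hη t
  have h1 := smoothStep_le_one hη t
  have h2 := step_nonneg t
  have h3 := step_le_one t
  by_cases h : |t| ≤ √η
  · have : nearZero (√η) t = 1 := by simp [nearZero, h]
    rw [this]
    have : |step t - smoothStep η t| ≤ 1 := abs_le.2 ⟨by linarith, by linarith⟩
    have := (sq_le_one_iff_abs_le_one _).2 this
    nlinarith [sq_nonneg η]
  · have hz : nearZero (√η) t = 0 := by simp [nearZero, h]
    rw [hz, zero_add]
    push Not at h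
    have ht2 : η < t ^ 2 := by
      rw [← Real.sq_sqrt hη.le, ← sq_abs t]
      exact pow_lt_pow_left₀ h (Real.sqrt_nonneg _) (by norm_num)
    set r := √(t ^ 2 + η ^ 2) with hr
    have hrp : 0 < r := sqrt_add_sq_pos hη t
    have hr2 : r ^ 2 = t ^ 2 + η ^ 2 := Real.sq_sqrt (by positivity)
    have htr : |t| ≤ r := Real.abs_le_sqrt (by nlinarith [sq_nonneg η])
    have htp : 0 < |t| := (Real.sqrt_nonneg _).trans_lt h
    have key : 1 - |t| / r ≤ η := by
      have e1 : 1 - |t| / r = (r - |t|) / r := by field_simp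
      rw [e1, div_le_iff₀ hrp]
      have e2 : (r - |t|) * (r + |t|) = η ^ 2 := by
        have := sq_abs t
        nlinarith
      have e3 : η ^ 2 ≤ η * (r * (r + |t|)) := by nlinarith [mul_nonneg hrp.le htp.le]
      have : (r - |t|) * (r + |t|) ≤ η * r * (r + |t|) := by linarith
      exact le_of_mul_le_mul_right this (by positivity)
    have key0 : 0 ≤ 1 - |t| / r := by
      rw [sub_nonneg, div_le_one hrp]; exact htr
    have hdiff : |step t - smoothStep η t| = 1 / 2 * (1 - |t| / r) := by
      unfold step smoothStep
      rcases lt_or_ge 0 t with hp | hp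
      · rw [if_pos hp, abs_of_pos hp] at *
        rw [← hr]
        rw [show (1 : ℝ) - 1 / 2 * (1 + t / r) = 1 / 2 * (1 - t / r) by ring, abs_of_nonneg]
        linarith
      · rw [if_neg (not_lt.2 hp), abs_of_nonpos hp] at *
        rw [← hr]
        rw [show (0 : ℝ) - 1 / 2 * (1 + t / r) = -(1 / 2 * (1 - -t / r)) by ring, abs_neg,
          abs_of_nonneg]
        linarith
    rw [← sq_abs, hdiff]
    have : 1 / 2 * (1 - |t| / r) ≤ η := by linarith
    exact pow_le_pow_left₀ (by linarith) this 2

lemma lintegral_step_sub_smoothStep_le {E : Type*} [NormedAddCommGroup E] [InnerProductSpace ℝ E]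
    [FiniteDimensional ℝ E] [MeasurableSpace E] [BorelSpace E] (hη : 0 < η) {w : E} (hw : ‖w‖ = 1) :
    ∫⁻ x, ENNReal.ofReal ((step (inner ℝ w x) - smoothStep η (inner ℝ w x)) ^ 2) ∂stdGaussian E ≤
      ENNReal.ofReal (√η + η ^ 2) := by
  rw [lintegral_inner_stdGaussian w
    (F := fun t => ENNReal.ofReal ((step t - smoothStep η t) ^ 2))
    ((measurable_step.sub (continuous_smoothStep hη).measurable).pow_const 2).ennreal_ofReal]
  simp_rw [hw, one_mul]
  calc _ ≤ ∫⁻ t, (ENNReal.ofReal (nearZero (√η) t) + ENNReal.ofReal (η ^ 2)) ∂gaussianReal 0 1 := by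
        refine lintegral_mono fun t => ?_
        rw [← ENNReal.ofReal_add (nearZero_nonneg _ _) (by positivity)]
        exact ENNReal.ofReal_le_ofReal (abs_step_sub_smoothStep_le hη t)
    _ = (∫⁻ t, ENNReal.ofReal (nearZero (√η) t) ∂gaussianReal 0 1) + ENNReal.ofReal (η ^ 2) := by
        rw [lintegral_add_right _ measurable_const]; simp
    _ ≤ ENNReal.ofReal (√η) + ENNReal.ofReal (η ^ 2) := by
        gcongr
        exact lintegral_nearZero_le _
    _ = _ := (ENNReal.ofReal_add (Real.sqrt_nonneg _) (by positivity)).symm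

end SmoothStep

/-! ### Concentration of the norm of the gradient. -/

section GradientConcentration

variable {d N : ℕ} {η : ℝ}

/-- The smoothed gradient. -/
def smoothGrad (η : ℝ) (w : Fin N → EuclideanSpace ℝ (Fin d)) (θ : EuclideanSpace ℝ (Fin N))
    (x : EuclideanSpace ℝ (Fin d)) : EuclideanSpace ℝ (Fin d) :=
  ∑ l, (θ l * smoothStep η (inner ℝ (w l) x)) • w l

/-- The derivative of the smoothed gradient. -/
def smoothGradDeriv (η : ℝ) (w : Fin N → EuclideanSpace ℝ (Fin d)) (θ : EuclideanSpace ℝ (Fin N))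
    (x : EuclideanSpace ℝ (Fin d)) : EuclideanSpace ℝ (Fin d) →L[ℝ] EuclideanSpace ℝ (Fin d) :=
  ∑ l, ((θ l * smoothStepDeriv η (inner ℝ (w l) x)) • innerSL ℝ (w l)).smulRight (w l)

lemma hasFDerivAt_smoothGrad (hη : 0 < η) (w : Fin N → EuclideanSpace ℝ (Fin d))
    (θ : EuclideanSpace ℝ (Fin N)) (x : EuclideanSpace ℝ (Fin d)) :
    HasFDerivAt (smoothGrad η w θ) (smoothGradDeriv η w θ x) x := by
  unfold smoothGrad smoothGradDeriv
  refine HasFDerivAt.fun_sum fun l _ => ?_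
  have h1 : HasFDerivAt (fun x => inner ℝ (w l) x) (innerSL ℝ (w l)) x :=
    (innerSL ℝ (w l)).hasFDerivAt
  have h2 := ((hasDerivAt_smoothStep hη (inner ℝ (w l) x)).comp_hasFDerivAt x h1).const_mul (θ l)
  have h3 := h2.smul_const (w l)
  rw [smul_smul] at h3
  exact h3

lemma continuous_smoothGrad (hη : 0 < η) (w : Fin N → EuclideanSpace ℝ (Fin d))
    (θ : EuclideanSpace ℝ (Fin N)) : Continuous (smoothGrad η w θ) :=
  continuous_iff_continuousAt.2 fun x => (hasFDerivAt_smoothGrad hη w θ x).continuousAt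

lemma continuous_smoothGradDeriv (hη : 0 < η) (w : Fin N → EuclideanSpace ℝ (Fin d))
    (θ : EuclideanSpace ℝ (Fin N)) : Continuous (smoothGradDeriv η w θ) := by
  unfold smoothGradDeriv
  refine continuous_finsetSum _ fun l _ => ?_
  have h1 : Continuous fun x => (θ l * smoothStepDeriv η (inner ℝ (w l) x)) • innerSL ℝ (w l) :=
    (continuous_const.mul ((continuous_smoothStepDeriv hη).comp (by fun_prop))).smul
      continuous_const
  exact ((ContinuousLinearMap.smulRightL ℝ _ _).flip (w l)).continuous.comp h1

lemma sum_mul_sq_le_of_abs_le_one (θ : EuclideanSpace ℝ (Fin N)) (s : Fin N → ℝ)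
    (hs : ∀ l, |s l| ≤ 1) : ∑ l, (θ l * s l) ^ 2 ≤ ‖θ‖ ^ 2 := by
  rw [EuclideanSpace.real_norm_sq_eq]
  refine Finset.sum_le_sum fun l _ => ?_
  rw [mul_pow]
  have := (sq_le_one_iff_abs_le_one _).2 (hs l)
  nlinarith [sq_nonneg (θ l)]

variable {w : Fin N → EuclideanSpace ℝ (Fin d)} {θ : EuclideanSpace ℝ (Fin N)} {C C₀ κ : ℝ}

lemma norm_gradAt_le (hC : 0 ≤ C) (hw : OpBound w C) (x : EuclideanSpace ℝ (Fin d)) :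
    ‖gradAt w θ x‖ ≤ √C * ‖θ‖ := by
  refine le_of_sq_le_sq ?_ (by positivity)
  rw [mul_pow, Real.sq_sqrt hC]
  refine (norm_sum_smul_sq_le hC hw _).trans ?_
  gcongr
  refine sum_mul_sq_le_of_abs_le_one θ _ fun l => ?_
  rw [abs_of_nonneg (step_nonneg _)]
  exact step_le_one _

lemma norm_smoothGrad_le (hη : 0 < η) (hC : 0 ≤ C) (hw : OpBound w C)
    (x : EuclideanSpace ℝ (Fin d)) : ‖smoothGrad η w θ x‖ ≤ √C * ‖θ‖ := by
  refine le_of_sq_le_sq ?_ (by positivity)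
  rw [mul_pow, Real.sq_sqrt hC]
  refine (norm_sum_smul_sq_le hC hw _).trans ?_
  gcongr
  refine sum_mul_sq_le_of_abs_le_one θ _ fun l => ?_
  rw [abs_of_nonneg (smoothStep_nonneg hη _)]
  exact smoothStep_le_one hη _

/-- The operator bound is used twice, for the vectors `w l` and for the coefficients `⟪w l, y⟫`, so
only the largest coordinate `κ` of `θ` enters. This is how small coordinates produce concentration.
-/
lemma norm_smoothGradDeriv_apply_le (hη : 0 < η) (hC : 0 ≤ C) (hw : OpBound w C) (hκ : 0 ≤ κ)
    (hθκ : ∀ l, |θ l| ≤ κ) (x y : EuclideanSpace ℝ (Fin d)) :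
    ‖smoothGradDeriv η w θ x y‖ ≤ C * (κ / η) * ‖y‖ := by
  have e : smoothGradDeriv η w θ x y =
      ∑ l, (θ l * smoothStepDeriv η (inner ℝ (w l) x) * inner ℝ (w l) y) • w l := by
    simp [smoothGradDeriv]
  rw [e]
  refine le_of_sq_le_sq ?_ (by positivity)
  refine (norm_sum_smul_sq_le hC hw _).trans ?_
  have h1 : ∑ l, (θ l * smoothStepDeriv η (inner ℝ (w l) x) * inner ℝ (w l) y) ^ 2 ≤
      (κ / η) ^ 2 * (C * ‖y‖ ^ 2) := by
    calc _ ≤ ∑ l, (κ / η) ^ 2 * inner ℝ (w l) y ^ 2 := by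
          refine Finset.sum_le_sum fun l _ => ?_
          rw [mul_pow _ (inner ℝ (w l) y)]
          gcongr ?_ * _
          rw [← sq_abs (θ l * _), abs_mul, abs_of_nonneg (smoothStepDeriv_nonneg _)]
          have h2 := smoothStepDeriv_le hη (inner ℝ (w l) x)
          have h3 := smoothStepDeriv_nonneg (η := η) (inner ℝ (w l) x)
          have : κ / η = κ * (1 / η) := by ring
          rw [this]
          gcongr
          exact hθκ l
      _ = (κ / η) ^ 2 * ∑ l, inner ℝ (w l) y ^ 2 := by rw [Finset.mul_sum]
      _ ≤ _ := by gcongr; exact hw y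
  calc _ ≤ C * ((κ / η) ^ 2 * (C * ‖y‖ ^ 2)) := by gcongr
    _ = _ := by ring

/-- Maurey–Pisier is applied to the squared norm `h`, with mean `e`; take `m = √e`. Then `(‖·‖ -
√e)² ≤ |h - e|`, and the elementary bound `u ≤ δ + u⁴ / δ³` turns a fourth moment into a first
moment. -/
lemma lintegral_abs_smoothGrad_sub_le (hη : 0 < η) (hC : 0 ≤ C) (hw : OpBound w C) (hκ : 0 ≤ κ)
    (hθκ : ∀ l, |θ l| ≤ κ) (hθ : ‖θ‖ ≤ C₀) {δ : ℝ} (hδ : 0 < δ) :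
    ∃ m : ℝ, ∫⁻ x, ENNReal.ofReal ((‖smoothGrad η w θ x‖ - m) ^ 2)
        ∂stdGaussian (EuclideanSpace ℝ (Fin d)) ≤
      ENNReal.ofReal (δ + pisierConst * (2 * (√C * C₀) * (C * (κ / η))) ^ 4 / δ ^ 3) := by
  have hC₀ : 0 ≤ C₀ := (norm_nonneg _).trans hθ
  set h : EuclideanSpace ℝ (Fin d) → ℝ := fun x => ‖smoothGrad η w θ x‖ ^ 2 with hh
  set h' : EuclideanSpace ℝ (Fin d) → EuclideanSpace ℝ (Fin d) →L[ℝ] ℝ := fun x =>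
    2 • (innerSL ℝ (smoothGrad η w θ x)).comp (smoothGradDeriv η w θ x) with hh'
  set M := 2 * (√C * C₀) * (C * (κ / η)) with hM
  have hder : ∀ x, HasFDerivAt h (h' x) x := fun x => (hasFDerivAt_smoothGrad hη w θ x).norm_sq
  have hcont : Continuous h' := by
    have h1 : Continuous fun x => innerSL ℝ (smoothGrad η w θ x) :=
      (innerSL ℝ).continuous.comp (continuous_smoothGrad hη w θ)
    exact (h1.clm_comp (continuous_smoothGradDeriv hη w θ)).const_smul 2
  have hbound : ∀ x, ‖h' x‖ ≤ M := by
    intro x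
    refine ContinuousLinearMap.opNorm_le_bound _ (by positivity) fun y => ?_
    have e : h' x y = 2 * inner ℝ (smoothGrad η w θ x) (smoothGradDeriv η w θ x y) := by
      simp [hh', two_mul, two_smul]
    rw [e, Real.norm_eq_abs, abs_mul, abs_two]
    have h1 := abs_real_inner_le_norm (smoothGrad η w θ x) (smoothGradDeriv η w θ x y)
    have h2 := norm_smoothGrad_le (θ := θ) hη hC hw x
    have h3 := norm_smoothGradDeriv_apply_le hη hC hw hκ hθκ x y
    have h4 : √C * ‖θ‖ ≤ √C * C₀ := by gcongr
    calc _ ≤ 2 * (‖smoothGrad η w θ x‖ * ‖smoothGradDeriv η w θ x y‖) := by gcongr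
      _ ≤ 2 * ((√C * C₀) * (C * (κ / η) * ‖y‖)) := by
        gcongr
        exact h2.trans h4
      _ = _ := by rw [hM]; ring
  have hMP := lintegral_pow_four_sub_mean_le hder hcont hbound
  set e := ∫ y, h y ∂stdGaussian (EuclideanSpace ℝ (Fin d)) with he
  have he0 : 0 ≤ e := integral_nonneg fun _ => sq_nonneg _
  refine ⟨√e, ?_⟩
  have hP := pisierConst_nonneg
  calc _ ≤ ∫⁻ x, (ENNReal.ofReal δ + ENNReal.ofReal (δ ^ 3)⁻¹ * ENNReal.ofReal ((h x - e) ^ 4))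
        ∂stdGaussian (EuclideanSpace ℝ (Fin d)) := by
        refine lintegral_mono fun x => ?_
        rw [← ENNReal.ofReal_mul (by positivity), ← ENNReal.ofReal_add hδ.le (by positivity)]
        apply ENNReal.ofReal_le_ofReal
        have h1 : (‖smoothGrad η w θ x‖ - √e) ^ 2 ≤ |h x - e| := by
          have h2 : h x - e = (‖smoothGrad η w θ x‖ - √e) * (‖smoothGrad η w θ x‖ + √e) := by
            have := Real.sq_sqrt he0
            simp only [hh]
            linear_combination this
          rw [h2, abs_mul, ← sq_abs, sq]
          have h3 : |‖smoothGrad η w θ x‖ - √e| ≤ |‖smoothGrad η w θ x‖ + √e| := by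
            rw [abs_of_nonneg (add_nonneg (norm_nonneg _) (Real.sqrt_nonneg e))]
            exact abs_le.2 ⟨by linarith [norm_nonneg (smoothGrad η w θ x)],
              by linarith [Real.sqrt_nonneg e]⟩
          gcongr
        refine h1.trans ?_
        set u := |h x - e| with hu
        have hu0 : 0 ≤ u := abs_nonneg _
        have hu4 : (h x - e) ^ 4 = u ^ 4 := by rw [hu, Even.pow_abs (by decide)]
        rw [hu4]
        rcases le_total u δ with hle | hle
        · have : 0 ≤ (δ ^ 3)⁻¹ * u ^ 4 := by positivity
          linarith
        · have : u ≤ (δ ^ 3)⁻¹ * u ^ 4 := by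
            rw [inv_mul_eq_div, le_div_iff₀ (by positivity)]
            have : δ ^ 3 ≤ u ^ 3 := pow_le_pow_left₀ hδ.le hle 3
            nlinarith
          linarith
    _ = ENNReal.ofReal δ + ENNReal.ofReal (δ ^ 3)⁻¹ * ∫⁻ x, ENNReal.ofReal ((h x - e) ^ 4)
        ∂stdGaussian (EuclideanSpace ℝ (Fin d)) := by
        have hhm : Measurable h := ((continuous_smoothGrad hη w θ).norm.pow 2).measurable
        rw [lintegral_add_left measurable_const, lintegral_const_mul _ (by fun_prop)]
        simp
    _ ≤ ENNReal.ofReal δ + ENNReal.ofReal (δ ^ 3)⁻¹ * ENNReal.ofReal (pisierConst * M ^ 4) := by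
        gcongr
    _ = _ := by
        rw [← ENNReal.ofReal_mul (by positivity), ← ENNReal.ofReal_add hδ.le (by positivity)]
        congr 1
        rw [inv_mul_eq_div]

lemma lintegral_gradAt_sub_smoothGrad_le (hη : 0 < η) (hC : 0 ≤ C) (hw : OpBound w C)
    (hw1 : ∀ l, ‖w l‖ = 1) (hθ : ‖θ‖ ≤ C₀) :
    ∫⁻ x, ENNReal.ofReal ((‖gradAt w θ x‖ - ‖smoothGrad η w θ x‖) ^ 2)
        ∂stdGaussian (EuclideanSpace ℝ (Fin d)) ≤
      ENNReal.ofReal (C * C₀ ^ 2 * (√η + η ^ 2)) := by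
  have hb : ∀ x, (‖gradAt w θ x‖ - ‖smoothGrad η w θ x‖) ^ 2 ≤
      ∑ l, C * θ l ^ 2 * (step (inner ℝ (w l) x) - smoothStep η (inner ℝ (w l) x)) ^ 2 := by
    intro x
    have e : gradAt w θ x - smoothGrad η w θ x =
        ∑ l, (θ l * (step (inner ℝ (w l) x) - smoothStep η (inner ℝ (w l) x))) • w l := by
      rw [gradAt, smoothGrad, ← Finset.sum_sub_distrib]
      refine Finset.sum_congr rfl fun l _ => ?_
      rw [← sub_smul, mul_sub]
    calc _ = |‖gradAt w θ x‖ - ‖smoothGrad η w θ x‖| ^ 2 := (sq_abs _).symm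
      _ ≤ ‖gradAt w θ x - smoothGrad η w θ x‖ ^ 2 := by
        gcongr
        exact abs_norm_sub_norm_le _ _
      _ ≤ C * ∑ l, (θ l * (step (inner ℝ (w l) x) - smoothStep η (inner ℝ (w l) x))) ^ 2 := by
        rw [e]
        exact norm_sum_smul_sq_le hC hw _
      _ = _ := by
        rw [Finset.mul_sum]
        refine Finset.sum_congr rfl fun l _ => by ring
  have hmeas : ∀ l, Measurable fun x =>
      ENNReal.ofReal ((step (inner ℝ (w l) x) - smoothStep η (inner ℝ (w l) x)) ^ 2) := fun l =>
    (((measurable_step.sub (continuous_smoothStep hη).measurable).pow_const 2).comp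
      (by fun_prop : Measurable fun x => inner ℝ (w l) x)).ennreal_ofReal
  calc _ ≤ ∫⁻ x, ∑ l, ENNReal.ofReal (C * θ l ^ 2) *
        ENNReal.ofReal ((step (inner ℝ (w l) x) - smoothStep η (inner ℝ (w l) x)) ^ 2)
        ∂stdGaussian (EuclideanSpace ℝ (Fin d)) := by
        refine lintegral_mono fun x => ?_
        simp_rw [← ENNReal.ofReal_mul (mul_nonneg hC (sq_nonneg _))]
        rw [← ENNReal.ofReal_sum_of_nonneg fun l _ => by positivity]
        exact ENNReal.ofReal_le_ofReal (hb x)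
    _ = ∑ l, ENNReal.ofReal (C * θ l ^ 2) * ∫⁻ x,
        ENNReal.ofReal ((step (inner ℝ (w l) x) - smoothStep η (inner ℝ (w l) x)) ^ 2)
        ∂stdGaussian (EuclideanSpace ℝ (Fin d)) := by
        rw [lintegral_finsetSum _ fun l _ => (hmeas l).const_mul _]
        refine Finset.sum_congr rfl fun l _ => ?_
        rw [lintegral_const_mul _ (hmeas l)]
    _ ≤ ∑ l, ENNReal.ofReal (C * θ l ^ 2) * ENNReal.ofReal (√η + η ^ 2) := by
        gcongr with l
        exact lintegral_step_sub_smoothStep_le hη (hw1 l)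
    _ = ENNReal.ofReal (C * ‖θ‖ ^ 2 * (√η + η ^ 2)) := by
        rw [← Finset.sum_mul, ← ENNReal.ofReal_sum_of_nonneg fun l _ => by positivity,
          ← ENNReal.ofReal_mul (Finset.sum_nonneg fun l _ => by positivity), ← Finset.mul_sum,
          EuclideanSpace.real_norm_sq_eq]
    _ ≤ _ := by
        apply ENNReal.ofReal_le_ofReal
        gcongr

/-- The norm of the gradient concentrates around its quadratic mean `√(θᵀ K θ)`. -/
lemma lintegral_norm_gradAt_sub_sq_le (hη : 0 < η) (hC : 0 ≤ C) (hw : OpBound w C)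
    (hw1 : ∀ l, ‖w l‖ = 1) (hκ : 0 ≤ κ) (hθκ : ∀ l, |θ l| ≤ κ) (hθ : ‖θ‖ ≤ C₀) {δ : ℝ}
    (hδ : 0 < δ) :
    ∫⁻ x, ENNReal.ofReal ((‖gradAt w θ x‖ - √(kForm w θ)) ^ 2)
        ∂stdGaussian (EuclideanSpace ℝ (Fin d)) ≤
      ENNReal.ofReal (4 * (C * C₀ ^ 2 * (√η + η ^ 2) +
        (δ + pisierConst * (2 * (√C * C₀) * (C * (κ / η))) ^ 4 / δ ^ 3))) := by
  have hP := pisierConst_nonneg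
  have hC₀ : 0 ≤ C₀ := (norm_nonneg _).trans hθ
  obtain ⟨m, hm⟩ := lintegral_abs_smoothGrad_sub_le hη hC hw hκ hθκ hθ hδ
  have hg := lintegral_gradAt_sub_smoothGrad_le hη hC hw hw1 hθ
  set q1 := C * C₀ ^ 2 * (√η + η ^ 2) with hq1
  set q2 := δ + pisierConst * (2 * (√C * C₀) * (C * (κ / η))) ^ 4 / δ ^ 3 with hq2
  have hq10 : 0 ≤ q1 := by positivity
  have hq20 : 0 ≤ q2 := by positivity
  set γ := stdGaussian (EuclideanSpace ℝ (Fin d)) with hγ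
  set Y : EuclideanSpace ℝ (Fin d) → ℝ := fun x => ‖gradAt w θ x‖ with hY
  have hYm : Measurable Y := (measurable_gradAt w θ).norm
  have hYi : Integrable Y γ := by
    refine (integrable_const (√C * ‖θ‖)).mono' hYm.aestronglyMeasurable (ae_of_all _ fun x => ?_)
    rw [Real.norm_of_nonneg (norm_nonneg _)]
    exact norm_gradAt_le hC hw x
  have hY2i : Integrable (fun x => Y x ^ 2) γ := integrable_norm_gradAt_sq w θ
  have hY2 : ∫ x, Y x ^ 2 ∂γ = kForm w θ := integral_norm_gradAt_sq hw1 θ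
  have hsm : Measurable fun x => ‖smoothGrad η w θ x‖ := (continuous_smoothGrad hη w θ).norm.measurable
  have hlin : ∫⁻ x, ENNReal.ofReal ((Y x - m) ^ 2) ∂γ ≤ ENNReal.ofReal (2 * (q1 + q2)) := by
    calc _ ≤ ∫⁻ x, (ENNReal.ofReal 2 * ENNReal.ofReal ((Y x - ‖smoothGrad η w θ x‖) ^ 2) +
          ENNReal.ofReal 2 * ENNReal.ofReal ((‖smoothGrad η w θ x‖ - m) ^ 2)) ∂γ := by
          refine lintegral_mono fun x => ?_
          rw [← ENNReal.ofReal_mul (by norm_num), ← ENNReal.ofReal_mul (by norm_num),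
            ← ENNReal.ofReal_add (by positivity) (by positivity)]
          apply ENNReal.ofReal_le_ofReal
          nlinarith [sq_nonneg ((Y x - ‖smoothGrad η w θ x‖) - (‖smoothGrad η w θ x‖ - m))]
      _ = ENNReal.ofReal 2 * ∫⁻ x, ENNReal.ofReal ((Y x - ‖smoothGrad η w θ x‖) ^ 2) ∂γ +
          ENNReal.ofReal 2 * ∫⁻ x, ENNReal.ofReal ((‖smoothGrad η w θ x‖ - m) ^ 2) ∂γ := by
          rw [lintegral_add_left (by fun_prop), lintegral_const_mul _ (by fun_prop),
            lintegral_const_mul _ (by fun_prop)]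
      _ ≤ ENNReal.ofReal 2 * ENNReal.ofReal q1 + ENNReal.ofReal 2 * ENNReal.ofReal q2 := by
          gcongr
      _ = _ := by
          rw [← ENNReal.ofReal_mul (by norm_num), ← ENNReal.ofReal_mul (by norm_num),
            ← ENNReal.ofReal_add (by positivity) (by positivity)]
          congr 1; ring
  have hexp : ∀ c : ℝ, ∫ x, (Y x - c) ^ 2 ∂γ = kForm w θ - 2 * c * ∫ x, Y x ∂γ + c ^ 2 := by
    intro c
    have : ∀ x, (Y x - c) ^ 2 = Y x ^ 2 - 2 * c * Y x + c ^ 2 := fun x => by ring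
    simp_rw [this]
    have h2 : Integrable (fun x => Y x ^ 2 - 2 * c * Y x) γ := hY2i.sub (hYi.const_mul _)
    rw [integral_add h2 (integrable_const _), integral_sub hY2i (hYi.const_mul _),
      integral_const_mul, hY2]
    simp
  have hint : ∀ c : ℝ, Integrable (fun x => (Y x - c) ^ 2) γ := by
    intro c
    have : ∀ x, (Y x - c) ^ 2 = Y x ^ 2 - 2 * c * Y x + c ^ 2 := fun x => by ring
    simp_rw [this]
    exact (hY2i.sub (hYi.const_mul _)).add (integrable_const _)
  rw [← ofReal_integral_eq_lintegral_ofReal (hint m) (ae_of_all _ fun _ => sq_nonneg _),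
    ENNReal.ofReal_le_ofReal_iff (by positivity), hexp] at hlin
  rw [← ofReal_integral_eq_lintegral_ofReal (hint _) (ae_of_all _ fun _ => sq_nonneg _)]
  apply ENNReal.ofReal_le_ofReal
  rw [hexp]
  -- With `k² = 𝔼 Y²` and `y = 𝔼 Y ≤ k`, one has `𝔼 (Y - k)² = 2 k (k - y) ≤ 2 (k² - y²)`, twice the
  -- variance, hence at most twice the mean square deviation from `m`. So the root mean square may
  -- serve as the center.
  have hk0 := kForm_nonneg hw1 θ
  set k := √(kForm w θ) with hk
  have hk2 : k ^ 2 = kForm w θ := Real.sq_sqrt hk0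
  have hkn : 0 ≤ k := Real.sqrt_nonneg _
  set y := ∫ x, Y x ∂γ with hy
  have hy0 : 0 ≤ y := integral_nonneg fun _ => norm_nonneg _
  have hvar : 0 ≤ kForm w θ - 2 * y * y + y ^ 2 := by
    rw [← hexp]; exact integral_nonneg fun _ => sq_nonneg _
  have hyk : y ≤ k := by
    refine le_of_sq_le_sq ?_ hkn
    nlinarith
  rw [← hk2] at hlin ⊢
  nlinarith [sq_nonneg (m - y), mul_nonneg hy0 (sub_nonneg.2 hyk)]

end GradientConcentration

/-! ### Linearization of the predictor and of the inner maximum. -/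

section Linearization

variable {d N n : ℕ}

lemma abs_shiftedReLU_sub_le (t s : ℝ) : |shiftedReLU t - shiftedReLU s| ≤ |t - s| := by
  have : shiftedReLU t - shiftedReLU s = max t 0 - max s 0 := by unfold shiftedReLU; ring
  rw [this]
  exact abs_max_sub_max_le_abs t s 0

/-- The activation is affine on each half-line, so the linearization is exact unless `s` can carry
`t` across zero, which requires `|t| ≤ |s|`. -/
lemma abs_shiftedReLU_add_sub_le (t s : ℝ) :
    |shiftedReLU (t + s) - shiftedReLU t - step t * s| ≤ |s| * nearZero |s| t := by
  unfold shiftedReLU step nearZero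
  by_cases h : |t| ≤ |s|
  · rw [if_pos h, mul_one]
    split_ifs with ht
    · rw [max_eq_left ht.le]
      rcases le_total (t + s) 0 with h2 | h2
      · rw [max_eq_right h2, abs_le]
        have : s ≤ 0 := by linarith
        rw [abs_of_nonpos this]
        constructor <;> linarith
      · rw [max_eq_left h2, show t + s - 1 / √(2 * Real.pi) - (t - 1 / √(2 * Real.pi)) - 1 * s = 0
          by ring, abs_zero]
        exact abs_nonneg _
    · rw [max_eq_right (not_lt.1 ht)]
      rcases le_total (t + s) 0 with h2 | h2
      · rw [max_eq_right h2]; simp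
      · rw [max_eq_left h2, abs_le]
        have : 0 ≤ s := by linarith
        rw [abs_of_nonneg this]
        constructor <;> linarith
  · rw [if_neg h, mul_zero]
    push Not at h
    have hs := abs_lt.1 h
    split_ifs with ht
    · rw [abs_of_pos ht] at hs
      rw [max_eq_left ht.le, max_eq_left (by linarith)]
      rw [show t + s - 1 / √(2 * Real.pi) - (t - 1 / √(2 * Real.pi)) - 1 * s = 0 by ring, abs_zero]
    · have ht' := not_lt.1 ht
      rw [abs_of_nonpos ht'] at hs
      rw [max_eq_right ht', max_eq_right (by linarith)]
      simp

/-- The squared linearization error of the predictor at `x` for perturbations of norm `≤ ε`. -/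
def linErrSq (C ε κ a : ℝ) (w : Fin N → EuclideanSpace ℝ (Fin d)) (θ : EuclideanSpace ℝ (Fin N))
    (x : EuclideanSpace ℝ (Fin d)) : ℝ :=
  C * ε ^ 2 * (∑ l, θ l ^ 2 * nearZero a (inner ℝ (w l) x) + κ ^ 2 / a ^ 2 * (C * ε ^ 2))

variable {w : Fin N → EuclideanSpace ℝ (Fin d)} {θ : EuclideanSpace ℝ (Fin N)} {C ε κ a : ℝ}

lemma linErrSq_nonneg (hC : 0 ≤ C) (x : EuclideanSpace ℝ (Fin d)) :
    0 ≤ linErrSq C ε κ a w θ x := by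
  have : 0 ≤ ∑ l, θ l ^ 2 * nearZero a (inner ℝ (w l) x) :=
    Finset.sum_nonneg fun l _ => mul_nonneg (sq_nonneg _) (nearZero_nonneg _ _)
  unfold linErrSq; positivity

/-- Only neurons with `|t l| ≤ |s l|` contribute. Those with `|t l| ≤ a` are counted by `nearZero
a`, whatever `δ` is. The others have `|s l| ≥ a`; as `∑ s l ² ≤ C ε²`, they number at most `C ε² /
a²`, each with `θ l ² ≤ κ²`. Cauchy–Schwarz against `∑ s l ²` gives the remaining factor `C ε²`, so
the bound is uniform in `δ`. -/
lemma predictor_linearization (hC : 0 ≤ C) (hw : OpBound w C) (ha : 0 < a)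
    (hθκ : ∀ l, |θ l| ≤ κ) (x δ : EuclideanSpace ℝ (Fin d)) (hδ : ‖δ‖ ≤ ε) :
    |predictor w θ (x + δ) - predictor w θ x - inner ℝ (gradAt w θ x) δ| ≤
      √(linErrSq C ε κ a w θ x) := by
  apply Real.abs_le_sqrt
  have e : predictor w θ (x + δ) - predictor w θ x - inner ℝ (gradAt w θ x) δ =
      ∑ l, θ l * (shiftedReLU (inner ℝ (w l) x + inner ℝ (w l) δ) -
        shiftedReLU (inner ℝ (w l) x) - step (inner ℝ (w l) x) * inner ℝ (w l) δ) := by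
    rw [predictor, predictor, gradAt, sum_inner, ← Finset.sum_sub_distrib, ← Finset.sum_sub_distrib]
    refine Finset.sum_congr rfl fun l _ => ?_
    rw [real_inner_smul_left, inner_add_right]
    ring
  set s : Fin N → ℝ := fun l => inner ℝ (w l) δ with hs
  set t : Fin N → ℝ := fun l => inner ℝ (w l) x with ht
  have hδ2 : ∑ l, s l ^ 2 ≤ C * ε ^ 2 := (hw δ).trans (by gcongr)
  have h1 : |∑ l, θ l * (shiftedReLU (t l + s l) - shiftedReLU (t l) - step (t l) * s l)| ≤
      ∑ l, (|θ l| * nearZero |s l| (t l)) * |s l| := by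
    refine (Finset.abs_sum_le_sum_abs _ _).trans (Finset.sum_le_sum fun l _ => ?_)
    rw [abs_mul]
    calc _ ≤ |θ l| * (|s l| * nearZero |s l| (t l)) := by
          gcongr; exact abs_shiftedReLU_add_sub_le _ _
      _ = _ := by ring
  have h2 : ∑ l, (|θ l| * nearZero |s l| (t l)) ^ 2 ≤
      ∑ l, θ l ^ 2 * nearZero a (t l) + κ ^ 2 / a ^ 2 * (C * ε ^ 2) := by
    calc _ ≤ ∑ l, (θ l ^ 2 * nearZero a (t l) + κ ^ 2 / a ^ 2 * s l ^ 2) := by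
          refine Finset.sum_le_sum fun l _ => ?_
          rw [mul_pow, sq_abs]
          have hθ2 : θ l ^ 2 ≤ κ ^ 2 := by
            rw [← sq_abs]; exact pow_le_pow_left₀ (abs_nonneg _) (hθκ l) 2
          by_cases h : |t l| ≤ |s l|
          · have e1 : nearZero |s l| (t l) = 1 := by simp [nearZero, h]
            rw [e1, one_pow, mul_one]
            by_cases h' : |t l| ≤ a
            · have e2 : nearZero a (t l) = 1 := by simp [nearZero, h']
              rw [e2, mul_one]
              have : 0 ≤ κ ^ 2 / a ^ 2 * s l ^ 2 := by positivity
              linarith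
            · have h3 : a ^ 2 ≤ s l ^ 2 := by
                rw [← sq_abs (s l)]
                exact pow_le_pow_left₀ ha.le ((not_le.1 h').le.trans h) 2
              have h4 : κ ^ 2 ≤ κ ^ 2 / a ^ 2 * s l ^ 2 := by
                rw [div_mul_eq_mul_div, le_div_iff₀ (by positivity)]
                gcongr
              have := mul_nonneg (sq_nonneg (θ l)) (nearZero_nonneg a (t l))
              linarith
          · have e1 : nearZero |s l| (t l) = 0 := by simp [nearZero, h]
            rw [e1]
            have := mul_nonneg (sq_nonneg (θ l)) (nearZero_nonneg a (t l))
            have : 0 ≤ κ ^ 2 / a ^ 2 * s l ^ 2 := by positivity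
            simp only [ne_eq, OfNat.ofNat_ne_zero, not_false_eq_true, zero_pow, mul_zero]
            linarith
      _ = ∑ l, θ l ^ 2 * nearZero a (t l) + κ ^ 2 / a ^ 2 * ∑ l, s l ^ 2 := by
          rw [Finset.sum_add_distrib, Finset.mul_sum]
      _ ≤ _ := by gcongr
  rw [e]
  calc _ = |∑ l, θ l * (shiftedReLU (t l + s l) - shiftedReLU (t l) - step (t l) * s l)| ^ 2 :=
        (sq_abs _).symm
    _ ≤ (∑ l, (|θ l| * nearZero |s l| (t l)) * |s l|) ^ 2 := by gcongr
    _ ≤ (∑ l, (|θ l| * nearZero |s l| (t l)) ^ 2) * ∑ l, |s l| ^ 2 :=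
        Finset.sum_mul_sq_le_sq_mul_sq _ _ _
    _ ≤ (∑ l, θ l ^ 2 * nearZero a (t l) + κ ^ 2 / a ^ 2 * (C * ε ^ 2)) * (C * ε ^ 2) := by
        simp_rw [sq_abs]
        have h0 : 0 ≤ ∑ l, θ l ^ 2 * nearZero a (t l) :=
          Finset.sum_nonneg fun l _ => mul_nonneg (sq_nonneg _) (nearZero_nonneg _ _)
        exact mul_le_mul h2 hδ2 (Finset.sum_nonneg fun _ _ => sq_nonneg _) (by positivity)
    _ = _ := by rw [linErrSq]; ring

/-- The residual `y_i - θᵀ σ(W (x_i + δ))`. -/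
def residual (β : EuclideanSpace ℝ (Fin d)) (s : Sample d N n) (θ : EuclideanSpace ℝ (Fin N))
    (i : Fin n) (δ : EuclideanSpace ℝ (Fin d)) : ℝ :=
  label β s i - predictor s.w θ (s.x i + δ)

lemma abs_residual_le {β : EuclideanSpace ℝ (Fin d)} {s : Sample d N n} {R : ℝ} {i : Fin n}
    (hR : ∀ δ : EuclideanSpace ℝ (Fin d), ‖δ‖ ≤ ε →
      |predictor s.w θ (s.x i + δ) - predictor s.w θ (s.x i) - inner ℝ (gradAt s.w θ (s.x i)) δ| ≤ R)
    (δ : EuclideanSpace ℝ (Fin d)) (hδ : ‖δ‖ ≤ ε) :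
    |residual β s θ i δ| ≤ |label β s i - predictor s.w θ (s.x i)| +
      ε * ‖gradAt s.w θ (s.x i)‖ + R := by
  set g := gradAt s.w θ (s.x i)
  have h1 := hR δ hδ
  have h2 : |inner ℝ g δ| ≤ ε * ‖g‖ := by
    refine (abs_real_inner_le_norm _ _).trans ?_
    rw [mul_comm]
    gcongr
  have e : residual β s θ i δ = (label β s i - predictor s.w θ (s.x i)) - inner ℝ g δ -
      (predictor s.w θ (s.x i + δ) - predictor s.w θ (s.x i) - inner ℝ g δ) := by
    unfold residual; ring
  rw [e]
  refine (abs_sub _ _).trans (add_le_add ((abs_sub _ _).trans ?_) h1)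
  gcongr

/-- The extremal perturbation has length `ε` along the gradient, with the sign that pushes the
residual away from zero. For a vanishing gradient the formula yields the zero perturbation, which
serves as well. -/
lemma exists_residual_ge (hε : 0 ≤ ε) {β : EuclideanSpace ℝ (Fin d)} {s : Sample d N n} {R : ℝ}
    {i : Fin n}
    (hR : ∀ δ : EuclideanSpace ℝ (Fin d), ‖δ‖ ≤ ε →
      |predictor s.w θ (s.x i + δ) - predictor s.w θ (s.x i) - inner ℝ (gradAt s.w θ (s.x i)) δ| ≤ R) :
    ∃ δ : EuclideanSpace ℝ (Fin d), ‖δ‖ ≤ ε ∧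
      |label β s i - predictor s.w θ (s.x i)| + ε * ‖gradAt s.w θ (s.x i)‖ - R ≤
        |residual β s θ i δ| := by
  set g := gradAt s.w θ (s.x i) with hg
  set a := label β s i - predictor s.w θ (s.x i) with ha
  obtain ⟨δ, hδ, hδg⟩ : ∃ δ : EuclideanSpace ℝ (Fin d), ‖δ‖ ≤ ε ∧
      |a| + ε * ‖g‖ = |a - inner ℝ g δ| := by
    have hn : ‖(ε / ‖g‖) • g‖ ≤ ε := by
      rw [norm_smul, Real.norm_of_nonneg (by positivity)]
      rcases eq_or_ne ‖g‖ 0 with h0 | h0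
      · rw [h0]; simpa using hε
      · rw [div_mul_cancel₀ _ h0]
    have hin : inner ℝ g ((ε / ‖g‖) • g) = ε * ‖g‖ := by
      rw [real_inner_smul_right, real_inner_self_eq_norm_sq]
      rcases eq_or_ne ‖g‖ 0 with h0 | h0
      · rw [h0]; simp
      · field_simp
    have hp : 0 ≤ ε * ‖g‖ := by positivity
    rcases le_total 0 a with h0 | h0
    · refine ⟨-((ε / ‖g‖) • g), by rwa [norm_neg], ?_⟩
      rw [inner_neg_right, hin, sub_neg_eq_add, abs_of_nonneg h0, abs_of_nonneg (by linarith)]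
    · refine ⟨(ε / ‖g‖) • g, hn, ?_⟩
      rw [hin, abs_of_nonpos h0, abs_of_nonpos (by linarith)]
      ring
  refine ⟨δ, hδ, ?_⟩
  have h1 := hR δ hδ
  have e : a - inner ℝ g δ = residual β s θ i δ +
      (predictor s.w θ (s.x i + δ) - predictor s.w θ (s.x i) - inner ℝ g δ) := by
    unfold residual; ring
  rw [hδg, e]
  have := abs_add_le (residual β s θ i δ)
    (predictor s.w θ (s.x i + δ) - predictor s.w θ (s.x i) - inner ℝ g δ)
  linarith

/-- If `a ≤ b ≤ a + e` then `b² - a² ≤ e (2a + e)`, and `2a ≤ 1 + a²`: closeness of square roots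
gives relative closeness of the losses. -/
lemma abs_half_sq_sub_le {α β e : ℝ} (hα : 0 ≤ α) (hβ : 0 ≤ β) (he : 0 ≤ e) (h : |α - β| ≤ e) :
    |α ^ 2 / 2 - β ^ 2 / 2| ≤ e * (1 + e) * (1 + min (β ^ 2 / 2) (α ^ 2 / 2)) := by
  have key : ∀ a b : ℝ, 0 ≤ a → a ≤ b → b - a ≤ e →
      b ^ 2 / 2 - a ^ 2 / 2 ≤ e * (1 + e) * (1 + a ^ 2 / 2) := by
    intro a b ha hab hb
    have h1 : b ^ 2 / 2 - a ^ 2 / 2 = (b - a) * (b + a) / 2 := by ring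
    have h2 : (b - a) * (b + a) ≤ e * (2 * a + e) := by
      apply mul_le_mul hb (by linarith) (by linarith) he
    nlinarith [sq_nonneg (a - 1), mul_nonneg he (sq_nonneg (a - 1)), mul_nonneg he he,
      mul_nonneg (mul_nonneg he he) (sq_nonneg a)]
  have h' := abs_le.1 h
  rcases le_total α β with hab | hab
  · have h2 : α ^ 2 ≤ β ^ 2 := pow_le_pow_left₀ hα hab 2
    rw [min_eq_right (by linarith), abs_sub_comm, abs_of_nonneg (by linarith)]
    exact key α β hα hab (by linarith)
  · have h2 : β ^ 2 ≤ α ^ 2 := pow_le_pow_left₀ hβ hab 2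
    rw [min_eq_left (by linarith), abs_of_nonneg (by linarith)]
    exact key β α hβ hab (by linarith)

lemma abs_add_sub_add_le_of_nonneg {p q r c : ℝ} (hc : 0 ≤ c) (hr : 0 ≤ r)
    (h : |p - q| ≤ c * (1 + min q p)) : |p + r - (q + r)| ≤ c * (1 + min (q + r) (p + r)) := by
  rw [add_sub_add_right_eq_sub]
  refine h.trans (mul_le_mul_of_nonneg_left ?_ hc)
  rw [min_add_add_right]
  linarith

lemma regularizer_eq (ζ : ℝ) (θ : EuclideanSpace ℝ (Fin N)) :
    regularizer d ζ θ = ζ / 2 * (‖θ‖ ^ 2 + √(Real.log d) / d * (∑ l, θ l) ^ 2) := by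
  unfold regularizer omegaMatrix
  congr 1
  rw [Matrix.add_mulVec, Matrix.one_mulVec, dotProduct_add, Matrix.smul_mulVec,
    dotProduct_smul, Matrix.vecMulVec_mulVec, EuclideanSpace.real_norm_sq_eq]
  simp only [dotProduct, smul_eq_mul, Pi.one_apply, one_mul, MulOpposite.smul_eq_mul_unop,
    Pi.smul_apply, MulOpposite.unop_op, ← Finset.sum_mul]
  congr 2
  · exact funext fun l => (sq (θ.ofLp l)).symm
  · ring

lemma regularizer_nonneg {ζ : ℝ} (hζ : 0 ≤ ζ) (θ : EuclideanSpace ℝ (Fin N)) :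
    0 ≤ regularizer d ζ θ := by
  rw [regularizer_eq]; positivity

/-- If, on average over the samples, the linearization error and the fluctuation of the gradient
norm are small, then the two losses are close. -/
lemma abs_simplifiedLoss_sub_robustLoss_le (hn : 0 < n) (hε : 0 ≤ ε) {ζ : ℝ} (hζ : 0 ≤ ζ)
    (β : EuclideanSpace ℝ (Fin d)) (s : Sample d N n) {e : ℝ} (he : 0 ≤ e) (R : Fin n → ℝ)
    (hR0 : ∀ i, 0 ≤ R i)
    (hR : ∀ i, ∀ δ : EuclideanSpace ℝ (Fin d), ‖δ‖ ≤ ε →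
      |predictor s.w θ (s.x i + δ) - predictor s.w θ (s.x i) -
        inner ℝ (gradAt s.w θ (s.x i)) δ| ≤ R i)
    (hsum : ∑ i, (R i + ε * |‖gradAt s.w θ (s.x i)‖ - ‖Matrix.toEuclideanLin (J s.w) θ‖|) ^ 2 ≤
      n * e ^ 2) :
    |simplifiedLoss ε ζ β s θ - robustLoss ε ζ β s θ| ≤
      e * (1 + e) * (1 + min (robustLoss ε ζ β s θ) (simplifiedLoss ε ζ β s θ)) := by
  have hn' : (0 : ℝ) < n := by exact_mod_cast hn
  set m := ‖Matrix.toEuclideanLin (J s.w) θ‖ with hm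
  -- In the Euclidean space over the samples, `B` carries the data term of the simplified loss and
  -- `E` the errors. The worst residuals differ from `B` by at most `E` in each coordinate, so the
  -- square roots of twice the data terms differ by at most `‖E‖ / √n ≤ e`.
  set E : EuclideanSpace ℝ (Fin n) := WithLp.toLp 2
    fun i => R i + ε * |‖gradAt s.w θ (s.x i)‖ - m| with hE
  set B : EuclideanSpace ℝ (Fin n) := WithLp.toLp 2
    fun i => |label β s i - predictor s.w θ (s.x i)| + ε * m with hB
  have hE2 : ‖E‖ ^ 2 ≤ n * e ^ 2 := by
    rw [EuclideanSpace.real_norm_sq_eq]; exact hsum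
  have hEn : ‖E‖ ≤ √n * e := by
    refine le_of_sq_le_sq ?_ (by positivity)
    rw [mul_pow, Real.sq_sqrt hn'.le]; exact hE2
  have hE0 : ∀ i, 0 ≤ E i := fun i => add_nonneg (hR0 i) (mul_nonneg hε (abs_nonneg _))
  have hup : ∀ i, ∀ δ : EuclideanSpace ℝ (Fin d), ‖δ‖ ≤ ε → |residual β s θ i δ| ≤ B i + E i := by
    intro i δ hδ
    have h1 := abs_residual_le (β := β) (hR i) δ hδ
    have h2 : ε * ‖gradAt s.w θ (s.x i)‖ ≤ ε * m + ε * |‖gradAt s.w θ (s.x i)‖ - m| := by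
      rw [← mul_add]
      gcongr
      linarith [le_abs_self (‖gradAt s.w θ (s.x i)‖ - m)]
    simp only [hB, hE]
    linarith
  have hlow : ∀ i, ∃ δ : EuclideanSpace ℝ (Fin d), ‖δ‖ ≤ ε ∧ B i - E i ≤ |residual β s θ i δ| := by
    intro i
    obtain ⟨δ, hδ, h1⟩ := exists_residual_ge (β := β) hε (hR i)
    refine ⟨δ, hδ, ?_⟩
    have h2 : ε * m ≤ ε * ‖gradAt s.w θ (s.x i)‖ + ε * |‖gradAt s.w θ (s.x i)‖ - m| := by
      rw [← mul_add]
      gcongr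
      linarith [neg_abs_le (‖gradAt s.w θ (s.x i)‖ - m)]
    simp only [hB, hE]
    linarith
  have hB0 : ∀ i, 0 ≤ B i := fun i => add_nonneg (abs_nonneg _) (mul_nonneg hε (norm_nonneg _))
  set F : {δ : Fin n → EuclideanSpace ℝ (Fin d) // ∀ i, ‖δ i‖ ≤ ε} → ℝ := fun δ =>
    1 / (2 * (n : ℝ)) * ∑ i, (label β s i - predictor s.w θ (s.x i + δ.1 i)) ^ 2 with hF
  have hFup : ∀ δ, F δ ≤ 1 / (2 * (n : ℝ)) * ‖B + E‖ ^ 2 := by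
    intro δ
    rw [EuclideanSpace.real_norm_sq_eq]
    simp only [hF]
    refine mul_le_mul_of_nonneg_left (Finset.sum_le_sum fun i _ => ?_) (by positivity)
    rw [← sq_abs]
    exact pow_le_pow_left₀ (abs_nonneg _) (hup i _ (δ.2 i)) 2
  choose δ₀ hδ₀ hδ₀' using hlow
  set r : EuclideanSpace ℝ (Fin n) := WithLp.toLp 2 fun i => |residual β s θ i (δ₀ i)| with hr
  have hrB : ‖r - B‖ ≤ ‖E‖ := by
    refine le_of_sq_le_sq ?_ (norm_nonneg _)
    rw [EuclideanSpace.real_norm_sq_eq, EuclideanSpace.real_norm_sq_eq]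
    refine Finset.sum_le_sum fun i _ => ?_
    rw [sq_le_sq, abs_of_nonneg (hE0 i), abs_le]
    have h1 := hup i _ (hδ₀ i)
    have h2 := hδ₀' i
    simp only [PiLp.sub_apply, hr] at *
    constructor <;> linarith
  have hne : Nonempty {δ : Fin n → EuclideanSpace ℝ (Fin d) // ∀ i, ‖δ i‖ ≤ ε} := ⟨⟨δ₀, hδ₀⟩⟩
  have hsup1 : (⨆ δ, F δ) ≤ 1 / (2 * (n : ℝ)) * ‖B + E‖ ^ 2 := ciSup_le hFup
  have hsup2 : 1 / (2 * (n : ℝ)) * ‖r‖ ^ 2 ≤ ⨆ δ, F δ := by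
    have h1 : F ⟨δ₀, hδ₀⟩ = 1 / (2 * (n : ℝ)) * ‖r‖ ^ 2 := by
      rw [EuclideanSpace.real_norm_sq_eq]
      simp only [hF, hr, sq_abs]
      rfl
    rw [← h1]
    exact le_ciSup ⟨_, Set.forall_mem_range.2 hFup⟩ _
  set P := ⨆ δ, F δ with hP
  have hP0 : 0 ≤ P := le_trans (by positivity) hsup2
  have hS : simplifiedLoss ε ζ β s θ = (‖B‖ / √n) ^ 2 / 2 + regularizer d ζ θ := by
    unfold simplifiedLoss
    rw [div_pow, Real.sq_sqrt hn'.le, EuclideanSpace.real_norm_sq_eq]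
    simp only [hB]
    field_simp
    simp only [hm]
  have hL : robustLoss ε ζ β s θ = (√(2 * P)) ^ 2 / 2 + regularizer d ζ θ := by
    rw [Real.sq_sqrt (by positivity)]
    simp [robustLoss, hP, hF]
  rw [hS, hL]
  refine abs_add_sub_add_le_of_nonneg (by positivity) (regularizer_nonneg hζ θ) ?_
  refine abs_half_sq_sub_le (by positivity) (Real.sqrt_nonneg _) he ?_
  have hsn : 0 < √(n : ℝ) := Real.sqrt_pos.2 hn'
  have hnn : √(n : ℝ) ^ 2 = n := Real.sq_sqrt hn'.le
  have hdiv : ‖E‖ / √n ≤ e := by rw [div_le_iff₀ hsn]; linarith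
  rw [abs_le]
  constructor
  · have h1 : √(2 * P) ≤ ‖B‖ / √n + ‖E‖ / √n := by
      rw [← add_div]
      refine Real.sqrt_le_iff.2 ⟨by positivity, ?_⟩
      rw [div_pow, hnn, le_div_iff₀ hn']
      have : 2 * P * n ≤ ‖B + E‖ ^ 2 := by
        have := mul_le_mul_of_nonneg_right hsup1 (by positivity : (0 : ℝ) ≤ 2 * n)
        calc 2 * P * n = P * (2 * n) := by ring
          _ ≤ _ := this
          _ = _ := by field_simp
      exact this.trans (pow_le_pow_left₀ (norm_nonneg _) (norm_add_le _ _) 2)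
    linarith
  · have h1 : ‖r‖ / √n ≤ √(2 * P) := by
      refine Real.le_sqrt_of_sq_le ?_
      rw [div_pow, hnn, div_le_iff₀ hn']
      have := mul_le_mul_of_nonneg_right hsup2 (by positivity : (0 : ℝ) ≤ 2 * n)
      calc ‖r‖ ^ 2 = 1 / (2 * (n : ℝ)) * ‖r‖ ^ 2 * (2 * n) := by field_simp
        _ ≤ _ := this
        _ = _ := by ring
    have h2 : ‖B‖ ≤ ‖r‖ + ‖E‖ := by
      have : ‖B‖ ≤ ‖r‖ + ‖r - B‖ := by
        have := norm_sub_le r (r - B)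
        rwa [sub_sub_cancel] at this
      linarith
    have h3 : ‖B‖ / √n ≤ ‖r‖ / √n + ‖E‖ / √n := by
      rw [← add_div]; gcongr
    linarith

end Linearization

/-! ### Closeness of the losses for fixed good weights. -/

section GapFixedWeights

variable {d N n : ℕ} {w : Fin N → EuclideanSpace ℝ (Fin d)} {θ : EuclideanSpace ℝ (Fin N)}
  {C C₀ ε κ a : ℝ}

/-- The squared deviation of `‖∇f(x)‖` from its root mean square under the Gaussian law. -/
def gradDev (w : Fin N → EuclideanSpace ℝ (Fin d)) (θ : EuclideanSpace ℝ (Fin N))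
    (x : EuclideanSpace ℝ (Fin d)) : ℝ :=
  (‖gradAt w θ x‖ - √(kForm w θ)) ^ 2

lemma gradDev_nonneg (x : EuclideanSpace ℝ (Fin d)) : 0 ≤ gradDev w θ x := sq_nonneg _

lemma kForm_le (hC : 0 ≤ C) (hw : OpBound w C) (hw1 : ∀ l, ‖w l‖ = 1) :
    kForm w θ ≤ C * ‖θ‖ ^ 2 := by
  rw [← integral_norm_gradAt_sq hw1]
  calc _ ≤ ∫ _x, C * ‖θ‖ ^ 2 ∂stdGaussian (EuclideanSpace ℝ (Fin d)) := by
        refine integral_mono (integrable_norm_gradAt_sq w θ) (integrable_const _) fun x => ?_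
        have := pow_le_pow_left₀ (norm_nonneg _) (norm_gradAt_le (θ := θ) hC hw x) 2
        rwa [mul_pow, Real.sq_sqrt hC] at this
    _ = _ := by simp

lemma sqrt_kForm_le (hC : 0 ≤ C) (hw : OpBound w C) (hw1 : ∀ l, ‖w l‖ = 1) :
    √(kForm w θ) ≤ √C * ‖θ‖ := by
  rw [← Real.sqrt_sq (norm_nonneg θ), ← Real.sqrt_mul hC]
  exact Real.sqrt_le_sqrt (kForm_le hC hw hw1)

lemma gradDev_le (hC : 0 ≤ C) (hw : OpBound w C) (hw1 : ∀ l, ‖w l‖ = 1) (hθ : ‖θ‖ ≤ C₀)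
    (x : EuclideanSpace ℝ (Fin d)) : gradDev w θ x ≤ C * C₀ ^ 2 := by
  have h1 := (norm_gradAt_le (θ := θ) hC hw x).trans (mul_le_mul_of_nonneg_left hθ (Real.sqrt_nonneg C))
  have h2 := (sqrt_kForm_le (θ := θ) hC hw hw1).trans
    (mul_le_mul_of_nonneg_left hθ (Real.sqrt_nonneg C))
  have h3 : |‖gradAt w θ x‖ - √(kForm w θ)| ≤ √C * C₀ :=
    abs_le.2 ⟨by linarith [norm_nonneg (gradAt w θ x)], by linarith [Real.sqrt_nonneg (kForm w θ)]⟩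
  rw [gradDev, ← sq_abs]
  refine (pow_le_pow_left₀ (abs_nonneg _) h3 2).trans_eq ?_
  rw [mul_pow, Real.sq_sqrt hC]

lemma gradAt_sub (θ θ' : EuclideanSpace ℝ (Fin N)) (x : EuclideanSpace ℝ (Fin d)) :
    gradAt w θ x - gradAt w θ' x = gradAt w (θ - θ') x := by
  simp only [gradAt, ← Finset.sum_sub_distrib]
  refine Finset.sum_congr rfl fun l _ => ?_
  rw [PiLp.sub_apply, sub_mul, sub_smul]

/-- Both `‖gradAt w θ x‖` and `√(kForm w θ) = ‖J θ‖` are seminorms of `θ` bounded by `√C ‖θ‖`, hence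
`√C`-Lipschitz in `θ`; this lets a net of parameters suffice. -/
lemma gradDev_le_of_norm_sub_le (hC : 0 ≤ C) (hw : OpBound w C) (hw1 : ∀ l, ‖w l‖ = 1)
    {θ' : EuclideanSpace ℝ (Fin N)} {ρ : ℝ} (h : ‖θ - θ'‖ ≤ ρ) (x : EuclideanSpace ℝ (Fin d)) :
    gradDev w θ x ≤ 2 * gradDev w θ' x + 8 * C * ρ ^ 2 := by
  have h1 : |‖gradAt w θ x‖ - ‖gradAt w θ' x‖| ≤ √C * ρ := by
    refine (abs_norm_sub_norm_le _ _).trans ?_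
    rw [gradAt_sub]
    exact (norm_gradAt_le hC hw x).trans (mul_le_mul_of_nonneg_left h (Real.sqrt_nonneg C))
  have h2 : |√(kForm w θ) - √(kForm w θ')| ≤ √C * ρ := by
    rw [← norm_J_eq_sqrt hw1, ← norm_J_eq_sqrt hw1]
    refine (abs_norm_sub_norm_le _ _).trans ?_
    rw [← map_sub, norm_J_eq_sqrt hw1]
    exact (sqrt_kForm_le hC hw hw1).trans (mul_le_mul_of_nonneg_left h (Real.sqrt_nonneg C))
  have h3 : |(‖gradAt w θ x‖ - √(kForm w θ)) - (‖gradAt w θ' x‖ - √(kForm w θ'))| ≤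
      2 * (√C * ρ) := by
    have := abs_sub (‖gradAt w θ x‖ - ‖gradAt w θ' x‖) (√(kForm w θ) - √(kForm w θ'))
    rw [show ‖gradAt w θ x‖ - √(kForm w θ) - (‖gradAt w θ' x‖ - √(kForm w θ')) =
      (‖gradAt w θ x‖ - ‖gradAt w θ' x‖) - (√(kForm w θ) - √(kForm w θ')) by ring]
    linarith
  have h4 := pow_le_pow_left₀ (abs_nonneg _) h3 2
  rw [sq_abs, mul_pow, mul_pow, Real.sq_sqrt hC] at h4
  unfold gradDev
  set p := ‖gradAt w θ x‖ - √(kForm w θ)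
  set q := ‖gradAt w θ' x‖ - √(kForm w θ')
  nlinarith [sq_nonneg (p - q - q)]

/-- Closeness of the losses at all small-coordinate parameters, from a bound on the number of nearly
inactive neurons and a bound on the gradient deviations over a net. -/
lemma gap_le_of_net (hn : 0 < n) (hε : 0 ≤ ε) {ζ : ℝ} (hζ : 0 ≤ ζ) (β : EuclideanSpace ℝ (Fin d))
    (s : Sample d N n) {e ρ t₁ t₂ : ℝ} (he : 0 ≤ e) (hC : 0 ≤ C) (hw : OpBound s.w C)
    (hw1 : ∀ l, ‖s.w l‖ = 1) (ha : 0 < a) (ht₁ : 0 ≤ t₁)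
    (hnear : ∀ l, ∑ i, nearZero a (inner ℝ (s.w l) (s.x i)) ≤ t₁ * n)
    {T : Set (EuclideanSpace ℝ (Fin N))}
    (hT : ∀ θ ∈ T, ∑ i, gradDev s.w θ (s.x i) ≤ t₂ * n)
    (hθ : ‖θ‖ ≤ C₀) (hθκ : ∀ l, |θ l| ≤ κ) (hθT : ∃ θ' ∈ T, ‖θ - θ'‖ ≤ ρ)
    (hnum : 2 * (C * ε ^ 2 * (C₀ ^ 2 * t₁ + κ ^ 2 / a ^ 2 * (C * ε ^ 2))) +
      2 * ε ^ 2 * (2 * t₂ + 8 * C * ρ ^ 2) ≤ e ^ 2) :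
    |simplifiedLoss ε ζ β s θ - robustLoss ε ζ β s θ| ≤
      e * (1 + e) * (1 + min (robustLoss ε ζ β s θ) (simplifiedLoss ε ζ β s θ)) := by
  have hn0 : (0 : ℝ) ≤ n := Nat.cast_nonneg n
  refine abs_simplifiedLoss_sub_robustLoss_le hn hε hζ β s he
    (fun i => √(linErrSq C ε κ a s.w θ (s.x i))) (fun i => Real.sqrt_nonneg _)
    (fun i δ hδ => predictor_linearization hC hw ha hθκ _ _ hδ) ?_
  obtain ⟨θ', hθ', hρ⟩ := hθT
  have h1 : ∀ i, (√(linErrSq C ε κ a s.w θ (s.x i)) +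
      ε * |‖gradAt s.w θ (s.x i)‖ - ‖Matrix.toEuclideanLin (J s.w) θ‖|) ^ 2 ≤
      2 * linErrSq C ε κ a s.w θ (s.x i) +
        2 * ε ^ 2 * (2 * gradDev s.w θ' (s.x i) + 8 * C * ρ ^ 2) := by
    intro i
    rw [norm_J_eq_sqrt hw1]
    have h2 := gradDev_le_of_norm_sub_le hC hw hw1 hρ (s.x i)
    have h3 := add_sq_le (a := √(linErrSq C ε κ a s.w θ (s.x i)))
      (b := ε * |‖gradAt s.w θ (s.x i)‖ - √(kForm s.w θ)|)
    rw [Real.sq_sqrt (linErrSq_nonneg hC _), mul_pow, sq_abs] at h3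
    change _ ≤ 2 * (_ + ε ^ 2 * gradDev s.w θ (s.x i)) at h3
    have h4 := mul_le_mul_of_nonneg_left h2 (by positivity : (0 : ℝ) ≤ 2 * ε ^ 2)
    linarith
  refine (Finset.sum_le_sum fun i _ => h1 i).trans ?_
  have h5 : ∑ i, linErrSq C ε κ a s.w θ (s.x i) ≤
      n * (C * ε ^ 2 * (C₀ ^ 2 * t₁ + κ ^ 2 / a ^ 2 * (C * ε ^ 2))) := by
    have h5' : ∑ i, linErrSq C ε κ a s.w θ (s.x i) = C * ε ^ 2 *
        (∑ l, θ l ^ 2 * ∑ i, nearZero a (inner ℝ (s.w l) (s.x i)) +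
          n * (κ ^ 2 / a ^ 2 * (C * ε ^ 2))) := by
      simp only [linErrSq]
      rw [← Finset.mul_sum, Finset.sum_add_distrib, Finset.sum_comm, Finset.sum_const,
        Finset.card_univ, Fintype.card_fin, nsmul_eq_mul]
      simp_rw [Finset.mul_sum]
    rw [h5']
    have h6 : ∑ l, θ l ^ 2 * ∑ i, nearZero a (inner ℝ (s.w l) (s.x i)) ≤ C₀ ^ 2 * (t₁ * n) := by
      calc _ ≤ ∑ l, θ l ^ 2 * (t₁ * n) :=
            Finset.sum_le_sum fun l _ => mul_le_mul_of_nonneg_left (hnear l) (sq_nonneg _)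
        _ = ‖θ‖ ^ 2 * (t₁ * n) := by rw [← Finset.sum_mul, EuclideanSpace.real_norm_sq_eq]
        _ ≤ _ := by gcongr
    calc _ ≤ C * ε ^ 2 * (C₀ ^ 2 * (t₁ * n) + n * (κ ^ 2 / a ^ 2 * (C * ε ^ 2))) := by gcongr
      _ = _ := by ring
  have h6 := hT θ' hθ'
  have h7 : ∑ i : Fin n, (2 * linErrSq C ε κ a s.w θ (s.x i) +
      2 * ε ^ 2 * (2 * gradDev s.w θ' (s.x i) + 8 * C * ρ ^ 2)) =
      2 * ∑ i, linErrSq C ε κ a s.w θ (s.x i) + 2 * ε ^ 2 * (2 * ∑ i, gradDev s.w θ' (s.x i) +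
        n * (8 * C * ρ ^ 2)) := by
    rw [Finset.sum_add_distrib, ← Finset.mul_sum, ← Finset.mul_sum, Finset.sum_add_distrib,
      ← Finset.mul_sum, Finset.sum_const, Finset.card_univ, Fintype.card_fin, nsmul_eq_mul]
  rw [h7]
  have h8 := mul_le_mul_of_nonneg_left h6 (by positivity : (0 : ℝ) ≤ 4 * ε ^ 2)
  have h9 := mul_le_mul_of_nonneg_left hnum hn0
  nlinarith

lemma measurable_inner_fst_snd (l : Fin N) :
    Measurable fun p : (Fin N → EuclideanSpace ℝ (Fin d)) × EuclideanSpace ℝ (Fin d) =>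
      inner ℝ (p.1 l) p.2 :=
  ((measurable_pi_apply l).comp measurable_fst).inner measurable_snd

lemma measurable_kForm (θ : EuclideanSpace ℝ (Fin N)) :
    Measurable fun w : Fin N → EuclideanSpace ℝ (Fin d) => kForm w θ := by
  unfold kForm
  simp only [arccosKernel_apply]
  refine Finset.measurable_sum _ fun l _ => Finset.measurable_sum _ fun k _ => ?_
  have h : Measurable fun w : Fin N → EuclideanSpace ℝ (Fin d) => inner ℝ (w l) (w k) :=
    (measurable_pi_apply l).inner (measurable_pi_apply k)
  have h' := Real.measurable_arccos.comp h
  fun_prop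

lemma measurable_gradDev (θ : EuclideanSpace ℝ (Fin N)) :
    Measurable fun p : (Fin N → EuclideanSpace ℝ (Fin d)) × EuclideanSpace ℝ (Fin d) =>
      gradDev p.1 θ p.2 := by
  unfold gradDev gradAt
  refine Measurable.pow_const (Measurable.sub (Measurable.norm ?_)
    (((measurable_kForm θ).comp measurable_fst).sqrt)) 2
  exact Finset.measurable_sum _ fun l _ =>
    ((measurable_step.comp (measurable_inner_fst_snd l)).const_mul _).smul
      ((measurable_pi_apply l).comp measurable_fst)

/-- A bound on a product measure from bounds on the sections over a good set. -/
lemma measure_prod_le_of_section {α γ : Type*} [MeasurableSpace α] [MeasurableSpace γ]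
    (μ : Measure α) (ν : Measure γ) [IsProbabilityMeasure μ] [IsProbabilityMeasure ν]
    {s : Set (α × γ)} (hs : MeasurableSet s) (G : Set α) (c : ℝ≥0∞)
    (h : ∀ a ∈ G, ν (Prod.mk a ⁻¹' s) ≤ c) : μ.prod ν s ≤ μ Gᶜ + c := by
  rw [Measure.prod_apply hs]
  -- `G` is not assumed measurable, so a measurable hull of its complement is used.
  calc _ ≤ ∫⁻ a, ((toMeasurable μ Gᶜ).indicator (fun _ => 1) a + c) ∂μ := by
        refine lintegral_mono fun a => ?_
        by_cases ha : a ∈ G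
        · exact (h a ha).trans le_add_self
        · rw [Set.indicator_of_mem (subset_toMeasurable μ Gᶜ ha)]
          exact prob_le_one.trans le_self_add
    _ = _ := by
        rw [lintegral_add_right _ measurable_const, lintegral_const, measure_univ, mul_one]
        simp [lintegral_indicator (measurableSet_toMeasurable _ _)]

/-- For unit weights, some neuron is nearly inactive on many samples only with small probability. -/
lemma measure_exists_nearZero_le (ha : 0 ≤ a) (hw1 : ∀ l, ‖w l‖ = 1) (t : ℝ) :
    Measure.pi (fun _ : Fin n => stdGaussian (EuclideanSpace ℝ (Fin d)))
      {x | ∃ l, t * n ≤ ∑ i, nearZero a (inner ℝ (w l) (x i))} ≤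
      ENNReal.ofReal (N * Real.exp (n * (a * Real.exp 1 - t))) := by
  have hsub : {x : Fin n → EuclideanSpace ℝ (Fin d) |
      ∃ l, t * n ≤ ∑ i, nearZero a (inner ℝ (w l) (x i))} ⊆
      ⋃ l, {x | t * n ≤ ∑ i, nearZero a (inner ℝ (w l) (x i))} := by
    intro x ⟨l, hl⟩
    exact Set.mem_iUnion.2 ⟨l, hl⟩
  refine (measure_mono hsub).trans ((measure_iUnion_fintype_le _ _).trans ?_)
  have hl : ∀ l : Fin N, Measure.pi (fun _ : Fin n => stdGaussian (EuclideanSpace ℝ (Fin d)))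
      {x | t * n ≤ ∑ i, nearZero a (inner ℝ (w l) (x i))} ≤
      ENNReal.ofReal (Real.exp (n * (a * Real.exp 1 - t))) := by
    intro l
    have hm := measure_pi_avg_ge_le (μ := stdGaussian (EuclideanSpace ℝ (Fin d))) (m := n)
      (Z := fun x => nearZero a (inner ℝ (w l) x)) (B := 1) (q := a) (lam := 1)
      ((measurable_nearZero a).comp (by fun_prop)) zero_le_one ha (fun _ => nearZero_nonneg _ _)
      (fun _ => nearZero_le_one _ _) ?_ t
    · simpa using hm
    · rw [lintegral_inner_stdGaussian (w l) (F := fun t => ENNReal.ofReal (nearZero a t))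
        ((measurable_nearZero a).ennreal_ofReal)]
      simpa [hw1 l] using lintegral_nearZero_le a
  refine (Finset.sum_le_sum fun l _ => hl l).trans_eq ?_
  rw [Finset.sum_const, Finset.card_univ, Fintype.card_fin, nsmul_eq_mul,
    ENNReal.ofReal_mul (by positivity), ENNReal.ofReal_natCast]

/-- For good weights, the gradient deviations are uniformly small on average over a finite set. -/
lemma measure_exists_gradDev_le (hC : 0 ≤ C) (hw : OpBound w C) (hw1 : ∀ l, ‖w l‖ = 1)
    {T : Finset (EuclideanSpace ℝ (Fin N))} (hT : ∀ θ ∈ T, ‖θ‖ ≤ C₀ ∧ ∀ l, |θ l| ≤ κ) (hκ : 0 ≤ κ)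
    {η δ : ℝ} (hη : 0 < η) (hδ : 0 < δ) {lam : ℝ} (hlam : 0 ≤ lam) (t : ℝ) {q : ℝ}
    (hq : 4 * (C * C₀ ^ 2 * (√η + η ^ 2) +
        (δ + pisierConst * (2 * (√C * C₀) * (C * (κ / η))) ^ 4 / δ ^ 3)) ≤ q)
    (hq1 : q * (lam * Real.exp (lam * (C * C₀ ^ 2))) ≤ 1) (hq0 : 0 ≤ q) :
    Measure.pi (fun _ : Fin n => stdGaussian (EuclideanSpace ℝ (Fin d)))
      {x | ∃ θ ∈ T, t * n ≤ ∑ i, gradDev w θ (x i)} ≤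
      ENNReal.ofReal (T.card * Real.exp (n * (1 - lam * t))) := by
  have hsub : {x : Fin n → EuclideanSpace ℝ (Fin d) |
      ∃ θ ∈ T, t * n ≤ ∑ i, gradDev w θ (x i)} ⊆
      ⋃ θ ∈ T, {x | t * n ≤ ∑ i, gradDev w θ (x i)} := by
    intro x ⟨θ, hθ, hl⟩
    exact Set.mem_iUnion₂.2 ⟨θ, hθ, hl⟩
  refine (measure_mono hsub).trans ((measure_biUnion_finset_le _ _).trans ?_)
  have hl : ∀ θ ∈ T, Measure.pi (fun _ : Fin n => stdGaussian (EuclideanSpace ℝ (Fin d)))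
      {x | t * n ≤ ∑ i, gradDev w θ (x i)} ≤ ENNReal.ofReal (Real.exp (n * (1 - lam * t))) := by
    intro θ hθ
    have hm : Measurable (gradDev w θ) := by
      have := (measurable_gradDev (d := d) θ).comp (measurable_prodMk_left (x := w))
      exact this
    have hZ : ∫⁻ x, ENNReal.ofReal (gradDev w θ x) ∂stdGaussian (EuclideanSpace ℝ (Fin d)) ≤
        ENNReal.ofReal q := by
      simp only [gradDev]
      exact le_trans (lintegral_norm_gradAt_sub_sq_le hη hC hw hw1 hκ (hT θ hθ).2 (hT θ hθ).1 hδ)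
        (ENNReal.ofReal_le_ofReal hq)
    refine (measure_pi_avg_ge_le (μ := stdGaussian (EuclideanSpace ℝ (Fin d))) (m := n)
      (Z := gradDev w θ) (B := C * C₀ ^ 2) (q := q) (lam := lam)
      hm hlam hq0 (fun _ => gradDev_nonneg _)
      (gradDev_le hC hw hw1 (hT θ hθ).1) hZ t).trans ?_
    exact ENNReal.ofReal_le_ofReal (Real.exp_le_exp.2
        (mul_le_mul_of_nonneg_left (by linarith) (Nat.cast_nonneg n)))
  refine (Finset.sum_le_sum hl).trans_eq ?_
  rw [Finset.sum_const, nsmul_eq_mul, ENNReal.ofReal_mul (by positivity), ENNReal.ofReal_natCast]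

/-- The mean gradient deviation can be made arbitrarily small by restricting the coordinates. -/
lemma exists_dev_params (C C₀ : ℝ) {q : ℝ} (hq : 0 < q) :
    ∃ η > 0, ∃ δ > 0, ∃ κ₀ > 0, ∀ κ, 0 ≤ κ → κ ≤ κ₀ →
      4 * (C * C₀ ^ 2 * (√η + η ^ 2) +
        (δ + pisierConst * (2 * (√C * C₀) * (C * (κ / η))) ^ 4 / δ ^ 3)) ≤ q := by
  -- Order of choice: `η` for the smoothing error, then `δ = q / 16`, and last `κ₀`, which has to
  -- absorb the negative powers of `η` and `δ`.
  have h1 : Tendsto (fun η : ℝ => C * C₀ ^ 2 * (√η + η ^ 2)) (𝓝[>] 0) (𝓝 0) := by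
    have : Continuous fun η : ℝ => C * C₀ ^ 2 * (√η + η ^ 2) := by fun_prop
    simpa using (this.tendsto 0).mono_left nhdsWithin_le_nhds
  obtain ⟨η, hη1, hη0⟩ := ((h1.eventually_lt_const (show (0 : ℝ) < q / 16 by positivity)).and
    self_mem_nhdsWithin).exists
  have hη : 0 < η := hη0
  have h2 : Tendsto (fun κ : ℝ =>
      pisierConst * (2 * (√C * C₀) * (C * (κ / η))) ^ 4 / (q / 16) ^ 3) (𝓝 0) (𝓝 0) := by
    have : Continuous fun κ : ℝ =>
      pisierConst * (2 * (√C * C₀) * (C * (κ / η))) ^ 4 / (q / 16) ^ 3 := by fun_prop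
    simpa using this.tendsto 0
  obtain ⟨κ₀, hκ₀, h3⟩ := Metric.eventually_nhds_iff.1
    (h2.eventually_lt_const (show (0 : ℝ) < q / 16 by positivity))
  refine ⟨η, hη, q / 16, by positivity, κ₀ / 2, by positivity, fun κ hκ0 hκ => ?_⟩
  have h4 := h3 (y := κ) (by rw [Real.dist_0_eq_abs, abs_of_nonneg hκ0]; linarith)
  linarith

end GapFixedWeights

/-! ### Events under the joint law. -/

section Probability

variable {d N n : ℕ} {τ : ℝ≥0}

lemma prob_mono {A B : Sample d N n → Prop} (h : ∀ s, A s → B s) : prob τ A ≤ prob τ B :=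
  measure_mono fun _ hp => h _ hp

lemma prob_or_le (A B : Sample d N n → Prop) :
    prob τ (fun s => A s ∨ B s) ≤ prob τ A + prob τ B :=
  measure_union_le _ _

lemma prob_weights (A : (Fin N → EuclideanSpace ℝ (Fin d)) → Prop) :
    prob τ (fun s : Sample d N n => A s.w) = Measure.pi (fun _ : Fin N => unifSphere d) {w | A w} := by
  have e : {p | A (Sample.ofTriple (d := d) (N := N) (n := n) p).w} = {w | A w} ×ˢ Set.univ := by
    ext p; simp [Sample.ofTriple]
  rw [prob, e, jointLaw, Measure.prod_prod, measure_univ, mul_one]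

variable [NeZero d]

lemma prob_covariates (A : (Fin n → EuclideanSpace ℝ (Fin d)) → Prop) :
    prob τ (fun s : Sample d N n => A s.x) =
      Measure.pi (fun _ : Fin n => stdGaussian (EuclideanSpace ℝ (Fin d))) {x | A x} := by
  have e : {p | A (Sample.ofTriple (d := d) (N := N) (n := n) p).x} =
      Set.univ ×ˢ ({x | A x} ×ˢ Set.univ) := by
    ext p; simp [Sample.ofTriple]
  rw [prob, e, jointLaw, Measure.prod_prod, Measure.prod_prod, measure_univ, measure_univ, mul_one,
    one_mul]

lemma prob_weights_covariates_le {A : (Fin N → EuclideanSpace ℝ (Fin d)) →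
      (Fin n → EuclideanSpace ℝ (Fin d)) → Prop}
    (hA : MeasurableSet {p : (Fin N → EuclideanSpace ℝ (Fin d)) ×
      (Fin n → EuclideanSpace ℝ (Fin d)) | A p.1 p.2})
    (G : Set (Fin N → EuclideanSpace ℝ (Fin d))) (c : ℝ≥0∞)
    (h : ∀ w ∈ G, Measure.pi (fun _ : Fin n => stdGaussian (EuclideanSpace ℝ (Fin d)))
      {x | A w x} ≤ c) :
    prob τ (fun s : Sample d N n => A s.w s.x) ≤
      Measure.pi (fun _ : Fin N => unifSphere d) Gᶜ + c := by
  refine measure_prod_le_of_section _ _ (s := {p : (Fin N → EuclideanSpace ℝ (Fin d)) ×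
    (Fin n → EuclideanSpace ℝ (Fin d)) × (Fin n → ℝ) | A p.1 p.2.1}) ?_ G c fun w hw => ?_
  · exact hA.preimage (measurable_fst.prodMk (measurable_fst.comp measurable_snd))
  · have e : Prod.mk w ⁻¹' {p : (Fin N → EuclideanSpace ℝ (Fin d)) ×
        (Fin n → EuclideanSpace ℝ (Fin d)) × (Fin n → ℝ) | A p.1 p.2.1} =
        {x | A w x} ×ˢ Set.univ := by
      ext p; simp
    rw [e, Measure.prod_prod, measure_univ, mul_one]
    exact h w hw

end Probability

/-! ### Proportional asymptotics and high-probability operator norm bounds. -/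

section Asymptotics

lemma eventually_le_mul {N : ℕ → ℕ} {ψ c : ℝ} (hN : Tendsto (fun d => (N d : ℝ) / d) atTop (𝓝 ψ))
    (hc : ψ < c) : ∀ᶠ d : ℕ in atTop, (N d : ℝ) ≤ c * d := by
  filter_upwards [hN.eventually_lt_const hc, eventually_gt_atTop 0] with d h hd
  have hd' : (0 : ℝ) < d := by exact_mod_cast hd
  exact ((div_lt_iff₀ hd').1 h).le

lemma eventually_mul_le {N : ℕ → ℕ} {ψ c : ℝ} (hN : Tendsto (fun d => (N d : ℝ) / d) atTop (𝓝 ψ))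
    (hc : c < ψ) : ∀ᶠ d : ℕ in atTop, c * d ≤ (N d : ℝ) := by
  filter_upwards [hN.eventually_const_lt hc, eventually_gt_atTop 0] with d h hd
  have hd' : (0 : ℝ) < d := by exact_mod_cast hd
  exact ((lt_div_iff₀ hd').1 h).le

lemma eventually_le_meanRadius_sq : ∀ᶠ d : ℕ in atTop, (d : ℝ) / 4 ≤ meanRadius d ^ 2 := by
  have h : Tendsto (fun d : ℕ => √(d : ℝ)) atTop atTop :=
    Real.tendsto_sqrt_atTop.comp tendsto_natCast_atTop_atTop
  filter_upwards [h.eventually_ge_atTop (2 * √(gaussMoment 4)), eventually_gt_atTop 0]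
    with d hd hd0
  have : NeZero d := ⟨hd0.ne'⟩
  have h1 := (abs_le.1 (abs_meanRadius_sub_sqrt_le (d := d))).1
  have h2 : √(d : ℝ) / 2 ≤ meanRadius d := by linarith
  calc (d : ℝ) / 4 = (√(d : ℝ) / 2) ^ 2 := by rw [div_pow, Real.sq_sqrt (Nat.cast_nonneg d)]; norm_num
    _ ≤ _ := pow_le_pow_left₀ (by positivity) h2 2

lemma tendsto_ofReal_mul_exp_neg (c : ℝ) {b : ℝ} (hb : 0 < b) :
    Tendsto (fun d : ℕ => ENNReal.ofReal (c * d * Real.exp (-(b * d)))) atTop (𝓝 0) := by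
  rw [← ENNReal.ofReal_zero]
  refine ENNReal.tendsto_ofReal ?_
  have h := (Real.tendsto_pow_mul_exp_neg_atTop_nhds_zero 1).comp
    ((tendsto_natCast_atTop_atTop (R := ℝ)).const_mul_atTop hb)
  have h2 := h.const_mul (c / b)
  rw [mul_zero] at h2
  refine h2.congr fun d => ?_
  simp only [Function.comp_apply, pow_one]
  field_simp

lemma tendsto_ofReal_exp_neg :
    Tendsto (fun d : ℕ => ENNReal.ofReal (Real.exp (-(d : ℝ)))) atTop (𝓝 0) := by
  rw [← ENNReal.ofReal_zero]
  exact ENNReal.tendsto_ofReal (Real.tendsto_exp_neg_atTop_nhds_zero.comp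
    tendsto_natCast_atTop_atTop)

/-- `s` is large enough to beat the net cardinality `5 ^ d` and the moment factor, which is at most
`fernBound ^ (2 ψ d)`, and to leave `exp (-d)`. -/
lemma exists_scale {N : ℕ → ℕ} {ψ : ℝ} (hψ : 0 < ψ)
    (hN : Tendsto (fun d => (N d : ℝ) / d) atTop (𝓝 ψ)) {c : ℝ} (hc : 0 < c) :
    ∃ s > 0, ∀ᶠ d : ℕ in atTop,
      5 ^ d * (fernBound ^ N d * Real.exp (-(c * d * s))) ≤ Real.exp (-(d : ℝ)) := by
  have hB := one_le_fernBound
  have hB0 : 0 < fernBound := by linarith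
  have hlB : 0 ≤ Real.log fernBound := Real.log_nonneg hB
  have hl5 : 0 ≤ Real.log 5 := Real.log_nonneg (by norm_num)
  refine ⟨(Real.log 5 + 2 * ψ * Real.log fernBound + 1) / c, by positivity, ?_⟩
  filter_upwards [eventually_le_mul hN (show ψ < 2 * ψ by linarith)] with d hd
  rw [← Real.exp_log (show (0 : ℝ) < 5 by norm_num), ← Real.exp_log hB0, ← Real.exp_nat_mul,
    ← Real.exp_nat_mul, ← Real.exp_add, ← Real.exp_add, Real.exp_le_exp, Real.exp_log hB0,
    Real.exp_log (by norm_num)]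
  have h1 := mul_le_mul_of_nonneg_right hd hlB
  have h2 : c * d * ((Real.log 5 + 2 * ψ * Real.log fernBound + 1) / c) =
      d * (Real.log 5 + 2 * ψ * Real.log fernBound + 1) := by field_simp
  rw [h2]
  linarith

/-- The weights are unit vectors and form a family of bounded operator norm, with high probability. -/
lemma exists_tendsto_weights {N : ℕ → ℕ} {ψ : ℝ} (hψ : 0 < ψ)
    (hN : Tendsto (fun d => (N d : ℝ) / d) atTop (𝓝 ψ)) :
    ∃ C > 0, Tendsto (fun d => Measure.pi (fun _ : Fin (N d) => unifSphere d)
      {w | OpBound w C ∧ ∀ l, ‖w l‖ = 1}ᶜ) atTop (𝓝 0) := by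
  have hf := fernConst_pos
  -- The factor `1 / 4` comes from `d / 4 ≤ meanRadius d ^ 2`.
  obtain ⟨s, hs, hev⟩ := exists_scale hψ hN (show 0 < fernConst / 4 by positivity)
  refine ⟨4 * s, by positivity, ?_⟩
  refine tendsto_of_tendsto_of_tendsto_of_le_of_le' tendsto_const_nhds tendsto_ofReal_exp_neg
    (Eventually.of_forall fun _ => zero_le) ?_
  filter_upwards [hev, eventually_le_meanRadius_sq, eventually_gt_atTop 0] with d h1 h2 hd
  have : NeZero d := ⟨hd.ne'⟩
  have hunit : ∀ᵐ w ∂Measure.pi (fun _ : Fin (N d) => unifSphere d), ∀ l, ‖w l‖ = 1 :=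
    ae_all_iff.2 fun l => (Measure.quasiMeasurePreserving_eval
      (fun _ : Fin (N d) => unifSphere d) l).ae (p := fun w => ‖w‖ = 1) ae_norm_eq_one_unifSphere
  have h3 : Measure.pi (fun _ : Fin (N d) => unifSphere d) {w | OpBound w (4 * s) ∧ ∀ l, ‖w l‖ = 1}ᶜ ≤
      Measure.pi (fun _ : Fin (N d) => unifSphere d) {w | ¬ OpBound w (4 * s)} := by
    refine measure_mono_ae ?_
    filter_upwards [hunit] with w hw hw'
    exact fun h => hw' ⟨h, hw⟩
  refine h3.trans ((measure_not_opBound_le (μ := unifSphere d) (B := fernBound)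
    (a := fernConst * meanRadius d ^ 2)
    (by positivity) (zero_le_one.trans one_le_fernBound)
    (fun u hu => lintegral_exp_inner_sq_unifSphere u hu) (N d) hs.le).trans
    (ENNReal.ofReal_le_ofReal (le_trans ?_ h1)))
  have hB : 0 < fernBound := zero_lt_one.trans_le one_le_fernBound
  rw [finrank_euclideanSpace, Fintype.card_fin]
  refine mul_le_mul_of_nonneg_left (mul_le_mul_of_nonneg_left (Real.exp_le_exp.2 ?_)
    (by positivity)) (by positivity)
  nlinarith [mul_le_mul_of_nonneg_left h2 (mul_pos hf hs).le]

/-- The covariates form a family of operator norm `O(√d)`, with high probability. -/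
lemma exists_tendsto_covariates {n : ℕ → ℕ} {ψ : ℝ} (hψ : 0 < ψ)
    (hn : Tendsto (fun d => (n d : ℝ) / d) atTop (𝓝 ψ)) :
    ∃ C > 0, Tendsto (fun d => Measure.pi (fun _ : Fin (n d) => stdGaussian (EuclideanSpace ℝ (Fin d)))
      {x | ¬ OpBound x (C * d)}) atTop (𝓝 0) := by
  have hf := fernConst_pos
  obtain ⟨s, hs, hev⟩ := exists_scale hψ hn hf
  refine ⟨4 * s, by positivity, ?_⟩
  refine tendsto_of_tendsto_of_tendsto_of_le_of_le' tendsto_const_nhds tendsto_ofReal_exp_neg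
    (Eventually.of_forall fun _ => zero_le) ?_
  filter_upwards [hev] with d h1
  rw [mul_assoc]
  refine (measure_not_opBound_le (μ := stdGaussian (EuclideanSpace ℝ (Fin d))) (B := fernBound)
    (a := fernConst) hf.le (zero_le_one.trans one_le_fernBound)
    (fun u hu => lintegral_exp_inner_sq_stdGaussian u hu) (n d) (s := s * d) (by positivity)).trans
    (ENNReal.ofReal_le_ofReal (le_trans (le_of_eq ?_) h1))
  rw [finrank_euclideanSpace, Fintype.card_fin]
  ring_nf

end Asymptotics

/-! ### Uniform closeness of the losses at parameters with small coordinates. -/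

section Gap

lemma measurableSet_gap_event {d N n : ℕ} (a t₁ t₂ : ℝ) (T : Finset (EuclideanSpace ℝ (Fin N))) :
    MeasurableSet {p : (Fin N → EuclideanSpace ℝ (Fin d)) × (Fin n → EuclideanSpace ℝ (Fin d)) |
      (∃ l, t₁ * n ≤ ∑ i, nearZero a (inner ℝ (p.1 l) (p.2 i))) ∨
      ∃ θ ∈ T, t₂ * n ≤ ∑ i, gradDev p.1 θ (p.2 i)} := by
  have hm : ∀ i : Fin n, Measurable fun p : (Fin N → EuclideanSpace ℝ (Fin d)) ×
      (Fin n → EuclideanSpace ℝ (Fin d)) => (p.1, p.2 i) := fun i =>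
    measurable_fst.prodMk ((measurable_pi_apply i).comp measurable_snd)
  have g1 : ∀ (l : Fin N) (i : Fin n), Measurable fun p : (Fin N → EuclideanSpace ℝ (Fin d)) ×
      (Fin n → EuclideanSpace ℝ (Fin d)) => nearZero a (inner ℝ (p.1 l) (p.2 i)) := fun l i =>
    (measurable_nearZero a).comp ((measurable_inner_fst_snd l).comp (hm i))
  have g2 : ∀ (θ : EuclideanSpace ℝ (Fin N)) (i : Fin n),
      Measurable fun p : (Fin N → EuclideanSpace ℝ (Fin d)) ×
        (Fin n → EuclideanSpace ℝ (Fin d)) => gradDev p.1 θ (p.2 i) := fun θ i => by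
    have := (measurable_gradDev (d := d) θ).comp (hm i)
    exact this
  rw [Set.ofPred_or]
  refine MeasurableSet.union ?_ ?_
  · rw [Set.ofPred_exists]
    refine MeasurableSet.iUnion fun l => measurableSet_le measurable_const ?_
    exact Finset.measurable_sum Finset.univ fun i _ => g1 l i
  · simp only [← exists_prop, Set.ofPred_exists]
    refine T.measurableSet_biUnion fun θ _ => measurableSet_le measurable_const ?_
    exact Finset.measurable_sum Finset.univ fun i _ => g2 θ i

lemma exists_mul_sq_le (K : ℝ) {e : ℝ} (he : 0 < e) : ∃ ρ > 0, ∀ x, 0 ≤ x → x ≤ ρ → K * x ^ 2 ≤ e := by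
  have h : Tendsto (fun x : ℝ => K * x ^ 2) (𝓝 0) (𝓝 0) := by
    have : Continuous fun x : ℝ => K * x ^ 2 := by fun_prop
    simpa using this.tendsto 0
  obtain ⟨ρ, hρ, h1⟩ := Metric.eventually_nhds_iff.1 (h.eventually_lt_const he)
  refine ⟨ρ / 2, by positivity, fun x hx hxρ => (h1 (y := x) ?_).le⟩
  rw [Real.dist_0_eq_abs, abs_of_nonneg hx]; linarith

variable {N n : ℕ → ℕ} {ψ₁ ψ₂ : ℝ}

/-- Uniform relative closeness of the two losses over bounded parameters with small coordinates. -/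
theorem exists_tendsto_prob_gap (hψ₁ : 0 < ψ₁) (hψ₂ : 0 < ψ₂)
    (hN : Tendsto (fun d => (N d : ℝ) / d) atTop (𝓝 ψ₁))
    (hn : Tendsto (fun d => (n d : ℝ) / d) atTop (𝓝 ψ₂))
    (β : ∀ d, EuclideanSpace ℝ (Fin d)) (τ : ℝ≥0) {ε ζ : ℝ} (hε : 0 < ε) (hζ : 0 ≤ ζ)
    {C₀ t : ℝ} (hC₀ : 0 < C₀) (ht : 0 < t) :
    ∃ κ > 0, Tendsto (fun d => prob τ fun s : Sample d (N d) (n d) =>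
      ∃ θ : EuclideanSpace ℝ (Fin (N d)), ‖θ‖ ≤ C₀ ∧ (∀ l, |θ l| ≤ κ) ∧
        ¬ |simplifiedLoss ε ζ (β d) s θ - robustLoss ε ζ (β d) s θ| ≤
          t * (1 + min (robustLoss ε ζ (β d) s θ) (simplifiedLoss ε ζ (β d) s θ)))
      atTop (𝓝 0) := by
  obtain ⟨C, hC, hW⟩ := exists_tendsto_weights hψ₁ hN
  obtain ⟨e, he, het⟩ : ∃ e > 0, e * (1 + e) ≤ t := by
    refine ⟨min 1 (t / 2), by positivity, ?_⟩
    have h1 := min_le_left 1 (t / 2)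
    have h2 := min_le_right 1 (t / 2)
    have h3 : 0 < min 1 (t / 2) := by positivity
    nlinarith
  -- The budget `e ^ 2` is spent in quarters: `t₁` for nearly inactive neurons, `t₂` for the
  -- gradient deviations, `ρ` for the mesh of the net, and `κ₁` for neurons moved by more than `a`.
  obtain ⟨t₁, ht₁, ht₁e⟩ : ∃ t₁ > 0, 2 * (C * ε ^ 2 * (C₀ ^ 2 * t₁)) = e ^ 2 / 4 :=
    ⟨e ^ 2 / (8 * C * ε ^ 2 * C₀ ^ 2), by positivity, by field_simp; norm_num⟩
  obtain ⟨t₂, ht₂, ht₂e⟩ : ∃ t₂ > 0, 4 * ε ^ 2 * t₂ = e ^ 2 / 4 :=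
    ⟨e ^ 2 / (16 * ε ^ 2), by positivity, by field_simp; norm_num⟩
  obtain ⟨ρ, hρ, hρe⟩ := exists_mul_sq_le (16 * ε ^ 2 * C) (show 0 < e ^ 2 / 4 by positivity)
  -- With this `a` the Chernoff exponent for nearly inactive neurons is `-n t₁ / 2`, which beats the
  -- union bound over `N` neurons.
  obtain ⟨a, ha, hat⟩ : ∃ a > 0, a * Real.exp 1 = t₁ / 2 :=
    ⟨t₁ / 2 / Real.exp 1, by positivity, by field_simp⟩
  obtain ⟨κ₁, hκ₁, hκ₁e⟩ := exists_mul_sq_le (2 * (C * ε ^ 2 * (C * ε ^ 2)) / a ^ 2)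
    (show 0 < e ^ 2 / 4 by positivity)
  set L := Real.log (1 + 2 * C₀ / ρ) with hL
  have hL1 : 1 ≤ 1 + 2 * C₀ / ρ := by
    have : 0 ≤ 2 * C₀ / ρ := by positivity
    linarith
  have hL0 : 0 ≤ L := Real.log_nonneg hL1
  -- The net has at most `exp (N L)` points and the Chernoff bound is `exp (n (1 - lam t₂))`; with
  -- this `lam` their product is at most `exp (-d)`.
  obtain ⟨lam, hlam, hlame⟩ : ∃ lam > 0, lam * t₂ * (ψ₂ / 2) = 2 * ψ₁ * L + 2 * ψ₂ + 1 :=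
    ⟨(2 * ψ₁ * L + 2 * ψ₂ + 1) / (t₂ * (ψ₂ / 2)), by positivity, by field_simp⟩
  -- The mean deviation `q` is chosen after `lam`. Neither depends on `d`, so a coordinate bound `κ`
  -- independent of `d` suffices.
  obtain ⟨q, hq, hqe⟩ : ∃ q > 0, q * (lam * Real.exp (lam * (C * C₀ ^ 2))) ≤ 1 :=
    ⟨1 / (lam * Real.exp (lam * (C * C₀ ^ 2))), by positivity, by
      rw [one_div_mul_cancel (by positivity)]⟩
  obtain ⟨η, hη, δ, hδ, κ₀, hκ₀, hdev⟩ := exists_dev_params C C₀ hq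
  set κ := min κ₀ κ₁ with hκdef
  have hκ : 0 < κ := lt_min hκ₀ hκ₁
  refine ⟨κ, hκ, ?_⟩
  have hlim : Tendsto (fun d : ℕ => Measure.pi (fun _ : Fin (N d) => unifSphere d)
      {w | OpBound w C ∧ ∀ l, ‖w l‖ = 1}ᶜ + (Measure.pi (fun _ : Fin (N d) => unifSphere d)
      {w | OpBound w C ∧ ∀ l, ‖w l‖ = 1}ᶜ + (ENNReal.ofReal (2 * ψ₁ * d * Real.exp
        (-(t₁ * ψ₂ / 4 * d))) + ENNReal.ofReal (Real.exp (-(d : ℝ)))))) atTop (𝓝 0) := by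
    simpa using hW.add (hW.add ((tendsto_ofReal_mul_exp_neg (2 * ψ₁)
      (show 0 < t₁ * ψ₂ / 4 by positivity)).add tendsto_ofReal_exp_neg))
  refine tendsto_of_tendsto_of_tendsto_of_le_of_le' tendsto_const_nhds hlim
    (Eventually.of_forall fun _ => zero_le) ?_
  filter_upwards [eventually_gt_atTop 0, eventually_le_mul hN (show ψ₁ < 2 * ψ₁ by linarith),
    eventually_le_mul hn (show ψ₂ < 2 * ψ₂ by linarith),
    eventually_mul_le hn (show ψ₂ / 2 < ψ₂ by linarith)] with d hd hN2 hn2 hn1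
  have : NeZero d := ⟨hd.ne'⟩
  have hd' : (0 : ℝ) < d := by exact_mod_cast hd
  have hnpos : 0 < n d := by
    have : (0 : ℝ) < n d := lt_of_lt_of_le (by positivity) hn1
    exact_mod_cast this
  obtain ⟨T, hTS, hTc, hTn⟩ := exists_net hC₀.le hρ
    {θ : EuclideanSpace ℝ (Fin (N d)) | ‖θ‖ ≤ C₀ ∧ ∀ l, |θ l| ≤ κ} (fun θ hθ => hθ.1)
  rw [finrank_euclideanSpace, Fintype.card_fin] at hTc
  set A : (Fin (N d) → EuclideanSpace ℝ (Fin d)) → (Fin (n d) → EuclideanSpace ℝ (Fin d)) → Prop :=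
    fun w x => (∃ l, t₁ * n d ≤ ∑ i, nearZero a (inner ℝ (w l) (x i))) ∨
      ∃ θ ∈ T, t₂ * n d ≤ ∑ i, gradDev w θ (x i) with hA
  have hsub : ∀ s : Sample d (N d) (n d), (∃ θ : EuclideanSpace ℝ (Fin (N d)), ‖θ‖ ≤ C₀ ∧
      (∀ l, |θ l| ≤ κ) ∧ ¬ |simplifiedLoss ε ζ (β d) s θ - robustLoss ε ζ (β d) s θ| ≤
        t * (1 + min (robustLoss ε ζ (β d) s θ) (simplifiedLoss ε ζ (β d) s θ))) →
      ¬ (OpBound s.w C ∧ ∀ l, ‖s.w l‖ = 1) ∨ A s.w s.x := by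
    intro s ⟨θ, hθ, hθκ, hbad⟩
    by_contra hcon
    push Not at hcon
    obtain ⟨⟨hw, hw1⟩, hnA⟩ := hcon
    rw [hA] at hnA
    push Not at hnA
    refine hbad ((gap_le_of_net hnpos hε.le hζ (β d) s he.le hC.le hw hw1 ha ht₁.le
      (fun l => (hnA.1 l).le) (T := T) (t₂ := t₂) (ρ := ρ) (fun θ hθ => (hnA.2 θ hθ).le) hθ hθκ
      (hTn θ ⟨hθ, hθκ⟩) ?_).trans ?_)
    · have h1 := hρe ρ hρ.le le_rfl
      have h2 := hκ₁e κ hκ.le (min_le_right _ _)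
      have h3 : 2 * (C * ε ^ 2 * (C * ε ^ 2)) / a ^ 2 * κ ^ 2 =
        2 * (C * ε ^ 2 * (κ ^ 2 / a ^ 2 * (C * ε ^ 2))) := by ring
      rw [h3] at h2
      linarith
    · have hm : 0 ≤ 1 + min (robustLoss ε ζ (β d) s θ) (simplifiedLoss ε ζ (β d) s θ) := by
        have h1 : 0 ≤ robustLoss ε ζ (β d) s θ :=
          add_nonneg (Real.iSup_nonneg fun _ => by positivity) (regularizer_nonneg hζ θ)
        have h2 : 0 ≤ simplifiedLoss ε ζ (β d) s θ :=
          add_nonneg (by positivity) (regularizer_nonneg hζ θ)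
        have := le_min h1 h2
        linarith
      exact mul_le_mul_of_nonneg_right het hm
  refine (prob_mono hsub).trans ((prob_or_le _ _).trans (add_le_add ?_ ?_))
  · rw [prob_weights fun w => ¬ (OpBound w C ∧ ∀ l, ‖w l‖ = 1)]
    rfl
  · refine prob_weights_covariates_le (measurableSet_gap_event a t₁ t₂ T)
      {w | OpBound w C ∧ ∀ l, ‖w l‖ = 1} _ fun w hw => (measure_union_le _ _).trans (add_le_add ?_ ?_)
    · refine (measure_exists_nearZero_le ha.le hw.2 t₁).trans (ENNReal.ofReal_le_ofReal ?_)
      rw [hat]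
      refine mul_le_mul hN2 (Real.exp_le_exp.2 ?_) (Real.exp_pos _).le (by positivity)
      have := mul_le_mul_of_nonneg_left hn1 ht₁.le
      linarith
    · refine (measure_exists_gradDev_le hC.le hw.1 hw.2 (fun θ hθ => hTS θ hθ) hκ.le hη hδ hlam.le
        t₂ (hdev κ hκ.le (min_le_left _ _)) hqe hq.le).trans (ENNReal.ofReal_le_ofReal ?_)
      have h1 : (1 + 2 * C₀ / ρ) ^ N d = Real.exp (N d * L) := by
        rw [Real.exp_nat_mul, hL, Real.exp_log (by linarith)]
      refine (mul_le_mul_of_nonneg_right hTc (Real.exp_pos _).le).trans ?_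
      rw [h1, ← Real.exp_add, Real.exp_le_exp]
      have h2 := mul_le_mul_of_nonneg_right hN2 hL0
      have h3 := mul_le_mul_of_nonneg_left hn1 (mul_pos hlam ht₂).le
      have h4 : lam * t₂ * (ψ₂ / 2 * d) = (2 * ψ₁ * L + 2 * ψ₂ + 1) * d := by
        rw [← hlame]; ring
      nlinarith

end Gap

/-! ### Strongly convex functions and their minimizers. -/

section StronglyConvex

variable {V : Type*} [NormedAddCommGroup V] [InnerProductSpace ℝ V] [FiniteDimensional ℝ V]
  {F : V → ℝ} {ζ : ℝ} {K : Set V}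

/-- A strongly convex function bounded below by the quadratic `ζ / 2 ‖θ‖²`. -/
structure IsRidge (ζ : ℝ) (F : V → ℝ) : Prop where
  strong : StrongConvexOn Set.univ ζ F
  lower : ∀ θ, ζ / 2 * ‖θ‖ ^ 2 ≤ F θ

omit [FiniteDimensional ℝ V] in
lemma isRidge_of_convexOn {Q : V → ℝ} (hQ : ConvexOn ℝ Set.univ Q) (hQ0 : ∀ θ, 0 ≤ Q θ)
    (hF : ∀ θ, F θ = Q θ + ζ / 2 * ‖θ‖ ^ 2) : IsRidge ζ F := by
  refine ⟨strongConvexOn_iff_convex.2 (hQ.congr fun θ _ => ?_), fun θ => ?_⟩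
  · simp only [hF]; ring
  · rw [hF]; linarith [hQ0 θ]

namespace IsRidge

omit [FiniteDimensional ℝ V] in
lemma convexOn (h : IsRidge ζ F) (hζ : 0 ≤ ζ) : ConvexOn ℝ Set.univ F :=
  UniformConvexOn.convexOn h.strong fun r => by
    have : 0 ≤ ζ / 2 * r ^ 2 := by positivity
    simpa using this

lemma continuous (h : IsRidge ζ F) (hζ : 0 ≤ ζ) : Continuous F :=
  (h.convexOn hζ).locallyLipschitz.continuous

omit [FiniteDimensional ℝ V] in
lemma segment_le (h : IsRidge ζ F) (θ θ' : V) {t : ℝ} (ht0 : 0 ≤ t) (ht1 : t ≤ 1) :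
    F (θ + t • (θ' - θ)) ≤ F θ + t * (F θ' - F θ) - t * (1 - t) * (ζ / 2 * ‖θ' - θ‖ ^ 2) := by
  have h1 := h.strong.2 (Set.mem_univ θ) (Set.mem_univ θ') (sub_nonneg.2 ht1) ht0 (by ring)
  have e : (1 - t) • θ + t • θ' = θ + t • (θ' - θ) := by
    rw [sub_smul, one_smul, smul_sub]; abel
  rw [e, norm_sub_rev] at h1
  simp only [smul_eq_mul] at h1
  linarith

omit [FiniteDimensional ℝ V] in
lemma add_le_of_hasDerivAt (h : IsRidge ζ F) {θ θ' : V} {g : ℝ}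
    (hg : HasDerivAt (fun t : ℝ => F (θ + t • (θ' - θ))) g 0) :
    F θ + g + ζ / 2 * ‖θ' - θ‖ ^ 2 ≤ F θ' := by
  have h1 := (hasDerivAt_iff_tendsto_slope_zero.1 hg).mono_left
    (nhdsWithin_mono 0 (fun x (hx : 0 < x) => hx.ne') : 𝓝[>] (0 : ℝ) ≤ 𝓝[≠] 0)
  have h2 : Tendsto (fun t : ℝ => (F θ' - F θ) - (1 - t) * (ζ / 2 * ‖θ' - θ‖ ^ 2)) (𝓝[>] 0)
      (𝓝 ((F θ' - F θ) - (1 - 0) * (ζ / 2 * ‖θ' - θ‖ ^ 2))) := by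
    refine (Continuous.tendsto ?_ 0).mono_left nhdsWithin_le_nhds
    fun_prop
  have h3 := le_of_tendsto_of_tendsto h1 h2 ?_
  · linarith
  · filter_upwards [Ioo_mem_nhdsGT (zero_lt_one (α := ℝ))] with t ht
    have h4 := h.segment_le θ θ' ht.1.le ht.2.le
    simp only [zero_add, zero_smul, add_zero, smul_eq_mul]
    rw [inv_mul_le_iff₀ ht.1]
    linarith

-- Divide the segment inequality by `t` and let `t → 0⁺`; minimality makes the increment
-- nonnegative. This is what turns near-minimal values into closeness of points.
omit [FiniteDimensional ℝ V] in
lemma add_le_of_isMinOn (h : IsRidge ζ F) (hK : Convex ℝ K) {θ θ' : V} (hθ : θ ∈ K)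
    (hmin : IsMinOn F K θ) (hθ' : θ' ∈ K) : F θ + ζ / 2 * ‖θ' - θ‖ ^ 2 ≤ F θ' := by
  have h2 : Tendsto (fun t : ℝ => (F θ' - F θ) - (1 - t) * (ζ / 2 * ‖θ' - θ‖ ^ 2)) (𝓝[>] 0)
      (𝓝 ((F θ' - F θ) - (1 - 0) * (ζ / 2 * ‖θ' - θ‖ ^ 2))) := by
    refine (Continuous.tendsto ?_ 0).mono_left nhdsWithin_le_nhds
    fun_prop
  have h3 := ge_of_tendsto (b := 0) h2 ?_
  · linarith
  · filter_upwards [Ioo_mem_nhdsGT (zero_lt_one (α := ℝ))] with t ht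
    have h4 := h.segment_le θ θ' ht.1.le ht.2.le
    have h5 : F θ ≤ F (θ + t • (θ' - θ)) :=
      hmin (hK.add_smul_sub_mem hθ hθ' ⟨ht.1.le, ht.2.le⟩)
    have h6 : 0 ≤ t * ((F θ' - F θ) - (1 - t) * (ζ / 2 * ‖θ' - θ‖ ^ 2)) := by linarith
    exact nonneg_of_mul_nonneg_right h6 ht.1

lemma exists_isMinOn (h : IsRidge ζ F) (hζ : 0 < ζ) (hK : IsClosed K) (hne : K.Nonempty) :
    ∃ θ ∈ K, IsMinOn F K θ := by
  obtain ⟨x₀, hx₀⟩ := hne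
  refine (h.continuous hζ.le).continuousOn.exists_isMinOn' hK hx₀ (Eventually.filter_mono inf_le_left ?_)
  have h1 : Tendsto (fun θ : V => ζ / 2 * ‖θ‖ ^ 2) (cocompact V) atTop :=
    ((tendsto_pow_atTop two_ne_zero).comp (tendsto_norm_cocompact_atTop)).const_mul_atTop
      (by positivity)
  filter_upwards [h1.eventually_ge_atTop (F x₀)] with θ hθ
  exact hθ.trans (h.lower θ)

omit [FiniteDimensional ℝ V] in
lemma eq_of_isMinOn (h : IsRidge ζ F) (hζ : 0 < ζ) {θ θ' : V} (hmin : IsMinOn F Set.univ θ)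
    (hmin' : IsMinOn F Set.univ θ') : θ' = θ := by
  have h1 := h.add_le_of_isMinOn convex_univ (Set.mem_univ θ) hmin (Set.mem_univ θ')
  have h2 : F θ' ≤ F θ := hmin' (Set.mem_univ θ)
  have h3 : ζ / 2 * ‖θ' - θ‖ ^ 2 ≤ 0 := by linarith
  have h4 : ‖θ' - θ‖ ^ 2 ≤ 0 := nonpos_of_mul_nonpos_right h3 (by positivity)
  have h5 : ‖θ' - θ‖ = 0 := pow_eq_zero_iff (two_ne_zero) |>.1 (le_antisymm h4 (sq_nonneg _))
  exact sub_eq_zero.1 (norm_eq_zero.1 h5)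

lemma existsUnique (h : IsRidge ζ F) (hζ : 0 < ζ) : ∃! θ, IsMinOn F Set.univ θ := by
  obtain ⟨θ, -, hθ⟩ := h.exists_isMinOn hζ isClosed_univ Set.univ_nonempty
  exact ⟨θ, hθ, fun θ' hθ' => h.eq_of_isMinOn hζ hθ hθ'⟩

omit [FiniteDimensional ℝ V] in
lemma norm_sq_le_of_le (h : IsRidge ζ F) (hζ : 0 < ζ) {θ : V} {b : ℝ} (hθ : F θ ≤ b) :
    ‖θ‖ ^ 2 ≤ 2 / ζ * b := by
  have h1 := (h.lower θ).trans hθ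
  have h2 : ‖θ‖ ^ 2 = 2 / ζ * (ζ / 2 * ‖θ‖ ^ 2) := by field_simp
  rw [h2]
  gcongr

end IsRidge

/-- A minimizer of `F` over `K`. -/
def argminOn (F : V → ℝ) (K : Set V) : V :=
  Classical.epsilon fun θ => θ ∈ K ∧ IsMinOn F K θ

lemma IsRidge.argminOn_spec (h : IsRidge ζ F) (hζ : 0 < ζ) (hK : IsClosed K) (hne : K.Nonempty) :
    argminOn F K ∈ K ∧ IsMinOn F K (argminOn F K) :=
  Classical.epsilon_spec (p := fun θ => θ ∈ K ∧ IsMinOn F K θ)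
    (by obtain ⟨θ, h1, h2⟩ := h.exists_isMinOn hζ hK hne; exact ⟨θ, h1, h2⟩)

/-- The minimizer over a closed convex set of a jointly continuous family of uniformly strongly
convex functions depends continuously on the parameter. -/
lemma continuous_argminOn {X : Type*} [TopologicalSpace X] {F : X → V → ℝ} (hζ : 0 < ζ)
    (hF : Continuous fun p : X × V => F p.1 p.2) (hr : ∀ s, IsRidge ζ (F s)) (hK : IsClosed K)
    (hKc : Convex ℝ K) (hne : K.Nonempty) : Continuous fun s => argminOn (F s) K := by
  refine continuous_iff_continuousAt.2 fun s₀ => Metric.tendsto_nhds.2 fun r' hr' => ?_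
  set r := r' / 2 with hrdef
  have hr0 : 0 < r := by positivity
  set θ₀ := argminOn (F s₀) K with hθ₀
  obtain ⟨h0K, h0m⟩ := (hr s₀).argminOn_spec hζ hK hne
  have hcpt : IsCompact (K ∩ Metric.sphere θ₀ r) := (isCompact_sphere θ₀ r).inter_left hK
  -- Strict inequality on a compact sphere persists for nearby parameters. A minimizer outside the
  -- ball would, by convexity along the segment from `θ₀`, give a point of the sphere with value at
  -- most `F s θ₀`.
  have hev : ∀ᶠ s in 𝓝 s₀, ∀ y ∈ K ∩ Metric.sphere θ₀ r, F s θ₀ < F s y := by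
    refine hcpt.eventually_forall_of_forall_eventually fun y hy => ?_
    have h1 : F s₀ θ₀ < F s₀ y := by
      have h2 := (hr s₀).add_le_of_isMinOn hKc h0K h0m hy.1
      rw [← hθ₀, ← dist_eq_norm, Metric.mem_sphere.1 hy.2] at h2
      have : 0 < ζ / 2 * r ^ 2 := by positivity
      linarith
    have hc1 : Continuous fun p : X × V => F p.1 θ₀ :=
      hF.comp (continuous_fst.prodMk continuous_const)
    exact (hc1.tendsto (s₀, y)).eventually_lt (hF.tendsto (s₀, y)) h1
  filter_upwards [hev] with s hs
  obtain ⟨hsK, hsm⟩ := (hr s).argminOn_spec hζ hK hne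
  set θ := argminOn (F s) K
  suffices hle : dist θ θ₀ ≤ r by rw [hrdef] at hle; linarith
  by_contra! hlt
  rw [dist_eq_norm] at hlt
  have hpos : 0 < ‖θ - θ₀‖ := hr0.trans hlt
  have ht1 : r / ‖θ - θ₀‖ ≤ 1 := (div_le_one hpos).2 hlt.le
  have ht0 : 0 ≤ r / ‖θ - θ₀‖ := by positivity
  have hy := hs (θ₀ + (r / ‖θ - θ₀‖) • (θ - θ₀))
    ⟨hKc.add_smul_sub_mem h0K hsK ⟨ht0, ht1⟩, by
      rw [Metric.mem_sphere, dist_eq_norm, add_sub_cancel_left, norm_smul, Real.norm_of_nonneg ht0,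
        div_mul_cancel₀ _ hpos.ne']⟩
  have h1 := (hr s).segment_le θ₀ θ ht0 ht1
  have h2 : F s θ ≤ F s θ₀ := hsm h0K
  have h3 : r / ‖θ - θ₀‖ * (F s θ - F s θ₀) ≤ 0 := mul_nonpos_of_nonneg_of_nonpos ht0 (by linarith)
  have h4 : 0 ≤ r / ‖θ - θ₀‖ * (1 - r / ‖θ - θ₀‖) * (ζ / 2 * ‖θ - θ₀‖ ^ 2) :=
    mul_nonneg (mul_nonneg ht0 (by linarith)) (by positivity)
  linarith

/-! ### Coordinates of a minimizer by comparison with a coordinate hyperplane. -/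

section Coordinate

variable {N : ℕ}

/-- The parameters that do not use neuron `l`. -/
def coordHyperplane (l : Fin N) : Set (EuclideanSpace ℝ (Fin N)) := {θ | θ l = 0}

lemma isClosed_coordHyperplane (l : Fin N) : IsClosed (coordHyperplane l) :=
  isClosed_eq (by fun_prop) continuous_const

lemma convex_coordHyperplane (l : Fin N) : Convex ℝ (coordHyperplane l) := by
  intro x hx y hy a b _ _ _
  simp only [coordHyperplane, Set.mem_ofPred_eq] at *
  simp [hx, hy]

lemma zero_mem_coordHyperplane (l : Fin N) : (0 : EuclideanSpace ℝ (Fin N)) ∈ coordHyperplane l := rfl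

/-- If a differentiable ridge function has a small partial derivative at its minimizer over the
coordinate hyperplane, then its global minimizer has a small coordinate. -/
lemma IsRidge.abs_coord_le {F : EuclideanSpace ℝ (Fin N) → ℝ} (h : IsRidge ζ F) (hζ : 0 < ζ)
    {l : Fin N} {θ μ D : EuclideanSpace ℝ (Fin N)} (hθ : θ ∈ coordHyperplane l)
    (hmin : IsMinOn F (coordHyperplane l) θ)
    (hD : ∀ v, HasDerivAt (fun t : ℝ => F (θ + t • v)) (inner ℝ D v) 0)
    (hμ : IsMinOn F Set.univ μ) : |μ l| ≤ 2 / ζ * |D l| := by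
  -- Constrained minimality kills all partial derivatives but the `l`-th, so the derivative in a
  -- direction `v` is `D l * v l`.
  have hzero : ∀ v ∈ coordHyperplane l, inner ℝ D v = 0 := by
    intro v hv
    refine IsLocalMin.hasDerivAt_eq_zero (Eventually.of_forall fun t => ?_) (hD v)
    simp only [zero_smul, add_zero]
    refine hmin (?_ : (θ + t • v) l = 0)
    have h1 : θ l = 0 := hθ
    have h2 : v l = 0 := hv
    simp [h1, h2]
  have hinner : ∀ v, inner ℝ D v = D l * v l := by
    intro v
    have h1 : v - EuclideanSpace.single l (v l) ∈ coordHyperplane l := by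
      simp [coordHyperplane]
    have h2 := hzero _ h1
    rw [inner_sub_right, sub_eq_zero] at h2
    rw [h2, EuclideanSpace.inner_single_right]
    simp [mul_comm]
  -- Strong convexity at `θ`, with `F μ ≤ F θ`, yields `ζ / 2 * μ l ^ 2 ≤ |D l| * |μ l|`.
  have h1 := h.add_le_of_hasDerivAt (hD (μ - θ))
  have h2 : F μ ≤ F θ := hμ (Set.mem_univ θ)
  have hθl : θ l = 0 := hθ
  rw [hinner, PiLp.sub_apply, hθl, sub_zero] at h1
  have h3 : μ l ^ 2 ≤ ‖μ - θ‖ ^ 2 := by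
    have := EuclideanSpace.real_norm_sq_eq (μ - θ)
    rw [this]
    refine le_trans (le_of_eq ?_) (Finset.single_le_sum (f := fun i => ((μ - θ).ofLp i) ^ 2)
      (fun i _ => sq_nonneg _) (Finset.mem_univ l))
    simp [hθl]
  have h4 : ζ / 2 * μ l ^ 2 ≤ |D l| * |μ l| := by
    have := mul_le_mul_of_nonneg_left h3 (by positivity : 0 ≤ ζ / 2)
    have h5 := neg_abs_le (D l * μ l)
    rw [abs_mul] at h5
    linarith
  rcases eq_or_ne (μ l) 0 with h0 | h0
  · rw [h0, abs_zero]; positivity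
  · have hp : 0 < |μ l| := abs_pos.2 h0
    rw [← sq_abs (μ l)] at h4
    have h5 : ζ / 2 * |μ l| ≤ |D l| := by
      refine le_of_mul_le_mul_right ?_ hp
      calc ζ / 2 * |μ l| * |μ l| = ζ / 2 * |μ l| ^ 2 := by ring
        _ ≤ _ := h4
    calc |μ l| = 2 / ζ * (ζ / 2 * |μ l|) := by field_simp
      _ ≤ _ := by gcongr

end Coordinate

end StronglyConvex

/-! ### Strong convexity of the two losses. -/

section LossConvexity

variable {d N n : ℕ} {ε ζ : ℝ}

lemma convexOn_of_le {V : Type*} [AddCommGroup V] [Module ℝ V] {f : V → ℝ}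
    (h : ∀ (x y : V) (a b : ℝ), 0 ≤ a → 0 ≤ b → a + b = 1 →
      f (a • x + b • y) ≤ a * f x + b * f y) : ConvexOn ℝ Set.univ f :=
  ⟨convex_univ, fun x _ y _ a b ha hb hab => h x y a b ha hb hab⟩

lemma predictor_add_smul (w : Fin N → EuclideanSpace ℝ (Fin d)) (θ θ' : EuclideanSpace ℝ (Fin N))
    (a b : ℝ) (x : EuclideanSpace ℝ (Fin d)) :
    predictor w (a • θ + b • θ') x = a * predictor w θ x + b * predictor w θ' x := by
  simp only [predictor, Finset.mul_sum, ← Finset.sum_add_distrib]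
  refine Finset.sum_congr rfl fun l _ => ?_
  simp only [PiLp.add_apply, PiLp.smul_apply, smul_eq_mul]
  ring

lemma residual_add_smul (β : EuclideanSpace ℝ (Fin d)) (s : Sample d N n)
    (θ θ' : EuclideanSpace ℝ (Fin N)) {a b : ℝ} (hab : a + b = 1) (i : Fin n)
    (δ : EuclideanSpace ℝ (Fin d)) :
    residual β s (a • θ + b • θ') i δ = a * residual β s θ i δ + b * residual β s θ' i δ := by
  simp only [residual, predictor_add_smul]
  linear_combination -(label β s i) * hab

lemma convexOn_abs_residual (β : EuclideanSpace ℝ (Fin d)) (s : Sample d N n) (i : Fin n)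
    (δ : EuclideanSpace ℝ (Fin d)) :
    ConvexOn ℝ Set.univ fun θ : EuclideanSpace ℝ (Fin N) => |residual β s θ i δ| := by
  refine convexOn_of_le fun θ θ' a b ha hb hab => ?_
  rw [residual_add_smul β s θ θ' hab]
  refine (abs_add_le _ _).trans ?_
  rw [abs_mul, abs_mul, abs_of_nonneg ha, abs_of_nonneg hb]

lemma convexOn_residual_sq (β : EuclideanSpace ℝ (Fin d)) (s : Sample d N n) (i : Fin n)
    (δ : EuclideanSpace ℝ (Fin d)) :
    ConvexOn ℝ Set.univ fun θ : EuclideanSpace ℝ (Fin N) => residual β s θ i δ ^ 2 := by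
  exact ((convexOn_abs_residual β s i δ).pow (fun _ _ => abs_nonneg _) 2).congr
    fun θ _ => sq_abs _

lemma convexOn_norm_linearMap {V W : Type*} [AddCommGroup V] [Module ℝ V] [NormedAddCommGroup W]
    [NormedSpace ℝ W] (T : V →ₗ[ℝ] W) : ConvexOn ℝ Set.univ fun θ => ‖T θ‖ :=
  (convexOn_norm convex_univ).comp_linearMap T

/-- `√(u² + η²)` is the Euclidean norm of `(u, η)`, convex and increasing in `u ≥ 0`; `hpq` is the
Cauchy–Schwarz inequality behind it. -/
lemma ConvexOn.sqrt_sq_add {V : Type*} [AddCommGroup V] [Module ℝ V] {u : V → ℝ}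
    (hu : ConvexOn ℝ Set.univ u) (hu0 : ∀ x, 0 ≤ u x) (η : ℝ) :
    ConvexOn ℝ Set.univ fun x => √(u x ^ 2 + η ^ 2) := by
  refine convexOn_of_le fun x y a b ha hb hab => ?_
  have h1 : u (a • x + b • y) ≤ a * u x + b * u y := hu.2 (Set.mem_univ x) (Set.mem_univ y) ha hb hab
  have hp := Real.sq_sqrt (show 0 ≤ u x ^ 2 + η ^ 2 by positivity)
  have hq := Real.sq_sqrt (show 0 ≤ u y ^ 2 + η ^ 2 by positivity)
  have hpq : u x * u y + η ^ 2 ≤ √(u x ^ 2 + η ^ 2) * √(u y ^ 2 + η ^ 2) := by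
    rw [← Real.sqrt_mul (by positivity)]
    refine Real.le_sqrt_of_sq_le ?_
    nlinarith [sq_nonneg (η * (u x - u y))]
  have h2 : u (a • x + b • y) ^ 2 ≤ (a * u x + b * u y) ^ 2 := pow_le_pow_left₀ (hu0 _) h1 2
  refine Real.sqrt_le_iff.2 ⟨by positivity, ?_⟩
  have hη : η ^ 2 = (a + b) ^ 2 * η ^ 2 := by rw [hab]; ring
  set p := √(u x ^ 2 + η ^ 2)
  set q := √(u y ^ 2 + η ^ 2)
  have h3 := mul_le_mul_of_nonneg_left hpq (mul_nonneg ha hb)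
  calc u (a • x + b • y) ^ 2 + η ^ 2 ≤ (a * u x + b * u y) ^ 2 + (a + b) ^ 2 * η ^ 2 := by linarith
    _ = a ^ 2 * (u x ^ 2 + η ^ 2) + b ^ 2 * (u y ^ 2 + η ^ 2) +
        2 * (a * b * (u x * u y + η ^ 2)) := by ring
    _ ≤ a ^ 2 * p ^ 2 + b ^ 2 * q ^ 2 + 2 * (a * b * (p * q)) := by rw [hp, hq]; linarith
    _ = _ := by ring

lemma convexOn_finset_sum {V ι : Type*} [AddCommGroup V] [Module ℝ V] (t : Finset ι)
    {f : ι → V → ℝ} (h : ∀ i ∈ t, ConvexOn ℝ Set.univ (f i)) :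
    ConvexOn ℝ Set.univ fun x => ∑ i ∈ t, f i x := by
  refine convexOn_of_le fun x y a b ha hb hab => ?_
  rw [Finset.mul_sum, Finset.mul_sum, ← Finset.sum_add_distrib]
  exact Finset.sum_le_sum fun i hi => (h i hi).2 (Set.mem_univ x) (Set.mem_univ y) ha hb hab

/-- Normalize the exponentials at the two endpoints to have sum one; convexity of `exp` applied term
by term then replaces Hölder's inequality. -/
lemma ConvexOn.log_sum_exp {V ι : Type*} [AddCommGroup V] [Module ℝ V] [Fintype ι] [Nonempty ι]
    {h : ι → V → ℝ} (hh : ∀ i, ConvexOn ℝ Set.univ (h i)) :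
    ConvexOn ℝ Set.univ fun x => Real.log (∑ i, Real.exp (h i x)) := by
  refine convexOn_of_le fun x y a b ha hb hab => ?_
  have hpos : ∀ x, 0 < ∑ i, Real.exp (h i x) := fun x =>
    Finset.sum_pos (fun i _ => Real.exp_pos _) Finset.univ_nonempty
  set U := Real.log (∑ i, Real.exp (h i x)) with hU
  set W := Real.log (∑ i, Real.exp (h i y)) with hW
  have hUe : Real.exp U = ∑ i, Real.exp (h i x) := Real.exp_log (hpos x)
  have hWe : Real.exp W = ∑ i, Real.exp (h i y) := Real.exp_log (hpos y)
  rw [← Real.exp_le_exp, Real.exp_log (hpos _), ← one_mul (Real.exp (a * U + b * W)),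
    ← div_le_iff₀ (Real.exp_pos _), Finset.sum_div]
  calc _ ≤ ∑ i, (a * Real.exp (h i x - U) + b * Real.exp (h i y - W)) := by
        refine Finset.sum_le_sum fun i _ => ?_
        rw [← Real.exp_sub]
        have h1 : h i (a • x + b • y) ≤ a * h i x + b * h i y :=
          (hh i).2 (Set.mem_univ x) (Set.mem_univ y) ha hb hab
        refine le_trans (Real.exp_le_exp.2 (?_ : _ ≤ a * (h i x - U) + b * (h i y - W))) ?_
        · linarith
        · exact convexOn_exp.2 (Set.mem_univ _) (Set.mem_univ _) ha hb hab
    _ = a * ((∑ i, Real.exp (h i x)) / Real.exp U) + b * ((∑ i, Real.exp (h i y)) / Real.exp W) := by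
        rw [Finset.sum_add_distrib, ← Finset.mul_sum, ← Finset.mul_sum, Finset.sum_div,
          Finset.sum_div]
        simp only [Real.exp_sub]
    _ = 1 := by rw [hUe, hWe, div_self (hpos x).ne', div_self (hpos y).ne', mul_one, mul_one, hab]

lemma isRidge_add_regularizer (hζ : 0 ≤ ζ) {Q : EuclideanSpace ℝ (Fin N) → ℝ}
    (hQ : ConvexOn ℝ Set.univ Q) (hQ0 : ∀ θ, 0 ≤ Q θ) :
    IsRidge ζ fun θ => Q θ + regularizer d ζ θ := by
  refine isRidge_of_convexOn (Q := fun θ => Q θ + ζ / 2 * (√(Real.log d) / d) * (∑ l, θ l) ^ 2)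
    ?_ (fun θ => ?_) fun θ => ?_
  · refine hQ.add ?_
    have h1 : ConvexOn ℝ Set.univ fun θ : EuclideanSpace ℝ (Fin N) => (∑ l, θ l) ^ 2 := by
      have h2 : ConvexOn ℝ Set.univ fun θ : EuclideanSpace ℝ (Fin N) => |∑ l, θ l| := by
        refine convexOn_of_le fun x y a b ha hb hab => ?_
        simp only [PiLp.add_apply, PiLp.smul_apply, smul_eq_mul, Finset.sum_add_distrib,
          ← Finset.mul_sum]
        refine (abs_add_le _ _).trans ?_
        rw [abs_mul, abs_mul, abs_of_nonneg ha, abs_of_nonneg hb]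
      exact (h2.pow (fun _ _ => abs_nonneg _) 2).congr fun θ _ => sq_abs _
    exact h1.smul (by positivity)
  · have := hQ0 θ
    positivity
  · rw [regularizer_eq]; ring

lemma isRidge_simplifiedLoss (hε : 0 ≤ ε) (hζ : 0 ≤ ζ) (β : EuclideanSpace ℝ (Fin d))
    (s : Sample d N n) : IsRidge ζ (simplifiedLoss ε ζ β s) := by
  refine isRidge_add_regularizer hζ (ConvexOn.smul (by positivity)
    (convexOn_finset_sum _ fun i _ => ConvexOn.pow (ConvexOn.add ?_
      ((convexOn_norm_linearMap _).smul hε)) (fun θ _ =>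
        add_nonneg (abs_nonneg _) (mul_nonneg hε (norm_nonneg _))) 2)) fun θ => by positivity
  simpa [residual] using! convexOn_abs_residual β s i 0

/-- A (non-uniform) Lipschitz bound for the predictor. -/
lemma abs_predictor_sub_le_sum (w : Fin N → EuclideanSpace ℝ (Fin d))
    (θ : EuclideanSpace ℝ (Fin N)) (x x' : EuclideanSpace ℝ (Fin d)) :
    |predictor w θ x - predictor w θ x'| ≤ ∑ l, |θ l| * |inner ℝ (w l) (x - x')| := by
  unfold predictor
  rw [← Finset.sum_sub_distrib]
  refine (Finset.abs_sum_le_sum_abs _ _).trans (Finset.sum_le_sum fun l _ => ?_)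
  rw [← mul_sub, abs_mul, inner_sub_right]
  exact mul_le_mul_of_nonneg_left (abs_shiftedReLU_sub_le _ _) (abs_nonneg _)

lemma bddAbove_robust (β : EuclideanSpace ℝ (Fin d)) (s : Sample d N n)
    (θ : EuclideanSpace ℝ (Fin N)) :
    BddAbove (Set.range fun δ : {δ : Fin n → EuclideanSpace ℝ (Fin d) // ∀ i, ‖δ i‖ ≤ ε} =>
      1 / (2 * (n : ℝ)) * ∑ i, (label β s i - predictor s.w θ (s.x i + δ.1 i)) ^ 2) := by
  refine ⟨1 / (2 * (n : ℝ)) * ∑ i, (|label β s i - predictor s.w θ (s.x i)| +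
    ∑ l, |θ l| * (‖s.w l‖ * ε)) ^ 2, ?_⟩
  rintro _ ⟨δ, rfl⟩
  refine mul_le_mul_of_nonneg_left (Finset.sum_le_sum fun i _ => ?_) (by positivity)
  rw [← sq_abs]
  refine pow_le_pow_left₀ (abs_nonneg _) ?_ 2
  have h1 := abs_predictor_sub_le_sum s.w θ (s.x i + δ.1 i) (s.x i)
  rw [add_sub_cancel_left] at h1
  have h2 : ∑ l, |θ l| * |inner ℝ (s.w l) (δ.1 i)| ≤ ∑ l, |θ l| * (‖s.w l‖ * ε) :=
    Finset.sum_le_sum fun l _ => mul_le_mul_of_nonneg_left ((abs_real_inner_le_norm _ _).trans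
      (mul_le_mul_of_nonneg_left (δ.2 i) (norm_nonneg _))) (abs_nonneg _)
  have h3 := abs_sub (label β s i - predictor s.w θ (s.x i))
    (predictor s.w θ (s.x i + δ.1 i) - predictor s.w θ (s.x i))
  rw [show label β s i - predictor s.w θ (s.x i) -
    (predictor s.w θ (s.x i + δ.1 i) - predictor s.w θ (s.x i)) =
    label β s i - predictor s.w θ (s.x i + δ.1 i) by ring] at h3
  linarith

/-- A supremum of convex functions, the residuals being affine in `θ`. The bound `bddAbove_robust`
keeps the real supremum from taking its default value. -/
lemma isRidge_robustLoss (hε : 0 ≤ ε) (hζ : 0 ≤ ζ) (β : EuclideanSpace ℝ (Fin d))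
    (s : Sample d N n) : IsRidge ζ (robustLoss ε ζ β s) := by
  have hne : Nonempty {δ : Fin n → EuclideanSpace ℝ (Fin d) // ∀ i, ‖δ i‖ ≤ ε} :=
    ⟨⟨fun _ => 0, fun _ => by simpa using hε⟩⟩
  refine isRidge_add_regularizer hζ (convexOn_of_le fun θ θ' a b ha hb hab => ?_) fun θ =>
    Real.iSup_nonneg fun _ => by positivity
  refine ciSup_le fun δ => ?_
  have hconv : ConvexOn ℝ Set.univ fun θ : EuclideanSpace ℝ (Fin N) =>
      1 / (2 * (n : ℝ)) * ∑ i, (label β s i - predictor s.w θ (s.x i + δ.1 i)) ^ 2 :=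
    ConvexOn.smul (by positivity) (convexOn_finset_sum _ fun i _ => convexOn_residual_sq β s i _)
  refine (hconv.2 (Set.mem_univ θ) (Set.mem_univ θ') ha hb hab).trans (add_le_add ?_ ?_)
  · exact mul_le_mul_of_nonneg_left (le_ciSup (bddAbove_robust β s θ) δ) ha
  · exact mul_le_mul_of_nonneg_left (le_ciSup (bddAbove_robust β s θ') δ) hb

end LossConvexity

/-! ### Differentiable surrogates of the two losses. -/

section SoftLoss

variable {d N n : ℕ} {ε ζ P η : ℝ} {ι : Type*} [Fintype ι]

lemma abs_predictor_sub_le {w : Fin N → EuclideanSpace ℝ (Fin d)} {C : ℝ} (hC : 0 ≤ C)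
    (hw : OpBound w C) (θ : EuclideanSpace ℝ (Fin N)) (x x' : EuclideanSpace ℝ (Fin d)) :
    |predictor w θ x - predictor w θ x'| ≤ √C * ‖θ‖ * ‖x - x'‖ := by
  refine (abs_predictor_sub_le_sum w θ x x').trans (le_of_sq_le_sq ?_ (by positivity))
  refine (Finset.sum_mul_sq_le_sq_mul_sq _ _ _).trans ?_
  simp_rw [sq_abs]
  rw [← EuclideanSpace.real_norm_sq_eq, mul_pow, mul_pow, Real.sq_sqrt hC]
  have := mul_le_mul_of_nonneg_left (hw (x - x')) (sq_nonneg ‖θ‖)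
  linarith

/-- The robust loss with the maximum over each perturbation replaced by a soft maximum over a finite
family of perturbations, at inverse temperature `P`. -/
def softLoss (ζ P : ℝ) (δ : ι → EuclideanSpace ℝ (Fin d)) (β : EuclideanSpace ℝ (Fin d))
    (s : Sample d N n) (θ : EuclideanSpace ℝ (Fin N)) : ℝ :=
  1 / (2 * (n : ℝ)) * ∑ i, 1 / P * Real.log (∑ a, Real.exp (P * residual β s θ i (δ a) ^ 2))
    + regularizer d ζ θ

/-- The simplified loss with both norms replaced by their smoothings at scale `η`. -/
def smoothLoss (ε ζ η : ℝ) (β : EuclideanSpace ℝ (Fin d)) (s : Sample d N n)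
    (θ : EuclideanSpace ℝ (Fin N)) : ℝ :=
  1 / (2 * (n : ℝ)) *
      ∑ i, (√(|residual β s θ i 0| ^ 2 + η ^ 2) + ε * √(√(kForm s.w θ) ^ 2 + η ^ 2)) ^ 2
    + regularizer d ζ θ

variable {β : EuclideanSpace ℝ (Fin d)} {s : Sample d N n} {θ : EuclideanSpace ℝ (Fin N)}
  {δ : ι → EuclideanSpace ℝ (Fin d)}

section Nonempty

variable [Nonempty ι]

lemma sq_le_softMax (hP : 0 < P) (r : ι → ℝ) (a : ι) :
    r a ^ 2 ≤ 1 / P * Real.log (∑ a, Real.exp (P * r a ^ 2)) := by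
  rw [one_div, inv_mul_eq_div, le_div_iff₀ hP]
  rw [Real.le_log_iff_exp_le (Finset.sum_pos (fun _ _ => Real.exp_pos _) Finset.univ_nonempty),
    mul_comm]
  exact Finset.single_le_sum (f := fun a => Real.exp (P * r a ^ 2)) (fun _ _ => (Real.exp_pos _).le)
    (Finset.mem_univ a)

lemma softMax_nonneg (hP : 0 < P) (r : ι → ℝ) :
    0 ≤ 1 / P * Real.log (∑ a, Real.exp (P * r a ^ 2)) :=
  (sq_nonneg _).trans (sq_le_softMax hP r (Classical.arbitrary ι))

/-- The sum of exponentials is at most `card ι` times its largest term. -/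
lemma exists_softMax_le (hP : 0 < P) (r : ι → ℝ) :
    ∃ a, 1 / P * Real.log (∑ a, Real.exp (P * r a ^ 2)) ≤
      r a ^ 2 + Real.log (Fintype.card ι) / P := by
  obtain ⟨a, ha⟩ := Finite.exists_max fun a => r a ^ 2
  refine ⟨a, ?_⟩
  have hcard : (0 : ℝ) < Fintype.card ι := by exact_mod_cast Fintype.card_pos
  rw [one_div, inv_mul_eq_div, div_le_iff₀ hP, add_mul, div_mul_cancel₀ _ hP.ne']
  have h1 : ∑ a, Real.exp (P * r a ^ 2) ≤ Fintype.card ι * Real.exp (P * r a ^ 2) := by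
    calc _ ≤ ∑ _b : ι, Real.exp (P * r a ^ 2) :=
          Finset.sum_le_sum fun b _ => Real.exp_le_exp.2 (mul_le_mul_of_nonneg_left (ha b) hP.le)
      _ = _ := by simp
  refine (Real.log_le_log (Finset.sum_pos (fun _ _ => Real.exp_pos _) Finset.univ_nonempty)
    h1).trans_eq ?_
  rw [Real.log_mul hcard.ne' (Real.exp_pos _).ne', Real.log_exp]
  ring

lemma isRidge_softLoss (hζ : 0 ≤ ζ) (hP : 0 < P) (δ : ι → EuclideanSpace ℝ (Fin d))
    (β : EuclideanSpace ℝ (Fin d)) (s : Sample d N n) : IsRidge ζ (softLoss ζ P δ β s) :=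
  isRidge_add_regularizer hζ (ConvexOn.smul (by positivity)
    (convexOn_finset_sum _ fun i _ => ConvexOn.smul (by positivity)
      (ConvexOn.log_sum_exp fun _ => ConvexOn.smul hP.le (convexOn_residual_sq _ _ _ _))))
    fun _ => mul_nonneg (by positivity) (Finset.sum_nonneg fun _ _ => softMax_nonneg hP _)

lemma add_sq_le_mul_add {m e : ℝ} (he : 0 ≤ e) : (m + e) ^ 2 ≤ (1 + e) * m ^ 2 + e * (1 + e) := by
  nlinarith [mul_nonneg he (sq_nonneg (m - 1))]

lemma mean_le_mean (hn : 0 < n) {x y : Fin n → ℝ} {a b : ℝ} (h : ∀ i, x i ≤ a * y i + b) :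
    1 / (2 * (n : ℝ)) * ∑ i, x i ≤ a * (1 / (2 * (n : ℝ)) * ∑ i, y i) + b / 2 := by
  have hn' : (0 : ℝ) < n := by exact_mod_cast hn
  calc _ ≤ 1 / (2 * (n : ℝ)) * ∑ i, (a * y i + b) :=
        mul_le_mul_of_nonneg_left (Finset.sum_le_sum fun i _ => h i) (by positivity)
    _ = _ := by
        rw [Finset.sum_add_distrib, ← Finset.mul_sum, Finset.sum_const, Finset.card_univ,
          Fintype.card_fin, nsmul_eq_mul]
        field_simp

/-- The perturbations of different samples are chosen independently, so the maximizing indices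
assemble into one admissible family. -/
lemma softLoss_le_robustLoss (hn : 0 < n) (hP : 0 < P) (hδ : ∀ a, ‖δ a‖ ≤ ε) {e : ℝ}
    (he : Real.log (Fintype.card ι) / P ≤ e) :
    softLoss ζ P δ β s θ ≤ robustLoss ε ζ β s θ + e / 2 := by
  choose a ha using fun i => exists_softMax_le hP fun a => residual β s θ i (δ a)
  have h1 := mean_le_mean hn (a := 1) (b := e) (x := fun i =>
    1 / P * Real.log (∑ a, Real.exp (P * residual β s θ i (δ a) ^ 2)))
    (y := fun i => residual β s θ i (δ (a i)) ^ 2) fun i => by rw [one_mul]; exact (ha i).trans (by gcongr)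
  have h2 := le_ciSup (bddAbove_robust (ε := ε) β s θ) ⟨fun i => δ (a i), fun i => hδ _⟩
  simp only [softLoss, robustLoss, residual] at *
  linarith

/-- The predictor is `√C ‖θ‖`-Lipschitz in its input, so moving each perturbation to the net changes
a residual by at most `e`. This direction needs the norm bound on `θ`; it is applied only at the
minimizer of the soft loss. -/
lemma robustLoss_le_softLoss (hn : 0 < n) (hε : 0 ≤ ε) (hP : 0 < P) (hζ : 0 ≤ ζ) {ρ C C₀ e : ℝ}
    (hnet : ∀ x : EuclideanSpace ℝ (Fin d), ‖x‖ ≤ ε → ∃ a, ‖x - δ a‖ ≤ ρ) (hC : 0 ≤ C)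
    (hw : OpBound s.w C) (hθ : ‖θ‖ ≤ C₀) (he : √C * C₀ * ρ ≤ e) (he0 : 0 ≤ e) :
    robustLoss ε ζ β s θ ≤ (1 + e) * softLoss ζ P δ β s θ + e * (1 + e) := by
  have hne : Nonempty {δ : Fin n → EuclideanSpace ℝ (Fin d) // ∀ i, ‖δ i‖ ≤ ε} :=
    ⟨⟨fun _ => 0, fun _ => by simpa using hε⟩⟩
  have hC₀ : 0 ≤ C₀ := (norm_nonneg _).trans hθ
  have hreg := mul_nonneg he0 (regularizer_nonneg (d := d) hζ θ)
  have h0 : 0 ≤ e * (1 + e) := by positivity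
  suffices h : (⨆ δ : {δ : Fin n → EuclideanSpace ℝ (Fin d) // ∀ i, ‖δ i‖ ≤ ε},
      1 / (2 * (n : ℝ)) * ∑ i, (label β s i - predictor s.w θ (s.x i + δ.1 i)) ^ 2) ≤
      (1 + e) * (1 / (2 * (n : ℝ)) * ∑ i, 1 / P *
        Real.log (∑ a, Real.exp (P * residual β s θ i (δ a) ^ 2))) + e * (1 + e) / 2 by
    simp only [robustLoss, softLoss]
    linarith
  refine ciSup_le fun x => ?_
  refine mean_le_mean hn fun i => ?_
  obtain ⟨a, ha⟩ := hnet (x.1 i) (x.2 i)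
  have h1 : |label β s i - predictor s.w θ (s.x i + x.1 i)| ≤ |residual β s θ i (δ a)| + e := by
    have h2 := abs_predictor_sub_le hC hw θ (s.x i + x.1 i) (s.x i + δ a)
    rw [add_sub_add_left_eq_sub] at h2
    have h3 : √C * ‖θ‖ * ‖x.1 i - δ a‖ ≤ √C * C₀ * ρ := by gcongr
    have h4 := abs_sub (residual β s θ i (δ a))
      (predictor s.w θ (s.x i + x.1 i) - predictor s.w θ (s.x i + δ a))
    rw [show residual β s θ i (δ a) -
      (predictor s.w θ (s.x i + x.1 i) - predictor s.w θ (s.x i + δ a)) =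
      label β s i - predictor s.w θ (s.x i + x.1 i) by unfold residual; ring] at h4
    linarith
  rw [← sq_abs]
  refine (pow_le_pow_left₀ (abs_nonneg _) h1 2).trans ((add_sq_le_mul_add he0).trans ?_)
  rw [sq_abs]
  have := sq_le_softMax hP (fun a => residual β s θ i (δ a)) a
  have := mul_le_mul_of_nonneg_left this (show 0 ≤ 1 + e by linarith)
  linarith

end Nonempty

lemma isRidge_smoothLoss (hε : 0 ≤ ε) (hζ : 0 ≤ ζ) (η : ℝ) (β : EuclideanSpace ℝ (Fin d))
    {s : Sample d N n} (hw1 : ∀ l, ‖s.w l‖ = 1) : IsRidge ζ (smoothLoss ε ζ η β s) := by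
  refine isRidge_add_regularizer hζ (ConvexOn.smul (by positivity)
    (convexOn_finset_sum _ fun i _ => ConvexOn.pow (ConvexOn.add
      (ConvexOn.sqrt_sq_add (convexOn_abs_residual β s i 0) (fun _ => abs_nonneg _) η)
      ((ConvexOn.sqrt_sq_add ?_ (fun _ => Real.sqrt_nonneg _) η).smul hε)) (fun θ _ =>
        add_nonneg (Real.sqrt_nonneg _) (mul_nonneg hε (Real.sqrt_nonneg _))) 2))
    fun θ => by positivity
  simp_rw [← norm_J_eq_sqrt hw1]
  exact convexOn_norm_linearMap _

lemma le_sqrt_sq_add (u η : ℝ) : u ≤ √(u ^ 2 + η ^ 2) :=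
  Real.le_sqrt_of_sq_le (by linarith [sq_nonneg η])

lemma sqrt_sq_add_le {u : ℝ} (hu : 0 ≤ u) (hη : 0 ≤ η) : √(u ^ 2 + η ^ 2) ≤ u + η :=
  Real.sqrt_le_iff.2 ⟨by positivity, by nlinarith [mul_nonneg hu hη]⟩

lemma simplifiedLoss_eq (hw1 : ∀ l, ‖s.w l‖ = 1) : simplifiedLoss ε ζ β s θ = 1 / (2 * (n : ℝ)) *
      ∑ i, (|residual β s θ i 0| + ε * √(kForm s.w θ)) ^ 2 + regularizer d ζ θ := by
  simp only [simplifiedLoss, residual, add_zero, norm_J_eq_sqrt hw1]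

lemma simplifiedLoss_le_smoothLoss (hε : 0 ≤ ε) (hw1 : ∀ l, ‖s.w l‖ = 1) :
    simplifiedLoss ε ζ β s θ ≤ smoothLoss ε ζ η β s θ := by
  rw [simplifiedLoss_eq hw1, smoothLoss]
  gcongr with i
  · exact le_sqrt_sq_add _ η
  · rw [Real.sq_sqrt (kForm_nonneg hw1 θ)]
    linarith [sq_nonneg η]

lemma smoothLoss_le_simplifiedLoss (hn : 0 < n) (hε : 0 ≤ ε) (hζ : 0 ≤ ζ) (hη : 0 ≤ η) {e : ℝ}
    (he : (1 + ε) * η ≤ e) (hw1 : ∀ l, ‖s.w l‖ = 1) :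
    smoothLoss ε ζ η β s θ ≤ (1 + e) * simplifiedLoss ε ζ β s θ + e * (1 + e) := by
  have he0 : 0 ≤ e := le_trans (by positivity) he
  rw [simplifiedLoss_eq hw1, smoothLoss]
  have hreg := mul_nonneg he0 (regularizer_nonneg (d := d) hζ θ)
  have h0 : 0 ≤ e * (1 + e) := by positivity
  have h1 := mean_le_mean hn (a := 1 + e) (b := e * (1 + e))
    (x := fun i => (√(|residual β s θ i 0| ^ 2 + η ^ 2) + ε * √(√(kForm s.w θ) ^ 2 + η ^ 2)) ^ 2)
    (y := fun i => (|residual β s θ i 0| + ε * √(kForm s.w θ)) ^ 2) fun i => by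
      refine le_trans (pow_le_pow_left₀ (by positivity) ?_ 2) (add_sq_le_mul_add he0)
      have h2 := sqrt_sq_add_le (abs_nonneg (residual β s θ i 0)) hη
      have h3 := mul_le_mul_of_nonneg_left (sqrt_sq_add_le (Real.sqrt_nonneg (kForm s.w θ)) hη) hε
      linarith
  linarith

end SoftLoss

/-! ### Gradients of the surrogates. -/

section LossGradients

variable {d N n : ℕ} {ε ζ P η : ℝ} {ι : Type*} [Fintype ι]

/-- The partial derivative of the regularizer. -/
def regGrad (d : ℕ) (ζ : ℝ) (θ : EuclideanSpace ℝ (Fin N)) (l : Fin N) : ℝ :=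
  ζ * (θ l + √(Real.log d) / d * ∑ k, θ k)

/-- A weighted sum of the activations of a neuron `v` over a family of inputs. -/
def featSum (b : Fin n → ι → ℝ) (z : Fin n → ι → EuclideanSpace ℝ (Fin d))
    (v : EuclideanSpace ℝ (Fin d)) : ℝ :=
  ∑ i, ∑ a, b i a * shiftedReLU (inner ℝ v (z i a))

/-- The product of the arccos kernel matrix with a vector. -/
def kGrad (w : Fin N → EuclideanSpace ℝ (Fin d)) (θ : EuclideanSpace ℝ (Fin N)) (l : Fin N) : ℝ :=
  ∑ k, θ k * arccosKernel w l k

/-- The weight of perturbation `a` of sample `i` in the gradient of the soft loss. -/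
def softCoef (P : ℝ) (δ : ι → EuclideanSpace ℝ (Fin d)) (β : EuclideanSpace ℝ (Fin d))
    (s : Sample d N n) (θ : EuclideanSpace ℝ (Fin N)) (i : Fin n) (a : ι) : ℝ :=
  1 / n * (Real.exp (P * residual β s θ i (δ a) ^ 2) /
    ∑ a, Real.exp (P * residual β s θ i (δ a) ^ 2)) * residual β s θ i (δ a)

/-- The gradient of the soft loss. -/
def softLossGrad (ζ P : ℝ) (δ : ι → EuclideanSpace ℝ (Fin d)) (β : EuclideanSpace ℝ (Fin d))
    (s : Sample d N n) (θ : EuclideanSpace ℝ (Fin N)) : EuclideanSpace ℝ (Fin N) :=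
  WithLp.toLp 2 fun l => regGrad d ζ θ l -
    featSum (softCoef P δ β s θ) (fun i a => s.x i + δ a) (s.w l)

/-- The square root of the contribution of sample `i` to the smooth loss. -/
def smoothTerm (ε η : ℝ) (β : EuclideanSpace ℝ (Fin d)) (s : Sample d N n)
    (θ : EuclideanSpace ℝ (Fin N)) (i : Fin n) : ℝ :=
  √(|residual β s θ i 0| ^ 2 + η ^ 2) + ε * √(√(kForm s.w θ) ^ 2 + η ^ 2)

/-- The weight of sample `i` in the gradient of the smooth loss. -/
def smoothCoef (ε η : ℝ) (β : EuclideanSpace ℝ (Fin d)) (s : Sample d N n)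
    (θ : EuclideanSpace ℝ (Fin N)) (i : Fin n) (_ : Unit) : ℝ :=
  1 / n * smoothTerm ε η β s θ i * (residual β s θ i 0 / √(|residual β s θ i 0| ^ 2 + η ^ 2))

/-- The weight of the kernel term in the gradient of the smooth loss. -/
def smoothConst (ε η : ℝ) (β : EuclideanSpace ℝ (Fin d)) (s : Sample d N n)
    (θ : EuclideanSpace ℝ (Fin N)) : ℝ :=
  1 / n * (∑ i, smoothTerm ε η β s θ i) * (ε / √(√(kForm s.w θ) ^ 2 + η ^ 2))

/-- The gradient of the smooth loss. -/
def smoothLossGrad (ε ζ η : ℝ) (β : EuclideanSpace ℝ (Fin d))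
    (s : Sample d N n) (θ : EuclideanSpace ℝ (Fin N)) : EuclideanSpace ℝ (Fin N) :=
  WithLp.toLp 2 fun l => regGrad d ζ θ l -
    featSum (smoothCoef ε η β s θ) (fun i _ => s.x i + 0) (s.w l) +
      smoothConst ε η β s θ * kGrad s.w θ l

variable {β : EuclideanSpace ℝ (Fin d)} {s : Sample d N n} {θ : EuclideanSpace ℝ (Fin N)}
  {δ : ι → EuclideanSpace ℝ (Fin d)}

lemma hasDerivAt_residual (v : EuclideanSpace ℝ (Fin N)) (i : Fin n)
    (u : EuclideanSpace ℝ (Fin d)) :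
    HasDerivAt (fun t : ℝ => residual β s (θ + t • v) i u) (-predictor s.w v (s.x i + u)) 0 := by
  have e : (fun t : ℝ => residual β s (θ + t • v) i u) = fun t =>
      residual β s θ i u - t * predictor s.w v (s.x i + u) := by
    ext t
    have := predictor_add_smul s.w θ v 1 t (s.x i + u)
    rw [one_smul] at this
    simp only [residual, this]
    ring
  rw [e]
  simpa using! (hasDerivAt_const (0 : ℝ) _).sub ((hasDerivAt_id (0 : ℝ)).mul_const _)

lemma hasDerivAt_regularizer (v : EuclideanSpace ℝ (Fin N)) :
    HasDerivAt (fun t : ℝ => regularizer d ζ (θ + t • v)) (∑ l, v l * regGrad d ζ θ l) 0 := by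
  have e : (fun t : ℝ => regularizer d ζ (θ + t • v)) = fun t =>
      regularizer d ζ θ + t * (∑ l, v l * regGrad d ζ θ l) + t ^ 2 * regularizer d ζ v := by
    ext t
    simp only [regularizer_eq, regGrad, EuclideanSpace.real_norm_sq_eq, PiLp.add_apply,
      PiLp.smul_apply, smul_eq_mul, Finset.sum_add_distrib, ← Finset.mul_sum, mul_add, add_sq,
      mul_pow]
    have h1 : ∑ l, v l * (ζ * θ l) = ζ * ∑ l, θ l * v l := by
      rw [Finset.mul_sum]; exact Finset.sum_congr rfl fun _ _ => by ring
    have h2 : ∑ l, 2 * θ l * (t * v l) = 2 * t * ∑ l, θ l * v l := by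
      rw [Finset.mul_sum]; exact Finset.sum_congr rfl fun _ _ => by ring
    rw [h1, h2, ← Finset.sum_mul]
    ring
  rw [e]
  have h := ((hasDerivAt_const (0 : ℝ) (regularizer d ζ θ)).add ((hasDerivAt_id (0 : ℝ)).mul_const
    (∑ l, v l * regGrad d ζ θ l))).add ((hasDerivAt_pow 2 (0 : ℝ)).mul_const (regularizer d ζ v))
  convert! h using 1
  simp

lemma hasDerivAt_kForm (w : Fin N → EuclideanSpace ℝ (Fin d)) (v : EuclideanSpace ℝ (Fin N)) :
    HasDerivAt (fun t : ℝ => kForm w (θ + t • v)) (2 * ∑ l, v l * kGrad w θ l) 0 := by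
  have e : (fun t : ℝ => kForm w (θ + t • v)) = fun t =>
      kForm w θ + t * (2 * ∑ l, v l * kGrad w θ l) + t ^ 2 * kForm w v := by
    ext t
    have h1 : ∑ l, v l * kGrad w θ l = ∑ l, ∑ k, v l * θ k * arccosKernel w l k := by
      simp only [kGrad, Finset.mul_sum, mul_assoc]
    have h2 : ∑ l, v l * kGrad w θ l = ∑ l, ∑ k, θ l * v k * arccosKernel w l k := by
      rw [h1, Finset.sum_comm]
      refine Finset.sum_congr rfl fun l _ => Finset.sum_congr rfl fun k _ => ?_
      rw [arccosKernel_symm]; ring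
    rw [two_mul]
    nth_rw 1 [h1]
    rw [h2]
    simp only [kForm, Finset.mul_sum, ← Finset.sum_add_distrib]
    refine Finset.sum_congr rfl fun l _ => Finset.sum_congr rfl fun k _ => ?_
    simp only [PiLp.add_apply, PiLp.smul_apply, smul_eq_mul]
    ring
  rw [e]
  have h := ((hasDerivAt_const (0 : ℝ) (kForm w θ)).add ((hasDerivAt_id (0 : ℝ)).mul_const
    (2 * ∑ l, v l * kGrad w θ l))).add ((hasDerivAt_pow 2 (0 : ℝ)).mul_const (kForm w v))
  convert! h using 1
  simp

lemma sum_mul_featSum (w : Fin N → EuclideanSpace ℝ (Fin d)) (v : EuclideanSpace ℝ (Fin N))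
    (b : Fin n → ι → ℝ) (z : Fin n → ι → EuclideanSpace ℝ (Fin d)) :
    ∑ l, v l * featSum b z (w l) = ∑ i, ∑ a, b i a * predictor w v (z i a) := by
  simp only [featSum, predictor, Finset.mul_sum]
  rw [Finset.sum_comm]
  refine Finset.sum_congr rfl fun i _ => ?_
  rw [Finset.sum_comm]
  exact Finset.sum_congr rfl fun a _ => Finset.sum_congr rfl fun l _ => by ring

lemma hasDerivAt_softLoss [Nonempty ι] (hn : 0 < n) (hP : 0 < P) (v : EuclideanSpace ℝ (Fin N)) :
    HasDerivAt (fun t : ℝ => softLoss ζ P δ β s (θ + t • v))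
      (inner ℝ (softLossGrad ζ P δ β s θ) v) 0 := by
  have hn' : (0 : ℝ) < n := by exact_mod_cast hn
  have e : inner ℝ (softLossGrad ζ P δ β s θ) v = ∑ l, v l * regGrad d ζ θ l -
      ∑ i, ∑ a, softCoef P δ β s θ i a * predictor s.w v (s.x i + δ a) := by
    rw [← sum_mul_featSum, ← Finset.sum_sub_distrib]
    simp [softLossGrad, PiLp.inner_apply, mul_sub]
  have h1 : ∀ i, HasDerivAt (fun t : ℝ => 1 / P * Real.log (∑ a, Real.exp
      (P * residual β s (θ + t • v) i (δ a) ^ 2)))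
      (2 * ∑ a, -(n * softCoef P δ β s θ i a * predictor s.w v (s.x i + δ a))) 0 := by
    intro i
    have h2 : ∀ a ∈ Finset.univ, HasDerivAt (fun t : ℝ => Real.exp
        (P * residual β s (θ + t • v) i (δ a) ^ 2))
        (Real.exp (P * residual β s θ i (δ a) ^ 2) *
          (P * (2 * residual β s θ i (δ a) * -predictor s.w v (s.x i + δ a)))) 0 := by
      intro a _
      have h3 := (((hasDerivAt_residual (β := β) (s := s) (θ := θ) v i (δ a)).pow 2).const_mul P).exp
      simpa using! h3
    have hpos : 0 < ∑ a, Real.exp (P * residual β s θ i (δ a) ^ 2) :=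
      Finset.sum_pos (fun _ _ => Real.exp_pos _) Finset.univ_nonempty
    have h4 := ((HasDerivAt.fun_sum h2).log (by simpa using hpos.ne')).const_mul (1 / P)
    convert! h4 using 1
    simp only [zero_smul, add_zero, softCoef]
    rw [Finset.sum_div, Finset.mul_sum, Finset.mul_sum]
    refine Finset.sum_congr rfl fun a _ => ?_
    field_simp
  have h5 := ((HasDerivAt.fun_sum fun i (_ : i ∈ Finset.univ) => h1 i).const_mul
    (1 / (2 * (n : ℝ)))).add (hasDerivAt_regularizer (d := d) (ζ := ζ) (θ := θ) v)
  rw [e]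
  convert! h5 using 1
  rw [← Finset.mul_sum]
  simp only [Finset.sum_neg_distrib, mul_assoc, ← Finset.mul_sum]
  field_simp
  ring

lemma hasDerivAt_smoothLoss (hn : 0 < n) (hη : 0 < η) (hw1 : ∀ l, ‖s.w l‖ = 1)
    (v : EuclideanSpace ℝ (Fin N)) :
    HasDerivAt (fun t : ℝ => smoothLoss ε ζ η β s (θ + t • v))
      (inner ℝ (smoothLossGrad ε ζ η β s θ) v) 0 := by
  have hn' : (0 : ℝ) < n := by exact_mod_cast hn
  have e : inner ℝ (smoothLossGrad ε ζ η β s θ) v = ∑ l, v l * regGrad d ζ θ l -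
      ∑ i, smoothCoef ε η β s θ i () * predictor s.w v (s.x i + 0) +
        smoothConst ε η β s θ * ∑ l, v l * kGrad s.w θ l := by
    have h := sum_mul_featSum s.w v (smoothCoef ε η β s θ) (fun i _ => s.x i + 0)
    simp only [Finset.univ_unique, PUnit.default_eq_unit, Finset.sum_singleton] at h
    rw [← h, ← Finset.sum_sub_distrib, Finset.mul_sum, ← Finset.sum_add_distrib]
    simp only [smoothLossGrad, PiLp.inner_apply, RCLike.inner_apply, conj_trivial]
    exact Finset.sum_congr rfl fun l _ => by ring
  have hk0 : 0 < √(kForm s.w θ) ^ 2 + η ^ 2 := by positivity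
  -- The inner root need not be differentiable where the form vanishes, but it is squared at once:
  -- the function is `√(kForm + η ^ 2)`, with positive radicand.
  have hk1 : HasDerivAt (fun t : ℝ => √(√(kForm s.w (θ + t • v)) ^ 2 + η ^ 2))
      ((∑ l, v l * kGrad s.w θ l) / √(√(kForm s.w θ) ^ 2 + η ^ 2)) 0 := by
    simp only [Real.sq_sqrt (kForm_nonneg hw1 _)] at hk0 ⊢
    have h := ((hasDerivAt_kForm (θ := θ) s.w v).add_const (η ^ 2)).sqrt (by simpa using hk0.ne')
    convert! h using 1
    simp only [zero_smul, add_zero]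
    field_simp
  have h1 : ∀ i, HasDerivAt (fun t : ℝ => smoothTerm ε η β s (θ + t • v) i ^ 2)
      (2 * smoothTerm ε η β s θ i * (-(residual β s θ i 0 * predictor s.w v (s.x i + 0)) /
        √(|residual β s θ i 0| ^ 2 + η ^ 2) +
        ε * ((∑ l, v l * kGrad s.w θ l) / √(√(kForm s.w θ) ^ 2 + η ^ 2)))) 0 := by
    intro i
    have hr0 : 0 < |residual β s θ i 0| ^ 2 + η ^ 2 := by positivity
    have h2 : HasDerivAt (fun t : ℝ => √(|residual β s (θ + t • v) i 0| ^ 2 + η ^ 2))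
        (-(residual β s θ i 0 * predictor s.w v (s.x i + 0)) /
          √(|residual β s θ i 0| ^ 2 + η ^ 2)) 0 := by
      simp only [sq_abs] at hr0 ⊢
      have h := (((hasDerivAt_residual (β := β) (s := s) (θ := θ) v i 0).pow 2).add_const
        (η ^ 2)).sqrt (by simpa using hr0.ne')
      convert! h using 1
      simp only [zero_smul, add_zero, Pi.pow_apply, Nat.cast_ofNat, Nat.add_one_sub_one, pow_one]
      field_simp
    have h3 := (h2.add (hk1.const_mul ε)).pow 2
    simpa [smoothTerm] using! h3
  have h5 := ((HasDerivAt.fun_sum fun i (_ : i ∈ Finset.univ) => h1 i).const_mul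
    (1 / (2 * (n : ℝ)))).add (hasDerivAt_regularizer (d := d) (ζ := ζ) (θ := θ) v)
  rw [e]
  convert! h5 using 1
  simp only [mul_add, Finset.sum_add_distrib, smoothCoef, smoothConst]
  have h6 : 1 / (2 * (n : ℝ)) * ∑ i, 2 * smoothTerm ε η β s θ i *
      (-(residual β s θ i 0 * predictor s.w v (s.x i + 0)) /
        √(|residual β s θ i 0| ^ 2 + η ^ 2)) = - ∑ i, 1 / (n : ℝ) * smoothTerm ε η β s θ i *
        (residual β s θ i 0 / √(|residual β s θ i 0| ^ 2 + η ^ 2)) *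
          predictor s.w v (s.x i + 0) := by
    rw [Finset.mul_sum, ← Finset.sum_neg_distrib]
    refine Finset.sum_congr rfl fun i _ => ?_
    field_simp
  have h7 : 1 / (2 * (n : ℝ)) * ∑ i, 2 * smoothTerm ε η β s θ i *
      (ε * ((∑ l, v l * kGrad s.w θ l) / √(√(kForm s.w θ) ^ 2 + η ^ 2))) =
      1 / (n : ℝ) * (∑ i, smoothTerm ε η β s θ i) * (ε / √(√(kForm s.w θ) ^ 2 + η ^ 2)) *
        ∑ l, v l * kGrad s.w θ l := by
    rw [← Finset.sum_mul, ← Finset.mul_sum]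
    field_simp
  rw [h6, h7]
  ring

end LossGradients

/-! ### Bounds on the gradient weights, and independence of an unused neuron. -/

section Coefficients

variable {d N n : ℕ} {ε ζ P η : ℝ} {ι : Type*} [Fintype ι] {β : EuclideanSpace ℝ (Fin d)}
  {s : Sample d N n} {θ : EuclideanSpace ℝ (Fin N)} {δ : ι → EuclideanSpace ℝ (Fin d)}

/-- For each sample the weights are `1 / n` times soft-max probabilities times residuals, and every
residual is at most the root of the soft maximum. Hence the bound is free of the number of
perturbations. -/
lemma sum_softCoef_sq_le [Nonempty ι] (hn : 0 < n) (hP : 0 < P) (hζ : 0 ≤ ζ) :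
    ∑ i, (∑ a, |softCoef P δ β s θ i a|) ^ 2 ≤ 2 / n * softLoss ζ P δ β s θ := by
  have hn' : (0 : ℝ) < n := by exact_mod_cast hn
  set m : Fin n → ℝ := fun i =>
    1 / P * Real.log (∑ a, Real.exp (P * residual β s θ i (δ a) ^ 2)) with hm
  have hm0 : ∀ i, 0 ≤ m i := fun i => softMax_nonneg hP _
  have h1 : ∀ i, ∑ a, |softCoef P δ β s θ i a| ≤ 1 / n * √(m i) := by
    intro i
    have hpos : 0 < ∑ a, Real.exp (P * residual β s θ i (δ a) ^ 2) :=
      Finset.sum_pos (fun _ _ => Real.exp_pos _) Finset.univ_nonempty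
    calc ∑ a, |softCoef P δ β s θ i a| ≤ ∑ a, 1 / n * (Real.exp (P * residual β s θ i (δ a) ^ 2) /
          ∑ a, Real.exp (P * residual β s θ i (δ a) ^ 2)) * √(m i) := by
          refine Finset.sum_le_sum fun a _ => ?_
          rw [softCoef, abs_mul, abs_of_nonneg (by positivity)]
          exact mul_le_mul_of_nonneg_left (Real.abs_le_sqrt
            (sq_le_softMax hP (fun a => residual β s θ i (δ a)) a)) (by positivity)
      _ = _ := by
          rw [← Finset.sum_mul, ← Finset.mul_sum, ← Finset.sum_div, div_self hpos.ne', mul_one]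
  calc _ ≤ ∑ i, (1 / n * √(m i)) ^ 2 := Finset.sum_le_sum fun i _ =>
        pow_le_pow_left₀ (Finset.sum_nonneg fun _ _ => abs_nonneg _) (h1 i) 2
    _ = 2 / n * (1 / (2 * (n : ℝ)) * ∑ i, m i) := by
        simp only [mul_pow, Real.sq_sqrt (hm0 _)]
        rw [← Finset.mul_sum]
        field_simp
    _ ≤ _ := by
        refine mul_le_mul_of_nonneg_left ?_ (by positivity)
        have := regularizer_nonneg (d := d) hζ θ
        simp only [softLoss, hm]
        linarith

lemma smoothTerm_nonneg (hε : 0 ≤ ε) (i : Fin n) : 0 ≤ smoothTerm ε η β s θ i := by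
  unfold smoothTerm; positivity

lemma sum_smoothTerm_sq_le (hn : 0 < n) (hζ : 0 ≤ ζ) :
    ∑ i, smoothTerm ε η β s θ i ^ 2 ≤ 2 * n * smoothLoss ε ζ η β s θ := by
  have hn' : (0 : ℝ) < n := by exact_mod_cast hn
  calc _ = 2 * n * (1 / (2 * (n : ℝ)) * ∑ i, smoothTerm ε η β s θ i ^ 2) := by field_simp
    _ ≤ _ := by
        refine mul_le_mul_of_nonneg_left ?_ (by positivity)
        have := regularizer_nonneg (d := d) hζ θ
        simp only [smoothLoss, smoothTerm]
        linarith

lemma sum_smoothCoef_sq_le (hn : 0 < n) (hε : 0 ≤ ε) (hζ : 0 ≤ ζ) :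
    ∑ i, (∑ a, |smoothCoef ε η β s θ i a|) ^ 2 ≤ 2 / n * smoothLoss ε ζ η β s θ := by
  have hn' : (0 : ℝ) < n := by exact_mod_cast hn
  have h1 : ∀ i, ∑ a, |smoothCoef ε η β s θ i a| ≤ 1 / n * smoothTerm ε η β s θ i := by
    intro i
    have hT := smoothTerm_nonneg (η := η) (β := β) (s := s) (θ := θ) hε i
    simp only [Finset.univ_unique, Finset.sum_singleton, smoothCoef]
    rw [abs_mul, abs_of_nonneg (by positivity)]
    refine mul_le_of_le_one_right (by positivity) ?_
    rw [abs_div, abs_of_nonneg (Real.sqrt_nonneg _)]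
    exact div_le_one_of_le₀ (le_sqrt_sq_add _ _) (Real.sqrt_nonneg _)
  calc _ ≤ ∑ i, (1 / n * smoothTerm ε η β s θ i) ^ 2 := Finset.sum_le_sum fun i _ =>
        pow_le_pow_left₀ (Finset.sum_nonneg fun _ _ => abs_nonneg _) (h1 i) 2
    _ = 1 / n ^ 2 * ∑ i, smoothTerm ε η β s θ i ^ 2 := by
        rw [Finset.mul_sum]
        exact Finset.sum_congr rfl fun i _ => by ring
    _ ≤ 1 / n ^ 2 * (2 * n * smoothLoss ε ζ η β s θ) :=
        mul_le_mul_of_nonneg_left (sum_smoothTerm_sq_le hn hζ) (by positivity)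
    _ = _ := by field_simp

lemma smoothConst_nonneg (hε : 0 ≤ ε) : 0 ≤ smoothConst ε η β s θ := by
  have := Finset.sum_nonneg fun i (_ : i ∈ Finset.univ) =>
    smoothTerm_nonneg (η := η) (β := β) (s := s) (θ := θ) hε i
  unfold smoothConst; positivity

lemma smoothConst_le (hn : 0 < n) (hε : 0 ≤ ε) (hζ : 0 ≤ ζ) (hη : 0 < η) :
    smoothConst ε η β s θ ≤ √(2 * smoothLoss ε ζ η β s θ) * (ε / η) := by
  have hn' : (0 : ℝ) < n := by exact_mod_cast hn
  have hS := Finset.sum_nonneg fun i (_ : i ∈ Finset.univ) =>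
    smoothTerm_nonneg (η := η) (β := β) (s := s) (θ := θ) hε i
  unfold smoothConst
  have h1 : 1 / (n : ℝ) * ∑ i, smoothTerm ε η β s θ i ≤ √(2 * smoothLoss ε ζ η β s θ) := by
    refine Real.le_sqrt_of_sq_le ?_
    have h2 := Finset.sum_mul_sq_le_sq_mul_sq Finset.univ (fun _ : Fin n => (1 : ℝ))
      (fun i => smoothTerm ε η β s θ i)
    simp only [one_mul, one_pow, Finset.sum_const, Finset.card_univ, Fintype.card_fin,
      nsmul_eq_mul, mul_one] at h2
    have h3 := sum_smoothTerm_sq_le (ε := ε) (η := η) (β := β) (s := s) (θ := θ) hn hζ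
    calc _ = 1 / (n : ℝ) ^ 2 * (∑ i, smoothTerm ε η β s θ i) ^ 2 := by ring
      _ ≤ 1 / (n : ℝ) ^ 2 * (n * (2 * n * smoothLoss ε ζ η β s θ)) := by
          refine mul_le_mul_of_nonneg_left (h2.trans ?_) (by positivity)
          exact mul_le_mul_of_nonneg_left h3 hn'.le
      _ = _ := by field_simp
  refine mul_le_mul h1 ?_ (by positivity) (Real.sqrt_nonneg _)
  refine div_le_div_of_nonneg_left hε hη ?_
  refine Real.le_sqrt_of_sq_le ?_
  linarith [sq_nonneg √(kForm s.w θ)]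

/-- The sample with the weight of neuron `l` replaced. -/
def Sample.setWeight (s : Sample d N n) (l : Fin N) (v : EuclideanSpace ℝ (Fin d)) : Sample d N n :=
  ⟨Function.update s.w l v, s.x, s.noise⟩

/-- A neuron with zero coefficient is invisible to the predictor. This is the source of all the
`setWeight` invariances, hence of the independence in the leave-one-out argument. -/
lemma predictor_update {w : Fin N → EuclideanSpace ℝ (Fin d)} {l : Fin N} (hθ : θ l = 0)
    (v x : EuclideanSpace ℝ (Fin d)) : predictor (Function.update w l v) θ x = predictor w θ x := by
  refine Finset.sum_congr rfl fun k _ => ?_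
  rcases eq_or_ne k l with rfl | h
  · rw [hθ, zero_mul, zero_mul]
  · rw [Function.update_of_ne h]

lemma kForm_update {w : Fin N → EuclideanSpace ℝ (Fin d)} {l : Fin N} (hθ : θ l = 0)
    (v : EuclideanSpace ℝ (Fin d)) : kForm (Function.update w l v) θ = kForm w θ := by
  refine Finset.sum_congr rfl fun k _ => Finset.sum_congr rfl fun j _ => ?_
  rcases eq_or_ne k l with rfl | h
  · rw [hθ, zero_mul, zero_mul, zero_mul]
  rcases eq_or_ne j l with rfl | h'
  · rw [hθ, mul_zero, zero_mul, zero_mul]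
  · rw [arccosKernel_apply, arccosKernel_apply, Function.update_of_ne h, Function.update_of_ne h']

variable {l : Fin N} (v : EuclideanSpace ℝ (Fin d))

lemma residual_setWeight (hθ : θ l = 0) (i : Fin n) (u : EuclideanSpace ℝ (Fin d)) :
    residual β (s.setWeight l v) θ i u = residual β s θ i u := by
  simp only [residual, Sample.setWeight, predictor_update hθ, label]

lemma kForm_setWeight (hθ : θ l = 0) : kForm (s.setWeight l v).w θ = kForm s.w θ :=
  kForm_update hθ v

lemma softLoss_setWeight (hθ : θ l = 0) :
    softLoss ζ P δ β (s.setWeight l v) θ = softLoss ζ P δ β s θ := by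
  simp only [softLoss, residual_setWeight v hθ]

lemma softCoef_setWeight (hθ : θ l = 0) :
    softCoef P δ β (s.setWeight l v) θ = softCoef P δ β s θ := by
  ext i a
  simp only [softCoef, residual_setWeight v hθ]

lemma smoothTerm_setWeight (hθ : θ l = 0) :
    smoothTerm ε η β (s.setWeight l v) θ = smoothTerm ε η β s θ := by
  ext i
  simp only [smoothTerm, residual_setWeight v hθ, kForm_setWeight v hθ]

lemma smoothLoss_setWeight (hθ : θ l = 0) :
    smoothLoss ε ζ η β (s.setWeight l v) θ = smoothLoss ε ζ η β s θ := by
  simp only [smoothLoss, residual_setWeight v hθ, kForm_setWeight v hθ]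

lemma smoothCoef_setWeight (hθ : θ l = 0) :
    smoothCoef ε η β (s.setWeight l v) θ = smoothCoef ε η β s θ := by
  ext i a
  simp only [smoothCoef, residual_setWeight v hθ, smoothTerm_setWeight v hθ]

lemma smoothConst_setWeight (hθ : θ l = 0) :
    smoothConst ε η β (s.setWeight l v) θ = smoothConst ε η β s θ := by
  simp only [smoothConst, smoothTerm_setWeight v hθ, kForm_setWeight v hθ]

end Coefficients

/-! ### Joint continuity in sample and parameter, needed for measurability of the bad events. -/

section JointContinuity

variable {d N n : ℕ} {ε ζ P η : ℝ} {ι : Type*} [Fintype ι] {β : EuclideanSpace ℝ (Fin d)}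
  {δ : ι → EuclideanSpace ℝ (Fin d)}

/-- The space of arrays of weights, covariates and noise. -/
abbrev Triple (d N n : ℕ) : Type :=
  (Fin N → EuclideanSpace ℝ (Fin d)) × (Fin n → EuclideanSpace ℝ (Fin d)) × (Fin n → ℝ)

lemma continuous_shiftedReLU : Continuous shiftedReLU := by
  unfold shiftedReLU; fun_prop

lemma continuous_residual (i : Fin n) (u : EuclideanSpace ℝ (Fin d)) :
    Continuous fun q : Triple d N n × EuclideanSpace ℝ (Fin N) =>
      residual β (Sample.ofTriple q.1) q.2 i u := by
  unfold residual predictor label Sample.ofTriple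
  have h1 : Continuous fun q : Triple d N n × EuclideanSpace ℝ (Fin N) => q.1.2.1 i := by fun_prop
  have h2 : ∀ l, Continuous fun q : Triple d N n × EuclideanSpace ℝ (Fin N) => q.1.1 l := by
    intro l; fun_prop
  have h3 : ∀ l, Continuous fun q : Triple d N n × EuclideanSpace ℝ (Fin N) => q.2 l := by
    intro l; fun_prop
  have h4 : Continuous fun q : Triple d N n × EuclideanSpace ℝ (Fin N) => q.1.2.2 i := by fun_prop
  exact ((h1.inner continuous_const).add h4).sub (continuous_finsetSum _ fun l _ =>
    (h3 l).mul (continuous_shiftedReLU.comp ((h2 l).inner (h1.add continuous_const))))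

lemma continuous_arccosKernel (l k : Fin N) :
    Continuous fun q : Triple d N n × EuclideanSpace ℝ (Fin N) =>
      arccosKernel (Sample.ofTriple q.1).w l k := by
  simp only [arccosKernel_apply, Sample.ofTriple]
  have h2 : ∀ l, Continuous fun q : Triple d N n × EuclideanSpace ℝ (Fin N) => q.1.1 l := by
    intro l; fun_prop
  have h := (h2 l).inner (𝕜 := ℝ) (h2 k)
  have h' := Real.continuous_arccos.comp h
  simp only [Function.comp_def] at h'
  fun_prop

lemma continuous_kForm :
    Continuous fun q : Triple d N n × EuclideanSpace ℝ (Fin N) =>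
      kForm (Sample.ofTriple q.1).w q.2 := by
  unfold kForm
  refine continuous_finsetSum _ fun l _ => continuous_finsetSum _ fun k _ =>
    Continuous.mul ?_ (continuous_arccosKernel l k)
  fun_prop

lemma continuous_regularizer :
    Continuous fun q : Triple d N n × EuclideanSpace ℝ (Fin N) => regularizer d ζ q.2 := by
  simp only [regularizer_eq]; fun_prop

lemma continuous_softLoss [Nonempty ι] : Continuous fun q : Triple d N n × EuclideanSpace ℝ (Fin N) =>
    softLoss ζ P δ β (Sample.ofTriple q.1) q.2 := by
  unfold softLoss
  refine Continuous.add (continuous_const.mul (continuous_finsetSum _ fun i _ =>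
    continuous_const.mul (Continuous.log (continuous_finsetSum _ fun a _ => ?_) fun q => ?_)))
    continuous_regularizer
  · exact (continuous_const.mul ((continuous_residual i (δ a)).pow 2)).rexp
  · exact (Finset.sum_pos (fun _ _ => Real.exp_pos _) Finset.univ_nonempty).ne'

lemma continuous_smoothTerm (i : Fin n) :
    Continuous fun q : Triple d N n × EuclideanSpace ℝ (Fin N) =>
      smoothTerm ε η β (Sample.ofTriple q.1) q.2 i := by
  unfold smoothTerm
  have h1 := continuous_residual (N := N) (β := β) i 0
  have h2 := continuous_kForm (d := d) (N := N) (n := n)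
  fun_prop

lemma continuous_smoothLoss : Continuous fun q : Triple d N n × EuclideanSpace ℝ (Fin N) =>
    smoothLoss ε ζ η β (Sample.ofTriple q.1) q.2 :=
  Continuous.add (continuous_const.mul (continuous_finsetSum _ fun i _ =>
    (continuous_smoothTerm (ε := ε) (η := η) (β := β) i).pow 2)) continuous_regularizer

lemma continuous_regGrad (l : Fin N) :
    Continuous fun q : Triple d N n × EuclideanSpace ℝ (Fin N) => regGrad d ζ q.2 l := by
  unfold regGrad; fun_prop

lemma continuous_softLossGrad [Nonempty ι] (l : Fin N) :
    Continuous fun q : Triple d N n × EuclideanSpace ℝ (Fin N) =>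
      softLossGrad ζ P δ β (Sample.ofTriple q.1) q.2 l := by
  have h1 : ∀ i a, Continuous fun q : Triple d N n × EuclideanSpace ℝ (Fin N) =>
      Real.exp (P * residual β (Sample.ofTriple q.1) q.2 i (δ a) ^ 2) := fun i a =>
    (continuous_const.mul ((continuous_residual i (δ a)).pow 2)).rexp
  have h2 : ∀ i a, Continuous fun q : Triple d N n × EuclideanSpace ℝ (Fin N) =>
      softCoef P δ β (Sample.ofTriple q.1) q.2 i a := fun i a =>
    (continuous_const.mul ((h1 i a).div (continuous_finsetSum _ fun b _ => h1 i b) fun q =>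
      (Finset.sum_pos (fun _ _ => Real.exp_pos _) Finset.univ_nonempty).ne')).mul
      (continuous_residual i (δ a))
  refine (continuous_regGrad l).sub (continuous_finsetSum _ fun i _ => continuous_finsetSum _
    fun a _ => (h2 i a).mul (continuous_shiftedReLU.comp ?_))
  simp only [Sample.ofTriple]
  fun_prop

lemma continuous_smoothLossGrad (hη : 0 < η) (l : Fin N) :
    Continuous fun q : Triple d N n × EuclideanSpace ℝ (Fin N) =>
      smoothLossGrad ε ζ η β (Sample.ofTriple q.1) q.2 l := by
  have h0 : ∀ x : ℝ, √(x ^ 2 + η ^ 2) ≠ 0 := fun x => by positivity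
  have hk := continuous_kForm (d := d) (N := N) (n := n)
  have h2 : ∀ i a, Continuous fun q : Triple d N n × EuclideanSpace ℝ (Fin N) =>
      smoothCoef ε η β (Sample.ofTriple q.1) q.2 i a := fun i a =>
    (continuous_const.mul (continuous_smoothTerm i)).mul ((continuous_residual i 0).div
      (((continuous_residual i 0).abs.pow 2).add continuous_const).sqrt fun q => h0 _)
  have h3 : Continuous fun q : Triple d N n × EuclideanSpace ℝ (Fin N) =>
      smoothConst ε η β (Sample.ofTriple q.1) q.2 :=
    (continuous_const.mul (continuous_finsetSum _ fun i _ => continuous_smoothTerm i)).mul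
      (continuous_const.div ((hk.sqrt.pow 2).add continuous_const).sqrt fun q => h0 _)
  refine Continuous.add ((continuous_regGrad l).sub (continuous_finsetSum _ fun i _ =>
    continuous_finsetSum _ fun a _ => (h2 i a).mul (continuous_shiftedReLU.comp ?_)))
    (h3.mul (continuous_finsetSum _ fun k _ => Continuous.mul ?_ (continuous_arccosKernel l k)))
  · simp only [Sample.ofTriple]
    fun_prop
  · fun_prop

end JointContinuity

/-! ### Fourth moments of centered sums of activations of a random neuron. -/

section FourthMoment

/-- This mean is exactly the shift in `shiftedReLU`. The antiderivative of `t exp (-t² / 2)` gives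
it. -/
lemma integral_max_gaussianReal : ∫ t, max t 0 ∂gaussianReal 0 1 = 1 / √(2 * Real.pi) := by
  rw [integral_gaussianReal_eq_integral_smul one_ne_zero]
  have e : (fun t : ℝ => gaussianPDFReal 0 1 t • max t 0) =
      (Set.Ioi (0 : ℝ)).indicator fun t => 1 / √(2 * Real.pi) * (t * Real.exp (-(t ^ 2 / 2))) := by
    ext t
    by_cases ht : 0 < t
    · rw [Set.indicator_of_mem (Set.mem_Ioi.2 ht), max_eq_left ht.le]
      simp only [gaussianPDFReal, NNReal.coe_one, mul_one, sub_zero, smul_eq_mul, one_div]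
      rw [neg_div]; ring
    · rw [Set.indicator_of_notMem (by simpa using ht), max_eq_right (not_lt.1 ht), smul_zero]
  rw [e, integral_indicator measurableSet_Ioi, integral_const_mul]
  have hd : ∀ t ∈ Set.Ici (0 : ℝ), HasDerivAt (fun t : ℝ => -Real.exp (-(t ^ 2 / 2)))
      (t * Real.exp (-(t ^ 2 / 2))) t := by
    intro t _
    have h := (((hasDerivAt_pow 2 t).div_const 2).neg.exp).neg
    convert! h using 1
    simp; ring
  have hlim : Tendsto (fun t : ℝ => -Real.exp (-(t ^ 2 / 2))) atTop (𝓝 0) := by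
    rw [← neg_zero]
    refine (Real.tendsto_exp_neg_atTop_nhds_zero.comp ?_).neg
    exact (tendsto_pow_atTop two_ne_zero).atTop_div_const (by norm_num)
  rw [integral_Ioi_of_hasDerivAt_of_nonneg' hd (fun t ht => mul_nonneg (le_of_lt ht)
    (Real.exp_pos _).le) hlim]
  simp

variable {d : ℕ} {A : Type*} [Fintype A] {b : A → ℝ} {z : A → EuclideanSpace ℝ (Fin d)}

lemma integrable_max_inner (z : EuclideanSpace ℝ (Fin d)) :
    Integrable (fun v => max (inner ℝ v z) 0) (stdGaussian (EuclideanSpace ℝ (Fin d))) := by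
  refine ((integrable_norm_stdGaussian).mul_const ‖z‖).mono' (by fun_prop) (ae_of_all _ fun v => ?_)
  rw [Real.norm_of_nonneg (le_max_right _ _)]
  exact max_le ((le_abs_self _).trans (abs_real_inner_le_norm _ _)) (by positivity)

lemma integral_max_inner (z : EuclideanSpace ℝ (Fin d)) :
    ∫ v, max (inner ℝ v z) 0 ∂stdGaussian (EuclideanSpace ℝ (Fin d)) = 1 / √(2 * Real.pi) * ‖z‖ := by
  simp_rw [fun v => real_inner_comm z v]
  rw [← integral_map (φ := fun x => inner ℝ z x) (f := fun t => max t 0) (by fun_prop)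
    (by fun_prop), map_inner_stdGaussian, integral_map (by fun_prop) (by fun_prop)]
  have : ∀ t : ℝ, max (‖z‖ * t) 0 = ‖z‖ * max t 0 := fun t => by
    rw [mul_max_of_nonneg _ _ (norm_nonneg z), mul_zero]
  simp_rw [this]
  rw [integral_const_mul, integral_max_gaussianReal, mul_comm]

/-- The positively homogeneous function `v ↦ ∑ b_a (⟪v, z_a⟫)₊`. -/
def reluSum (b : A → ℝ) (z : A → EuclideanSpace ℝ (Fin d)) (v : EuclideanSpace ℝ (Fin d)) : ℝ :=
  ∑ a, b a * max (inner ℝ v (z a)) 0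

/-- A smoothing of `reluSum`. -/
def smoothReluSum (b : A → ℝ) (z : A → EuclideanSpace ℝ (Fin d)) (v : EuclideanSpace ℝ (Fin d)) :
    ℝ :=
  ∑ a, b a * (1 / 2 * (inner ℝ v (z a) + √(inner ℝ v (z a) ^ 2 + 1 ^ 2)))

lemma abs_reluSum_sub_smoothReluSum_le (v : EuclideanSpace ℝ (Fin d)) :
    |reluSum b z v - smoothReluSum b z v| ≤ ∑ a, |b a| := by
  unfold reluSum smoothReluSum
  rw [← Finset.sum_sub_distrib]
  refine (Finset.abs_sum_le_sum_abs _ _).trans (Finset.sum_le_sum fun a _ => ?_)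
  rw [← mul_sub, abs_mul]
  refine mul_le_of_le_one_right (abs_nonneg _) ?_
  set t := inner ℝ v (z a)
  obtain ⟨q, hq⟩ : ∃ q, q = √(t ^ 2 + 1 ^ 2) := ⟨_, rfl⟩
  have h1 : |t| ≤ q := by rw [hq, ← sq_abs]; exact le_sqrt_sq_add _ _
  have h2 : q ≤ |t| + 1 := by
    rw [hq, ← sq_abs]; exact sqrt_sq_add_le (abs_nonneg t) zero_le_one
  rw [← hq]
  rcases le_total t 0 with h | h
  · rw [max_eq_right h, abs_le]
    rw [abs_of_nonpos h] at h1 h2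
    constructor <;> linarith
  · rw [max_eq_left h, abs_le]
    rw [abs_of_nonneg h] at h1 h2
    constructor <;> linarith

lemma hasFDerivAt_smoothReluSum (v : EuclideanSpace ℝ (Fin d)) :
    HasFDerivAt (smoothReluSum b z)
      (innerSL ℝ (∑ a, (b a * smoothStep 1 (inner ℝ v (z a))) • z a)) v := by
  have h : ∀ a ∈ Finset.univ, HasFDerivAt (fun v : EuclideanSpace ℝ (Fin d) =>
      b a * (1 / 2 * (inner ℝ v (z a) + √(inner ℝ v (z a) ^ 2 + 1 ^ 2))))
      ((b a * smoothStep 1 (inner ℝ v (z a))) • innerSL ℝ (z a)) v := by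
    intro a _
    have h1 : HasFDerivAt (fun v : EuclideanSpace ℝ (Fin d) => inner ℝ v (z a)) (innerSL ℝ (z a)) v := by
      have := (innerSL ℝ (z a)).hasFDerivAt (x := v)
      refine this.congr_of_eventuallyEq (Eventually.of_forall fun x => ?_)
      simp [real_inner_comm]
    have h2 : HasDerivAt (fun t : ℝ => b a * (1 / 2 * (t + √(t ^ 2 + 1 ^ 2))))
        (b a * smoothStep 1 (inner ℝ v (z a))) (inner ℝ v (z a)) :=
      (((hasDerivAt_id _).add (hasDerivAt_sqrt_add_sq one_pos _)).const_mul (1 / 2)).const_mul (b a)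
    exact HasDerivAt.comp_hasFDerivAt (f := fun v : EuclideanSpace ℝ (Fin d) => inner ℝ v (z a))
      v h2 h1
  convert! HasFDerivAt.fun_sum h using 1
  ext u
  simp

lemma add_pow_four_le (x y : ℝ) : (x + y) ^ 4 ≤ 8 * (x ^ 4 + y ^ 4) := by
  have h1 : (x + y) ^ 2 ≤ 2 * (x ^ 2 + y ^ 2) := by nlinarith [sq_nonneg (x - y)]
  have h2 := pow_le_pow_left₀ (sq_nonneg (x + y)) h1 2
  nlinarith [sq_nonneg (x ^ 2 - y ^ 2)]

/-- Fourth moment bound, under the uniform law on the sphere, of a centered sum of activations. -/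
lemma lintegral_reluSum_pow_four_le [NeZero d] {B M Λ : ℝ}
    (hM : ∀ c : A → ℝ, (∀ a, |c a| ≤ |b a|) → ‖∑ a, c a • z a‖ ≤ M)
    (hB : ∑ a, |b a| ≤ B) (hΛ : ∑ a, |b a| * |‖z a‖ - meanRadius d| ≤ Λ) :
    ∫⁻ v, ENNReal.ofReal ((meanRadius d * ∑ a, b a * shiftedReLU (inner ℝ v (z a))) ^ 4)
      ∂unifSphere d ≤ ENNReal.ofReal (216 * (2 * B ^ 4 + pisierConst * M ^ 4) + 8 * Λ ^ 4) := by
  set k := 1 / √(2 * Real.pi) with hk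
  have hk0 : 0 ≤ k := by positivity
  have hk1 : k ≤ 1 := by
    rw [hk, one_div]
    refine inv_le_one_of_one_le₀ (Real.one_le_sqrt.2 ?_)
    linarith [Real.pi_gt_three]
  set R := meanRadius d
  set c := ∑ a, b a * (k * ‖z a‖) with hc
  set γ := stdGaussian (EuclideanSpace ℝ (Fin d))
  have hB0 : 0 ≤ ∑ a, |b a| := Finset.sum_nonneg fun _ _ => abs_nonneg _
  have hΛ0 : 0 ≤ ∑ a, |b a| * |‖z a‖ - R| :=
    Finset.sum_nonneg fun _ _ => mul_nonneg (abs_nonneg _) (abs_nonneg _)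
  have hint : Integrable (reluSum b z) γ :=
    integrable_finsetSum _ fun a _ => (integrable_max_inner (z a)).const_mul (b a)
  have hmeanc : ∫ v, reluSum b z v ∂γ = c := by
    unfold reluSum
    rw [integral_finsetSum _ fun a _ => (integrable_max_inner (z a)).const_mul (b a)]
    simp only [integral_const_mul, integral_max_inner, hc, hk]
  have hgrad : ∀ v, ‖innerSL ℝ (∑ a, (b a * smoothStep 1 (inner ℝ v (z a))) • z a)‖ ≤ M := by
    intro v
    rw [innerSL_apply_norm]
    refine hM _ fun a => ?_
    rw [abs_mul, abs_of_nonneg (smoothStep_nonneg one_pos _)]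
    exact mul_le_of_le_one_right (abs_nonneg _) (smoothStep_le_one one_pos _)
  have hcont : Continuous fun v : EuclideanSpace ℝ (Fin d) =>
      innerSL ℝ (∑ a, (b a * smoothStep 1 (inner ℝ v (z a))) • z a) := by
    refine (innerSL ℝ).continuous.comp (continuous_finsetSum _ fun a _ => ?_)
    have := (continuous_smoothStep one_pos).comp (f := fun v : EuclideanSpace ℝ (Fin d) =>
      inner ℝ v (z a)) (by fun_prop)
    simp only [Function.comp_def] at this
    fun_prop
  set m := ∫ v, smoothReluSum b z v ∂γ with hm
  have hints : Integrable (smoothReluSum b z) γ :=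
    integrable_of_hasFDerivAt_bounded hasFDerivAt_smoothReluSum hgrad
  have hP := lintegral_pow_four_sub_mean_le hasFDerivAt_smoothReluSum hcont hgrad
  have hcm : |m - c| ≤ B := by
    rw [hm, ← hmeanc, ← integral_sub hints hint]
    refine (abs_integral_le_integral_abs).trans ?_
    calc _ ≤ ∫ _v, B ∂γ := by
          refine integral_mono (hints.sub hint).abs (integrable_const _) fun v => ?_
          rw [abs_sub_comm]
          exact (abs_reluSum_sub_smoothReluSum_le v).trans hB
      _ = B := by simp
  have hpow4 : ∀ x y : ℝ, 0 ≤ y → |x| ≤ y → x ^ 4 ≤ y ^ 4 := fun x y hy h => by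
    rw [← Even.pow_abs (by decide : Even 4) x]
    exact pow_le_pow_left₀ (abs_nonneg _) h 4
  have hB' : 0 ≤ B := hB0.trans hB
  have hconv : ∀ x y w : ℝ, (x + y + w) ^ 4 ≤ 27 * (x ^ 4 + y ^ 4 + w ^ 4) := by
    intro x y w
    have h1 : (x + y + w) ^ 2 ≤ 3 * (x ^ 2 + y ^ 2 + w ^ 2) := by
      nlinarith [sq_nonneg (x - y), sq_nonneg (y - w), sq_nonneg (x - w)]
    have h2 := pow_le_pow_left₀ (sq_nonneg (x + y + w)) h1 2
    nlinarith [sq_nonneg (x ^ 2 - y ^ 2), sq_nonneg (y ^ 2 - w ^ 2), sq_nonneg (x ^ 2 - w ^ 2)]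
  -- Three terms: the smoothing error, at most `B`; the deviation of the smoothed sum from its mean
  -- `m`, by Maurey–Pisier with gradient bound `M`; and `m - c`, again at most `B`.
  have hgauss : ∫⁻ v, ENNReal.ofReal ((reluSum b z v - c) ^ 4) ∂γ ≤
      ENNReal.ofReal (27 * (2 * B ^ 4 + pisierConst * M ^ 4)) := by
    calc _ ≤ ∫⁻ v, (ENNReal.ofReal (27 * (2 * B ^ 4)) +
          ENNReal.ofReal 27 * ENNReal.ofReal ((smoothReluSum b z v - m) ^ 4)) ∂γ := by
          refine lintegral_mono fun v => ?_
          rw [← ENNReal.ofReal_mul (by norm_num), ← ENNReal.ofReal_add (by positivity) (by positivity)]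
          refine ENNReal.ofReal_le_ofReal ?_
          have h1 := hconv (reluSum b z v - smoothReluSum b z v) (smoothReluSum b z v - m) (m - c)
          rw [show reluSum b z v - smoothReluSum b z v + (smoothReluSum b z v - m) + (m - c) =
            reluSum b z v - c by ring] at h1
          have h2 := hpow4 _ B hB' ((abs_reluSum_sub_smoothReluSum_le (b := b) (z := z) v).trans hB)
          have h3 := hpow4 _ B hB' hcm
          linarith
      _ = ENNReal.ofReal (27 * (2 * B ^ 4)) + ENNReal.ofReal 27 *
          ∫⁻ v, ENNReal.ofReal ((smoothReluSum b z v - m) ^ 4) ∂γ := by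
          rw [lintegral_add_left measurable_const, lintegral_const, measure_univ, mul_one,
            lintegral_const_mul' _ _ ENNReal.ofReal_ne_top]
      _ ≤ ENNReal.ofReal (27 * (2 * B ^ 4)) + ENNReal.ofReal 27 *
          ENNReal.ofReal (pisierConst * M ^ 4) := by gcongr
      _ = _ := by
          have := pisierConst_nonneg
          rw [← ENNReal.ofReal_mul (by norm_num), ← ENNReal.ofReal_add (by positivity)
            (by positivity)]
          congr 1; ring
  -- The passage to the sphere needs a homogeneous function, so it is made for the unshifted sum,
  -- with the centering put into the convex function.
  have hΦ : ConvexOn ℝ Set.univ fun t : ℝ => (t - c) ^ 4 := by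
    have h := (Even.convexOn_pow (𝕜 := ℝ) (n := 4) (by decide)).translate_left (-c)
    simpa [Function.comp_def, sub_eq_add_neg] using! h
  have hcomp := lintegral_unifSphere_le_stdGaussian hΦ (fun t => by positivity)
    (f := reluSum b z) (by unfold reluSum; fun_prop) (fun r hr w => by
      unfold reluSum
      rw [Finset.mul_sum]
      refine Finset.sum_congr rfl fun a _ => ?_
      rw [real_inner_smul_left, ← mul_zero r, ← mul_max_of_nonneg _ _ hr, mul_zero]
      ring)
  calc _ ≤ ∫⁻ v, (ENNReal.ofReal (8 * Λ ^ 4) + ENNReal.ofReal 8 *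
        ENNReal.ofReal ((R * reluSum b z v - c) ^ 4)) ∂unifSphere d := by
        refine lintegral_mono fun v => ?_
        rw [← ENNReal.ofReal_mul (by norm_num), ← ENNReal.ofReal_add (by positivity) (by positivity)]
        refine ENNReal.ofReal_le_ofReal ?_
        -- After multiplication by `R` the shift contributes `k * R` per unit weight, while the
        -- Gaussian mean contributes `k * ‖z a‖`: they cancel up to `‖z a‖ - R`, which `Λ` controls.
        have e : R * ∑ a, b a * shiftedReLU (inner ℝ v (z a)) =
            (R * reluSum b z v - c) + k * ∑ a, b a * (‖z a‖ - R) := by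
          simp only [reluSum, hc, Finset.mul_sum, ← Finset.sum_sub_distrib,
            ← Finset.sum_add_distrib, shiftedReLU, ← hk]
          exact Finset.sum_congr rfl fun a _ => by ring
        have h1 : |k * ∑ a, b a * (‖z a‖ - R)| ≤ Λ := by
          rw [abs_mul, abs_of_nonneg hk0]
          refine (mul_le_of_le_one_left (abs_nonneg _) hk1).trans
            ((Finset.abs_sum_le_sum_abs _ _).trans (le_trans (le_of_eq ?_) hΛ))
          exact Finset.sum_congr rfl fun a _ => abs_mul _ _
        rw [e]
        have h2 := hpow4 _ Λ (hΛ0.trans hΛ) h1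
        have h3 := add_pow_four_le (R * reluSum b z v - c)
          (k * ∑ a, b a * (‖z a‖ - R))
        linarith
    _ = ENNReal.ofReal (8 * Λ ^ 4) + ENNReal.ofReal 8 *
        ∫⁻ v, ENNReal.ofReal ((R * reluSum b z v - c) ^ 4) ∂unifSphere d := by
        rw [lintegral_add_left measurable_const, lintegral_const, measure_univ, mul_one,
          lintegral_const_mul' _ _ ENNReal.ofReal_ne_top]
    _ ≤ ENNReal.ofReal (8 * Λ ^ 4) + ENNReal.ofReal 8 *
        ENNReal.ofReal (27 * (2 * B ^ 4 + pisierConst * M ^ 4)) := by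
        gcongr
        exact hcomp.trans hgauss
    _ = _ := by
        have := pisierConst_nonneg
        rw [← ENNReal.ofReal_mul (by norm_num), ← ENNReal.ofReal_add (by positivity)
          (by positivity)]
        congr 1; ring

end FourthMoment

/-! ### The leave-one-out argument. -/

section LeaveOneOut

variable {d N n : ℕ} {τ : ℝ≥0} {ζ : ℝ}

/-- A bound on the joint law from bounds conditionally on all but one weight. -/
lemma jointLaw_le_of_update [NeZero d] {B : Set (Triple d N n)} (hB : MeasurableSet B) (l : Fin N)
    (c : ℝ≥0∞)
    (h : ∀ p : Triple d N n, unifSphere d {v | (Function.update p.1 l v, p.2) ∈ B} ≤ c) :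
    jointLaw d N n τ B ≤ c := by
  rw [jointLaw, Measure.prod_apply_symm hB]
  calc _ ≤ ∫⁻ _y, c ∂((Measure.pi fun _ : Fin n => stdGaussian (EuclideanSpace ℝ (Fin d))).prod
        (Measure.pi fun _ : Fin n => gaussianReal 0 (τ ^ 2))) := by
        refine lintegral_mono fun y => ?_
        have hBy : MeasurableSet ((fun w => (w, y)) ⁻¹' B) := measurable_prodMk_right hB
        rw [← lintegral_indicator_one hBy]
        -- Integrating out the weight `l` first, it is enough to compare the marginals in that
        -- coordinate.
        refine (lintegral_le_of_lmarginal_le (μ := fun _ : Fin N => unifSphere d) {l} (g := fun _ => c)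
          (measurable_one.indicator hBy) measurable_const ?_).trans_eq (by simp)
        rw [lmarginal_singleton, lmarginal_singleton]
        intro w
        simp only [lintegral_const, measure_univ, mul_one]
        have hm : MeasurableSet {v | (Function.update w l v, y) ∈ B} :=
          hB.preimage ((measurable_update w).prodMk measurable_const)
        refine le_trans (le_of_eq ?_) (h (w, y))
        rw [← lintegral_indicator_one hm]
        rfl
    _ = c := by simp

lemma isClosed_unit : IsClosed {p : Triple d N n | ∀ l, ‖p.1 l‖ = 1} := by
  simp only [Set.ofPred_forall]
  exact isClosed_iInter fun l => isClosed_eq (by fun_prop) continuous_const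

lemma continuous_setWeight (l : Fin N) (e : EuclideanSpace ℝ (Fin d)) :
    Continuous fun p : Triple d N n => ((Function.update p.1 l e, p.2) : Triple d N n) :=
  (continuous_fst.update l continuous_const).prodMk continuous_snd

lemma norm_setWeight {s : Sample d N n} {l : Fin N} {e : EuclideanSpace ℝ (Fin d)} (he : ‖e‖ = 1)
    (hw : ∀ k, k ≠ l → ‖s.w k‖ = 1) : ∀ k, ‖(s.setWeight l e).w k‖ = 1 := by
  intro k
  unfold Sample.setWeight
  rcases eq_or_ne k l with rfl | h
  · simp only [Function.update_self, he]
  · simp only [Function.update_of_ne h, hw k h]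

variable {F : Sample d N n → EuclideanSpace ℝ (Fin N) → ℝ}
  {D : Sample d N n → EuclideanSpace ℝ (Fin N) → EuclideanSpace ℝ (Fin N)}

/-- Leave-one-out bound: for a smooth ridge loss, if conditionally on the other weights the `l`-th
partial derivative is small at parameters that do not use neuron `l`, then all coordinates of the
minimizer are small with high probability. -/
lemma prob_exists_coord_le [NeZero d] (hζ : 0 < ζ)
    (hF : Continuous fun q : Triple d N n × EuclideanSpace ℝ (Fin N) =>
      F (Sample.ofTriple q.1) q.2)
    (hD : ∀ l, Continuous fun q : Triple d N n × EuclideanSpace ℝ (Fin N) =>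
      D (Sample.ofTriple q.1) q.2 l)
    (hridge : ∀ s : Sample d N n, (∀ k, ‖s.w k‖ = 1) → IsRidge ζ (F s))
    (hderiv : ∀ s : Sample d N n, (∀ k, ‖s.w k‖ = 1) → ∀ θ v,
      HasDerivAt (fun t : ℝ => F s (θ + t • v)) (inner ℝ (D s θ) v) 0)
    (hinv : ∀ (s : Sample d N n) (l : Fin N) (v : EuclideanSpace ℝ (Fin d))
      (θ : EuclideanSpace ℝ (Fin N)), θ l = 0 → F (s.setWeight l v) θ = F s θ)
    {e : EuclideanSpace ℝ (Fin d)} (he : ‖e‖ = 1) {G G' : Sample d N n → Prop}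
    (hG : MeasurableSet {p : Triple d N n | G (Sample.ofTriple p)})
    (hGG' : ∀ s l, G' s → G (s.setWeight l e)) {κ κ' : ℝ} (hκ : 2 / ζ * κ' ≤ κ) {c : ℝ≥0∞}
    (hmom : ∀ s : Sample d N n, (∀ k, ‖s.w k‖ = 1) → G s → ∀ (l : Fin N)
      (θ : EuclideanSpace ℝ (Fin N)), θ l = 0 → F s θ ≤ F s 0 →
      unifSphere d {v | κ' ≤ |D (s.setWeight l v) θ l|} ≤ c) :
    prob τ (fun s : Sample d N n => (∀ k, ‖s.w k‖ = 1) ∧ G' s ∧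
      ∃ μ, IsMinOn (F s) Set.univ μ ∧ ∃ l, κ < |μ l|) ≤ N * c := by
  -- The constrained minimizer is computed with `w l` replaced by the fixed unit vector `e`. It
  -- visibly does not depend on `w l`, and by `hinv` it also minimizes the original loss on the
  -- hyperplane.
  obtain ⟨θs, hθs⟩ : ∃ θs : Fin N → Triple d N n → EuclideanSpace ℝ (Fin N), ∀ l p, θs l p =
    argminOn (F ((Sample.ofTriple p).setWeight l e)) (coordHyperplane l) := ⟨_, fun _ _ => rfl⟩
  have hspec : ∀ (l : Fin N) (p : Triple d N n), (∀ k, k ≠ l → ‖p.1 k‖ = 1) →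
      θs l p ∈ coordHyperplane l ∧
      IsMinOn (F ((Sample.ofTriple p).setWeight l e)) (coordHyperplane l) (θs l p) := fun l p hp => by
    rw [hθs]
    exact (hridge _ (norm_setWeight (s := Sample.ofTriple p) he hp)).argminOn_spec hζ (isClosed_coordHyperplane l)
      ⟨0, zero_mem_coordHyperplane l⟩
  -- The good event is likewise tested after inserting `e`, so that conditioning on the other
  -- weights leaves it fixed; `hGG'` says that the original condition `G'` implies it.
  obtain ⟨B, hB⟩ : ∃ B : Fin N → Set (Triple d N n), ∀ l, B l = {p | G ((Sample.ofTriple p).setWeight l e)} ∩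
    ({p | ∀ l, ‖p.1 l‖ = 1} ∩ {p | κ' ≤ |D (Sample.ofTriple p) (θs l p) l|}) := ⟨_, fun _ => rfl⟩
  -- Continuity of the minimizer on the closed set of unit weights makes the bad event measurable,
  -- as Fubini requires.
  have hcont : ∀ l, ContinuousOn (θs l) {p | ∀ l, ‖p.1 l‖ = 1} := by
    intro l
    rw [funext (hθs l), continuousOn_iff_continuous_domRestrict]
    refine continuous_argminOn (F := fun (p : {p : Triple d N n | ∀ l, ‖p.1 l‖ = 1}) =>
      F ((Sample.ofTriple p.1).setWeight l e)) hζ ?_ (fun p => hridge _ ?_)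
      (isClosed_coordHyperplane l) (convex_coordHyperplane l) ⟨0, zero_mem_coordHyperplane l⟩
    · exact hF.comp ((((continuous_setWeight l e).comp continuous_subtype_val).comp
        continuous_fst).prodMk continuous_snd)
    · exact norm_setWeight (s := Sample.ofTriple p.1) he fun k _ => p.2 k
  have hBm : ∀ l, MeasurableSet (B l) := by
    intro l
    rw [hB]
    refine (hG.preimage (continuous_setWeight l e).measurable).inter (IsClosed.measurableSet ?_)
    have h1 : ContinuousOn (fun p => |D (Sample.ofTriple p) (θs l p) l|)
        {p | ∀ l, ‖p.1 l‖ = 1} :=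
      ((hD l).comp_continuousOn (continuousOn_id.prodMk (hcont l))).abs
    exact h1.preimage_isClosed_of_isClosed isClosed_unit isClosed_Ici
  have hsub : {p : Triple d N n | (∀ k, ‖(Sample.ofTriple p).w k‖ = 1) ∧ G' (Sample.ofTriple p) ∧
      ∃ μ, IsMinOn (F (Sample.ofTriple p)) Set.univ μ ∧ ∃ l, κ < |μ l|} ⊆ ⋃ l, B l := by
    rintro p ⟨hu, hg, μ, hμ, l, hl⟩
    refine Set.mem_iUnion.2 ⟨l, ?_⟩
    rw [hB]
    refine ⟨hGG' _ l hg, hu, ?_⟩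
    obtain ⟨h1, h2⟩ := hspec l p fun k _ => hu k
    have h3 : IsMinOn (F (Sample.ofTriple p)) (coordHyperplane l) (θs l p) := by
      intro x hx
      have h4 : F ((Sample.ofTriple p).setWeight l e) (θs l p) ≤
        F ((Sample.ofTriple p).setWeight l e) x := h2 hx
      rwa [hinv _ _ _ _ hx, hinv _ _ _ _ h1] at h4
    have h4 := (hridge _ hu).abs_coord_le hζ h1 h3 (hderiv _ hu _) hμ
    have h5 : 2 / ζ * κ' ≤ 2 / ζ * |D (Sample.ofTriple p) (θs l p) l| := by linarith
    exact le_of_mul_le_mul_left h5 (by positivity)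
  refine (measure_mono hsub).trans ((measure_iUnion_fintype_le _ _).trans ?_)
  have hc : ∀ l, jointLaw d N n τ (B l) ≤ c := by
    intro l
    refine jointLaw_le_of_update (hBm l) l c fun p => ?_
    rw [hB]
    set s := (Sample.ofTriple p).setWeight l e with hs
    have hup : ∀ v, Function.update (Function.update p.1 l v) l e = Function.update p.1 l e :=
      fun v => Function.update_idem _ _ _
    have hth : ∀ v, θs l (Function.update p.1 l v, p.2) = θs l p := fun v => by
      simp only [hθs, Sample.setWeight, Sample.ofTriple, hup]
    by_cases hgood : (∀ k, k ≠ l → ‖p.1 k‖ = 1) ∧ G s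
    · obtain ⟨h1, h2⟩ := hspec l p hgood.1
      refine (measure_mono ?_).trans (hmom s (norm_setWeight (s := Sample.ofTriple p) he hgood.1) hgood.2 l (θs l p) h1
        (h2 (zero_mem_coordHyperplane l)))
      rintro v ⟨-, -, hv⟩
      have hv' : κ' ≤ |D (Sample.ofTriple (Function.update p.1 l v, p.2))
        (θs l (Function.update p.1 l v, p.2)) l| := hv
      rw [hth] at hv'
      have : s.setWeight l v = Sample.ofTriple (Function.update p.1 l v, p.2) := by
        simp only [hs, Sample.setWeight, Sample.ofTriple, Function.update_idem]
      rw [Set.mem_ofPred_eq, this]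
      exact hv'
    · refine le_trans (le_of_eq ?_) zero_le
      rw [show {v | (Function.update p.1 l v, p.2) ∈ _} = ∅ from ?_, measure_empty]
      refine Set.eq_empty_iff_forall_notMem.2 ?_
      rintro v ⟨hv1, hv2, -⟩
      refine hgood ⟨fun k hk => ?_, ?_⟩
      · have := hv2 k
        simpa [Function.update_of_ne hk] using this
      · have h3 : G ((Sample.ofTriple (Function.update p.1 l v, p.2)).setWeight l e) := hv1
        have : (Sample.ofTriple (Function.update p.1 l v, p.2)).setWeight l e = s := by
          simp only [hs, Sample.setWeight, Sample.ofTriple, Function.update_idem]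
        rwa [this] at h3
  refine (Finset.sum_le_sum fun l _ => hc l).trans_eq ?_
  simp

end LeaveOneOut

/-! ### Fourth moments of the gradient terms. -/

section Moments

variable {d N n : ℕ} {ι : Type*} [Fintype ι]

/-- The constant in the fourth moment bound for `featSum`. -/
def featConst (K C₁ Cr ε : ℝ) : ℝ :=
  216 * (2 * √K ^ 4 + pisierConst * (√K * (√C₁ + ε)) ^ 4) + 8 * (√K * (√Cr + ε)) ^ 4

/-- The previous fourth moment bound over the pairs (sample, perturbation). For `M`, the covariate
part pairs the operator bound `C₁ n` with `∑ (∑ |b|)² ≤ K / n`, and the perturbation part uses `∑ ∑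
|b| ≤ √K`. The number of perturbations does not enter. -/
lemma lintegral_featSum_pow_four_le [NeZero d] (hn : 0 < n) {x : Fin n → EuclideanSpace ℝ (Fin d)}
    {δ : ι → EuclideanSpace ℝ (Fin d)} {b : Fin n → ι → ℝ} {K C₁ Cr ε : ℝ} (hK : 0 ≤ K)
    (hC₁ : 0 ≤ C₁) (hε : 0 ≤ ε) (hx : OpBound x (C₁ * n)) (hδ : ∀ a, ‖δ a‖ ≤ ε)
    (hr : ∑ i, (‖x i‖ - meanRadius d) ^ 2 ≤ Cr * n) (hb : ∑ i, (∑ a, |b i a|) ^ 2 ≤ K / n) :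
    ∫⁻ v, ENNReal.ofReal ((meanRadius d * featSum b (fun i a => x i + δ a) v) ^ 4) ∂unifSphere d ≤
      ENNReal.ofReal (featConst K C₁ Cr ε) := by
  have hn' : (0 : ℝ) < n := by exact_mod_cast hn
  set R := meanRadius d
  have hsum : ∑ i, ∑ a, |b i a| ≤ √K := by
    refine Real.le_sqrt_of_sq_le ?_
    have h := Finset.sum_mul_sq_le_sq_mul_sq Finset.univ (fun _ : Fin n => (1 : ℝ))
      (fun i => ∑ a, |b i a|)
    simp only [one_mul, one_pow, Finset.sum_const, Finset.card_univ, Fintype.card_fin,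
      nsmul_eq_mul, mul_one] at h
    refine h.trans ((mul_le_mul_of_nonneg_left hb hn'.le).trans_eq ?_)
    field_simp
  have hfs : ∀ v, featSum b (fun i a => x i + δ a) v = ∑ p : Fin n × ι, b p.1 p.2 *
      shiftedReLU (inner ℝ v (x p.1 + δ p.2)) := fun v => by
    rw [featSum, Fintype.sum_prod_type]
  simp_rw [hfs]
  have hB : ∑ p : Fin n × ι, |b p.1 p.2| ≤ √K := by rw [Fintype.sum_prod_type]; exact hsum
  refine lintegral_reluSum_pow_four_le (z := fun p : Fin n × ι => x p.1 + δ p.2)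
    (b := fun p : Fin n × ι => b p.1 p.2) (fun c hc => ?_) hB ?_
  · have e : ∑ p : Fin n × ι, c p • (x p.1 + δ p.2) =
        ∑ i, (∑ a, c (i, a)) • x i + ∑ p : Fin n × ι, c p • δ p.2 := by
      simp only [smul_add, Finset.sum_add_distrib, Finset.sum_smul]
      congr 1
      rw [Fintype.sum_prod_type]
    rw [e]
    have h1 : ‖∑ i, (∑ a, c (i, a)) • x i‖ ≤ √K * √C₁ := by
      rw [← Real.sqrt_mul hK]
      refine Real.le_sqrt_of_sq_le ((norm_sum_smul_sq_le (by positivity) hx _).trans ?_)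
      have h2 : ∑ i, (∑ a, c (i, a)) ^ 2 ≤ K / n := by
        refine le_trans (Finset.sum_le_sum fun i _ => ?_) hb
        rw [← sq_abs]
        exact pow_le_pow_left₀ (abs_nonneg _) ((Finset.abs_sum_le_sum_abs _ _).trans
          (Finset.sum_le_sum fun a _ => hc (i, a))) 2
      refine (mul_le_mul_of_nonneg_left h2 (by positivity)).trans_eq ?_
      field_simp
    have h2 : ‖∑ p : Fin n × ι, c p • δ p.2‖ ≤ √K * ε := by
      refine (norm_sum_le _ _).trans ?_
      calc _ ≤ ∑ p : Fin n × ι, |b p.1 p.2| * ε := by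
            refine Finset.sum_le_sum fun p _ => ?_
            rw [norm_smul, Real.norm_eq_abs]
            exact mul_le_mul (hc p) (hδ _) (norm_nonneg _) (abs_nonneg _)
        _ ≤ _ := by rw [← Finset.sum_mul]; gcongr
    rw [mul_add]
    exact (norm_add_le _ _).trans (add_le_add h1 h2)
  · have h1 : ∀ i a, |‖x i + δ a‖ - R| ≤ |‖x i‖ - R| + ε := by
      intro i a
      have h2 := abs_norm_sub_norm_le (x i + δ a) (x i)
      rw [add_sub_cancel_left] at h2
      have h3 := abs_add_le (‖x i + δ a‖ - ‖x i‖) (‖x i‖ - R)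
      rw [sub_add_sub_cancel] at h3
      linarith [hδ a]
    have h2 : ∑ i, (∑ a, |b i a|) * |‖x i‖ - R| ≤ √K * √Cr := by
      have hCr : 0 ≤ Cr := by
        have : 0 ≤ Cr * n := (Finset.sum_nonneg fun _ _ => sq_nonneg _).trans hr
        exact nonneg_of_mul_nonneg_left this hn'
      rw [← Real.sqrt_mul hK]
      refine Real.le_sqrt_of_sq_le ((Finset.sum_mul_sq_le_sq_mul_sq _ _ _).trans ?_)
      simp_rw [sq_abs]
      refine (mul_le_mul hb hr (Finset.sum_nonneg fun _ _ => sq_nonneg _) (by positivity)).trans_eq ?_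
      field_simp
    calc ∑ p : Fin n × ι, |b p.1 p.2| * |‖x p.1 + δ p.2‖ - R|
        ≤ ∑ p : Fin n × ι, |b p.1 p.2| * (|‖x p.1‖ - R| + ε) :=
          Finset.sum_le_sum fun p _ => mul_le_mul_of_nonneg_left (h1 _ _) (abs_nonneg _)
      _ = ∑ i, (∑ a, |b i a|) * |‖x i‖ - R| + (∑ p : Fin n × ι, |b p.1 p.2|) * ε := by
          simp only [mul_add, Finset.sum_add_distrib, Finset.sum_mul]
          congr 1
          rw [Fintype.sum_prod_type]
      _ ≤ √K * √Cr + √K * ε := by gcongr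
      _ = _ := by ring

lemma measurable_featSum (b : Fin n → ι → ℝ) (z : Fin n → ι → EuclideanSpace ℝ (Fin d)) :
    Measurable (featSum b z) := by
  refine Continuous.measurable (continuous_finsetSum _ fun i _ => continuous_finsetSum _ fun a _ =>
    continuous_const.mul (continuous_shiftedReLU.comp ?_))
  fun_prop

lemma measure_abs_ge_le_of_pow_four {α : Type*} [MeasurableSpace α] {μ : Measure α} {X : α → ℝ}
    (hX : Measurable X) {R H a : ℝ} (hR : 0 < R) (ha : 0 < a)
    (h : ∫⁻ v, ENNReal.ofReal ((R * X v) ^ 4) ∂μ ≤ ENNReal.ofReal H) :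
    μ {v | a ≤ |X v|} ≤ ENNReal.ofReal (H / (R * a) ^ 4) := by
  have h4 : (0 : ℝ) < (R * a) ^ 4 := by positivity
  have h1 := meas_ge_le_lintegral_div (μ := μ) (f := fun v => ENNReal.ofReal ((R * X v) ^ 4))
    (by fun_prop) (ε := ENNReal.ofReal ((R * a) ^ 4)) (by simpa using h4) ENNReal.ofReal_ne_top
  refine (measure_mono fun v hv => ?_).trans (h1.trans ?_)
  · refine ENNReal.ofReal_le_ofReal ?_
    rw [← Even.pow_abs (by decide : Even 4) (R * X v), abs_mul, abs_of_pos hR]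
    have : a ≤ |X v| := hv
    gcongr
  · rw [ENNReal.ofReal_div_of_pos h4]
    gcongr

/-- Jordan's inequality `2 / π * s ≤ sin s` at `s = arcsin t`; for `t ≥ 1` the bound `arcsin t ≤ π /
2` is enough. -/
lemma abs_arcsin_le (t : ℝ) : |Real.arcsin t| ≤ Real.pi / 2 * |t| := by
  have hpos : ∀ t : ℝ, 0 ≤ t → Real.arcsin t ≤ Real.pi / 2 * t := by
    intro t ht
    rcases le_total t 1 with h1 | h1
    · have h2 := Real.mul_le_sin (Real.arcsin_nonneg.2 ht) (Real.arcsin_le_pi_div_two t)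
      rw [Real.sin_arcsin (by linarith) h1] at h2
      have h3 := mul_le_mul_of_nonneg_left h2 (by positivity : 0 ≤ Real.pi / 2)
      calc Real.arcsin t = Real.pi / 2 * (2 / Real.pi * Real.arcsin t) := by
            have := Real.pi_pos.ne'; field_simp
        _ ≤ _ := h3
    · have := Real.arcsin_le_pi_div_two t
      nlinarith [Real.pi_pos]
  rcases le_total 0 t with h | h
  · rw [abs_of_nonneg h, abs_of_nonneg (Real.arcsin_nonneg.2 h)]
    exact hpos t h
  · rw [abs_of_nonpos h, abs_of_nonpos (Real.arcsin_nonpos.2 h), ← Real.arcsin_neg]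
    exact hpos (-t) (by linarith)

/-- Writing `arccos = π / 2 - arcsin` separates a linear part, which sees only one projection of `w
l`, from a part of order `t²`. -/
lemma kernel_eq (t : ℝ) : t * ((Real.pi - Real.arccos t) / (2 * Real.pi)) =
    1 / 4 * t + 1 / (2 * Real.pi) * (t * Real.arcsin t) := by
  rw [Real.arccos]
  have := Real.pi_pos.ne'
  field_simp
  ring

lemma abs_kGrad_update_le {w : Fin N → EuclideanSpace ℝ (Fin d)} {θ : EuclideanSpace ℝ (Fin N)}
    {l : Fin N} (hθ : θ l = 0) (v : EuclideanSpace ℝ (Fin d)) :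
    |kGrad (Function.update w l v) θ l| ≤
      |inner ℝ v (∑ k, θ k • w k)| + ∑ k, |θ k| * inner ℝ v (w k) ^ 2 := by
  have e : kGrad (Function.update w l v) θ l = 1 / 4 * inner ℝ v (∑ k, θ k • w k) +
      ∑ k, θ k * (1 / (2 * Real.pi) * (inner ℝ v (w k) * Real.arcsin (inner ℝ v (w k)))) := by
    rw [inner_sum, Finset.mul_sum, ← Finset.sum_add_distrib, kGrad]
    refine Finset.sum_congr rfl fun k _ => ?_
    rcases eq_or_ne k l with rfl | h
    · simp [hθ]
    · rw [arccosKernel_apply, Function.update_self, Function.update_of_ne h, kernel_eq,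
        real_inner_smul_right]
      ring
  rw [e]
  refine (abs_add_le _ _).trans (add_le_add ?_ ?_)
  · rw [abs_mul]
    refine mul_le_of_le_one_left (abs_nonneg _) ?_
    rw [abs_of_pos (by norm_num)]; norm_num
  · refine (Finset.abs_sum_le_sum_abs _ _).trans (Finset.sum_le_sum fun k _ => ?_)
    rw [abs_mul]
    refine mul_le_mul_of_nonneg_left ?_ (abs_nonneg _)
    rw [abs_mul, abs_mul, abs_of_pos (by positivity)]
    have h1 := mul_le_mul_of_nonneg_left (abs_arcsin_le (inner ℝ v (w k)))
      (abs_nonneg (inner ℝ v (w k)))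
    rw [← sq_abs]
    have h2 := Real.pi_pos
    calc _ ≤ 1 / (2 * Real.pi) * (|inner ℝ v (w k)| * (Real.pi / 2 * |inner ℝ v (w k)|)) := by gcongr
      _ = 1 / 4 * |inner ℝ v (w k)| ^ 2 := by field_simp; norm_num; ring
      _ ≤ _ := mul_le_of_le_one_left (by positivity) (by norm_num)

/-- The constant in the fourth moment bound for the kernel term. -/
def kernelConst (C T q : ℝ) : ℝ := 8 * ((C * T) ^ 2 * gaussMoment 4 + T ^ 2 * q ^ 2 * gaussMoment 8)

/-- The linear term is the projection on `u`, with `‖u‖² ≤ C T`. For the quadratic term two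
Cauchy–Schwarz inequalities lead to `T² N ∑ ⟪v, w k⟫⁸`; each rescaled eighth moment is at most
Gaussian, and the powers of `R` that remain give `N² / R⁴ ≤ q²`. -/
lemma lintegral_kernel_pow_four_le [NeZero d] (hR : 0 < meanRadius d)
    {w : Fin N → EuclideanSpace ℝ (Fin d)}
    {θ : EuclideanSpace ℝ (Fin N)} {C T q : ℝ} (hC : 0 ≤ C) (hw : OpBound w C)
    (hw1 : ∀ k, ‖w k‖ = 1) (hθ : ‖θ‖ ^ 2 ≤ T) (hq : N ≤ q * meanRadius d ^ 2) :
    ∫⁻ v, ENNReal.ofReal ((meanRadius d * (|inner ℝ v (∑ k, θ k • w k)| +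
      ∑ k, |θ k| * inner ℝ v (w k) ^ 2)) ^ 4) ∂unifSphere d ≤
      ENNReal.ofReal (kernelConst C T q) := by
  set R := meanRadius d
  set u := ∑ k, θ k • w k with hu
  have hT : 0 ≤ T := (sq_nonneg _).trans hθ
  have hg4 := gaussMoment_nonneg 4
  have hg8 := gaussMoment_nonneg 8
  have hu2 : ‖u‖ ^ 2 ≤ C * T := by
    refine (norm_sum_smul_sq_le hC hw _).trans ?_
    rw [← EuclideanSpace.real_norm_sq_eq]
    gcongr
  have h1 : ∀ v, (R * (|inner ℝ v u| + ∑ k, |θ k| * inner ℝ v (w k) ^ 2)) ^ 4 ≤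
      8 * (|R * inner ℝ v u| ^ 4 + T ^ 2 * N / R ^ 4 * ∑ k, |R * inner ℝ v (w k)| ^ 8) := by
    intro v
    rw [mul_add]
    refine (add_pow_four_le _ _).trans (mul_le_mul_of_nonneg_left (add_le_add (le_of_eq ?_) ?_)
      (by norm_num))
    · rw [abs_mul, abs_of_pos hR]
    · have h2 : (∑ k, |θ k| * inner ℝ v (w k) ^ 2) ^ 2 ≤ T * ∑ k, (inner ℝ v (w k) ^ 2) ^ 2 := by
        refine (Finset.sum_mul_sq_le_sq_mul_sq _ _ _).trans ?_
        simp_rw [sq_abs]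
        rw [← EuclideanSpace.real_norm_sq_eq]
        gcongr
      have h3 : (∑ k, (inner ℝ v (w k) ^ 2) ^ 2) ^ 2 ≤ N * ∑ k, inner ℝ v (w k) ^ 8 := by
        have h := Finset.sum_mul_sq_le_sq_mul_sq Finset.univ (fun _ : Fin N => (1 : ℝ))
          (fun k => (inner ℝ v (w k) ^ 2) ^ 2)
        simp only [one_mul, one_pow, Finset.sum_const, Finset.card_univ, Fintype.card_fin,
          nsmul_eq_mul, mul_one, ← pow_mul] at h
        simpa only [← pow_mul] using h
      calc _ = R ^ 4 * ((∑ k, |θ k| * inner ℝ v (w k) ^ 2) ^ 2) ^ 2 := by ring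
        _ ≤ R ^ 4 * (T * ∑ k, (inner ℝ v (w k) ^ 2) ^ 2) ^ 2 := by gcongr
        _ ≤ R ^ 4 * (T ^ 2 * (N * ∑ k, inner ℝ v (w k) ^ 8)) := by rw [mul_pow]; gcongr
        _ = _ := by
            simp only [abs_mul, abs_of_pos hR, mul_pow, Even.pow_abs (by decide : Even 8)]
            rw [← Finset.mul_sum]
            field_simp
  have hc0 : 0 ≤ T ^ 2 * N / R ^ 4 := by positivity
  calc _ ≤ ∫⁻ v, ENNReal.ofReal 8 * (ENNReal.ofReal (|R * inner ℝ v u| ^ 4) +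
        ENNReal.ofReal (T ^ 2 * N / R ^ 4) * ∑ k, ENNReal.ofReal (|R * inner ℝ v (w k)| ^ 8))
          ∂unifSphere d := by
        refine lintegral_mono fun v => ?_
        rw [← ENNReal.ofReal_sum_of_nonneg fun _ _ => by positivity, ← ENNReal.ofReal_mul hc0,
          ← ENNReal.ofReal_add (by positivity)
            (mul_nonneg hc0 (Finset.sum_nonneg fun _ _ => by positivity)),
          ← ENNReal.ofReal_mul (by norm_num)]
        exact ENNReal.ofReal_le_ofReal (h1 v)
    _ = ENNReal.ofReal 8 * (∫⁻ v, ENNReal.ofReal (|R * inner ℝ v u| ^ 4) ∂unifSphere d +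
        ENNReal.ofReal (T ^ 2 * N / R ^ 4) *
          ∑ k, ∫⁻ v, ENNReal.ofReal (|R * inner ℝ v (w k)| ^ 8) ∂unifSphere d) := by
        rw [lintegral_const_mul' _ _ ENNReal.ofReal_ne_top, lintegral_add_left (by fun_prop),
          lintegral_const_mul' _ _ ENNReal.ofReal_ne_top,
          lintegral_finsetSum _ fun k _ => by fun_prop]
    _ ≤ ENNReal.ofReal 8 * (ENNReal.ofReal ((C * T) ^ 2 * gaussMoment 4) +
        ENNReal.ofReal (T ^ 2 * N / R ^ 4) * ∑ k : Fin N, ENNReal.ofReal (gaussMoment 8)) := by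
        gcongr with k
        · refine (lintegral_inner_pow_unifSphere_le 4 u).trans (ENNReal.ofReal_le_ofReal ?_)
          rw [show ‖u‖ ^ 4 = (‖u‖ ^ 2) ^ 2 by ring]
          gcongr
        · refine (lintegral_inner_pow_unifSphere_le 8 (w k)).trans (le_of_eq ?_)
          rw [hw1 k, one_pow, one_mul]
    _ ≤ _ := by
        rw [Finset.sum_const, Finset.card_univ, Fintype.card_fin, nsmul_eq_mul,
          ← ENNReal.ofReal_natCast, ← ENNReal.ofReal_mul (Nat.cast_nonneg N),
          ← ENNReal.ofReal_mul hc0, ← ENNReal.ofReal_add (by positivity) (by positivity),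
          ← ENNReal.ofReal_mul (by norm_num)]
        refine ENNReal.ofReal_le_ofReal ?_
        unfold kernelConst
        have h2 : T ^ 2 * N / R ^ 4 * (N * gaussMoment 8) ≤ T ^ 2 * q ^ 2 * gaussMoment 8 := by
          have h3 : (N : ℝ) ^ 2 / R ^ 4 ≤ q ^ 2 := by
            rw [div_le_iff₀ (by positivity)]
            have := pow_le_pow_left₀ (Nat.cast_nonneg N) hq 2
            calc _ ≤ _ := this
              _ = _ := by ring
          calc _ = T ^ 2 * ((N : ℝ) ^ 2 / R ^ 4) * gaussMoment 8 := by ring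
            _ ≤ _ := by gcongr
        linarith

end Moments

/-! ### Small coordinates of the surrogate minimizers on regular samples. -/

section Regular

variable {d N n : ℕ} {τ : ℝ≥0} {ε ζ P η : ℝ} {ι : Type*} [Fintype ι]
  {C C₁ Cr Cy : ℝ} {β : EuclideanSpace ℝ (Fin d)} {δ : ι → EuclideanSpace ℝ (Fin d)}

/-- A sample with weights and covariates of controlled operator norm, with covariates of norm close
to the mean radius, and with bounded labels. -/
structure IsRegular (C C₁ Cr Cy : ℝ) (β : EuclideanSpace ℝ (Fin d)) (s : Sample d N n) : Prop where
  weights : OpBound s.w C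
  covariates : OpBound s.x (C₁ * n)
  radii : ∑ i, (‖s.x i‖ - meanRadius d) ^ 2 ≤ Cr * n
  labels : ∑ i, label β s i ^ 2 ≤ Cy * n

/-- The operator norm conditions range over uncountably many `u`, but each is closed, and so is
their intersection. -/
lemma measurableSet_isRegular (C C₁ Cr Cy : ℝ) (β : EuclideanSpace ℝ (Fin d)) :
    MeasurableSet {p : Triple d N n | IsRegular C C₁ Cr Cy β (Sample.ofTriple p)} := by
  have e : {p : Triple d N n | IsRegular C C₁ Cr Cy β (Sample.ofTriple p)} =
      (⋂ u, {p | ∑ i, inner ℝ (p.1 i) u ^ 2 ≤ C * ‖u‖ ^ 2}) ∩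
      ((⋂ u, {p | ∑ i, inner ℝ (p.2.1 i) u ^ 2 ≤ C₁ * n * ‖u‖ ^ 2}) ∩
      ({p | ∑ i, (‖p.2.1 i‖ - meanRadius d) ^ 2 ≤ Cr * n} ∩
      {p | ∑ i, (inner ℝ (p.2.1 i) β + p.2.2 i) ^ 2 ≤ Cy * n})) := by
    ext p
    simp only [Set.mem_inter_iff, Set.mem_iInter, Set.mem_ofPred_eq]
    exact ⟨fun h => ⟨h.1, h.2, h.3, h.4⟩, fun h => ⟨h.1, h.2.1, h.2.2.1, h.2.2.2⟩⟩
  rw [e]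
  refine IsClosed.measurableSet (IsClosed.inter (isClosed_iInter fun u => ?_) (IsClosed.inter
    (isClosed_iInter fun u => ?_) (IsClosed.inter ?_ ?_))) <;>
  exact isClosed_le (by fun_prop) continuous_const

lemma OpBound.update {w : Fin N → EuclideanSpace ℝ (Fin d)} (h : OpBound w C) (l : Fin N)
    {e : EuclideanSpace ℝ (Fin d)} (he : ‖e‖ = 1) : OpBound (Function.update w l e) (C + 1) := by
  intro u
  have h1 : ∀ k, inner ℝ (Function.update w l e k) u ^ 2 ≤
      inner ℝ (w k) u ^ 2 + if k = l then ‖u‖ ^ 2 else 0 := by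
    intro k
    rcases eq_or_ne k l with rfl | hk
    · have := real_inner_mul_inner_self_le e u
      rw [real_inner_self_eq_norm_sq, real_inner_self_eq_norm_sq, he] at this
      rw [Function.update_self, if_pos rfl]
      nlinarith [sq_nonneg (inner ℝ (w k) u)]
    · rw [Function.update_of_ne hk, if_neg hk, add_zero]
  calc _ ≤ _ := Finset.sum_le_sum fun k _ => h1 k
    _ = ∑ k, inner ℝ (w k) u ^ 2 + ‖u‖ ^ 2 := by rw [Finset.sum_add_distrib]; simp
    _ ≤ _ := by linarith [h u]

lemma IsRegular.setWeight {s : Sample d N n} (h : IsRegular C C₁ Cr Cy β s) (l : Fin N)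
    {e : EuclideanSpace ℝ (Fin d)} (he : ‖e‖ = 1) :
    IsRegular (C + 1) C₁ Cr Cy β (s.setWeight l e) :=
  ⟨h.weights.update l he, h.covariates, h.radii, h.labels⟩

variable {s : Sample d N n}

lemma residual_zero (i : Fin n) (u : EuclideanSpace ℝ (Fin d)) :
    residual β s 0 i u = label β s i := by
  simp [residual, predictor]

lemma regularizer_zero : regularizer d ζ (0 : EuclideanSpace ℝ (Fin N)) = 0 := by
  simp [regularizer_eq]

lemma softLoss_zero_le [Nonempty ι] (hn : 0 < n) (hP : 0 < P)
    (hc : Real.log (Fintype.card ι) / P ≤ 1) (h : ∑ i, label β s i ^ 2 ≤ Cy * n) :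
    softLoss ζ P δ β s 0 ≤ Cy + 1 := by
  have hn' : (0 : ℝ) < n := by exact_mod_cast hn
  have h1 := mean_le_mean hn (a := 1) (b := 1) (x := fun i =>
    1 / P * Real.log (∑ a, Real.exp (P * residual β s 0 i (δ a) ^ 2)))
    (y := fun i => label β s i ^ 2) fun i => by
      obtain ⟨a, ha⟩ := exists_softMax_le hP fun a => residual β s 0 i (δ a)
      rw [residual_zero] at ha
      linarith
  have h2 : 1 / (2 * (n : ℝ)) * ∑ i, label β s i ^ 2 ≤ Cy / 2 := by
    calc _ ≤ 1 / (2 * (n : ℝ)) * (Cy * n) := mul_le_mul_of_nonneg_left h (by positivity)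
      _ = _ := by field_simp
  have h3 : 0 ≤ Cy := by
    have := (Finset.sum_nonneg fun i (_ : i ∈ Finset.univ) => sq_nonneg (label β s i)).trans h
    exact nonneg_of_mul_nonneg_left this hn'
  rw [softLoss, regularizer_zero]
  linarith

lemma smoothLoss_zero_le (hn : 0 < n) (hε : 0 ≤ ε) (hη : 0 ≤ η) (hη1 : (1 + ε) * η ≤ 1)
    (h : ∑ i, label β s i ^ 2 ≤ Cy * n) : smoothLoss ε ζ η β s 0 ≤ Cy + 1 := by
  have hn' : (0 : ℝ) < n := by exact_mod_cast hn
  have h1 := mean_le_mean hn (a := 2) (b := 2) (x := fun i =>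
    (√(|residual β s 0 i 0| ^ 2 + η ^ 2) + ε * √(√(kForm s.w 0) ^ 2 + η ^ 2)) ^ 2)
    (y := fun i => label β s i ^ 2) fun i => by
      have h2 := sqrt_sq_add_le (abs_nonneg (residual β s 0 i 0)) hη
      have h3 : √(√(kForm s.w 0) ^ 2 + η ^ 2) ≤ η := by
        have : kForm s.w 0 = 0 := by simp [kForm]
        rw [this, Real.sqrt_zero, zero_pow two_ne_zero, zero_add, Real.sqrt_sq hη]
      have h4 := mul_le_mul_of_nonneg_left h3 hε
      rw [residual_zero] at h2 ⊢
      have h5 : √(|label β s i| ^ 2 + η ^ 2) + ε * √(√(kForm s.w 0) ^ 2 + η ^ 2) ≤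
        |label β s i| + 1 := by linarith
      refine (pow_le_pow_left₀ (by positivity) h5 2).trans ?_
      nlinarith [sq_nonneg (|label β s i| - 1), sq_abs (label β s i)]
  have h2 : 1 / (2 * (n : ℝ)) * ∑ i, label β s i ^ 2 ≤ Cy / 2 := by
    calc _ ≤ 1 / (2 * (n : ℝ)) * (Cy * n) := mul_le_mul_of_nonneg_left h (by positivity)
      _ = _ := by field_simp
  rw [smoothLoss, regularizer_zero]
  linarith

/-- With `θ l = 0` only the rank-one part of the regularizer remains, and `|∑ θ k| ≤ √N ‖θ‖`; for
`N` of order `d` this is of order `√(log d / d)`. -/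
lemma abs_regGrad_le {θ : EuclideanSpace ℝ (Fin N)} {l : Fin N} (hζ : 0 ≤ ζ) (hθ : θ l = 0) {T : ℝ}
    (hT : ‖θ‖ ^ 2 ≤ T) : |regGrad d ζ θ l| ≤ ζ * (√(Real.log d) / d * √(N * T)) := by
  rw [regGrad, hθ, zero_add, abs_mul, abs_of_nonneg hζ, abs_mul, abs_of_nonneg (by positivity)]
  gcongr
  refine Real.abs_le_sqrt ?_
  have h := Finset.sum_mul_sq_le_sq_mul_sq Finset.univ (fun _ : Fin N => (1 : ℝ)) (fun k => θ k)
  simp only [one_mul, one_pow, Finset.sum_const, Finset.card_univ, Fintype.card_fin, nsmul_eq_mul,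
    mul_one] at h
  rw [← EuclideanSpace.real_norm_sq_eq] at h
  exact h.trans (by gcongr)

/-- Smallness of all coordinates of the minimizer of the soft loss. -/
lemma prob_softLoss_coord_le [NeZero d] [Nonempty ι] (hn : 0 < n) (hR : 0 < meanRadius d)
    (hζ : 0 < ζ) (hε : 0 ≤ ε) (hP : 0 < P) (hC₁ : 0 ≤ C₁) (hδ : ∀ a, ‖δ a‖ ≤ ε)
    (hc : Real.log (Fintype.card ι) / P ≤ 1) {a : ℝ} (ha : 0 < a)
    (hreg : ζ * (√(Real.log d) / d * √(N * (2 / ζ * (Cy + 1)))) ≤ a) :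
    prob τ (fun s : Sample d N n => (∀ k, ‖s.w k‖ = 1) ∧ IsRegular C C₁ Cr Cy β s ∧
      ∃ μ, IsMinOn (softLoss ζ P δ β s) Set.univ μ ∧ ∃ l, 2 / ζ * (3 * a) < |μ l|) ≤
      N * ENNReal.ofReal (featConst (2 * (Cy + 1)) C₁ Cr ε / (meanRadius d * a) ^ 4) := by
  have hn' : (0 : ℝ) < n := by exact_mod_cast hn
  have he : ‖EuclideanSpace.single (0 : Fin d) (1 : ℝ)‖ = 1 := by simp
  refine prob_exists_coord_le hζ continuous_softLoss continuous_softLossGrad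
    (fun s _ => isRidge_softLoss hζ.le hP δ β s) (fun s _ θ v => hasDerivAt_softLoss hn hP v)
    (fun s l v θ hθ => softLoss_setWeight v hθ) he (measurableSet_isRegular (C + 1) C₁ Cr Cy β)
    (fun s l hs => hs.setWeight l he) le_rfl fun s _ hs l θ hθ hle => ?_
  have h0 := hle.trans (softLoss_zero_le hn hP hc hs.labels)
  have hnorm := (isRidge_softLoss hζ.le hP δ β s).norm_sq_le_of_le hζ h0
  have hF : 0 ≤ Cy + 1 := by
    have := (sq_nonneg _).trans hnorm
    exact nonneg_of_mul_nonneg_right this (by positivity)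
  have hb : ∑ i, (∑ a, |softCoef P δ β s θ i a|) ^ 2 ≤ 2 * (Cy + 1) / n := by
    refine (sum_softCoef_sq_le hn hP hζ.le).trans ?_
    rw [mul_comm 2 (Cy + 1), mul_div_assoc, mul_comm]
    gcongr
  refine le_trans (measure_mono fun v hv => ?_) (measure_abs_ge_le_of_pow_four
    (measurable_featSum (softCoef P δ β s θ) fun i a => s.x i + δ a) hR ha
    (lintegral_featSum_pow_four_le hn (by positivity) hC₁ hε hs.covariates hδ hs.radii hb))
  -- The regularizer accounts for at most `a`, so the feature sum exceeds `a`. The threshold `3 * a`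
  -- is shared with the smooth loss, whose gradient has a third term.
  have hv' : 3 * a ≤ |regGrad d ζ θ l - featSum (softCoef P δ β (s.setWeight l v) θ)
    (fun i a => s.x i + δ a) (Function.update s.w l v l)| := hv
  rw [softCoef_setWeight v hθ, Function.update_self] at hv'
  have h1 := (abs_regGrad_le (d := d) hζ.le hθ hnorm).trans hreg
  have h2 := hv'.trans (abs_sub _ _)
  show a ≤ |featSum (softCoef P δ β s θ) (fun i a => s.x i + δ a) v|
  linarith

/-- Smallness of all coordinates of the minimizer of the smooth loss. -/
lemma prob_smoothLoss_coord_le [NeZero d] (hn : 0 < n) (hR : 0 < meanRadius d)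
    (hζ : 0 < ζ) (hε : 0 ≤ ε) (hη : 0 < η) (hη1 : (1 + ε) * η ≤ 1) (hC : 0 ≤ C) (hC₁ : 0 ≤ C₁)
    {a q : ℝ} (ha : 0 < a) (hreg : ζ * (√(Real.log d) / d * √(N * (2 / ζ * (Cy + 1)))) ≤ a)
    (hq : N ≤ q * meanRadius d ^ 2) :
    prob τ (fun s : Sample d N n => (∀ k, ‖s.w k‖ = 1) ∧ IsRegular C C₁ Cr Cy β s ∧
      ∃ μ, IsMinOn (smoothLoss ε ζ η β s) Set.univ μ ∧ ∃ l, 2 / ζ * (3 * a) < |μ l|) ≤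
      N * (ENNReal.ofReal (featConst (2 * (Cy + 1)) C₁ Cr ε / (meanRadius d * a) ^ 4) +
        ENNReal.ofReal (kernelConst (C + 1) (2 / ζ * (Cy + 1)) q /
          (meanRadius d * (a / (√(2 * (Cy + 1)) * (ε / η) + 1))) ^ 4)) := by
  have hn' : (0 : ℝ) < n := by exact_mod_cast hn
  have he : ‖EuclideanSpace.single (0 : Fin d) (1 : ℝ)‖ = 1 := by simp
  refine prob_exists_coord_le hζ continuous_smoothLoss (continuous_smoothLossGrad hη)
    (fun s hs => isRidge_smoothLoss hε hζ.le η β hs)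
    (fun s hs θ v => hasDerivAt_smoothLoss hn hη hs v)
    (fun s l v θ hθ => smoothLoss_setWeight v hθ) he (measurableSet_isRegular (C + 1) C₁ Cr Cy β)
    (fun s l hs => hs.setWeight l he) le_rfl fun s hw1 hs l θ hθ hle => ?_
  have h0 := hle.trans (smoothLoss_zero_le hn hε hη.le hη1 hs.labels)
  have hnorm := (isRidge_smoothLoss hε hζ.le η β hw1).norm_sq_le_of_le hζ h0
  have hF : 0 ≤ Cy + 1 := by
    have := (sq_nonneg _).trans hnorm
    exact nonneg_of_mul_nonneg_right this (by positivity)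
  have hb : ∑ i, (∑ a, |smoothCoef ε η β s θ i a|) ^ 2 ≤ 2 * (Cy + 1) / n := by
    refine (sum_smoothCoef_sq_le hn hε hζ.le).trans ?_
    rw [mul_comm 2 (Cy + 1), mul_div_assoc, mul_comm]
    gcongr
  set c₀ := √(2 * (Cy + 1)) * (ε / η) with hc₀
  have hc₀0 : 0 ≤ c₀ := by positivity
  have hcle : smoothConst ε η β s θ ≤ c₀ :=
    (smoothConst_le hn hε hζ.le hη).trans (by rw [hc₀]; gcongr)
  set Y : EuclideanSpace ℝ (Fin d) → ℝ := fun v => |inner ℝ v (∑ k, θ k • s.w k)| +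
    ∑ k, |θ k| * inner ℝ v (s.w k) ^ 2 with hY
  have hYm : Measurable Y := by
    refine Continuous.measurable ?_
    fun_prop
  have hY0 : ∀ v, 0 ≤ Y v := fun v => by positivity
  have hm1 := measure_abs_ge_le_of_pow_four
    (measurable_featSum (smoothCoef ε η β s θ) fun i _ => s.x i + 0) hR ha
    (lintegral_featSum_pow_four_le hn (by positivity) hC₁ hε hs.covariates
      (δ := fun _ : Unit => 0) (fun _ => by simpa using hε) hs.radii hb)
  -- Below this threshold the kernel term, at most `c₀ * Y v`, is less than `a`; the `+ 1` covers
  -- `c₀ = 0`.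
  have hm2 := measure_abs_ge_le_of_pow_four hYm hR (show 0 < a / (c₀ + 1) by positivity)
    (lintegral_kernel_pow_four_le hR (by linarith) hs.weights hw1 hnorm hq)
  refine le_trans (measure_mono fun v hv => ?_) ((measure_union_le _ _).trans (add_le_add hm1 hm2))
  have hv' : 3 * a ≤ |regGrad d ζ θ l - featSum (smoothCoef ε η β (s.setWeight l v) θ)
    (fun i _ => s.x i + 0) (Function.update s.w l v l) +
      smoothConst ε η β (s.setWeight l v) θ * kGrad (Function.update s.w l v) θ l| := hv
  rw [smoothCoef_setWeight v hθ, smoothConst_setWeight v hθ, Function.update_self] at hv'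
  have h1 := (abs_regGrad_le (d := d) hζ.le hθ hnorm).trans hreg
  by_contra hcon
  rw [Set.mem_union, not_or] at hcon
  have h3 : |featSum (smoothCoef ε η β s θ) (fun i _ => s.x i + 0) v| < a := not_le.1 hcon.1
  have h4 : |Y v| < a / (c₀ + 1) := not_le.1 hcon.2
  rw [abs_of_nonneg (hY0 v), lt_div_iff₀ (by positivity)] at h4
  have h5 := abs_kGrad_update_le (w := s.w) hθ v
  have h6 : |smoothConst ε η β s θ * kGrad (Function.update s.w l v) θ l| ≤ c₀ * Y v := by
    rw [abs_mul, abs_of_nonneg (smoothConst_nonneg hε)]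
    exact mul_le_mul hcle h5 (abs_nonneg _) hc₀0
  have h7 := (hv'.trans (abs_add_le _ _)).trans (add_le_add_left (abs_sub _ _) _)
  linarith [hY0 v]

end Regular

/-! ### The coordinate bounds in the proportional limit. -/

section CoordAsymptotics

variable {N n : ℕ → ℕ} {ψ₁ ψ₂ : ℝ} {τ : ℝ≥0} {ε ζ : ℝ} {C C₁ Cr Cy : ℝ}

/-- `meanRadius d ^ 4` is at least of order `d²` and `N` of order `d`, so the union bound leaves
`O(1 / d)`. A second moment would leave only `O(1)`; hence the fourth moments. -/
lemma tendsto_mul_ofReal_div_meanRadius (hψ₁ : 0 < ψ₁)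
    (hN : Tendsto (fun d => (N d : ℝ) / d) atTop (𝓝 ψ₁)) (H : ℝ) {a : ℝ} (ha : 0 < a) :
    Tendsto (fun d => (N d : ℝ≥0∞) * ENNReal.ofReal (H / (meanRadius d * a) ^ 4)) atTop (𝓝 0) := by
  have h : Tendsto (fun d : ℕ => ENNReal.ofReal (2 * ψ₁ * (16 * |H| / a ^ 4) / d)) atTop (𝓝 0) := by
    rw [← ENNReal.ofReal_zero]
    exact ENNReal.tendsto_ofReal (tendsto_const_div_atTop_nhds_zero_nat _)
  refine tendsto_of_tendsto_of_tendsto_of_le_of_le' tendsto_const_nhds h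
    (Eventually.of_forall fun _ => zero_le) ?_
  filter_upwards [eventually_gt_atTop 0, eventually_le_mul hN (show ψ₁ < 2 * ψ₁ by linarith),
    eventually_le_meanRadius_sq] with d hd hN2 hR
  have hd' : (0 : ℝ) < d := by exact_mod_cast hd
  rw [← ENNReal.ofReal_natCast, ← ENNReal.ofReal_mul (Nat.cast_nonneg _)]
  refine ENNReal.ofReal_le_ofReal ?_
  have h1 : (d / 4 : ℝ) ^ 2 * a ^ 4 ≤ (meanRadius d * a) ^ 4 := by
    rw [mul_pow, show meanRadius d ^ 4 = (meanRadius d ^ 2) ^ 2 by ring]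
    gcongr
  have h2 : H / (meanRadius d * a) ^ 4 ≤ |H| / ((d / 4 : ℝ) ^ 2 * a ^ 4) := by
    refine (div_le_div_of_nonneg_right (le_abs_self H) (by positivity)).trans ?_
    gcongr
  calc _ ≤ 2 * ψ₁ * d * (|H| / ((d / 4 : ℝ) ^ 2 * a ^ 4)) :=
        (mul_le_mul_of_nonneg_left h2 (Nat.cast_nonneg _)).trans (by gcongr)
    _ = _ := by field_simp; norm_num

lemma tendsto_sqrt_log_div : Tendsto (fun d : ℕ => √(Real.log d / d)) atTop (𝓝 0) := by
  have h : Tendsto (fun d : ℕ => Real.log d / d) atTop (𝓝 0) := by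
    have := (Real.isLittleO_log_id_atTop.tendsto_div_nhds_zero).comp
      (tendsto_natCast_atTop_atTop (R := ℝ))
    exact this
  simpa using h.sqrt

lemma eventually_regGrad_le (hψ₁ : 0 < ψ₁)
    (hN : Tendsto (fun d => (N d : ℝ) / d) atTop (𝓝 ψ₁)) (hζ : 0 ≤ ζ) {T a : ℝ} (hT : 0 ≤ T)
    (ha : 0 < a) : ∀ᶠ d : ℕ in atTop, ζ * (√(Real.log d) / d * √(N d * T)) ≤ a := by
  have h := tendsto_sqrt_log_div.const_mul (ζ * √(2 * ψ₁ * T))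
  rw [mul_zero] at h
  filter_upwards [eventually_gt_atTop 0, eventually_le_mul hN (show ψ₁ < 2 * ψ₁ by linarith),
    h.eventually_le_const ha] with d hd hN2 hd2
  have hd' : (0 : ℝ) < d := by exact_mod_cast hd
  refine le_trans ?_ hd2
  rw [mul_assoc]
  refine mul_le_mul_of_nonneg_left ?_ hζ
  calc _ ≤ √(Real.log d) / d * √(2 * ψ₁ * d * T) := by gcongr
    _ = _ := by
      rw [show 2 * ψ₁ * d * T = 2 * ψ₁ * T * d by ring, Real.sqrt_mul (by positivity) (d : ℝ),
        Real.sqrt_div' _ hd'.le]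
      have h3 := Real.mul_self_sqrt hd'.le
      have h4 : √(d : ℝ) ≠ 0 := by positivity
      field_simp
      rw [sq, h3]
      ring

/-- The bound for fixed `d` contains neither the number of perturbations nor the inverse
temperature, so both may vary with `d` subject to `hc`. -/
lemma tendsto_prob_softLoss_coord (hψ₁ : 0 < ψ₁) (hψ₂ : 0 < ψ₂)
    (hN : Tendsto (fun d => (N d : ℝ) / d) atTop (𝓝 ψ₁))
    (hn : Tendsto (fun d => (n d : ℝ) / d) atTop (𝓝 ψ₂)) (β : ∀ d, EuclideanSpace ℝ (Fin d))
    (hζ : 0 < ζ) (hε : 0 ≤ ε) {ι : ℕ → Type*} [∀ d, Fintype (ι d)] [∀ d, Nonempty (ι d)]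
    {P : ℕ → ℝ} (hP : ∀ d, 0 < P d) {δ : ∀ d, ι d → EuclideanSpace ℝ (Fin d)}
    (hδ : ∀ d a, ‖δ d a‖ ≤ ε) (hc : ∀ d, Real.log (Fintype.card (ι d)) / P d ≤ 1)
    (hC₁ : 0 ≤ C₁) (hCy : 0 ≤ Cy) {κ : ℝ} (hκ : 0 < κ) :
    Tendsto (fun d => prob τ fun s : Sample d (N d) (n d) => (∀ k, ‖s.w k‖ = 1) ∧
      IsRegular C C₁ Cr Cy (β d) s ∧ ∃ μ, IsMinOn (softLoss ζ (P d) (δ d) (β d) s) Set.univ μ ∧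
        ∃ l, κ < |μ l|) atTop (𝓝 0) := by
  -- This value of `a` solves `2 / ζ * (3 * a) = κ`.
  have ha : 0 < ζ * κ / 6 := by positivity
  refine tendsto_of_tendsto_of_tendsto_of_le_of_le' tendsto_const_nhds
    (tendsto_mul_ofReal_div_meanRadius hψ₁ hN (featConst (2 * (Cy + 1)) C₁ Cr ε) ha)
    (Eventually.of_forall fun _ => zero_le) ?_
  filter_upwards [eventually_gt_atTop 0, eventually_mul_le hn (show ψ₂ / 2 < ψ₂ by linarith),
    eventually_le_meanRadius_sq, eventually_regGrad_le hψ₁ hN hζ.le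
      (T := 2 / ζ * (Cy + 1)) (by positivity) ha] with d hd hn1 hR hreg
  have : NeZero d := ⟨hd.ne'⟩
  have hd' : (0 : ℝ) < d := by exact_mod_cast hd
  have hnpos : 0 < n d := by
    have : (0 : ℝ) < n d := lt_of_lt_of_le (by positivity) hn1
    exact_mod_cast this
  have hR0 : 0 < meanRadius d := by
    refine lt_of_le_of_ne meanRadius_nonneg fun h => ?_
    rw [← h] at hR
    have : (0 : ℝ) < d / 4 := by positivity
    linarith
  have h := prob_softLoss_coord_le (τ := τ) (N := N d) (n := n d) (C := C) (Cr := Cr) (β := β d)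
    hnpos hR0 hζ hε (hP d) hC₁ (hδ d) (hc d) ha hreg
  rwa [show 2 / ζ * (3 * (ζ * κ / 6)) = κ by field_simp; norm_num] at h

lemma tendsto_prob_smoothLoss_coord (hψ₁ : 0 < ψ₁) (hψ₂ : 0 < ψ₂)
    (hN : Tendsto (fun d => (N d : ℝ) / d) atTop (𝓝 ψ₁))
    (hn : Tendsto (fun d => (n d : ℝ) / d) atTop (𝓝 ψ₂)) (β : ∀ d, EuclideanSpace ℝ (Fin d))
    (hζ : 0 < ζ) (hε : 0 ≤ ε) {η : ℝ} (hη : 0 < η) (hη1 : (1 + ε) * η ≤ 1) (hC : 0 ≤ C)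
    (hC₁ : 0 ≤ C₁) (hCy : 0 ≤ Cy) {κ : ℝ} (hκ : 0 < κ) :
    Tendsto (fun d => prob τ fun s : Sample d (N d) (n d) => (∀ k, ‖s.w k‖ = 1) ∧
      IsRegular C C₁ Cr Cy (β d) s ∧ ∃ μ, IsMinOn (smoothLoss ε ζ η (β d) s) Set.univ μ ∧
        ∃ l, κ < |μ l|) atTop (𝓝 0) := by
  have ha : 0 < ζ * κ / 6 := by positivity
  have hlim := (tendsto_mul_ofReal_div_meanRadius hψ₁ hN (featConst (2 * (Cy + 1)) C₁ Cr ε)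
    ha).add (tendsto_mul_ofReal_div_meanRadius hψ₁ hN
      (kernelConst (C + 1) (2 / ζ * (Cy + 1)) (8 * ψ₁))
      (a := ζ * κ / 6 / (√(2 * (Cy + 1)) * (ε / η) + 1)) (by positivity))
  rw [add_zero] at hlim
  refine tendsto_of_tendsto_of_tendsto_of_le_of_le' tendsto_const_nhds hlim
    (Eventually.of_forall fun _ => zero_le) ?_
  filter_upwards [eventually_gt_atTop 0, eventually_mul_le hn (show ψ₂ / 2 < ψ₂ by linarith),
    eventually_le_meanRadius_sq, eventually_regGrad_le hψ₁ hN hζ.le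
      (T := 2 / ζ * (Cy + 1)) (by positivity) ha,
    eventually_le_mul hN (show ψ₁ < 2 * ψ₁ by linarith)] with d hd hn1 hR hreg hN2
  have : NeZero d := ⟨hd.ne'⟩
  have hd' : (0 : ℝ) < d := by exact_mod_cast hd
  have hnpos : 0 < n d := by
    have : (0 : ℝ) < n d := lt_of_lt_of_le (by positivity) hn1
    exact_mod_cast this
  have hR0 : 0 < meanRadius d := by
    refine lt_of_le_of_ne meanRadius_nonneg fun h => ?_
    rw [← h] at hR
    have : (0 : ℝ) < d / 4 := by positivity
    linarith
  have hq : (N d : ℝ) ≤ 8 * ψ₁ * meanRadius d ^ 2 := by nlinarith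
  have h := prob_smoothLoss_coord_le (τ := τ) (N := N d) (n := n d) (C := C) (Cr := Cr) (β := β d)
    hnpos hR0 hζ hε hη hη1 hC hC₁ ha hreg hq
  rw [mul_add] at h
  rwa [show 2 / ζ * (3 * (ζ * κ / 6)) = κ by field_simp; norm_num] at h

end CoordAsymptotics

/-! ### Regular samples have probability close to one. -/

section Tightness

section Fixed

variable {d N n : ℕ} {τ : ℝ≥0}

lemma prob_not_sum_le (hn : 0 < n) {g : Fin n → Triple d N n → ℝ} (hg : ∀ i, Measurable (g i))
    (hg0 : ∀ i p, 0 ≤ g i p) {V A : ℝ} (hA : 0 < A)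
    (h : ∀ i, ∫⁻ p, ENNReal.ofReal (g i p) ∂jointLaw d N n τ ≤ ENNReal.ofReal V) :
    jointLaw d N n τ {p | ¬ ∑ i, g i p ≤ A * n} ≤ ENNReal.ofReal (V / A) := by
  have hn' : (0 : ℝ) < n := by exact_mod_cast hn
  have hAn : 0 < A * n := by positivity
  have h1 := meas_ge_le_lintegral_div (μ := jointLaw d N n τ)
    (f := fun p => ENNReal.ofReal (∑ i, g i p)) (by fun_prop) (ε := ENNReal.ofReal (A * n))
    (by simpa using hAn) ENNReal.ofReal_ne_top
  refine (measure_mono fun p hp => ENNReal.ofReal_le_ofReal (not_le.1 hp).le).trans (h1.trans ?_)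
  have h2 : ∫⁻ p, ENNReal.ofReal (∑ i, g i p) ∂jointLaw d N n τ ≤ ENNReal.ofReal (n * V) := by
    simp_rw [ENNReal.ofReal_sum_of_nonneg fun i _ => hg0 i _]
    rw [lintegral_finsetSum _ fun i _ => by fun_prop]
    refine (Finset.sum_le_sum fun i _ => h i).trans (le_of_eq ?_)
    rw [Finset.sum_const, Finset.card_univ, Fintype.card_fin, nsmul_eq_mul,
      ENNReal.ofReal_mul (Nat.cast_nonneg n), ENNReal.ofReal_natCast]
  refine (ENNReal.div_le_div_right h2 _).trans (le_of_eq ?_)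
  rw [← ENNReal.ofReal_div_of_pos hAn]
  congr 1
  field_simp

variable [NeZero d]

lemma measurePreserving_covariate (i : Fin n) :
    MeasurePreserving (fun p : Triple d N n => p.2.1 i) (jointLaw d N n τ)
      (stdGaussian (EuclideanSpace ℝ (Fin d))) :=
  (measurePreserving_eval (fun _ : Fin n => stdGaussian (EuclideanSpace ℝ (Fin d))) i).comp
    (measurePreserving_fst.comp measurePreserving_snd)

lemma measurePreserving_noise (i : Fin n) :
    MeasurePreserving (fun p : Triple d N n => p.2.2 i) (jointLaw d N n τ)
      (gaussianReal 0 (τ ^ 2)) :=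
  (measurePreserving_eval (fun _ : Fin n => gaussianReal 0 (τ ^ 2)) i).comp
    (measurePreserving_snd.comp measurePreserving_snd)

lemma lintegral_norm_sub_meanRadius_sq_le :
    ∫⁻ x, ENNReal.ofReal ((‖x‖ - meanRadius d) ^ 2) ∂stdGaussian (EuclideanSpace ℝ (Fin d)) ≤
      ENNReal.ofReal (4 * gaussMoment 4) := by
  have hg := gaussMoment_nonneg 4
  have hm : (meanRadius d - √d) ^ 2 ≤ gaussMoment 4 := meanRadius_sub_sqrt_sq_le
  calc _ ≤ ∫⁻ x, (ENNReal.ofReal 2 * ENNReal.ofReal ((‖x‖ - √d) ^ 2) +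
        ENNReal.ofReal (2 * gaussMoment 4)) ∂stdGaussian (EuclideanSpace ℝ (Fin d)) := by
        refine lintegral_mono fun x => ?_
        rw [← ENNReal.ofReal_mul (by norm_num), ← ENNReal.ofReal_add (by positivity) (by positivity)]
        refine ENNReal.ofReal_le_ofReal ?_
        nlinarith [sq_nonneg (‖x‖ - √d + (meanRadius d - √d))]
    _ ≤ ENNReal.ofReal 2 * ENNReal.ofReal (gaussMoment 4) + ENNReal.ofReal (2 * gaussMoment 4) := by
        rw [lintegral_add_right _ measurable_const, lintegral_const_mul' _ _ ENNReal.ofReal_ne_top,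
          lintegral_const, measure_univ, mul_one]
        gcongr
        exact lintegral_norm_sub_sqrt_sq_le
    _ = _ := by
        rw [← ENNReal.ofReal_mul (by norm_num), ← ENNReal.ofReal_add (by positivity) (by positivity)]
        congr 1; ring

/-- The second moment of the label noise. -/
def noiseMoment (τ : ℝ≥0) : ℝ := ∫ t, t ^ 2 ∂gaussianReal 0 (τ ^ 2)

lemma noiseMoment_nonneg : 0 ≤ noiseMoment τ := integral_nonneg fun _ => sq_nonneg _

lemma lintegral_sq_noise :
    ∫⁻ t, ENNReal.ofReal (t ^ 2) ∂gaussianReal 0 (τ ^ 2) = ENNReal.ofReal (noiseMoment τ) := by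
  rw [noiseMoment, ofReal_integral_eq_lintegral_ofReal]
  · have := (IsGaussian.memLp_id (gaussianReal 0 (τ ^ 2)) 2 (by simp)).integrable_norm_pow'
    simpa using this
  · exact ae_of_all _ fun _ => by positivity

lemma lintegral_label_sq_le (β : EuclideanSpace ℝ (Fin d)) (i : Fin n) :
    ∫⁻ p, ENNReal.ofReal (label β (Sample.ofTriple p : Sample d N n) i ^ 2) ∂jointLaw d N n τ ≤
      ENNReal.ofReal (2 * (‖β‖ ^ 2 * gaussMoment 2) + 2 * noiseMoment τ) := by
  have hg := gaussMoment_nonneg 2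
  have hv := noiseMoment_nonneg (τ := τ)
  have h1 : ∫⁻ p : Triple d N n, ENNReal.ofReal (|inner ℝ β (p.2.1 i)| ^ 2) ∂jointLaw d N n τ =
      ENNReal.ofReal (‖β‖ ^ 2 * gaussMoment 2) := by
    rw [← lintegral_inner_pow_stdGaussian β 2, ← (measurePreserving_covariate (d := d) (N := N) (τ := τ)
      i).lintegral_comp (by fun_prop)]
  have h2 : ∫⁻ p : Triple d N n, ENNReal.ofReal (p.2.2 i ^ 2) ∂jointLaw d N n τ =
      ENNReal.ofReal (noiseMoment τ) := by
    rw [← lintegral_sq_noise, ← (measurePreserving_noise (d := d) (N := N) (τ := τ)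
      i).lintegral_comp (by fun_prop)]
  calc _ ≤ ∫⁻ p : Triple d N n, (ENNReal.ofReal 2 * ENNReal.ofReal (|inner ℝ β (p.2.1 i)| ^ 2) +
        ENNReal.ofReal 2 * ENNReal.ofReal (p.2.2 i ^ 2)) ∂jointLaw d N n τ := by
        refine lintegral_mono fun p => ?_
        rw [← ENNReal.ofReal_mul (by norm_num), ← ENNReal.ofReal_mul (by norm_num),
          ← ENNReal.ofReal_add (by positivity) (by positivity)]
        refine ENNReal.ofReal_le_ofReal ?_
        rw [sq_abs, label, real_inner_comm]
        simp only [Sample.ofTriple]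
        nlinarith [sq_nonneg (inner ℝ β (p.2.1 i) - p.2.2 i)]
    _ = _ := by
        rw [lintegral_add_left (by fun_prop), lintegral_const_mul' _ _ ENNReal.ofReal_ne_top,
          lintegral_const_mul' _ _ ENNReal.ofReal_ne_top, h1, h2, ← ENNReal.ofReal_mul (by norm_num),
          ← ENNReal.ofReal_mul (by norm_num), ← ENNReal.ofReal_add (by positivity) (by positivity)]

end Fixed

variable {N n : ℕ → ℕ} {ψ₁ ψ₂ : ℝ}

/-- Samples are regular with probability arbitrarily close to one. -/
lemma exists_isRegular (hψ₁ : 0 < ψ₁) (hψ₂ : 0 < ψ₂)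
    (hN : Tendsto (fun d => (N d : ℝ) / d) atTop (𝓝 ψ₁))
    (hn : Tendsto (fun d => (n d : ℝ) / d) atTop (𝓝 ψ₂)) {β : ∀ d, EuclideanSpace ℝ (Fin d)}
    (hβ : Tendsto (fun d => ‖β d‖) atTop (𝓝 1)) (τ : ℝ≥0) {e : ℝ} (he : 0 < e) :
    ∃ C C₁ Cr Cy : ℝ, 0 < C ∧ 0 ≤ C₁ ∧ 0 ≤ Cy ∧ ∀ᶠ d in atTop,
      prob τ (fun s : Sample d (N d) (n d) => ¬ ((∀ k, ‖s.w k‖ = 1) ∧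
        IsRegular C C₁ Cr Cy (β d) s)) ≤ ENNReal.ofReal e := by
  obtain ⟨C, hC, hW⟩ := exists_tendsto_weights hψ₁ hN
  obtain ⟨C', hC', hX⟩ := exists_tendsto_covariates hψ₂ hn
  have hg4 := gaussMoment_nonneg 4
  have hg2 := gaussMoment_nonneg 2
  have hv := noiseMoment_nonneg (τ := τ)
  have he4 : 0 < ENNReal.ofReal (e / 4) := by simpa using he
  set Vr := 4 * gaussMoment 4 with hVr
  set Vy := 2 * (2 ^ 2 * gaussMoment 2) + 2 * noiseMoment τ with hVy
  have hVr0 : 0 ≤ Vr := by positivity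
  have hVy0 : 0 ≤ Vy := by positivity
  -- `2 * C' / ψ₂` converts the factor `d` into `n`. The last two constants make Markov's inequality
  -- give at most `e / 4` each; since only second moments are used, they depend on `e`.
  refine ⟨C, 2 * C' / ψ₂, (Vr + 1) / (e / 4), (Vy + 1) / (e / 4), hC, by positivity, by positivity, ?_⟩
  filter_upwards [eventually_gt_atTop 0, eventually_mul_le hn (show ψ₂ / 2 < ψ₂ by linarith),
    hW.eventually_le_const he4, hX.eventually_le_const he4,
    hβ.eventually_le_const (show (1 : ℝ) < 2 by norm_num)] with d hd hn1 hW hX hβ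
  have : NeZero d := ⟨hd.ne'⟩
  have hd' : (0 : ℝ) < d := by exact_mod_cast hd
  have hnpos : 0 < n d := by
    have : (0 : ℝ) < n d := lt_of_lt_of_le (by positivity) hn1
    exact_mod_cast this
  have hrat : ∀ V : ℝ, 0 ≤ V → V / ((V + 1) / (e / 4)) ≤ e / 4 := by
    intro V hV
    rw [div_div_eq_mul_div, div_le_iff₀ (by positivity)]
    nlinarith
  have hcov : C' * d ≤ 2 * C' / ψ₂ * n d := by
    have := mul_le_mul_of_nonneg_left hn1 (show 0 ≤ 2 * C' / ψ₂ by positivity)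
    calc C' * d = 2 * C' / ψ₂ * (ψ₂ / 2 * d) := by field_simp
      _ ≤ _ := this
  have hsub : ∀ s : Sample d (N d) (n d), ¬ ((∀ k, ‖s.w k‖ = 1) ∧
      IsRegular C (2 * C' / ψ₂) ((Vr + 1) / (e / 4)) ((Vy + 1) / (e / 4)) (β d) s) →
      (¬ (OpBound s.w C ∧ ∀ l, ‖s.w l‖ = 1) ∨ ¬ OpBound s.x (C' * d)) ∨
      (¬ ∑ i, (‖s.x i‖ - meanRadius d) ^ 2 ≤ (Vr + 1) / (e / 4) * n d ∨
        ¬ ∑ i, label (β d) s i ^ 2 ≤ (Vy + 1) / (e / 4) * n d) := by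
    intro s hs
    by_contra hcon
    push Not at hcon
    obtain ⟨⟨⟨h1, h2⟩, h3⟩, h4, h5⟩ := hcon
    exact hs ⟨h2, h1, fun u => (h3 u).trans (by gcongr), h4, h5⟩
  refine (prob_mono hsub).trans ((prob_or_le _ _).trans ((add_le_add ((prob_or_le _ _).trans
    (add_le_add (b := ENNReal.ofReal (e / 4)) (d := ENNReal.ofReal (e / 4)) ?_ ?_))
    ((prob_or_le _ _).trans
    (add_le_add (b := ENNReal.ofReal (e / 4)) (d := ENNReal.ofReal (e / 4)) ?_ ?_))).trans
    (le_of_eq ?_)))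
  · rw [prob_weights fun w => ¬ (OpBound w C ∧ ∀ l, ‖w l‖ = 1)]
    exact hW
  · rw [prob_covariates fun x => ¬ OpBound x (C' * d)]
    exact hX
  · refine (prob_not_sum_le hnpos (g := fun i p => (‖p.2.1 i‖ - meanRadius d) ^ 2)
      (fun i => by fun_prop) (fun i p => sq_nonneg _) (by positivity) fun i => ?_).trans
      (ENNReal.ofReal_le_ofReal (hrat Vr hVr0))
    rw [(measurePreserving_covariate (N := N d) (τ := τ) i).lintegral_comp
      (f := fun x => ENNReal.ofReal ((‖x‖ - meanRadius d) ^ 2)) (by fun_prop)]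
    exact lintegral_norm_sub_meanRadius_sq_le
  · refine (prob_not_sum_le hnpos (g := fun i p => label (β d) (Sample.ofTriple p) i ^ 2)
      (fun i => ?_) (fun i p => sq_nonneg _) (by positivity) fun i => ?_).trans
      (ENNReal.ofReal_le_ofReal (hrat Vy hVy0))
    · unfold label Sample.ofTriple
      fun_prop
    · refine (lintegral_label_sq_le (β d) i).trans (ENNReal.ofReal_le_ofReal ?_)
      rw [hVy]
      gcongr
  · rw [← ENNReal.ofReal_add (by positivity) (by positivity),
      ← ENNReal.ofReal_add (by positivity) (by positivity)]
    congr 1; ring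

end Tightness

/-! ### Merging of the minimizers, and the uniform relative gap. -/

section Minimizers

/-- Minimizers of two ridge losses `L` and `S` are close when `S` and `L` have surrogates `A` and `B`
whose minimizers are parameters at which `S` and `L` are close. -/
lemma norm_sub_sq_le_of_surrogates {N : ℕ} {ζ : ℝ} (hζ : 0 < ζ)
    {L S A B : EuclideanSpace ℝ (Fin N) → ℝ} (hL : IsRidge ζ L) (hS : IsRidge ζ S)
    {e K : ℝ} (he : 0 ≤ e) (he1 : e ≤ 1) (hSA : ∀ θ, S θ ≤ A θ)
    (hAS : ∀ θ, A θ ≤ (1 + e) * S θ + e * (1 + e)) (hBL : ∀ θ, B θ ≤ L θ + e / 2)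
    {θL θS μA μB : EuclideanSpace ℝ (Fin N)} (hθL : IsMinOn L Set.univ θL)
    (hθS : IsMinOn S Set.univ θS) (hμA : IsMinOn A Set.univ μA) (hμB : IsMinOn B Set.univ μB)
    (hLB : L μB ≤ (1 + e) * B μB + e * (1 + e)) (hA : A μA ≤ K) (hB : B μB ≤ K)
    (hgA : |S μA - L μA| ≤ e * (1 + min (L μA) (S μA)))
    (hgB : |S μB - L μB| ≤ e * (1 + min (L μB) (S μB))) :
    ‖θS - θL‖ ^ 2 ≤ 4 / ζ * (e * (9 * K + 16)) := by
  have hS0 : ∀ θ, 0 ≤ S θ := fun θ => (by positivity : 0 ≤ ζ / 2 * ‖θ‖ ^ 2).trans (hS.lower θ)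
  have hK : 0 ≤ K := ((hS0 μA).trans (hSA μA)).trans hA
  have m1 : B μB ≤ B θL := hμB (Set.mem_univ _)
  have m2 : A μA ≤ A μB := hμA (Set.mem_univ _)
  have m3 : A μA ≤ A θS := hμA (Set.mem_univ _)
  have m4 : S θS ≤ S μA := hθS (Set.mem_univ _)
  have hee : e * e ≤ e := mul_le_of_le_one_right he he1
  have b1 : e * B μB ≤ e * K := mul_le_mul_of_nonneg_left hB he
  have b2 : e * S μA ≤ e * K := mul_le_mul_of_nonneg_left ((hSA μA).trans hA) he
  have b3 : e * S θS ≤ e * K := mul_le_mul_of_nonneg_left (m4.trans ((hSA μA).trans hA)) he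
  have heK : e * K ≤ K := mul_le_of_le_one_left hK he1
  have c1 : L μA ≤ S μA + e * (1 + S μA) := by
    have h1 := (abs_le.1 hgA).1
    have h2 := mul_le_mul_of_nonneg_left (min_le_right (L μA) (S μA)) he
    linarith
  have c2 : S μB ≤ L μB + e * (1 + L μB) := by
    have h1 := (abs_le.1 hgB).2
    have h2 := mul_le_mul_of_nonneg_left (min_le_left (L μB) (S μB)) he
    linarith
  have c3 : L μB ≤ B μB + e * (K + 2) := by linarith
  have c4 : e * L μB ≤ e * (2 * K + 2) := mul_le_mul_of_nonneg_left (by linarith) he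
  have c5 : S μB ≤ B μB + e * (3 * K + 5) := by linarith
  have c6 : e * S μB ≤ e * (4 * K + 5) := mul_le_mul_of_nonneg_left (by linarith) he
  -- `A μA ≤ A μB`, then `A` is compared with `S`, `S` with `L`, and `L` with `B`, all at `μB`.
  have c7 : A μA ≤ B μB + e * (7 * K + 12) := by linarith [hAS μB]
  -- `B μB ≤ B θL ≤ L θL + e / 2` closes the chain, so `μA` nearly minimizes `L`; it nearly
  -- minimizes `S` through `A μA ≤ A θS`. Thus `μA` is close to both minimizers.
  have d1 : L μA - L θL ≤ e * (8 * K + 14) := by linarith [hBL θL, hSA μA]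
  have d2 : S μA - S θS ≤ e * (K + 2) := by linarith [hAS θS, hSA μA]
  have r1 := hL.add_le_of_isMinOn convex_univ (Set.mem_univ _) hθL (Set.mem_univ μA)
  have r2 := hS.add_le_of_isMinOn convex_univ (Set.mem_univ _) hθS (Set.mem_univ μA)
  have r3 : ‖θS - θL‖ ≤ ‖μA - θS‖ + ‖μA - θL‖ := by
    rw [show θS - θL = (μA - θL) - (μA - θS) by abel]
    exact (norm_sub_le _ _).trans (by linarith)
  have r4 : ‖θS - θL‖ ^ 2 ≤ 2 * (‖μA - θS‖ ^ 2 + ‖μA - θL‖ ^ 2) := by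
    refine (pow_le_pow_left₀ (norm_nonneg _) r3 2).trans ?_
    linarith [sq_nonneg (‖μA - θS‖ - ‖μA - θL‖)]
  have r5 : ζ / 2 * (‖μA - θS‖ ^ 2 + ‖μA - θL‖ ^ 2) ≤ e * (9 * K + 16) := by linarith
  calc _ ≤ _ := r4
    _ = 4 / ζ * (ζ / 2 * (‖μA - θS‖ ^ 2 + ‖μA - θL‖ ^ 2)) := by field_simp; norm_num; ring
    _ ≤ _ := mul_le_mul_of_nonneg_left r5 (by positivity)

variable {N n : ℕ → ℕ} {ψ₁ ψ₂ : ℝ}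

/-- The minimizers of the robust loss and of the simplified loss merge in probability. -/
theorem tendsto_prob_minimizers (hψ₁ : 0 < ψ₁) (hψ₂ : 0 < ψ₂)
    (hN : Tendsto (fun d => (N d : ℝ) / d) atTop (𝓝 ψ₁))
    (hn : Tendsto (fun d => (n d : ℝ) / d) atTop (𝓝 ψ₂)) {β : ∀ d, EuclideanSpace ℝ (Fin d)}
    (hβ : Tendsto (fun d => ‖β d‖) atTop (𝓝 1)) (τ : ℝ≥0) {ε ζ : ℝ} (hε : 0 < ε) (hζ : 0 < ζ)
    {θhat θoo : ∀ d, Sample d (N d) (n d) → EuclideanSpace ℝ (Fin (N d))}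
    (hhat : ∀ d s, IsMinOn (robustLoss ε ζ (β d) s) Set.univ (θhat d s))
    (hoo : ∀ d s, IsMinOn (simplifiedLoss ε ζ (β d) s) Set.univ (θoo d s)) {t : ℝ} (ht : 0 < t) :
    Tendsto (fun d => prob τ fun s : Sample d (N d) (n d) => t < ‖θoo d s - θhat d s‖) atTop
      (𝓝 0) := by
  rw [ENNReal.tendsto_nhds_zero]
  intro e₀ he₀
  obtain ⟨r, hr, hre⟩ : ∃ r : ℝ, 0 < r ∧ ENNReal.ofReal r ≤ e₀ := by
    obtain ⟨r, -, hr, hre⟩ := ENNReal.lt_iff_exists_real_btwn.1 he₀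
    exact ⟨r, by simpa using hr, hre.le⟩
  -- The regularity constants depend on the tolerated probability `r / 2`, so they are fixed before
  -- all other parameters.
  obtain ⟨C, C₁, Cr, Cy, hC, hC₁, hCy, hreg⟩ :=
    exists_isRegular hψ₁ hψ₂ hN hn hβ τ (show 0 < r / 2 by positivity)
  set K := Cy + 1 with hK
  have hK0 : 0 < K := by positivity
  obtain ⟨e, he, he1, het⟩ : ∃ e > 0, e ≤ 1 ∧ 4 / ζ * (e * (9 * K + 16)) ≤ t ^ 2 := by
    refine ⟨min 1 (t ^ 2 / (4 / ζ * (9 * K + 16))), by positivity, min_le_left _ _, ?_⟩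
    have h := min_le_right 1 (t ^ 2 / (4 / ζ * (9 * K + 16)))
    rw [le_div_iff₀ (by positivity)] at h
    linarith
  -- The ridge lower bound puts every parameter with surrogate loss at most `K`, in particular both
  -- surrogate minimizers, in the ball of radius `C₀`.
  set C₀ := √(2 / ζ * K) with hC₀
  have hC₀0 : 0 < C₀ := by positivity
  obtain ⟨κ, hκ, hgap⟩ := exists_tendsto_prob_gap hψ₁ hψ₂ hN hn β τ hε hζ.le hC₀0 he
  have hη : 0 < e / (1 + ε) := by positivity
  have hηe : (1 + ε) * (e / (1 + ε)) = e := by field_simp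
  have hρ : 0 < e / (√C * C₀) := by positivity
  have hρe : √C * C₀ * (e / (√C * C₀)) = e := by field_simp
  choose T hTS hTc hTn using fun d => exists_net (E := EuclideanSpace ℝ (Fin d)) hε.le hρ
    {x | ‖x‖ ≤ ε} fun x hx => hx
  have hne : ∀ d, Nonempty (T d) := fun d => by
    obtain ⟨a, ha, -⟩ := hTn d 0 (by simpa using hε.le)
    exact ⟨⟨a, ha⟩⟩
  have hlog : ∀ d, 0 ≤ Real.log (Fintype.card (T d)) := fun d => Real.log_natCast_nonneg _
  -- The inverse temperature makes the soft-max error at most `e`; the `+ 1` keeps it positive when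
  -- the net is a single point.
  set P : ℕ → ℝ := fun d => Real.log (Fintype.card (T d)) / e + 1 with hPdef
  have hP : ∀ d, 0 < P d := fun d => by have := hlog d; positivity
  have hPe : ∀ d, Real.log (Fintype.card (T d)) / P d ≤ e := fun d => by
    rw [div_le_iff₀ (hP d), hPdef]
    have : e * (Real.log (Fintype.card (T d)) / e + 1) = Real.log (Fintype.card (T d)) + e := by
      field_simp
    linarith
  have hδ : ∀ d (a : T d), ‖(a : EuclideanSpace ℝ (Fin d))‖ ≤ ε := fun d a => hTS d a a.2
  have hA := tendsto_prob_smoothLoss_coord (τ := τ) (C := C) (C₁ := C₁) (Cr := Cr) (Cy := Cy) hψ₁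
    hψ₂ hN hn β hζ hε.le hη (hηe.trans_le he1) hC.le hC₁ hCy hκ
  have hB := tendsto_prob_softLoss_coord (τ := τ) (C := C) (C₁ := C₁) (Cr := Cr) (Cy := Cy) hψ₁
    hψ₂ hN hn β hζ hε.le hP (δ := fun d (a : T d) => (a : EuclideanSpace ℝ (Fin d))) hδ
    (fun d => (hPe d).trans he1) hC₁ hCy hκ
  have hlim := (hgap.add (hA.add hB))
  simp only [add_zero] at hlim
  have hr2 : 0 < ENNReal.ofReal (r / 2) := by simpa using hr
  filter_upwards [eventually_gt_atTop 0, eventually_mul_le hn (show ψ₂ / 2 < ψ₂ by linarith), hreg,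
    hlim.eventually_le_const hr2] with d hd hn1 hreg hlim
  have hd' : (0 : ℝ) < d := by exact_mod_cast hd
  have hnpos : 0 < n d := by
    have : (0 : ℝ) < n d := lt_of_lt_of_le (by positivity) hn1
    exact_mod_cast this
  refine le_trans (le_trans ?_ (add_le_add hreg hlim)) (le_trans (le_of_eq ?_) hre)
  swap
  · rw [← ENNReal.ofReal_add (by positivity) (by positivity), add_halves]
  refine le_trans (prob_mono fun s hs => ?_) ((prob_or_le _ _).trans (add_le_add le_rfl
    ((prob_or_le _ _).trans (add_le_add le_rfl (prob_or_le _ _)))))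
  by_contra hcon
  simp only [not_or, not_not] at hcon
  obtain ⟨⟨hw1, hs0⟩, hg, ha, hb⟩ := hcon
  have ridgeA := isRidge_smoothLoss hε.le hζ.le (e / (1 + ε)) (β d) hw1
  have ridgeB := isRidge_softLoss hζ.le (hP d) (fun a : T d => (a : EuclideanSpace ℝ (Fin d)))
    (β d) s
  obtain ⟨μA, hμA, -⟩ := ridgeA.existsUnique hζ
  obtain ⟨μB, hμB, -⟩ := ridgeB.existsUnique hζ
  have hAK := (hμA (Set.mem_univ 0)).out.trans
    (smoothLoss_zero_le hnpos hε.le hη.le (hηe.trans_le he1) hs0.labels)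
  have hBK := (hμB (Set.mem_univ 0)).out.trans
    (softLoss_zero_le hnpos (hP d) ((hPe d).trans he1) hs0.labels)
  have hAn : ‖μA‖ ≤ C₀ := Real.le_sqrt_of_sq_le (ridgeA.norm_sq_le_of_le hζ hAK)
  have hBn : ‖μB‖ ≤ C₀ := Real.le_sqrt_of_sq_le (ridgeB.norm_sq_le_of_le hζ hBK)
  have hgap' : ∀ μ : EuclideanSpace ℝ (Fin (N d)), ‖μ‖ ≤ C₀ → (¬ ∃ l, κ < |μ l|) →
      |simplifiedLoss ε ζ (β d) s μ - robustLoss ε ζ (β d) s μ| ≤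
        e * (1 + min (robustLoss ε ζ (β d) s μ) (simplifiedLoss ε ζ (β d) s μ)) := by
    intro μ hμ hl
    by_contra hbad
    exact hg ⟨μ, hμ, fun l => not_lt.1 fun h => hl ⟨l, h⟩, hbad⟩
  have hfin := norm_sub_sq_le_of_surrogates hζ (isRidge_robustLoss hε.le hζ.le (β d) s)
    (isRidge_simplifiedLoss hε.le hζ.le (β d) s) he.le he1
    (fun θ => simplifiedLoss_le_smoothLoss hε.le hw1)
    (fun θ => smoothLoss_le_simplifiedLoss hnpos hε.le hζ.le hη.le hηe.le hw1)
    (fun θ => softLoss_le_robustLoss hnpos (hP d) (hδ d) (hPe d))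
    (hhat d s) (hoo d s) hμA hμB
    (robustLoss_le_softLoss hnpos hε.le (hP d) hζ.le (fun x hx => by
      obtain ⟨a, haT, hax⟩ := hTn d x hx
      exact ⟨⟨a, haT⟩, hax⟩) hC.le hs0.weights hBn hρe.le he.le)
    hAK hBK
    (hgap' μA hAn fun h => ha ⟨hw1, hs0, μA, hμA, h⟩)
    (hgap' μB hBn fun h => hb ⟨hw1, hs0, μB, hμB, h⟩)
  exact absurd (hfin.trans het) (not_le.2 (pow_lt_pow_left₀ hs ht.le two_ne_zero))

/-- Uniform relative closeness of the two losses over `paramSet`. -/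
theorem tendsto_prob_supRelGap (hψ₁ : 0 < ψ₁) (hψ₂ : 0 < ψ₂)
    (hN : Tendsto (fun d => (N d : ℝ) / d) atTop (𝓝 ψ₁))
    (hn : Tendsto (fun d => (n d : ℝ) / d) atTop (𝓝 ψ₂)) (β : ∀ d, EuclideanSpace ℝ (Fin d))
    (τ : ℝ≥0) {ε ζ : ℝ} (hε : 0 < ε) (hζ : 0 < ζ) {C₀ t : ℝ} (hC₀ : 0 < C₀) (ht : 0 < t) :
    Tendsto (fun d => prob τ fun s : Sample d (N d) (n d) =>
      ENNReal.ofReal t < supRelGap C₀ ε ζ (β d) s) atTop (𝓝 0) := by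
  obtain ⟨κ, hκ, hgap⟩ := exists_tendsto_prob_gap hψ₁ hψ₂ hN hn β τ hε hζ.le hC₀ ht
  -- The coordinate bound defining `paramSet` tends to zero, so it is eventually below the fixed
  -- `κ`.
  have h := tendsto_sqrt_log_div.const_mul C₀
  rw [mul_zero] at h
  refine tendsto_of_tendsto_of_tendsto_of_le_of_le' tendsto_const_nhds hgap
    (Eventually.of_forall fun _ => zero_le) ?_
  filter_upwards [h.eventually_le_const hκ] with d hd
  refine prob_mono fun s hs => ?_
  simp only [supRelGap, lt_iSup_iff] at hs
  obtain ⟨θ, ⟨hθ, hθ'⟩, hlt⟩ := hs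
  refine ⟨θ, hθ', fun l => (hθ l).trans hd, fun hle => ?_⟩
  have h1 := ((isRidge_robustLoss hε.le hζ.le (β d) s).lower θ)
  have h2 := ((isRidge_simplifiedLoss hε.le hζ.le (β d) s).lower θ)
  have h3 : 0 ≤ ζ / 2 * ‖θ‖ ^ 2 := by positivity
  have h4 := le_min (h3.trans h1) (h3.trans h2)
  refine absurd hlt (not_lt.2 (ENNReal.ofReal_le_ofReal ?_))
  rwa [div_le_iff₀ (by linarith)]

end Minimizers

end RobustRF

end

theorem mainTheorem6
    (N n : ℕ → ℕ) (ψ₁ ψ₂ : ℝ) (hψ₁ : 0 < ψ₁) (hψ₂ : 0 < ψ₂)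
    (hN : Tendsto (fun d => (N d : ℝ) / d) atTop (𝓝 ψ₁))
    (hn : Tendsto (fun d => (n d : ℝ) / d) atTop (𝓝 ψ₂))
    (β : ∀ d, EuclideanSpace ℝ (Fin d)) (hβ : Tendsto (fun d => ‖β d‖) atTop (𝓝 1))
    (τ : ℝ≥0) (ε ζ : ℝ) (hε : 0 < ε) (hζ : 0 < ζ) :
    -- uniform closeness of the two losses on `C_θ`, for every fixed constant `C₀`
    (∀ C₀ : ℝ, 0 < C₀ → ∀ t : ℝ, 0 < t →
      Tendsto (fun d => RobustRF.prob τ fun s : RobustRF.Sample d (N d) (n d) =>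
        ENNReal.ofReal t < RobustRF.supRelGap C₀ ε ζ (β d) s) atTop (𝓝 0)) ∧
    -- both losses have exactly one minimizer over the whole parameter space
    (∀ d (s : RobustRF.Sample d (N d) (n d)),
      (∃! θ, IsMinOn (RobustRF.robustLoss ε ζ (β d) s) Set.univ θ) ∧
      (∃! θ, IsMinOn (RobustRF.simplifiedLoss ε ζ (β d) s) Set.univ θ)) ∧
    -- the two minimizers merge in `ℓ₂`, in probability
    (∀ θhat θoo : ∀ d, RobustRF.Sample d (N d) (n d) → EuclideanSpace ℝ (Fin (N d)),
      (∀ d s, IsMinOn (RobustRF.robustLoss ε ζ (β d) s) Set.univ (θhat d s)) →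
      (∀ d s, IsMinOn (RobustRF.simplifiedLoss ε ζ (β d) s) Set.univ (θoo d s)) →
      ∀ t : ℝ, 0 < t →
        Tendsto (fun d => RobustRF.prob τ fun s : RobustRF.Sample d (N d) (n d) =>
          t < ‖θoo d s - θhat d s‖) atTop (𝓝 0)) := by
  exact ⟨fun C₀ hC₀ t ht => RobustRF.tendsto_prob_supRelGap hψ₁ hψ₂ hN hn β τ hε hζ hC₀ ht,
    fun d s => ⟨(RobustRF.isRidge_robustLoss hε.le hζ.le (β d) s).existsUnique hζ,
      (RobustRF.isRidge_simplifiedLoss hε.le hζ.le (β d) s).existsUnique hζ⟩,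
    fun _ _ hhat hoo _ ht =>
      RobustRF.tendsto_prob_minimizers hψ₁ hψ₂ hN hn hβ τ hε hζ hhat hoo ht⟩
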